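/- Fix $\kappa>0$. Let $Z\sim\mathcal N(0,1)$, $p=\mathbb P[|Z|\le\kappa]$, $\alpha_c=-\log 2/\log p$, $\mu_2=\mathbb E[Z^2\mathbf 1_{|Z|\le\kappa}]/p$ and $\beta=-\frac{\sqrt{\alpha_c}}{2}(1-\mu_2)$. For a sequence $M=(M_j)_{j\ge1}$ of vectors in $\mathbb R^n$ and integers $k,m\ge 1$, let $$C_k(m,M)=\frac{1}{(mn)^{k/2}}\sum_{\substack{i_1,\dots,i_k\in[n]\text{ distinct}\\ j_1,\dots,j_k\in[m]\text{ distinct}}}\ \prod_{\ell=1}^k M_{j_\ell,i_\ell}M_{j_\ell,i_{\ell+1}}-\mathbf 1_{k=1}\sqrt{mn},\qquad i_{k+1}=i_1 .$$ For an integer $t\in[-n,n]$ with $t\equiv n\pmod 2$, let $v_t\in\mathbb R^n$ be the vector whose first $(n+t)/2$ coordinates are $1$ and whose other coordinates are $-1$. Let $\Delta_0=\mathcal N(0,1)^{\otimes n}$, let $\Delta_1$ be the law of $x\sim\Delta_0$ conditioned on $|\langle x,v_n\rangle|\le\kappa\sqrt n$, and let $\Delta_2(t)$ be the law of $x\sim\Delta_1$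 further conditioned on $|\langle x,v_t\rangle|\le\kappa\sqrt n$. Let $G^{(0)},G^{(1)},G^{(2)}(t)$ be sequences of independent random vectors with laws $\Delta_0,\Delta_1,\Delta_2(t)$ respectively. For $g\in\mathcal C^3(\mathbb R^K)$ let $M_r(g)=\sup_{x}\|D^rg(x)\|_{\mathrm{op}}\in[0,\infty]$, where $\|A\|_{\mathrm{op}}=\sup_{|u_1|=\dots=|u_r|=1}|A(u_1,\dots,u_r)|$ with Euclidean norms $|u_i|$. **Lemma.** There is $\eta_0=\eta_0(\kappa)>0$ such that for every $0<\eta\le\eta_0$ there is $N=N(\kappa,\eta)$ for which the following holds for all $n\ge N$. Let $m=\lfloor\alpha_cn-\eta\log n\rfloor$, $K=\lceil\eta\log n\rceil$, $$V(M)=\Big(\frac{C_k(m,M)}{\sqrt{2k}}\Big)_{1\le k\le K},\qquad \mu=\Big(\frac{(2\beta)^k}{\sqrt{2k}}\Big)_{1\le k\le K}.$$ Then for every $g\in\mathcal C^3(\mathbb R^K)$ and every integer $t\equiv n\pmod 2$ with $|t|\le\sqrt n\log n$, with $Z_K\sim\mathcal N(0,I_K)$, $$|\mathbb E\,g(V(G^{(0)}))-\mathbb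 E\,g(Z_K)|\le (M_1(g)+M_2(g)+M_3(g))\,n^{-1/5},$$ $$|\mathbb E\,g(V(G^{(1)})-\mu)-\mathbb E\,g(Z_K)|\le (M_1(g)+M_2(g)+M_3(g))\,n^{-1/5},$$ $$|\mathbb E\,g(V(G^{(2)}(t))-2\mu)-\mathbb E\,g(Z_K)|\le (M_1(g)+M_2(g)+M_3(g))\,n^{-1/5}.$$ Here all the expectations exist whenever $M_1(g)<\infty$, and the bounds are void if some $M_r(g)$ is infinite. -/

import Mathlib

open MeasureTheory ProbabilityTheory
open scoped ENNReal

noncomputable section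

namespace Perceptron

/-- `p = ℙ[|Z| ≤ κ]` for a standard Gaussian `Z`. -/
def gaussProb (κ : ℝ) : ℝ := (gaussianReal 0 1).real {z | |z| ≤ κ}

/-- The critical value `α_c = - log 2 / log p`. -/
def alphaC (κ : ℝ) : ℝ := - Real.log 2 / Real.log (gaussProb κ)

/-- `μ₂ = 𝔼[Z² 1_{|Z| ≤ κ}] / p`. -/
def mu2 (κ : ℝ) : ℝ := (∫ z in {z : ℝ | |z| ≤ κ}, z ^ 2 ∂(gaussianReal 0 1)) / gaussProb κ

/-- `β = - (√α_c / 2) (1 - μ₂)`. -/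
def beta (κ : ℝ) : ℝ := - (Real.sqrt (alphaC κ) / 2) * (1 - mu2 κ)

/-- `τ_pre = ⌊α_c n - η log n⌋`. -/
def tauPre (κ η : ℝ) (n : ℕ) : ℕ := ⌊alphaC κ * n - η * Real.log n⌋₊

/-- `K = ⌈η log n⌉`. -/
def maxLen (η : ℝ) (n : ℕ) : ℕ := ⌈η * Real.log n⌉₊

/-- The `2k`-cycle count `C_k(m, M)` of a sequence of vectors of `ℝⁿ`. The vectors are indexed from
`0`, so the first `m` of them are `M 0, …, M (m - 1)`. Sequences of `k` distinct indices are
embeddings of `Fin k`, and `finRotate k` is the cyclic successor `ℓ ↦ ℓ + 1`. -/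
def cycleCount {n : ℕ} (k m : ℕ) (M : ℕ → Fin n → ℝ) : ℝ :=
  (1 / Real.sqrt n) ^ k * (1 / Real.sqrt m) ^ k *
      (∑ i : Fin k ↪ Fin n, ∑ j : Fin k ↪ Fin m,
        ∏ l : Fin k, M (j l) (i l) * M (j l) (i (finRotate k l)))
    - (if k = 1 then Real.sqrt ((m : ℝ) * n) else 0)

/-- `V(M) = (C_k(m, M) / √(2k))_{1 ≤ k ≤ K}` with `m = τ_pre`; coordinate `k` of `Fin K` stands for
the cycle parameter `k + 1`. -/
def cycleVec (κ η : ℝ) (n : ℕ) (M : ℕ → Fin n → ℝ) : EuclideanSpace ℝ (Fin (maxLen η n)) :=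
  WithLp.toLp 2 fun k =>
    cycleCount ((k : ℕ) + 1) (tauPre κ η n) M / Real.sqrt (2 * ((k : ℝ) + 1))

/-- `μ = ((2β)^k / √(2k))_{1 ≤ k ≤ K}`. -/
def shiftVec (κ η : ℝ) (n : ℕ) : EuclideanSpace ℝ (Fin (maxLen η n)) :=
  WithLp.toLp 2 fun k => (2 * beta κ) ^ ((k : ℕ) + 1) / Real.sqrt (2 * ((k : ℝ) + 1))

/-- `v_t = (1, …, 1, -1, …, -1) ∈ ℝⁿ` with `(n + t) / 2` ones, for `t ≡ n (mod 2)`, `|t| ≤ n`. -/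
def signVec (n : ℕ) (t : ℤ) (i : Fin n) : ℝ := if 2 * ((i : ℕ) : ℤ) < n + t then 1 else -1

/-- The slab `{x ∈ ℝⁿ : |⟨x, v_t⟩| ≤ κ √n}`. -/
def slab (κ : ℝ) (n : ℕ) (t : ℤ) : Set (Fin n → ℝ) :=
  {x | |∑ i, x i * signVec n t i| ≤ κ * Real.sqrt n}

/-- `Δ₀ = 𝒩(0,1)^{⊗ n}`. -/
def delta0 (n : ℕ) : Measure (Fin n → ℝ) := Measure.pi fun _ => gaussianReal 0 1

/-- `Δ₁`: the law `Δ₀` conditioned on `|⟨x, v_n⟩| ≤ κ √n`. -/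
def delta1 (κ : ℝ) (n : ℕ) : Measure (Fin n → ℝ) := cond (delta0 n) (slab κ n n)

/-- `Δ₂(t)`: the law `Δ₁` further conditioned on `|⟨x, v_t⟩| ≤ κ √n`. -/
def delta2 (κ : ℝ) (n : ℕ) (t : ℤ) : Measure (Fin n → ℝ) := cond (delta1 κ n) (slab κ n t)

/-- `M = (M_j)_j` is a sequence of independent random vectors of `ℝⁿ`, each with law `Δ`. -/
structure IsSample {Ω : Type*} [MeasurableSpace Ω] (P : Measure Ω) {n : ℕ}
    (Δ : Measure (Fin n → ℝ)) (M : ℕ → Ω → Fin n → ℝ) : Prop where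
  measurable : ∀ j, Measurable (M j)
  law : ∀ j, P.map (M j) = Δ
  indep : iIndepFun M P

/-- `M_r(g) = sup_x ‖D^r g(x)‖_op`, possibly infinite. -/
def supDeriv {K : ℕ} (r : ℕ) (g : EuclideanSpace ℝ (Fin K) → ℝ) : ℝ≥0∞ :=
  ⨆ x, ‖iteratedFDeriv ℝ r g x‖ₑ

/-- `|𝔼 g(X) - 𝔼 g(Z)| ≤ (M₁(g) + M₂(g) + M₃(g)) ε` for `Z ∼ 𝒩(0, I_K)`. If `M₁(g)` is finite, both
expectations are asserted to exist; if some `M_r(g)` is infinite, the bound is void. -/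
def CloseToGaussian {Ω : Type*} [MeasurableSpace Ω] (P : Measure Ω) {K : ℕ}
    (X : Ω → EuclideanSpace ℝ (Fin K)) (g : EuclideanSpace ℝ (Fin K) → ℝ) (ε : ℝ) : Prop :=
  (supDeriv 1 g < ∞ →
    Integrable (fun ω => g (X ω)) P ∧ Integrable g (stdGaussian (EuclideanSpace ℝ (Fin K)))) ∧
  ENNReal.ofReal |(∫ ω, g (X ω) ∂P) - ∫ z, g z ∂(stdGaussian (EuclideanSpace ℝ (Fin K)))|
    ≤ (supDeriv 1 g + supDeriv 2 g + supDeriv 3 g) * ENNReal.ofReal ε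

end Perceptron

end

/-!
# Cycle counts of conditioned Gaussian matrices

Up to the normalisation, `cycleCount k m M` is a sum over the cycles of length `2 k` in the complete
bipartite graph on rows and columns. For independent standard Gaussian rows, sort the cycles by
their largest row `j`: the count becomes `∑ j, cycleInc (k - 1) j` (`cycleCount_eq_sum`), where the
cycles with largest row `j` are the paths through the earlier rows, closed up through row `j`. These
increments are martingale differences. Their conditional covariances `incCov` concentrate
(`integral_abs_incCov_sub_le`): a covariance between two pairs of paths is nonzero only if every edge
is covered twice and the pairs meet, and counting such quadruples with weight `1 / n` per edge loses
a factor `n` (`sum_quadruple_le`). Their fourth moments are bounded by hypercontractivity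
(`exists_integral_cycleInc_four_le`). Lindeberg replacement (`lindeberg_le`) then gives the Gaussian
approximation `exists_gaussMatrix_close`, with an error `C ^ K` times a power of `K`, divided by `√n`.

A conditioned row is a Gaussian vector with conditions on its coefficients with respect to one or
two orthonormal vectors `u p` with entries of order `1 / √n`. Exchanging only the projection to the
span of these vectors (`rowMix`) couples it with a standard Gaussian row `y`. In this coupling the
product of the coordinates `c` and `d` of the conditioned row is `y c * y d + A c d` plus a centred
fluctuation with small covariances, where `A = covShift` is of order `1 / n`
(`isPerturbation_rowStep`). Expand the cycle count accordingly. The terms with all factors Gaussian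
form the cycle count of the Gaussian matrix, those with all factors deterministic form a constant,
and every other kind of cycle can be rotated such that its first factor is random and its last one
is deterministic or a fluctuation, which makes its second moment smaller by a factor `n`
(`IsPerturbation.integral_cycle_diff_sq_le`). The cycle counts of the conditioned matrix are thus
those of a Gaussian matrix plus a constant (`IsConditioned.exists_coupling`).

The constant is the mean shift. With one slab, `A c d` is `(μ₂ - 1) / n`, and the sum over the cycles
is about `(√α_c (μ₂ - 1)) ^ k = (2 β) ^ k`. With two slabs, whose directions have correlation
`t / n = O(log n / √n)`, `A c d` is close to `(μ₂ - 1) (1 + s c * s d) / n` with `s` the signs of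
`v_t`; around a cycle the product of the factors `1 + s s'` is `2 ^ k` if all the signs agree and `0`
otherwise (`prod_one_add_sign`), and as about half of the signs are positive, the shift doubles.

All the errors are at most `Λ ^ (2 K + 1)` times powers of `K` and `log n`, divided by `√n`, with `Λ`
depending only on `κ`. For `K ≤ η log n + 1` and small `η` this is at most `n ^ (-1 / 5)`
(`exists_error_le`).
-/

namespace Perceptron

/-! ### Functions with all moments, and resampling one coordinate -/

/-- `f` has finite absolute moments of all orders under `μ`. Unlike each single `L^p`, this class
is closed under products. -/
def HasAllMoments {α : Type*} [MeasurableSpace α] (μ : Measure α) (f : α → ℝ) : Prop :=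
  ∀ p : ℕ, MemLp f p μ

namespace HasAllMoments

variable {α β : Type*} [MeasurableSpace α] [MeasurableSpace β] {μ : Measure α} {ν : Measure β}
  {f g : α → ℝ}

lemma const [IsFiniteMeasure μ] (c : ℝ) : HasAllMoments μ (fun _ => c) := fun _ => memLp_const c

lemma add (hf : HasAllMoments μ f) (hg : HasAllMoments μ g) :
    HasAllMoments μ (fun x => f x + g x) := fun p => (hf p).add (hg p)

lemma sub (hf : HasAllMoments μ f) (hg : HasAllMoments μ g) :
    HasAllMoments μ (fun x => f x - g x) := fun p => (hf p).sub (hg p)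

lemma mul (hf : HasAllMoments μ f) (hg : HasAllMoments μ g) :
    HasAllMoments μ (fun x => f x * g x) := by
  intro p
  have h2 : ENNReal.HolderTriple ((2 * p : ℕ) : ℝ≥0∞) ((2 * p : ℕ) : ℝ≥0∞) (p : ℝ≥0∞) := by
    constructor
    rcases Nat.eq_zero_or_pos p with rfl | hp
    · simp
    · push_cast
      rw [ENNReal.mul_inv (by simp) (by simp), ← add_mul, ENNReal.inv_two_add_inv_two, one_mul]
  exact (hg (2 * p)).mul' (hf (2 * p))

lemma const_mul (c : ℝ) (hf : HasAllMoments μ f) : HasAllMoments μ (fun x => c * f x) :=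
  fun p => (hf p).const_mul c

lemma pow [IsFiniteMeasure μ] (hf : HasAllMoments μ f) (k : ℕ) :
    HasAllMoments μ (fun x => f x ^ k) := by
  induction k with
  | zero => simpa using const (μ := μ) 1
  | succ k ih => simpa [pow_succ] using ih.mul hf

lemma sum {ι : Type*} (s : Finset ι) {F : ι → α → ℝ} (hF : ∀ i ∈ s, HasAllMoments μ (F i)) :
    HasAllMoments μ (fun x => ∑ i ∈ s, F i x) :=
  fun p => memLp_finsetSum s fun i hi => hF i hi p

lemma prod [IsFiniteMeasure μ] {ι : Type*} (s : Finset ι) {F : ι → α → ℝ}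
    (hF : ∀ i ∈ s, HasAllMoments μ (F i)) : HasAllMoments μ (fun x => ∏ i ∈ s, F i x) := by
  classical
  induction s using Finset.induction_on with
  | empty => simpa using const (μ := μ) 1
  | insert a s ha ih =>
    simp only [Finset.prod_insert ha]
    exact (hF a (by simp)).mul (ih fun i hi => hF i (by simp [hi]))

lemma integrable (hf : HasAllMoments μ f) : Integrable f μ := by
  have := hf 1
  rwa [Nat.cast_one, memLp_one_iff_integrable] at this

lemma integral_add (hf : HasAllMoments μ f) (hg : HasAllMoments μ g) :
    ∫ x, (f x + g x) ∂μ = ∫ x, f x ∂μ + ∫ x, g x ∂μ :=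
  MeasureTheory.integral_add hf.integrable hg.integrable

lemma memLp_two (hf : HasAllMoments μ f) : MemLp f 2 μ := by exact_mod_cast hf 2

lemma comp {φ : β → α} (hf : HasAllMoments μ f) (hφ : MeasurePreserving φ ν μ) :
    HasAllMoments ν (fun x => f (φ x)) :=
  fun p => (hf p).comp_measurePreserving hφ

lemma mono_measure {μ' : Measure α} (c : ℝ≥0∞) (hc : c ≠ ∞) (h : μ' ≤ c • μ)
    (hf : HasAllMoments μ f) : HasAllMoments μ' f :=
  fun p => (hf p).of_measure_le_smul hc h

end HasAllMoments

lemma integral_comp_measurePreserving {α β E : Type*} [MeasurableSpace α] [MeasurableSpace β]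
    [NormedAddCommGroup E] [NormedSpace ℝ E] {μ : Measure α} {ν : Measure β} {φ : α → β}
    (hφ : MeasurePreserving φ μ ν) {f : β → E} (hf : AEStronglyMeasurable f ν) :
    ∫ x, f (φ x) ∂μ = ∫ y, f y ∂ν := by
  rw [← hφ.map_eq, integral_map hφ.measurable.aemeasurable (by rwa [hφ.map_eq])]

lemma measurable_update_pair {ι : Type*} [DecidableEq ι] {α : ι → Type*}
    [∀ i, MeasurableSpace (α i)] (j : ι) :
    Measurable (fun p : (∀ i, α i) × α j => Function.update p.1 j p.2) := by
  rw [measurable_pi_iff]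
  intro i
  by_cases h : i = j
  · subst h; simpa using measurable_snd
  · simp only [Function.update_of_ne h]
    exact (measurable_pi_apply i).comp measurable_fst

section Resample

variable {ι : Type*} [Fintype ι] [DecidableEq ι] {α : ι → Type*} [∀ i, MeasurableSpace (α i)]
  (ρ : ∀ i, Measure (α i)) [∀ i, IsProbabilityMeasure (ρ i)]

/-- Resampling one coordinate of a product measure does not change the law. -/
lemma measurePreserving_update (j : ι) :
    MeasurePreserving (fun p : (∀ i, α i) × α j => Function.update p.1 j p.2)
      ((Measure.pi ρ).prod (ρ j)) (Measure.pi ρ) := by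
  refine ⟨measurable_update_pair j, ?_⟩
  refine (Measure.pi_eq fun s hs => ?_).symm
  rw [Measure.map_apply (measurable_update_pair j) (MeasurableSet.univ_pi hs)]
  have : (fun p : (∀ i, α i) × α j => Function.update p.1 j p.2) ⁻¹' Set.univ.pi s
      = (Set.univ.pi (Function.update s j Set.univ)) ×ˢ s j := by
    ext p
    simp only [Set.mem_preimage, Set.mem_univ_pi, Set.mem_prod]
    constructor
    · intro h
      refine ⟨fun i => ?_, by simpa using h j⟩
      by_cases hi : i = j
      · subst hi; simp
      · simpa [Function.update_of_ne hi] using h i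
    · rintro ⟨h1, h2⟩ i
      by_cases hi : i = j
      · subst hi; simpa using h2
      · simpa [Function.update_of_ne hi] using h1 i
  rw [this, Measure.prod_prod, Measure.pi_pi, ← Finset.mul_prod_erase _ _ (Finset.mem_univ j),
    ← Finset.mul_prod_erase _ _ (Finset.mem_univ j)]
  simp only [Function.update_self, measure_univ, one_mul]
  rw [mul_comm]
  congr 1
  refine Finset.prod_congr rfl fun i hi => ?_
  rw [Function.update_of_ne (Finset.ne_of_mem_erase hi)]

lemma integral_update {E : Type*} [NormedAddCommGroup E] [NormedSpace ℝ E] (j : ι)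
    {f : (∀ i, α i) → E} (hf : Integrable f (Measure.pi ρ)) :
    ∫ x, f x ∂(Measure.pi ρ) =
      ∫ x, ∫ y, f (Function.update x j y) ∂(ρ j) ∂(Measure.pi ρ) := by
  have h := measurePreserving_update ρ j
  rw [← integral_prod (fun p : (∀ i, α i) × α j => f (Function.update p.1 j p.2))
    (h.integrable_comp_of_integrable hf)]
  exact (integral_comp_measurePreserving h hf.aestronglyMeasurable).symm

end Resample

/-! ### Moments of the standard Gaussian -/

lemma hasAllMoments_gaussian : HasAllMoments (gaussianReal 0 1) (fun x => x) :=
  fun p => memLp_id_gaussianReal' p (by simp)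

lemma integral_gaussian_odd {f : ℝ → ℝ} (hf : ∀ x, f (-x) = -f x) :
    ∫ x, f x ∂(gaussianReal 0 1) = 0 := by
  have h : (gaussianReal 0 1).map (fun x => -x) = gaussianReal 0 1 := by
    rw [gaussianReal_map_neg]; simp
  have h1 : ∫ x, f x ∂(gaussianReal 0 1) = ∫ x, f (-x) ∂(gaussianReal 0 1) := by
    conv_lhs => rw [← h]
    exact (MeasurableEquiv.neg ℝ).measurableEmbedding.integral_map f
  simp only [hf, integral_neg] at h1
  linarith

lemma integral_gaussian_id : ∫ x, x ∂(gaussianReal 0 1) = 0 := integral_gaussian_odd fun _ => rfl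

lemma integral_gaussian_cube : ∫ x, x ^ 3 ∂(gaussianReal 0 1) = 0 :=
  integral_gaussian_odd fun x => by ring

lemma integral_gaussian_sq : ∫ x, x ^ 2 ∂(gaussianReal 0 1) = 1 := by
  have := variance_fun_id_gaussianReal (μ := 0) (v := 1)
  rw [variance_of_integral_eq_zero (by fun_prop) integral_gaussian_id] at this
  simpa using this

/-- The fourth moment is `3`: `(X + Y) / √2` is again standard Gaussian. -/
lemma integral_gaussian_four : ∫ x, x ^ 4 ∂(gaussianReal 0 1) = 3 := by
  have h1 : ((gaussianReal 0 1).prod (gaussianReal 0 1)).map (fun p : ℝ × ℝ => p.1 + p.2)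
      = gaussianReal 0 2 := by
    have := gaussianReal_conv_gaussianReal (m₁ := 0) (m₂ := 0) (v₁ := 1) (v₂ := 1)
    rw [Measure.conv] at this
    rw [this]; norm_num
  have h2 : (gaussianReal 0 1).map (fun x => Real.sqrt 2 * x) = gaussianReal 0 2 := by
    rw [gaussianReal_map_const_mul]
    congr 1
    · simp
    · ext; simp
  have e1 : ∫ x, x ^ 4 ∂(gaussianReal 0 2) = 4 * ∫ x, x ^ 4 ∂(gaussianReal 0 1) := by
    rw [← h2, integral_map (by fun_prop) (by fun_prop), ← integral_const_mul]
    congr 1; ext x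
    rw [mul_pow]
    have : Real.sqrt 2 ^ 4 = 4 := by
      rw [show (4 : ℕ) = 2 * 2 from rfl, pow_mul, Real.sq_sqrt (by norm_num)]; norm_num
    rw [this]
  have hm := hasAllMoments_gaussian
  have e2 : ∫ x, x ^ 4 ∂(gaussianReal 0 2) = 2 * ∫ x, x ^ 4 ∂(gaussianReal 0 1) + 6 := by
    rw [← h1, integral_map (by fun_prop) (by fun_prop)]
    have hX : HasAllMoments ((gaussianReal 0 1).prod (gaussianReal 0 1)) (fun p : ℝ × ℝ => p.1) :=
      hm.comp measurePreserving_fst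
    have hY : HasAllMoments ((gaussianReal 0 1).prod (gaussianReal 0 1)) (fun p : ℝ × ℝ => p.2) :=
      hm.comp measurePreserving_snd
    have key : ∀ a b : ℕ, ∫ p : ℝ × ℝ, p.1 ^ a * p.2 ^ b
        ∂((gaussianReal 0 1).prod (gaussianReal 0 1))
        = (∫ x, x ^ a ∂(gaussianReal 0 1)) * ∫ x, x ^ b ∂(gaussianReal 0 1) :=
      fun a b => integral_prod_mul (fun x : ℝ => x ^ a) (fun x : ℝ => x ^ b)
    have hi : ∀ a b : ℕ, Integrable (fun p : ℝ × ℝ => p.1 ^ a * p.2 ^ b)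
        ((gaussianReal 0 1).prod (gaussianReal 0 1)) :=
      fun a b => ((hX.pow a).mul (hY.pow b)).integrable
    have : ∀ p : ℝ × ℝ, (p.1 + p.2) ^ 4 = p.1 ^ 4 * p.2 ^ 0 + 4 * (p.1 ^ 3 * p.2 ^ 1)
        + 6 * (p.1 ^ 2 * p.2 ^ 2) + 4 * (p.1 ^ 1 * p.2 ^ 3) + p.1 ^ 0 * p.2 ^ 4 := by
      intro p; ring
    simp_rw [this]
    rw [integral_add, integral_add, integral_add, integral_add]
    · simp only [integral_const_mul, key, integral_gaussian_sq, integral_gaussian_cube]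
      simp
      ring
    all_goals first
      | exact hi _ _
      | exact (hi _ _).const_mul _
      | exact (hi _ _).add ((hi _ _).const_mul _)
      | exact ((hi _ _).add ((hi _ _).const_mul _)).add ((hi _ _).const_mul _)
      | exact (((hi _ _).add ((hi _ _).const_mul _)).add ((hi _ _).const_mul _)).add
          ((hi _ _).const_mul _)
  linarith

end Perceptron

namespace Perceptron

/-! ### Lindeberg replacement for vector-valued martingale differences -/

section Lindeberg

variable {K : ℕ}

/-- Coordinatewise product of a vector of `ℝ^K` with fixed multipliers. -/
noncomputable def diagMul (s : Fin K → ℝ) (z : EuclideanSpace ℝ (Fin K)) :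
    EuclideanSpace ℝ (Fin K) :=
  WithLp.toLp 2 fun k => s k * z k

lemma continuous_diagMul (s : Fin K → ℝ) : Continuous (diagMul s) := by
  unfold diagMul
  fun_prop

lemma memLp_euclidean {α : Type*} [MeasurableSpace α] {μ : Measure α} {p : ℝ≥0∞}
    {f : α → EuclideanSpace ℝ (Fin K)} (hf : ∀ k, MemLp (fun x => f x k) p μ) : MemLp f p μ := by
  have : f = fun x => ∑ k, f x k • EuclideanSpace.basisFun (Fin K) ℝ k := by
    ext1 x
    exact ((EuclideanSpace.basisFun (Fin K) ℝ).sum_repr (f x)).symm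
  rw [this]
  exact memLp_finsetSum _ fun k _ => MemLp.smul (memLp_top_const (EuclideanSpace.basisFun (Fin K) ℝ k)) (hf k)

lemma euclidean_eq_sum (y : EuclideanSpace ℝ (Fin K)) :
    y = ∑ k, y k • EuclideanSpace.basisFun (Fin K) ℝ k :=
  ((EuclideanSpace.basisFun (Fin K) ℝ).sum_repr y).symm

/-- Second partial derivatives. -/
noncomputable def hess (g : EuclideanSpace ℝ (Fin K) → ℝ) (x : EuclideanSpace ℝ (Fin K))
    (k l : Fin K) : ℝ :=
  fderiv ℝ (fderiv ℝ g) x (EuclideanSpace.basisFun (Fin K) ℝ k)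
    (EuclideanSpace.basisFun (Fin K) ℝ l)

lemma abs_hess_le {g : EuclideanSpace ℝ (Fin K) → ℝ} {M : ℝ} {x : EuclideanSpace ℝ (Fin K)}
    (hM : ‖iteratedFDeriv ℝ 2 g x‖ ≤ M) (k l : Fin K) : |hess g x k l| ≤ M := by
  have h := (iteratedFDeriv ℝ 2 g x).le_opNorm
    ![EuclideanSpace.basisFun (Fin K) ℝ k, EuclideanSpace.basisFun (Fin K) ℝ l]
  rw [iteratedFDeriv_two_apply] at h
  simp only [Matrix.cons_val_zero, Matrix.cons_val_one, Fin.prod_univ_two,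
    OrthonormalBasis.norm_eq_one, mul_one] at h
  exact h.trans hM

lemma fderiv_fderiv_apply_eq (g : EuclideanSpace ℝ (Fin K) → ℝ)
    (x y : EuclideanSpace ℝ (Fin K)) :
    fderiv ℝ (fderiv ℝ g) x y y = ∑ k, ∑ l, hess g x k l * (y k * y l) := by
  conv_lhs => rw [euclidean_eq_sum y]
  simp only [map_sum, map_smul, sum_apply,
    smul_apply, smul_eq_mul, hess, Finset.mul_sum]
  rw [Finset.sum_comm]
  refine Finset.sum_congr rfl fun k _ => Finset.sum_congr rfl fun l _ => ?_
  ring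

lemma fderiv_apply_eq (g : EuclideanSpace ℝ (Fin K) → ℝ) (x y : EuclideanSpace ℝ (Fin K)) :
    fderiv ℝ g x y = ∑ k, fderiv ℝ g x (EuclideanSpace.basisFun (Fin K) ℝ k) * y k := by
  conv_lhs => rw [euclidean_eq_sum y]
  simp only [map_sum, map_smul, smul_eq_mul]
  exact Finset.sum_congr rfl fun k _ => mul_comm _ _

/-- Second-order Taylor expansion with a cubic remainder. -/
lemma abs_taylor_two_le {g : EuclideanSpace ℝ (Fin K) → ℝ} (hg : ContDiff ℝ 3 g) {M : ℝ}
    (hM : ∀ x, ‖iteratedFDeriv ℝ 3 g x‖ ≤ M) (x y : EuclideanSpace ℝ (Fin K)) :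
    |g (x + y) - (g x + fderiv ℝ g x y + 1 / 2 * fderiv ℝ (fderiv ℝ g) x y y)|
      ≤ 1 / 2 * M * ‖y‖ ^ 3 := by
  have h := map_add_eq_sum_add_integral_iteratedFDeriv (f := g) (x := x) (y := y) (n := 2)
    (fun t _ => by norm_num; exact hg.contDiffAt)
  simp only [Finset.sum_range_succ, Finset.sum_range_zero, zero_add, iteratedFDeriv_zero_apply,
    iteratedFDeriv_one_apply, iteratedFDeriv_two_apply, Nat.factorial] at h
  have hb : ‖∫ t in (0:ℝ)..1, (1 - t) ^ 2 • iteratedFDeriv ℝ (2 + 1) g (x + t • y) (fun _ => y)‖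
      ≤ (M * ‖y‖ ^ 3) * |1 - 0| := by
    refine intervalIntegral.norm_integral_le_of_norm_le_const fun t ht => ?_
    rw [Set.uIoc_of_le zero_le_one] at ht
    rw [norm_smul]
    have h1 : ‖(1 - t) ^ 2‖ ≤ 1 := by
      rw [Real.norm_eq_abs, abs_of_nonneg (sq_nonneg _)]
      nlinarith [ht.1, ht.2]
    have h2 : ‖iteratedFDeriv ℝ (2 + 1) g (x + t • y) (fun _ => y)‖ ≤ M * ‖y‖ ^ 3 := by
      refine ((iteratedFDeriv ℝ (2 + 1) g (x + t • y)).le_opNorm _).trans ?_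
      simp only [Finset.prod_const, Finset.card_univ, Fintype.card_fin]
      exact mul_le_mul_of_nonneg_right (hM _) (by positivity)
    calc _ ≤ 1 * (M * ‖y‖ ^ 3) := mul_le_mul h1 h2 (norm_nonneg _) zero_le_one
      _ = _ := one_mul _
  rw [h]
  rw [show (1:ℝ) - 0 = 1 by norm_num, abs_one, mul_one, Real.norm_eq_abs] at hb
  simp only [smul_eq_mul] at hb ⊢
  rw [show ∀ a b c d : ℝ, a = b + d → a - (b) = d from fun a b c d h => by rw [h]; ring]
  rotate_left 2
  · exact 1/2 * ∫ t in (0:ℝ)..1, (1 - t) ^ 2 * iteratedFDeriv ℝ (2 + 1) g (x + t • y) (fun _ => y)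
  · norm_num
  · rw [abs_mul, abs_of_pos (by norm_num : (0:ℝ) < 1/2)]
    linarith
  · exact 0

lemma lipschitz_of_iteratedFDeriv {g : EuclideanSpace ℝ (Fin K) → ℝ} (hg : ContDiff ℝ 3 g)
    {M : ℝ} (hM : ∀ x, ‖iteratedFDeriv ℝ 1 g x‖ ≤ M) (x y : EuclideanSpace ℝ (Fin K)) :
    |g x - g y| ≤ M * ‖x - y‖ := by
  have := (convex_univ (𝕜 := ℝ) (E := EuclideanSpace ℝ (Fin K))).norm_image_sub_le_of_norm_fderiv_le
    (f := g) (C := M) (fun z _ => (hg.differentiable (by norm_num)).differentiableAt)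
    (fun z _ => by
      have := hM z
      rwa [norm_iteratedFDeriv_one] at this) (Set.mem_univ y) (Set.mem_univ x)
  simpa using this

lemma integrable_comp_of_lipschitz {α : Type*} [MeasurableSpace α] {μ : Measure α}
    [IsFiniteMeasure μ] {g : EuclideanSpace ℝ (Fin K) → ℝ} (hg : ContDiff ℝ 3 g)
    {M : ℝ} (hM : ∀ x, ‖iteratedFDeriv ℝ 1 g x‖ ≤ M) {X : α → EuclideanSpace ℝ (Fin K)}
    (hX : Integrable X μ) : Integrable (fun a => g (X a)) μ := by
  refine Integrable.mono' (g := fun a => |g 0| + M * ‖X a‖)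
    ((integrable_const _).add (hX.norm.const_mul M))
    (hg.continuous.comp_aestronglyMeasurable hX.aestronglyMeasurable) (Filter.Eventually.of_forall fun a => ?_)
  have h1 := lipschitz_of_iteratedFDeriv hg hM (X a) 0
  rw [sub_zero] at h1
  rw [Real.norm_eq_abs]
  have := abs_sub_abs_le_abs_sub (g (X a)) (g 0)
  linarith

/-- Adding a conditionally centred increment `Y` with conditional covariance `q` changes the mean
of `g (X)` by half the contraction of `q` with the Hessian, up to a cubic error. -/
lemma abs_integral_increment_le {Ω A : Type*} [MeasurableSpace Ω] [MeasurableSpace A]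
    (P : Measure Ω) [IsProbabilityMeasure P] (α : Measure A) [IsProbabilityMeasure α]
    {g : EuclideanSpace ℝ (Fin K) → ℝ} (hg : ContDiff ℝ 3 g) {M₁ M₂ M₃ : ℝ}
    (hM₁ : ∀ x, ‖iteratedFDeriv ℝ 1 g x‖ ≤ M₁) (hM₂ : ∀ x, ‖iteratedFDeriv ℝ 2 g x‖ ≤ M₂)
    (hM₃ : ∀ x, ‖iteratedFDeriv ℝ 3 g x‖ ≤ M₃)
    {X : Ω → EuclideanSpace ℝ (Fin K)} {Y : Ω × A → EuclideanSpace ℝ (Fin K)}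
    (hX : Integrable X P) (hY : MemLp Y 3 (P.prod α))
    (hY2 : ∀ ω k, MemLp (fun a => Y (ω, a) k) 2 α)
    (hmean : ∀ ω k, ∫ a, Y (ω, a) k ∂α = 0)
    {q : Fin K → Fin K → Ω → ℝ} (hq : ∀ ω k l, ∫ a, Y (ω, a) k * Y (ω, a) l ∂α = q k l ω) :
    |∫ p, g (X p.1 + Y p) ∂(P.prod α)
      - ∫ ω, (g (X ω) + 1 / 2 * ∑ k, ∑ l, hess g (X ω) k l * q k l ω) ∂P|
      ≤ 1 / 2 * M₃ * ∫ p, ‖Y p‖ ^ 3 ∂(P.prod α) := by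
  have hX' : Integrable (fun p : Ω × A => X p.1) (P.prod α) := hX.comp_fst α
  have hY1 : Integrable Y (P.prod α) := hY.integrable (by norm_num)
  have hY2' : MemLp Y 2 (P.prod α) := hY.mono_exponent (by norm_num)
  have hYsq : Integrable (fun p => ‖Y p‖ ^ 2) (P.prod α) := by
    simpa using hY2'.integrable_norm_pow (p := 2) (by norm_num)
  have hYcb : Integrable (fun p => ‖Y p‖ ^ 3) (P.prod α) := by
    simpa using hY.integrable_norm_pow (p := 3) (by norm_num)
  have hc1 : Continuous (fderiv ℝ g) := hg.continuous_fderiv (by norm_num)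
  have hc2 : Continuous (fderiv ℝ (fderiv ℝ g)) :=
    (hg.fderiv_right (m := 2) (by norm_num)).continuous_fderiv (by norm_num)
  have hpair : AEStronglyMeasurable (fun p : Ω × A => (X p.1, Y p)) (P.prod α) :=
    hX'.aestronglyMeasurable.prodMk hY1.aestronglyMeasurable
  have hT1 : Integrable (fun p : Ω × A => fderiv ℝ g (X p.1) (Y p)) (P.prod α) := by
    refine Integrable.mono' (hY1.norm.const_mul M₁) ?_ (Filter.Eventually.of_forall fun p => ?_)
    · exact Continuous.comp_aestronglyMeasurable
        (g := fun z : EuclideanSpace ℝ (Fin K) × EuclideanSpace ℝ (Fin K) => fderiv ℝ g z.1 z.2)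
        (by fun_prop) hpair
    · refine (ContinuousLinearMap.le_opNorm _ _).trans ?_
      refine mul_le_mul_of_nonneg_right ?_ (norm_nonneg _)
      have := hM₁ (X p.1)
      rwa [norm_iteratedFDeriv_one] at this
  have hT2 : Integrable (fun p : Ω × A => fderiv ℝ (fderiv ℝ g) (X p.1) (Y p) (Y p))
      (P.prod α) := by
    refine Integrable.mono' (hYsq.const_mul M₂) ?_ (Filter.Eventually.of_forall fun p => ?_)
    · exact Continuous.comp_aestronglyMeasurable
        (g := fun z : EuclideanSpace ℝ (Fin K) × EuclideanSpace ℝ (Fin K) =>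
          fderiv ℝ (fderiv ℝ g) z.1 z.2 z.2)
        (by fun_prop) hpair
    · have h := (iteratedFDeriv ℝ 2 g (X p.1)).le_opNorm ![Y p, Y p]
      rw [iteratedFDeriv_two_apply] at h
      simp only [Matrix.cons_val_zero, Matrix.cons_val_one, Fin.prod_univ_two] at h
      refine h.trans ?_
      rw [← sq]
      exact mul_le_mul_of_nonneg_right (hM₂ _) (by positivity)
  have hgXY : Integrable (fun p : Ω × A => g (X p.1 + Y p)) (P.prod α) :=
    integrable_comp_of_lipschitz hg hM₁ (hX'.add hY1)
  have hgX : Integrable (fun p : Ω × A => g (X p.1)) (P.prod α) :=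
    integrable_comp_of_lipschitz hg hM₁ hX'
  have hmain : Integrable (fun p : Ω × A => g (X p.1) + fderiv ℝ g (X p.1) (Y p)
      + 1 / 2 * fderiv ℝ (fderiv ℝ g) (X p.1) (Y p) (Y p)) (P.prod α) :=
    (hgX.add hT1).add (hT2.const_mul _)
  have hinner : ∫ ω, (g (X ω) + 1 / 2 * ∑ k, ∑ l, hess g (X ω) k l * q k l ω) ∂P
      = ∫ p, (g (X p.1) + fderiv ℝ g (X p.1) (Y p)
      + 1 / 2 * fderiv ℝ (fderiv ℝ g) (X p.1) (Y p) (Y p)) ∂(P.prod α) := by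
    rw [integral_prod _ hmain]
    congr 1
    ext ω
    have i1 : ∀ k, Integrable (fun a => Y (ω, a) k) α :=
      fun k => (hY2 ω k).integrable (by norm_num)
    have i2 : ∀ k l, Integrable (fun a => Y (ω, a) k * Y (ω, a) l) α :=
      fun k l => (hY2 ω k).integrable_mul (hY2 ω l)
    have e : ∀ a, g (X ω) + fderiv ℝ g (X ω) (Y (ω, a))
        + 1 / 2 * fderiv ℝ (fderiv ℝ g) (X ω) (Y (ω, a)) (Y (ω, a))
        = g (X ω) + (∑ k, fderiv ℝ g (X ω) (EuclideanSpace.basisFun (Fin K) ℝ k) * Y (ω, a) k)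
          + 1 / 2 * ∑ k, ∑ l, hess g (X ω) k l * (Y (ω, a) k * Y (ω, a) l) := fun a => by
      rw [fderiv_fderiv_apply_eq, fderiv_apply_eq g (X ω) (Y (ω, a))]
    rw [integral_congr_ae (Filter.Eventually.of_forall e), integral_add, integral_add, integral_const, integral_const_mul, integral_finsetSum,
      integral_finsetSum]
    · simp_rw [integral_const_mul, hmean]
      simp only [probReal_univ, one_smul, mul_zero, Finset.sum_const_zero, add_zero]
      congr 2
      refine Finset.sum_congr rfl fun k _ => ?_
      rw [integral_finsetSum]
      · simp_rw [integral_const_mul, hq]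
      · exact fun l _ => (i2 k l).const_mul _
    · exact fun k _ => integrable_finsetSum _ fun l _ => (i2 k l).const_mul _
    · exact fun k _ => (i1 k).const_mul _
    · exact integrable_const _
    · exact integrable_finsetSum _ fun k _ => (i1 k).const_mul _
    · exact (integrable_const _).add (integrable_finsetSum _ fun k _ => (i1 k).const_mul _)
    · exact (integrable_finsetSum _ fun k _ =>
        integrable_finsetSum _ fun l _ => (i2 k l).const_mul _).const_mul _
  rw [hinner, ← integral_sub hgXY hmain, ← integral_const_mul]
  refine (abs_integral_le_integral_abs).trans ?_
  exact integral_mono (hgXY.sub hmain).abs (hYcb.const_mul _)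
    fun p => abs_taylor_two_le hg hM₃ _ _

end Lindeberg

end Perceptron

namespace Perceptron

section GaussianVector

variable {K : ℕ}

lemma hasAllMoments_stdGaussian (k : Fin K) :
    HasAllMoments (stdGaussian (EuclideanSpace ℝ (Fin K))) (fun z => z k) := by
  have h : MeasurePreserving (fun z : EuclideanSpace ℝ (Fin K) => WithLp.ofLp z)
      (stdGaussian (EuclideanSpace ℝ (Fin K))) (Measure.pi fun _ => gaussianReal 0 1) := by
    refine ⟨by fun_prop, ?_⟩
    rw [← map_pi_eq_stdGaussian, Measure.map_map (by fun_prop) (by fun_prop)]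
    exact Measure.map_id
  exact (hasAllMoments_gaussian.comp (measurePreserving_eval _ k)).comp h

lemma integral_stdGaussian_comp {f : EuclideanSpace ℝ (Fin K) → ℝ} (hf : Continuous f) :
    ∫ z, f z ∂(stdGaussian (EuclideanSpace ℝ (Fin K)))
      = ∫ x, f (WithLp.toLp 2 x) ∂(Measure.pi fun _ : Fin K => gaussianReal 0 1) := by
  rw [← map_pi_eq_stdGaussian, integral_map (by fun_prop) (by fun_prop)]

lemma integral_stdGaussian_apply (k : Fin K) :
    ∫ z, z k ∂(stdGaussian (EuclideanSpace ℝ (Fin K))) = 0 := by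
  rw [integral_stdGaussian_comp (by fun_prop)]
  have := integral_comp_measurePreserving
    (measurePreserving_eval (fun _ : Fin K => gaussianReal 0 1) k)
    (f := fun x => x) (by fun_prop)
  rw [integral_gaussian_id] at this
  exact this

lemma integral_pi_gaussian_mul {ι : Type*} [Fintype ι] [DecidableEq ι] (k l : ι) :
    ∫ x : ι → ℝ, x k * x l ∂(Measure.pi fun _ => gaussianReal 0 1) = if k = l then 1 else 0 := by
  have h := integral_fintype_prod_eq_prod (𝕜 := ℝ) (μ := fun _ : ι => gaussianReal 0 1)
    (fun i t => (if i = k then t else 1) * (if i = l then t else 1))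
  simp only [Finset.prod_mul_distrib, Finset.prod_ite_eq', Finset.mem_univ, if_true] at h
  rw [h]
  split_ifs with hkl
  · subst hkl
    refine Finset.prod_eq_one fun i _ => ?_
    by_cases hi : i = k
    · simp only [hi, if_true, ← sq]; exact integral_gaussian_sq
    · simp [hi]
  · refine Finset.prod_eq_zero (Finset.mem_univ k) ?_
    simp [hkl]

lemma integral_stdGaussian_mul (k l : Fin K) :
    ∫ z, z k * z l ∂(stdGaussian (EuclideanSpace ℝ (Fin K))) = if k = l then 1 else 0 := by
  rw [integral_stdGaussian_comp (by fun_prop)]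
  exact integral_pi_gaussian_mul k l

lemma inner_diagMul (s : Fin K → ℝ) (z t : EuclideanSpace ℝ (Fin K)) :
    inner ℝ (diagMul s z) t = inner ℝ z (diagMul s t) := by
  simp only [PiLp.inner_apply, diagMul, RCLike.inner_apply, conj_trivial]
  exact Finset.sum_congr rfl fun k _ => by ring

lemma norm_diagMul_sq (s : Fin K → ℝ) (z : EuclideanSpace ℝ (Fin K)) :
    ‖diagMul s z‖ ^ 2 = ∑ k, s k ^ 2 * z k ^ 2 := by
  rw [EuclideanSpace.norm_sq_eq]
  exact Finset.sum_congr rfl fun k _ => by simp [diagMul, mul_pow]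

lemma charFun_map_diagMul (s : Fin K → ℝ) (t : EuclideanSpace ℝ (Fin K)) :
    charFun ((stdGaussian (EuclideanSpace ℝ (Fin K))).map (diagMul s)) t
      = Complex.exp (-(∑ k, s k ^ 2 * t k ^ 2 : ℝ) / 2) := by
  rw [charFun_apply, integral_map (continuous_diagMul s).aemeasurable (by fun_prop)]
  simp_rw [inner_diagMul]
  rw [← charFun_apply, charFun_stdGaussian, ← norm_diagMul_sq]
  push_cast
  rfl

/-- A sum of independent scaled standard Gaussian vectors is a scaled standard Gaussian vector. -/
lemma map_sum_diagMul {m : ℕ} (s : Fin m → Fin K → ℝ) (σ : Fin K → ℝ)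
    (hσ : ∀ k, σ k ^ 2 = ∑ j, s j k ^ 2) :
    (Measure.pi fun _ : Fin m => stdGaussian (EuclideanSpace ℝ (Fin K))).map
      (fun z => ∑ j, diagMul (s j) (z j))
      = (stdGaussian (EuclideanSpace ℝ (Fin K))).map (diagMul σ) := by
  have hm : ∀ j, Measurable (diagMul (s j)) := fun j => (continuous_diagMul _).measurable
  have : ∀ j, IsProbabilityMeasure
      ((stdGaussian (EuclideanSpace ℝ (Fin K))).map (diagMul (s j))) :=
    fun j => Measure.isProbabilityMeasure_map (hm j).aemeasurable
  have : IsProbabilityMeasure ((stdGaussian (EuclideanSpace ℝ (Fin K))).map (diagMul σ)) :=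
    Measure.isProbabilityMeasure_map (continuous_diagMul _).aemeasurable
  have hp : MeasurePreserving (fun (z : Fin m → EuclideanSpace ℝ (Fin K)) j => diagMul (s j) (z j))
      (Measure.pi fun _ : Fin m => stdGaussian (EuclideanSpace ℝ (Fin K)))
      (Measure.pi fun j => (stdGaussian (EuclideanSpace ℝ (Fin K))).map (diagMul (s j))) :=
    measurePreserving_pi _ _ fun j => ⟨hm j, rfl⟩
  have e : (Measure.pi fun _ : Fin m => stdGaussian (EuclideanSpace ℝ (Fin K))).map
      (fun z => ∑ j, diagMul (s j) (z j))
      = (Measure.pi fun j => (stdGaussian (EuclideanSpace ℝ (Fin K))).map (diagMul (s j))).map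
        (fun p => ∑ j, p j) := by
    rw [← hp.map_eq, Measure.map_map (by fun_prop) hp.measurable]
    rfl
  rw [e]
  have : IsProbabilityMeasure ((Measure.pi fun j =>
      (stdGaussian (EuclideanSpace ℝ (Fin K))).map (diagMul (s j))).map
        (fun p => ∑ j, p j)) := Measure.isProbabilityMeasure_map (by fun_prop)
  refine Measure.ext_of_charFun ?_
  rw [charFun_map_sum_pi_eq_prod]
  ext t
  rw [Finset.prod_apply]
  simp_rw [charFun_map_diagMul]
  rw [← Complex.exp_sum]
  congr 1
  rw [← Finset.sum_div, Finset.sum_neg_distrib, ← Complex.ofReal_sum, Finset.sum_comm]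
  simp_rw [← Finset.sum_mul, hσ]

end GaussianVector

section Lindeberg

variable {R : Type*} [MeasurableSpace R] (ρ : Measure R) [IsProbabilityMeasure ρ] {m K : ℕ}

/-- Lindeberg interpolation: the first `t` martingale differences are kept, the others are replaced
by Gaussian vectors. -/
noncomputable def hybridTerm (D : Fin m → (Fin m → R) → EuclideanSpace ℝ (Fin K))
    (s : Fin m → Fin K → ℝ) (t : ℕ) (i : Fin m) (ω : Fin m → R × EuclideanSpace ℝ (Fin K)) :
    EuclideanSpace ℝ (Fin K) :=
  if (i : ℕ) < t then D i (fun a => (ω a).1) else diagMul (s i) (ω i).2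

lemma measurePreserving_rows :
    MeasurePreserving (fun (ω : Fin m → R × EuclideanSpace ℝ (Fin K)) a => (ω a).1)
      (Measure.pi fun _ => ρ.prod (stdGaussian (EuclideanSpace ℝ (Fin K))))
      (Measure.pi fun _ => ρ) :=
  measurePreserving_pi _ _ fun _ => measurePreserving_fst

lemma measurePreserving_gaussians :
    MeasurePreserving (fun (ω : Fin m → R × EuclideanSpace ℝ (Fin K)) a => (ω a).2)
      (Measure.pi fun _ => ρ.prod (stdGaussian (EuclideanSpace ℝ (Fin K))))
      (Measure.pi fun _ => stdGaussian (EuclideanSpace ℝ (Fin K))) :=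
  measurePreserving_pi _ _ fun _ => measurePreserving_snd

/-- Quantitative multivariate martingale CLT: if `D j` depends on the rows `≤ j`, is centred given
the rows `< j` and has conditional covariance `q j`, then `∑ j, D j` is close in law to a centred
Gaussian vector with covariance `diag (∑ j, s j ^ 2)`. -/
theorem lindeberg_le {D : Fin m → (Fin m → R) → EuclideanSpace ℝ (Fin K)}
    (hD3 : ∀ j, MemLp (D j) 3 (Measure.pi fun _ => ρ))
    (hdep : ∀ j i, j < i → ∀ x y, D j (Function.update x i y) = D j x)
    (hD2 : ∀ j x k, MemLp (fun y => D j (Function.update x j y) k) 2 ρ)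
    (hmean : ∀ j x k, ∫ y, D j (Function.update x j y) k ∂ρ = 0)
    {q : Fin m → Fin K → Fin K → (Fin m → R) → ℝ}
    (hq : ∀ j x k l,
      ∫ y, D j (Function.update x j y) k * D j (Function.update x j y) l ∂ρ = q j k l x)
    (hqi : ∀ j k l, Integrable (q j k l) (Measure.pi fun _ => ρ))
    (s : Fin m → Fin K → ℝ) (σ : Fin K → ℝ) (hσ : ∀ k, σ k ^ 2 = ∑ j, s j k ^ 2)
    {g : EuclideanSpace ℝ (Fin K) → ℝ} (hg : ContDiff ℝ 3 g) {M₁ M₂ M₃ : ℝ}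
    (hM₁ : ∀ x, ‖iteratedFDeriv ℝ 1 g x‖ ≤ M₁) (hM₂ : ∀ x, ‖iteratedFDeriv ℝ 2 g x‖ ≤ M₂)
    (hM₃ : ∀ x, ‖iteratedFDeriv ℝ 3 g x‖ ≤ M₃) :
    |∫ x, g (∑ j, D j x) ∂(Measure.pi fun _ => ρ)
      - ∫ z, g (diagMul σ z) ∂(stdGaussian (EuclideanSpace ℝ (Fin K)))|
    ≤ ∑ j, (1 / 2 * M₂ * ∑ k, ∑ l,
          ∫ x, |q j k l x - (if k = l then s j k ^ 2 else 0)| ∂(Measure.pi fun _ => ρ)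
        + 1 / 2 * M₃ * (∫ x, ‖D j x‖ ^ 3 ∂(Measure.pi fun _ => ρ)
          + ∫ z, ‖diagMul (s j) z‖ ^ 3 ∂(stdGaussian (EuclideanSpace ℝ (Fin K))))) := by
  classical
  set γ := stdGaussian (EuclideanSpace ℝ (Fin K)) with hγ
  set α := ρ.prod γ with hα
  set Q : Measure (Fin m → R × EuclideanSpace ℝ (Fin K)) := Measure.pi fun _ => α with hQ
  have hrows := measurePreserving_rows (m := m) (K := K) ρ
  have hmemZ : ∀ j, MemLp (diagMul (s j)) 3 γ := fun j =>
    memLp_euclidean fun k => by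
      exact_mod_cast ((hasAllMoments_stdGaussian k).const_mul (s j k)) 3
  have hmemD : ∀ j, MemLp (fun ω : Fin m → R × EuclideanSpace ℝ (Fin K) =>
      D j (fun a => (ω a).1)) 3 Q := fun j => (hD3 j).comp_measurePreserving hrows
  have hmemT : ∀ t i, MemLp (hybridTerm D s t i) 3 Q := by
    intro t i
    unfold hybridTerm
    by_cases h : (i : ℕ) < t
    · simpa [h] using hmemD i
    · simp only [h, if_false]
      exact (hmemZ i).comp_measurePreserving
        ((measurePreserving_snd (μ := ρ) (ν := γ)).comp (measurePreserving_eval (fun _ => α) i))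
  have hintH : ∀ t, Integrable (fun ω => g (∑ i, hybridTerm D s t i ω)) Q := fun t =>
    integrable_comp_of_lipschitz hg hM₁
      (integrable_finsetSum _ fun i _ => (hmemT t i).integrable (by norm_num))
  -- Replacing increment `j`: both hybrids are `X` plus a centred increment, and in second order
  -- they differ by the conditional covariances `q j` and `diag (s j ^ 2)`, compared in `b3`.
  have step : ∀ j : Fin m, |∫ ω, g (∑ i, hybridTerm D s (j + 1) i ω) ∂Q
      - ∫ ω, g (∑ i, hybridTerm D s j i ω) ∂Q| ≤
      1 / 2 * M₂ * ∑ k, ∑ l,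
          ∫ x, |q j k l x - (if k = l then s j k ^ 2 else 0)| ∂(Measure.pi fun _ => ρ)
        + 1 / 2 * M₃ * (∫ x, ‖D j x‖ ^ 3 ∂(Measure.pi fun _ => ρ)
          + ∫ z, ‖diagMul (s j) z‖ ^ 3 ∂γ) := by
    intro j
    set X : (Fin m → R × EuclideanSpace ℝ (Fin K)) → EuclideanSpace ℝ (Fin K) :=
      fun ω => ∑ i ∈ Finset.univ.erase j, hybridTerm D s j i ω with hX
    have hXint : Integrable X Q :=
      integrable_finsetSum _ fun i _ => (hmemT j i).integrable (by norm_num)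
    have hXupd : ∀ ω a, X (Function.update ω j a) = X ω := by
      intro ω a
      refine Finset.sum_congr rfl fun i hi => ?_
      have hij : i ≠ j := Finset.ne_of_mem_erase hi
      unfold hybridTerm
      by_cases h : (i : ℕ) < j
      · simp only [h, if_true]
        have : (fun b => (Function.update ω j a b).1)
            = Function.update (fun b => (ω b).1) j a.1 := by
          ext b
          by_cases hb : b = j
          · subst hb; simp
          · simp [Function.update_of_ne hb]
        rw [this, hdep i j h]
      · simp [h, Function.update_of_ne hij]
    have hfst : ∀ (ω : Fin m → R × EuclideanSpace ℝ (Fin K)) (a : R × EuclideanSpace ℝ (Fin K)),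
        (fun b => (Function.update ω j a b).1) = Function.update (fun b => (ω b).1) j a.1 := by
      intro ω a
      ext b
      by_cases hb : b = j
      · subst hb; simp
      · simp [Function.update_of_ne hb]
    set Y : (Fin m → R × EuclideanSpace ℝ (Fin K)) × (R × EuclideanSpace ℝ (Fin K)) →
        EuclideanSpace ℝ (Fin K) :=
      fun p => D j (Function.update (fun b => (p.1 b).1) j p.2.1) with hY
    set Z : (Fin m → R × EuclideanSpace ℝ (Fin K)) × (R × EuclideanSpace ℝ (Fin K)) →
        EuclideanSpace ℝ (Fin K) := fun p => diagMul (s j) p.2.2 with hZ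
    have hYp : MeasurePreserving (fun p : (Fin m → R × EuclideanSpace ℝ (Fin K)) ×
        (R × EuclideanSpace ℝ (Fin K)) => Function.update (fun b => (p.1 b).1) j p.2.1)
        (Q.prod α) (Measure.pi fun _ => ρ) := by
      have := hrows.comp (measurePreserving_update (fun _ : Fin m => α) j)
      convert this using 1
      ext1 p
      exact (hfst p.1 p.2).symm
    have hZp : MeasurePreserving (fun p : (Fin m → R × EuclideanSpace ℝ (Fin K)) ×
        (R × EuclideanSpace ℝ (Fin K)) => p.2.2) (Q.prod α) γ :=
      measurePreserving_snd.comp measurePreserving_snd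
    have e1 : ∫ ω, g (∑ i, hybridTerm D s (j + 1) i ω) ∂Q
        = ∫ p, g (X p.1 + Y p) ∂(Q.prod α) := by
      have hi : Integrable (fun p => g (X p.1 + Y p)) (Q.prod α) :=
        integrable_comp_of_lipschitz hg hM₁ ((hXint.comp_fst α).add
          (((hD3 j).comp_measurePreserving hYp).integrable (by norm_num)))
      rw [integral_prod _ hi, hQ, integral_update (fun _ : Fin m => α) j (hintH _)]
      congr 1; ext ω; congr 1; ext a; congr 1
      rw [← Finset.add_sum_erase _ _ (Finset.mem_univ j), add_comm]
      congr 1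
      · rw [← hXupd ω a]
        refine Finset.sum_congr rfl fun i hi => ?_
        have hij : (i : ℕ) ≠ j := fun h => Finset.ne_of_mem_erase hi (Fin.ext h)
        unfold hybridTerm
        simp only [show (i : ℕ) < j + 1 ↔ (i : ℕ) < j by omega]
      · simp only [hybridTerm, Nat.lt_succ_self, if_true, hY, hfst]
    have e2 : ∫ ω, g (∑ i, hybridTerm D s j i ω) ∂Q
        = ∫ p, g (X p.1 + Z p) ∂(Q.prod α) := by
      have hi : Integrable (fun p => g (X p.1 + Z p)) (Q.prod α) :=
        integrable_comp_of_lipschitz hg hM₁ ((hXint.comp_fst α).add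
          (((hmemZ j).comp_measurePreserving hZp).integrable (by norm_num)))
      rw [integral_prod _ hi, hQ, integral_update (fun _ : Fin m => α) j (hintH _)]
      congr 1; ext ω; congr 1; ext a; congr 1
      rw [← Finset.add_sum_erase _ _ (Finset.mem_univ j), add_comm]
      congr 1
      · exact hXupd ω a
      · simp [hybridTerm, hZ]
    have b1 := abs_integral_increment_le Q α hg hM₁ hM₂ hM₃ hXint (Y := Y)
      ((hD3 j).comp_measurePreserving hYp)
      (fun ω k => (hD2 j (fun b => (ω b).1) k).comp_measurePreserving measurePreserving_fst)
      (fun ω k => by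
        rw [← hmean j (fun b => (ω b).1) k, hα]
        exact integral_fun_fst (μ := ρ) (ν := γ)
          (fun y => D j (Function.update (fun b => (ω b).1) j y) k) |>.trans (by simp))
      (q := fun k l ω => q j k l (fun b => (ω b).1))
      (fun ω k l => by
        rw [← hq j (fun b => (ω b).1) k l, hα]
        exact integral_fun_fst (μ := ρ) (ν := γ)
          (fun y => D j (Function.update (fun b => (ω b).1) j y) k *
            D j (Function.update (fun b => (ω b).1) j y) l) |>.trans (by simp))
    have b2 := abs_integral_increment_le Q α hg hM₁ hM₂ hM₃ hXint (Y := Z)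
      ((hmemZ j).comp_measurePreserving hZp)
      (fun ω k => by
        have : MemLp (fun z : EuclideanSpace ℝ (Fin K) => s j k * z k) 2 γ :=
          ((hasAllMoments_stdGaussian k).const_mul (s j k)).memLp_two
        exact this.comp_measurePreserving measurePreserving_snd)
      (fun ω k => by
        have := integral_fun_snd (μ := ρ) (ν := γ)
          (fun z : EuclideanSpace ℝ (Fin K) => s j k * z k)
        refine this.trans ?_
        rw [integral_const_mul, integral_stdGaussian_apply]; simp)
      (q := fun k l _ => if k = l then s j k ^ 2 else 0)
      (fun ω k l => by
        have := integral_fun_snd (μ := ρ) (ν := γ)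
          (fun z : EuclideanSpace ℝ (Fin K) => (s j k * z k) * (s j l * z l))
        refine this.trans ?_
        simp_rw [mul_mul_mul_comm (s j k)]
        rw [integral_const_mul, integral_stdGaussian_mul]
        by_cases h : k = l
        · subst h; simp [sq]
        · simp [h])
    rw [e1, e2]
    have i1 : ∫ p, ‖Y p‖ ^ 3 ∂(Q.prod α) = ∫ x, ‖D j x‖ ^ 3 ∂(Measure.pi fun _ => ρ) :=
      integral_comp_measurePreserving hYp ((hD3 j).aestronglyMeasurable.norm.pow 3)
    have i2 : ∫ p, ‖Z p‖ ^ 3 ∂(Q.prod α) = ∫ z, ‖diagMul (s j) z‖ ^ 3 ∂γ :=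
      integral_comp_measurePreserving hZp ((hmemZ j).aestronglyMeasurable.norm.pow 3)
    rw [i1] at b1
    rw [i2] at b2
    have hc2 : Continuous (fderiv ℝ (fderiv ℝ g)) :=
      (hg.fderiv_right (m := 2) (by norm_num)).continuous_fderiv (by norm_num)
    have hhess : ∀ k l, Continuous (fun x => hess g x k l) := fun k l => by
      unfold hess; fun_prop
    have hqQ : ∀ k l, Integrable (fun ω : Fin m → R × EuclideanSpace ℝ (Fin K) =>
        q j k l (fun b => (ω b).1)) Q :=
      fun k l => hrows.integrable_comp_of_integrable (hqi j k l)
    have hterm : ∀ (k l : Fin K) (f : (Fin m → R × EuclideanSpace ℝ (Fin K)) → ℝ),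
        Integrable f Q → Integrable (fun ω => hess g (X ω) k l * f ω) Q := by
      intro k l f hf
      refine hf.bdd_mul ((hhess k l).comp_aestronglyMeasurable hXint.aestronglyMeasurable)
        (c := M₂) (Filter.Eventually.of_forall fun ω => abs_hess_le (hM₂ _) k l)
    have hgX := integrable_comp_of_lipschitz hg hM₁ hXint
    have b3 : |∫ ω, (g (X ω) + 1 / 2 * ∑ k, ∑ l, hess g (X ω) k l * q j k l (fun b => (ω b).1)) ∂Q
        - ∫ ω, (g (X ω) + 1 / 2 * ∑ k, ∑ l,
            hess g (X ω) k l * (if k = l then s j k ^ 2 else 0)) ∂Q|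
        ≤ 1 / 2 * M₂ * ∑ k, ∑ l,
          ∫ x, |q j k l x - (if k = l then s j k ^ 2 else 0)| ∂(Measure.pi fun _ => ρ) := by
      rw [← integral_sub]
      · refine abs_integral_le_integral_abs.trans ?_
        have hk : ∀ k l, ∫ x, |q j k l x - (if k = l then s j k ^ 2 else 0)|
            ∂(Measure.pi fun _ => ρ) = ∫ ω : Fin m → R × EuclideanSpace ℝ (Fin K),
              |q j k l (fun b => (ω b).1) - (if k = l then s j k ^ 2 else 0)| ∂Q := by
          intro k l
          exact (integral_comp_measurePreserving hrows
            ((hqi j k l).sub (integrable_const _)).abs.aestronglyMeasurable).symm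
        simp_rw [hk]
        have hi : ∀ k l, Integrable (fun ω : Fin m → R × EuclideanSpace ℝ (Fin K) =>
            |q j k l (fun b => (ω b).1) - (if k = l then s j k ^ 2 else 0)|) Q :=
          fun k l => ((hqQ k l).sub (integrable_const _)).abs
        have : ∑ k, ∑ l, ∫ ω : Fin m → R × EuclideanSpace ℝ (Fin K),
              |q j k l (fun b => (ω b).1) - (if k = l then s j k ^ 2 else 0)| ∂Q
            = ∫ ω : Fin m → R × EuclideanSpace ℝ (Fin K), ∑ k, ∑ l,
              |q j k l (fun b => (ω b).1) - (if k = l then s j k ^ 2 else 0)| ∂Q := by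
          rw [integral_finsetSum _ fun k _ => integrable_finsetSum _ fun l _ => hi k l]
          refine Finset.sum_congr rfl fun k _ => ?_
          rw [integral_finsetSum _ fun l _ => hi k l]
        rw [this, ← integral_const_mul]
        refine integral_mono_of_nonneg (Filter.Eventually.of_forall fun _ => abs_nonneg _)
          ((integrable_finsetSum _ fun k _ => integrable_finsetSum _ fun l _ => hi k l).const_mul _)
          (Filter.Eventually.of_forall fun ω => ?_)
        simp only
        rw [add_sub_add_left_eq_sub, ← mul_sub, ← Finset.sum_sub_distrib, abs_mul, mul_assoc,
          abs_of_pos (by norm_num : (0:ℝ) < 1 / 2)]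
        refine mul_le_mul_of_nonneg_left ?_ (by norm_num)
        rw [Finset.mul_sum]
        refine (Finset.abs_sum_le_sum_abs _ _).trans (Finset.sum_le_sum fun k _ => ?_)
        rw [Finset.mul_sum, ← Finset.sum_sub_distrib]
        refine (Finset.abs_sum_le_sum_abs _ _).trans (Finset.sum_le_sum fun l _ => ?_)
        rw [← mul_sub, abs_mul]
        exact mul_le_mul_of_nonneg_right (abs_hess_le (hM₂ _) k l) (abs_nonneg _)
      · exact hgX.add ((integrable_finsetSum _ fun k _ => integrable_finsetSum _ fun l _ =>
          hterm k l _ (hqQ k l)).const_mul _)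
      · exact hgX.add ((integrable_finsetSum _ fun k _ => integrable_finsetSum _ fun l _ =>
          hterm k l _ (integrable_const _)).const_mul _)
    have := abs_sub_le (∫ p, g (X p.1 + Y p) ∂(Q.prod α))
      (∫ ω, (g (X ω) + 1 / 2 * ∑ k, ∑ l, hess g (X ω) k l * q j k l (fun b => (ω b).1)) ∂Q)
      (∫ p, g (X p.1 + Z p) ∂(Q.prod α))
    have t2 := abs_sub_le
      (∫ ω, (g (X ω) + 1 / 2 * ∑ k, ∑ l, hess g (X ω) k l * q j k l (fun b => (ω b).1)) ∂Q)
      (∫ ω, (g (X ω) + 1 / 2 * ∑ k, ∑ l,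
            hess g (X ω) k l * (if k = l then s j k ^ 2 else 0)) ∂Q)
      (∫ p, g (X p.1 + Z p) ∂(Q.prod α))
    rw [abs_sub_comm] at b2
    rw [mul_add]
    linarith
  -- telescoping
  have hm : ∫ x, g (∑ j, D j x) ∂(Measure.pi fun _ => ρ)
      = ∫ ω, g (∑ i, hybridTerm D s m i ω) ∂Q := by
    have : ∀ ω : Fin m → R × EuclideanSpace ℝ (Fin K), ∑ i, hybridTerm D s m i ω
        = ∑ i, D i (fun a => (ω a).1) := fun ω =>
      Finset.sum_congr rfl fun i _ => by simp [hybridTerm]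
    simp_rw [this]
    exact (integral_comp_measurePreserving hrows (integrable_comp_of_lipschitz hg hM₁
      (integrable_finsetSum _ fun i _ =>
        (hD3 i).integrable (by norm_num))).aestronglyMeasurable).symm
  have h0 : ∫ z, g (diagMul σ z) ∂γ = ∫ ω, g (∑ i, hybridTerm D s 0 i ω) ∂Q := by
    have hgs := measurePreserving_gaussians (m := m) (K := K) ρ
    have hcs : Measurable (fun z : Fin m → EuclideanSpace ℝ (Fin K) => ∑ j, diagMul (s j) (z j)) :=
      Finset.measurable_sum _ fun j _ =>
        (continuous_diagMul (s j)).measurable.comp (measurable_pi_apply j)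
    simp only [hybridTerm, Nat.not_lt_zero, if_false]
    have e3 := map_sum_diagMul s σ hσ
    rw [← integral_map (φ := diagMul σ) (f := g) (continuous_diagMul σ).aemeasurable
      hg.continuous.aestronglyMeasurable, hγ, ← e3,
      integral_map hcs.aemeasurable hg.continuous.aestronglyMeasurable]
    exact (integral_comp_measurePreserving hgs
      (hg.continuous.measurable.comp hcs).aestronglyMeasurable).symm
  rw [hm, h0]
  have tel : ∀ t : ℕ, ∀ ht : t ≤ m, |∫ ω, g (∑ i, hybridTerm D s t i ω) ∂Q
      - ∫ ω, g (∑ i, hybridTerm D s 0 i ω) ∂Q| ≤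
      ∑ j : Fin t, (1 / 2 * M₂ * ∑ k, ∑ l,
          ∫ x, |q (Fin.castLE ht j) k l x - (if k = l then s (Fin.castLE ht j) k ^ 2 else 0)|
            ∂(Measure.pi fun _ => ρ)
        + 1 / 2 * M₃ * (∫ x, ‖D (Fin.castLE ht j) x‖ ^ 3 ∂(Measure.pi fun _ => ρ)
          + ∫ z, ‖diagMul (s (Fin.castLE ht j)) z‖ ^ 3 ∂γ)) := by
    intro t
    induction t with
    | zero => intro _; simp
    | succ t ih =>
      intro ht
      have h1 := ih (by omega)
      have h2 := step ⟨t, by omega⟩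
      rw [Fin.sum_univ_castSucc]
      refine (abs_sub_le _ (∫ ω, g (∑ i, hybridTerm D s t i ω) ∂Q) _).trans ?_
      rw [add_comm]
      exact add_le_add h1 h2
  exact tel m le_rfl

end Lindeberg

end Perceptron

namespace Perceptron

/-! ### Monomials in independent Gaussian entries -/

instance isProbabilityMeasure_delta0 (n : ℕ) : IsProbabilityMeasure (delta0 n) := by
  unfold delta0; infer_instance

/-- Law of an `m × n` matrix with independent standard Gaussian entries. -/
noncomputable abbrev gaussMatrix (m n : ℕ) : Measure (Fin m → Fin n → ℝ) :=
  Measure.pi fun _ => delta0 n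

lemma hasAllMoments_row {n : ℕ} (i : Fin n) : HasAllMoments (delta0 n) (fun y => y i) :=
  hasAllMoments_gaussian.comp (measurePreserving_eval _ i)

lemma hasAllMoments_entry {m n : ℕ} (j : Fin m) (i : Fin n) :
    HasAllMoments (gaussMatrix m n) (fun x => x j i) :=
  (hasAllMoments_row i).comp (measurePreserving_eval _ j)

/-- Square-free monomial in the entries of a matrix. -/
noncomputable def monom {m n : ℕ} (S : Finset (Fin m × Fin n)) (x : Fin m → Fin n → ℝ) : ℝ :=
  ∏ e ∈ S, x e.1 e.2

lemma hasAllMoments_monom {m n : ℕ} (S : Finset (Fin m × Fin n)) :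
    HasAllMoments (gaussMatrix m n) (monom S) :=
  HasAllMoments.prod S fun e _ => hasAllMoments_entry e.1 e.2

lemma integral_gaussMatrix_prod {m n : ℕ} (f : Fin m × Fin n → ℝ → ℝ) :
    ∫ x, ∏ e : Fin m × Fin n, f e (x e.1 e.2) ∂(gaussMatrix m n)
      = ∏ e, ∫ t, f e t ∂(gaussianReal 0 1) := by
  simp_rw [Fintype.prod_prod_type]
  rw [integral_fintype_prod_eq_prod (𝕜 := ℝ) (μ := fun _ : Fin m => delta0 n)
    (fun j y => ∏ i, f (j, i) (y i))]
  refine Finset.prod_congr rfl fun j _ => ?_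
  rw [delta0, integral_fintype_prod_eq_prod (𝕜 := ℝ) (μ := fun _ : Fin n => gaussianReal 0 1)
    (fun i t => f (j, i) t)]

/-- Moments of the standard Gaussian. -/
noncomputable def gaussMoment (a : ℕ) : ℝ := ∫ t, t ^ a ∂(gaussianReal 0 1)

lemma gaussMoment_zero : gaussMoment 0 = 1 := by simp [gaussMoment]
lemma gaussMoment_one : gaussMoment 1 = 0 := by simp [gaussMoment]
lemma gaussMoment_two : gaussMoment 2 = 1 := integral_gaussian_sq
lemma gaussMoment_three : gaussMoment 3 = 0 := integral_gaussian_cube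
lemma gaussMoment_four : gaussMoment 4 = 3 := integral_gaussian_four

/-- Number of times `e` is covered by two sets. -/
def mult₂ {ε : Type*} [DecidableEq ε] (S T : Finset ε) (e : ε) : ℕ :=
  (if e ∈ S then 1 else 0) + (if e ∈ T then 1 else 0)

lemma monom_eq_prod {m n : ℕ} (S : Finset (Fin m × Fin n)) (x : Fin m → Fin n → ℝ) :
    monom S x = ∏ e : Fin m × Fin n, x e.1 e.2 ^ (if e ∈ S then 1 else 0) := by
  unfold monom
  rw [← Finset.prod_subset (Finset.subset_univ S) fun e _ he => by simp [he]]
  exact Finset.prod_congr rfl fun e he => by simp [he]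

lemma integral_monom₄ {m n : ℕ} (S₁ S₂ S₃ S₄ : Finset (Fin m × Fin n)) :
    ∫ x, (monom S₁ x * monom S₂ x) * (monom S₃ x * monom S₄ x) ∂(gaussMatrix m n)
      = ∏ e, gaussMoment (mult₂ S₁ S₂ e + mult₂ S₃ S₄ e) := by
  simp_rw [monom_eq_prod, ← Finset.prod_mul_distrib, ← pow_add]
  exact integral_gaussMatrix_prod (fun e t => t ^ (mult₂ S₁ S₂ e + mult₂ S₃ S₄ e))

lemma integral_monom₂_eq_prod {m n : ℕ} (S₁ S₂ : Finset (Fin m × Fin n)) :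
    ∫ x, monom S₁ x * monom S₂ x ∂(gaussMatrix m n) = ∏ e, gaussMoment (mult₂ S₁ S₂ e) := by
  simp_rw [monom_eq_prod, ← Finset.prod_mul_distrib, ← pow_add]
  exact integral_gaussMatrix_prod (fun e t => t ^ (mult₂ S₁ S₂ e))

lemma gaussMoment_mult₂ {ε : Type*} [DecidableEq ε] (S T : Finset ε) (e : ε) :
    gaussMoment (mult₂ S T e) = if (e ∈ S ↔ e ∈ T) then 1 else 0 := by
  unfold mult₂
  by_cases h1 : e ∈ S <;> by_cases h2 : e ∈ T <;>
    simp [h1, h2, gaussMoment_zero, gaussMoment_one, gaussMoment_two]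

lemma integral_monom₂ {m n : ℕ} (S₁ S₂ : Finset (Fin m × Fin n)) :
    ∫ x, monom S₁ x * monom S₂ x ∂(gaussMatrix m n) = if S₁ = S₂ then 1 else 0 := by
  rw [integral_monom₂_eq_prod]
  simp_rw [gaussMoment_mult₂]
  split_ifs with h
  · subst h; simp
  · have : ∃ e, ¬ (e ∈ S₁ ↔ e ∈ S₂) := by
      by_contra hcon
      push Not at hcon
      exact h (Finset.ext hcon)
    obtain ⟨e, he⟩ := this
    exact Finset.prod_eq_zero (Finset.mem_univ e) (if_neg he)

/-- Two products of square-free monomials are uncorrelated unless they share a variable and every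
variable occurs an even number of times in total. -/
lemma abs_cov_monom_le {m n : ℕ} (S₁ S₂ S₃ S₄ : Finset (Fin m × Fin n)) :
    |∫ x, (monom S₁ x * monom S₂ x) * (monom S₃ x * monom S₄ x) ∂(gaussMatrix m n)
      - (∫ x, monom S₁ x * monom S₂ x ∂(gaussMatrix m n))
        * ∫ x, monom S₃ x * monom S₄ x ∂(gaussMatrix m n)|
    ≤ if (∀ e, Even (mult₂ S₁ S₂ e + mult₂ S₃ S₄ e)) ∧ ((S₁ ∪ S₂) ∩ (S₃ ∪ S₄)).Nonempty
      then 3 ^ S₁.card else 0 := by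
  rw [integral_monom₄, integral_monom₂_eq_prod, integral_monom₂_eq_prod]
  by_cases hev : ∀ e, Even (mult₂ S₁ S₂ e + mult₂ S₃ S₄ e)
  swap
  · have hz : ∏ e, gaussMoment (mult₂ S₁ S₂ e + mult₂ S₃ S₄ e) = 0 := by
      push Not at hev
      obtain ⟨e, he⟩ := hev
      refine Finset.prod_eq_zero (Finset.mem_univ e) ?_
      have h4 : mult₂ S₁ S₂ e + mult₂ S₃ S₄ e ≤ 4 := by
        unfold mult₂; split_ifs <;> omega
      rw [Nat.not_even_iff_odd] at he
      generalize mult₂ S₁ S₂ e + mult₂ S₃ S₄ e = r at he h4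
      interval_cases r
      · exact absurd he (by decide)
      · exact gaussMoment_one
      · exact absurd he (by decide)
      · exact gaussMoment_three
      · exact absurd he (by decide)
    have hz2 : (∏ e, gaussMoment (mult₂ S₁ S₂ e)) * ∏ e, gaussMoment (mult₂ S₃ S₄ e) = 0 := by
      by_contra hne
      rw [← Finset.prod_mul_distrib] at hne
      refine hev fun e => ?_
      have := Finset.prod_ne_zero_iff.mp hne e (Finset.mem_univ e)
      rw [gaussMoment_mult₂, gaussMoment_mult₂] at this
      have h1 : (e ∈ S₁ ↔ e ∈ S₂) := by by_contra h; simp [h] at this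
      have h2 : (e ∈ S₃ ↔ e ∈ S₄) := by by_contra h; simp [h] at this
      unfold mult₂
      simp only [h1, h2]
      split_ifs <;> decide
    rw [hz, hz2, if_neg fun h => hev h.1]
    simp
  by_cases hne : ((S₁ ∪ S₂) ∩ (S₃ ∪ S₄)).Nonempty
  swap
  · have : ∀ e, gaussMoment (mult₂ S₁ S₂ e + mult₂ S₃ S₄ e)
        = gaussMoment (mult₂ S₁ S₂ e) * gaussMoment (mult₂ S₃ S₄ e) := by
      intro e
      rw [Finset.not_nonempty_iff_eq_empty] at hne
      have he : e ∉ (S₁ ∪ S₂) ∩ (S₃ ∪ S₄) := by rw [hne]; simp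
      simp only [Finset.mem_inter, Finset.mem_union, not_and_or, not_or] at he
      rcases he with ⟨h1, h2⟩ | ⟨h1, h2⟩ <;> simp [mult₂, h1, h2, gaussMoment_zero]
    simp_rw [this, Finset.prod_mul_distrib, sub_self]
    rw [if_neg fun h => hne h.2]
    simp
  simp only [hev, hne, and_self, implies_true, if_true]
  have hpow : (3 : ℝ) ^ S₁.card = ∏ e : Fin m × Fin n, (if e ∈ S₁ then 3 else 1) := by
    rw [Finset.prod_ite]; simp
  have b1 : 0 ≤ ∏ e, gaussMoment (mult₂ S₁ S₂ e + mult₂ S₃ S₄ e) ∧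
      ∏ e, gaussMoment (mult₂ S₁ S₂ e + mult₂ S₃ S₄ e) ≤ 3 ^ S₁.card := by
    have hb : ∀ e, 0 ≤ gaussMoment (mult₂ S₁ S₂ e + mult₂ S₃ S₄ e) ∧
        gaussMoment (mult₂ S₁ S₂ e + mult₂ S₃ S₄ e) ≤ if e ∈ S₁ then 3 else 1 := by
      intro e
      have hb := hev e
      unfold mult₂ at hb ⊢
      by_cases h1 : e ∈ S₁ <;> by_cases h2 : e ∈ S₂ <;> by_cases h3 : e ∈ S₃ <;>
        by_cases h4 : e ∈ S₄ <;> simp [h1, h2, h3, h4, gaussMoment_zero, gaussMoment_one,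
          gaussMoment_two, gaussMoment_three, gaussMoment_four]
    rw [hpow]
    exact ⟨Finset.prod_nonneg fun e _ => (hb e).1,
      Finset.prod_le_prod (fun e _ => (hb e).1) fun e _ => (hb e).2⟩
  have b2 : ∀ S T : Finset (Fin m × Fin n), 0 ≤ ∏ e, gaussMoment (mult₂ S T e) ∧
      ∏ e, gaussMoment (mult₂ S T e) ≤ 1 := by
    intro S T
    simp_rw [gaussMoment_mult₂]
    exact ⟨Finset.prod_nonneg fun e _ => by split_ifs <;> norm_num,
      Finset.prod_le_one (fun e _ => by split_ifs <;> norm_num)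
        fun e _ => by split_ifs <;> norm_num⟩
  have b3 := b2 S₁ S₂
  have b4 := b2 S₃ S₄
  have h3 : (1 : ℝ) ≤ 3 ^ S₁.card := one_le_pow₀ (by norm_num)
  rw [abs_le]
  constructor
  · nlinarith [mul_le_one₀ b3.2 b4.1 b4.2]
  · nlinarith [mul_nonneg b3.1 b4.1]

/-! ### Hypercontractivity -/

lemma sq_integral_mul_le {α : Type*} [MeasurableSpace α] {μ : Measure α} {F G : α → ℝ}
    (hF : MemLp F 2 μ) (hG : MemLp G 2 μ) :
    (∫ x, F x * G x ∂μ) ^ 2 ≤ (∫ x, F x ^ 2 ∂μ) * ∫ x, G x ^ 2 ∂μ := by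
  have hFF := hF.integrable_sq
  have hGG := hG.integrable_sq
  have hFG : Integrable (fun x => F x * G x) μ := hF.integrable_mul hG
  have key : ∀ t : ℝ, 0 ≤ (∫ x, G x ^ 2 ∂μ) * (t * t) + (2 * ∫ x, F x * G x ∂μ) * t
      + ∫ x, F x ^ 2 ∂μ := by
    intro t
    have : 0 ≤ ∫ x, (F x + t * G x) ^ 2 ∂μ := integral_nonneg fun x => sq_nonneg _
    have e : ∀ x, (F x + t * G x) ^ 2 = (t * t) * G x ^ 2 + (2 * t) * (F x * G x) + F x ^ 2 :=
      fun x => by ring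
    simp_rw [e] at this
    have i1 : Integrable (fun x => (t * t) * G x ^ 2 + (2 * t) * (F x * G x)) μ :=
      (hGG.const_mul _).add (hFG.const_mul _)
    rw [integral_add i1 hFF, integral_add (hGG.const_mul _) (hFG.const_mul _), integral_const_mul,
      integral_const_mul] at this
    linarith
  have := discrim_le_zero key
  unfold discrim at this
  nlinarith

/-- Bonami's inequality: a polynomial of degree at most `d` that is affine in each of the
independent normalised variables `φ (x a)` satisfies `𝔼 f⁴ ≤ β^{2d} (𝔼 f²)²`. -/
lemma integral_pow_four_le {ι : Type*} [Fintype ι] [DecidableEq ι] (ν : Measure ℝ)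
    [IsProbabilityMeasure ν] {φ : ℝ → ℝ} (hφ : HasAllMoments ν φ) (h1 : ∫ t, φ t ∂ν = 0)
    (h2 : ∫ t, φ t ^ 2 ∂ν = 1) {β : ℝ} (hβ1 : 3 + |∫ t, φ t ^ 3 ∂ν| ≤ β)
    (hβ2 : (∫ t, φ t ^ 4 ∂ν) + 2 * |∫ t, φ t ^ 3 ∂ν| ≤ β ^ 2)
    {τ : Type*} (T : Finset ι) : ∀ (d : ℕ) (s : Finset τ) (c : τ → ℝ) (A : τ → Finset ι),
      (∀ p ∈ s, A p ⊆ T) → (∀ p ∈ s, (A p).card ≤ d) →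
      ∫ x : ι → ℝ, (∑ p ∈ s, c p * ∏ a ∈ A p, φ (x a)) ^ 4 ∂(Measure.pi fun _ => ν)
        ≤ (β ^ 2) ^ d *
          (∫ x : ι → ℝ, (∑ p ∈ s, c p * ∏ a ∈ A p, φ (x a)) ^ 2 ∂(Measure.pi fun _ => ν)) ^ 2 := by
  classical
  have hβ3 : 3 ≤ β := by linarith [abs_nonneg (∫ t, φ t ^ 3 ∂ν)]
  have hβsq : 1 ≤ β ^ 2 := by nlinarith
  have hmom : ∀ (s : Finset τ) (c : τ → ℝ) (A : τ → Finset ι), HasAllMoments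
      (Measure.pi fun _ : ι => ν) (fun x => ∑ p ∈ s, c p * ∏ a ∈ A p, φ (x a)) :=
    fun s c A => HasAllMoments.sum s fun p _ => (HasAllMoments.prod (A p) fun a _ =>
      hφ.comp (measurePreserving_eval (fun _ : ι => ν) a)).const_mul _
  induction T using Finset.induction_on with
  | empty =>
    intro d s c A hA _
    have : ∀ x : ι → ℝ, ∑ p ∈ s, c p * ∏ a ∈ A p, φ (x a) = ∑ p ∈ s, c p := fun x =>
      Finset.sum_congr rfl fun p hp => by
        rw [Finset.subset_empty.mp (hA p hp)]; simp
    simp_rw [this]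
    simp only [integral_const, probReal_univ, one_smul]
    have h := one_le_pow₀ hβsq (n := d)
    have h4 : 0 ≤ (∑ p ∈ s, c p) ^ 4 := by positivity
    nlinarith
  | insert a T ha ih =>
    intro d s c A hA hd
    -- The polynomial is `f₀ + φ (x a) * f₁` with `f₀`, `f₁` free of `x a`, and `f₁` has lower degree.
    set s₁ := s.filter fun p => a ∈ A p with hs1
    set s₀ := s.filter fun p => a ∉ A p with hs0
    set f₁ : (ι → ℝ) → ℝ := fun x => ∑ p ∈ s₁, c p * ∏ b ∈ (A p).erase a, φ (x b) with hf1
    set f₀ : (ι → ℝ) → ℝ := fun x => ∑ p ∈ s₀, c p * ∏ b ∈ A p, φ (x b) with hf0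
    have hsplit : ∀ x : ι → ℝ, ∑ p ∈ s, c p * ∏ b ∈ A p, φ (x b) = f₀ x + φ (x a) * f₁ x := by
      intro x
      rw [← Finset.sum_filter_add_sum_filter_not s (fun p => a ∈ A p), add_comm]
      congr 1
      rw [hf1]
      simp only
      rw [Finset.mul_sum]
      refine Finset.sum_congr rfl fun p hp => ?_
      rw [← Finset.mul_prod_erase _ _ (Finset.mem_filter.mp hp).2]
      ring
    have ih0 := ih d s₀ c A
      (fun p hp => by
        have hp' := Finset.mem_filter.mp hp
        exact (Finset.subset_insert_iff_of_notMem hp'.2).mp (hA p hp'.1))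
      (fun p hp => hd p (Finset.mem_filter.mp hp).1)
    by_cases he : s₁ = ∅
    · have : ∀ x : ι → ℝ, ∑ p ∈ s, c p * ∏ b ∈ A p, φ (x b) = f₀ x := fun x => by
        rw [hsplit]; simp [hf1, he]
      simp_rw [this]
      exact ih0
    obtain ⟨p₁, hp₁⟩ := Finset.nonempty_of_ne_empty he
    have hp₁' := Finset.mem_filter.mp hp₁
    obtain ⟨d, rfl⟩ : ∃ d', d = d' + 1 := by
      have := hd p₁ hp₁'.1
      have h0 : 0 < (A p₁).card := Finset.card_pos.mpr ⟨a, hp₁'.2⟩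
      exact ⟨d - 1, by omega⟩
    have ih1 := ih d s₁ c (fun p => (A p).erase a)
      (fun p hp => Finset.subset_insert_iff.mp (hA p (Finset.mem_filter.mp hp).1))
      (fun p hp => by
        have hp' := Finset.mem_filter.mp hp
        rw [Finset.card_erase_of_mem hp'.2]
        have := hd p hp'.1
        omega)
    simp_rw [hsplit]
    have m0 : HasAllMoments (Measure.pi fun _ : ι => ν) f₀ := hmom _ _ _
    have m1 : HasAllMoments (Measure.pi fun _ : ι => ν) f₁ := hmom _ _ _
    have mφ : HasAllMoments (Measure.pi fun _ : ι => ν) (fun x : ι → ℝ => φ (x a)) :=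
      hφ.comp (measurePreserving_eval (fun _ : ι => ν) a)
    have u0 : ∀ x y, f₀ (Function.update x a y) = f₀ x := fun x y =>
      Finset.sum_congr rfl fun p hp => by
        congr 1
        refine Finset.prod_congr rfl fun b hb => ?_
        have : b ≠ a := fun h => (Finset.mem_filter.mp hp).2 (h ▸ hb)
        rw [Function.update_of_ne this]
    have u1 : ∀ x y, f₁ (Function.update x a y) = f₁ x := fun x y =>
      Finset.sum_congr rfl fun p hp => by
        congr 1
        refine Finset.prod_congr rfl fun b hb => ?_
        rw [Function.update_of_ne (Finset.ne_of_mem_erase hb)]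
    have ind : ∀ i j r : ℕ, ∫ x, f₀ x ^ i * f₁ x ^ j * φ (x a) ^ r ∂(Measure.pi fun _ => ν)
        = (∫ x, f₀ x ^ i * f₁ x ^ j ∂(Measure.pi fun _ => ν)) * ∫ t, φ t ^ r ∂ν := by
      intro i j r
      rw [integral_update (fun _ : ι => ν) a (((m0.pow i).mul (m1.pow j)).mul
        (mφ.pow r)).integrable]
      simp_rw [u0, u1, Function.update_self, integral_const_mul, integral_mul_const]
    have int : ∀ i j r : ℕ, HasAllMoments (Measure.pi fun _ => ν)
        (fun x => f₀ x ^ i * f₁ x ^ j * φ (x a) ^ r) := fun i j r =>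
      ((m0.pow i).mul (m1.pow j)).mul (mφ.pow r)
    have e2 : ∫ x, (f₀ x + φ (x a) * f₁ x) ^ 2 ∂(Measure.pi fun _ => ν)
        = ∫ x, f₀ x ^ 2 ∂(Measure.pi fun _ => ν) + ∫ x, f₁ x ^ 2 ∂(Measure.pi fun _ => ν) := by
      have : ∀ x, (f₀ x + φ (x a) * f₁ x) ^ 2 = f₀ x ^ 2 * f₁ x ^ 0 * φ (x a) ^ 0
          + 2 * (f₀ x ^ 1 * f₁ x ^ 1 * φ (x a) ^ 1) + f₀ x ^ 0 * f₁ x ^ 2 * φ (x a) ^ 2 :=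
        fun x => by ring
      simp_rw [this]
      rw [((int 2 0 0).add ((int 1 1 1).const_mul 2)).integral_add (int 0 2 2),
        (int 2 0 0).integral_add ((int 1 1 1).const_mul 2), integral_const_mul, ind, ind, ind, h2]
      simp [h1]
    set t := ∫ t, φ t ^ 3 ∂ν with ht
    set b := ∫ t, φ t ^ 4 ∂ν with hb
    have e4 : ∫ x, (f₀ x + φ (x a) * f₁ x) ^ 4 ∂(Measure.pi fun _ => ν)
        = ∫ x, f₀ x ^ 4 ∂(Measure.pi fun _ => ν)
          + 6 * ∫ x, f₀ x ^ 2 * f₁ x ^ 2 ∂(Measure.pi fun _ => ν)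
          + 4 * ((∫ x, f₀ x ^ 1 * f₁ x ^ 3 ∂(Measure.pi fun _ => ν)) * t)
          + b * ∫ x, f₁ x ^ 4 ∂(Measure.pi fun _ => ν) := by
      have : ∀ x, (f₀ x + φ (x a) * f₁ x) ^ 4 = f₀ x ^ 4 * f₁ x ^ 0 * φ (x a) ^ 0
          + 4 * (f₀ x ^ 3 * f₁ x ^ 1 * φ (x a) ^ 1)
          + 6 * (f₀ x ^ 2 * f₁ x ^ 2 * φ (x a) ^ 2)
          + 4 * (f₀ x ^ 1 * f₁ x ^ 3 * φ (x a) ^ 3)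
          + f₀ x ^ 0 * f₁ x ^ 4 * φ (x a) ^ 4 := fun x => by ring
      simp_rw [this]
      have j1 := (int 4 0 0).add ((int 3 1 1).const_mul 4)
      have j2 := j1.add ((int 2 2 2).const_mul 6)
      have j3 := j2.add ((int 1 3 3).const_mul 4)
      rw [j3.integral_add (int 0 4 4), j2.integral_add ((int 1 3 3).const_mul 4),
        j1.integral_add ((int 2 2 2).const_mul 6),
        (int 4 0 0).integral_add ((int 3 1 1).const_mul 4), integral_const_mul,
        integral_const_mul, integral_const_mul, ind, ind, ind, ind, ind, h2, ← ht, ← hb]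
      simp only [pow_one, h1]
      simp only [pow_zero, one_mul, mul_one, integral_const, probReal_univ, one_smul]
      ring
    rw [e2, e4]
    set a₂ := ∫ x, f₀ x ^ 2 ∂(Measure.pi fun _ => ν)
    set b₂ := ∫ x, f₁ x ^ 2 ∂(Measure.pi fun _ => ν)
    set a₄ := ∫ x, f₀ x ^ 4 ∂(Measure.pi fun _ => ν)
    set b₄ := ∫ x, f₁ x ^ 4 ∂(Measure.pi fun _ => ν)
    set c₂₂ := ∫ x, f₀ x ^ 2 * f₁ x ^ 2 ∂(Measure.pi fun _ => ν)
    set c₁₃ := ∫ x, f₀ x ^ 1 * f₁ x ^ 3 ∂(Measure.pi fun _ => ν)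
    have ha2 : 0 ≤ a₂ := integral_nonneg fun x => sq_nonneg _
    have hb2 : 0 ≤ b₂ := integral_nonneg fun x => sq_nonneg _
    have hb4 : 0 ≤ b₄ := integral_nonneg fun x => by positivity
    have hc22 : 0 ≤ c₂₂ := integral_nonneg fun x => by positivity
    have hcs : c₂₂ ^ 2 ≤ a₄ * b₄ := by
      have := sq_integral_mul_le (m0.pow 2).memLp_two (m1.pow 2).memLp_two
      simpa only [← pow_mul] using this
    have h13 : |c₁₃| ≤ 1 / 2 * (c₂₂ + b₄) := by
      refine abs_integral_le_integral_abs.trans ?_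
      have : 1 / 2 * (c₂₂ + b₄)
          = ∫ x, 1 / 2 * (f₀ x ^ 2 * f₁ x ^ 2 + f₁ x ^ 4) ∂(Measure.pi fun _ => ν) := by
        rw [integral_const_mul, integral_add ((m0.pow 2).mul (m1.pow 2)).integrable
          (m1.pow 4).integrable]
      rw [this]
      refine integral_mono ((m0.pow 1).mul (m1.pow 3)).integrable.abs
        ((((m0.pow 2).mul (m1.pow 2)).add (m1.pow 4)).const_mul _).integrable fun x => ?_
      simp only
      rw [abs_le]
      constructor
      · nlinarith [mul_nonneg (sq_nonneg (f₁ x)) (sq_nonneg (f₀ x + f₁ x))]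
      · nlinarith [mul_nonneg (sq_nonneg (f₁ x)) (sq_nonneg (f₀ x - f₁ x))]
    have hβ0 : 0 ≤ β := by linarith
    have hBd : 0 ≤ (β ^ 2) ^ d := by positivity
    have hc22' : c₂₂ ≤ (β ^ 2) ^ d * β * (a₂ * b₂) := by
      refine le_of_sq_le_sq ?_ (by positivity)
      calc c₂₂ ^ 2 ≤ a₄ * b₄ := hcs
        _ ≤ ((β ^ 2) ^ (d + 1) * a₂ ^ 2) * ((β ^ 2) ^ d * b₂ ^ 2) :=
            mul_le_mul ih0 ih1 hb4 (by positivity)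
        _ = _ := by ring
    have ht13 : c₁₃ * t ≤ |t| * (1 / 2 * (c₂₂ + b₄)) := by
      calc c₁₃ * t ≤ |c₁₃ * t| := le_abs_self _
        _ = |t| * |c₁₃| := by rw [abs_mul, mul_comm]
        _ ≤ _ := mul_le_mul_of_nonneg_left h13 (abs_nonneg _)
    have hk1 : (6 + 2 * |t|) * c₂₂ ≤ 2 * β * ((β ^ 2) ^ d * β * (a₂ * b₂)) := by
      have : 6 + 2 * |t| ≤ 2 * β := by linarith
      exact mul_le_mul this hc22' hc22 (by linarith)
    have hk2 : (b + 2 * |t|) * b₄ ≤ β ^ 2 * ((β ^ 2) ^ d * b₂ ^ 2) := by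
      exact mul_le_mul hβ2 ih1 hb4 (by positivity)
    calc a₄ + 6 * c₂₂ + 4 * (c₁₃ * t) + b * b₄
        ≤ a₄ + (6 + 2 * |t|) * c₂₂ + (b + 2 * |t|) * b₄ := by linarith
      _ ≤ (β ^ 2) ^ (d + 1) * a₂ ^ 2 + 2 * β * ((β ^ 2) ^ d * β * (a₂ * b₂))
          + β ^ 2 * ((β ^ 2) ^ d * b₂ ^ 2) := by linarith
      _ = (β ^ 2) ^ (d + 1) * (a₂ + b₂) ^ 2 := by ring

end Perceptron

namespace Perceptron

/-! ### Weighted walks in a bipartite graph -/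

section Walks

variable {m n : ℕ}

/-- Walks `i 0 → J 0 → i 1 → ⋯ → J (L-1) → i L` with `L + 1` columns `i` and `L` rows `J`, in
alternation. -/
abbrev Walk (m n L : ℕ) := (Fin (L + 1) → Fin n) × (Fin L → Fin m)

/-- Product of the weights `w` of the edges of a walk. -/
noncomputable def walkWeight (w : Fin m → Fin n → ℝ) {L : ℕ} (p : Walk m n L) : ℝ :=
  ∏ l : Fin L, w (p.2 l) (p.1 l.castSucc) * w (p.2 l) (p.1 l.succ)

/-- Prepend a column and a row to a walk. -/
def consWalk {L : ℕ} (a : Fin n) (r : Fin m) (p : Walk m n L) : Walk m n (L + 1) :=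
  (Fin.cons a p.1, Fin.cons r p.2)

lemma walkWeight_cons (w : Fin m → Fin n → ℝ) {L : ℕ} (a : Fin n) (r : Fin m)
    (p : Walk m n L) :
    walkWeight w (consWalk a r p) = w r a * w r (p.1 0) * walkWeight w p := by
  unfold walkWeight consWalk
  rw [Fin.prod_univ_succ]
  simp [Fin.castSucc_succ]

lemma walkWeight_nonneg {w : Fin m → Fin n → ℝ} (hw : ∀ r c, 0 ≤ w r c) {L : ℕ}
    (p : Walk m n L) : 0 ≤ walkWeight w p :=
  Finset.prod_nonneg fun _ _ => mul_nonneg (hw _ _) (hw _ _)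

lemma sum_cons {α β : Type*} [Fintype α] [AddCommMonoid β] {L : ℕ}
    (f : (Fin (L + 1) → α) → β) :
    ∑ i : Fin (L + 1) → α, f i = ∑ a, ∑ i : Fin L → α, f (Fin.cons a i) := by
  rw [← (Fin.consEquiv fun _ : Fin (L + 1) => α).sum_comp f, Fintype.sum_prod_type]
  rfl

lemma sum_snoc {α β : Type*} [Fintype α] [AddCommMonoid β] {L : ℕ}
    (f : (Fin (L + 1) → α) → β) :
    ∑ i : Fin (L + 1) → α, f i = ∑ a, ∑ i : Fin L → α, f (Fin.snoc i a) := by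
  rw [← (Fin.snocEquiv fun _ : Fin (L + 1) => α).sum_comp f, Fintype.sum_prod_type]
  rfl

lemma sum_walk_succ {L : ℕ} (F : Walk m n (L + 1) → ℝ) :
    ∑ p, F p = ∑ a, ∑ r, ∑ p : Walk m n L, F (consWalk a r p) := by
  rw [Fintype.sum_prod_type, sum_cons]
  refine Finset.sum_congr rfl fun a _ => ?_
  simp_rw [sum_cons (L := L) (α := Fin m), Fintype.sum_prod_type]
  rw [Finset.sum_comm]
  rfl

lemma sum_walk_zero (F : Walk m n 0 → ℝ) :
    ∑ p, F p = ∑ a, F (fun _ => a, Fin.elim0) := by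
  rw [Fintype.sum_prod_type, sum_cons]
  refine Finset.sum_congr rfl fun a _ => ?_
  simp only [Finset.univ_unique, Finset.sum_singleton]
  congr 2
  · ext l; fin_cases l; rfl

lemma sum_walk_start {L : ℕ} (G : Fin n → ℝ) (f : Walk m n L → ℝ) :
    ∑ p, G (p.1 0) * f p = ∑ b, G b * ∑ p, if p.1 0 = b then f p else 0 := by
  simp_rw [Finset.mul_sum]
  rw [Finset.sum_comm]
  refine Finset.sum_congr rfl fun p _ => ?_
  rw [Finset.sum_eq_single (p.1 0) (fun b _ hb => by simp [Ne.symm hb]) (by simp)]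
  simp

/-- Total weight of the walks of a given length from `a` to an arbitrary column. -/
lemma sum_walkWeight_le {w : Fin m → Fin n → ℝ} (hw : ∀ r c, 0 ≤ w r c) {B : ℝ}
    (hrow : ∀ r, ∑ c, w r c ≤ B) (hcol : ∀ c, ∑ r, w r c ≤ B) (hB : 0 ≤ B) (L : ℕ) (a : Fin n) :
    ∑ p : Walk m n L, (if p.1 0 = a then walkWeight w p else 0) ≤ B ^ (2 * L) := by
  induction L generalizing a with
  | zero =>
    rw [sum_walk_zero]
    simp [walkWeight]
  | succ L ih =>
    rw [sum_walk_succ]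
    simp only [consWalk, Fin.cons_zero]
    rw [Finset.sum_eq_single a (fun b _ hb => by simp [hb]) (by simp)]
    simp only [if_true]
    calc ∑ r, ∑ p : Walk m n L, walkWeight w (consWalk a r p)
        = ∑ r, ∑ b, w r a * w r b * ∑ p : Walk m n L, (if p.1 0 = b then walkWeight w p else 0) := by
          refine Finset.sum_congr rfl fun r _ => ?_
          simp_rw [walkWeight_cons]
          exact sum_walk_start (fun b => w r a * w r b) _
      _ ≤ ∑ r, ∑ b, w r a * w r b * B ^ (2 * L) := by
            refine Finset.sum_le_sum fun r _ => Finset.sum_le_sum fun b _ => ?_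
            exact mul_le_mul_of_nonneg_left (ih b) (mul_nonneg (hw _ _) (hw _ _))
      _ = (∑ r, w r a * ∑ b, w r b) * B ^ (2 * L) := by
            simp_rw [Finset.sum_mul, Finset.mul_sum, Finset.sum_mul]
      _ ≤ (B * B) * B ^ (2 * L) := by
            refine mul_le_mul_of_nonneg_right ?_ (by positivity)
            calc ∑ r, w r a * ∑ b, w r b ≤ ∑ r, w r a * B :=
                  Finset.sum_le_sum fun r _ => mul_le_mul_of_nonneg_left (hrow r) (hw _ _)
              _ = (∑ r, w r a) * B := by rw [Finset.sum_mul]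
              _ ≤ B * B := mul_le_mul_of_nonneg_right (hcol a) hB
      _ = B ^ (2 * (L + 1)) := by ring

/-- The walk uses an edge of `S`. -/
def Hits (S : Finset (Fin m × Fin n)) {L : ℕ} (p : Walk m n L) : Prop :=
  ∃ l : Fin L, (p.2 l, p.1 l.castSucc) ∈ S ∨ (p.2 l, p.1 l.succ) ∈ S

instance (S : Finset (Fin m × Fin n)) {L : ℕ} (p : Walk m n L) : Decidable (Hits S p) := by
  unfold Hits; infer_instance

lemma hits_cons (S : Finset (Fin m × Fin n)) {L : ℕ} (a : Fin n) (r : Fin m) (p : Walk m n L) :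
    Hits S (consWalk a r p) ↔ (r, a) ∈ S ∨ (r, p.1 0) ∈ S ∨ Hits S p := by
  unfold Hits consWalk
  rw [Fin.exists_fin_succ]
  simp [Fin.castSucc_succ, or_assoc]

/-- Total weight of the walks (with free starting point) that use an edge of `S`. Compared with
all walks, one free choice of a vertex is lost. -/
lemma sum_walkWeight_hits_le {w : Fin m → Fin n → ℝ} (hw : ∀ r c, 0 ≤ w r c)
    (hw1 : ∀ r c, w r c ≤ 1) {B : ℝ}
    (hrow : ∀ r, ∑ c, w r c ≤ B) (hcol : ∀ c, ∑ r, w r c ≤ B) (hB : 1 ≤ B)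
    (S : Finset (Fin m × Fin n)) (L : ℕ) :
    ∑ p : Walk m n L, (if Hits S p then walkWeight w p else 0)
      ≤ 2 * L * S.card * B ^ (2 * L) := by
  have hB0 : 0 ≤ B := by linarith
  induction L with
  | zero => simp [Hits]
  | succ L ih =>
    set W : Fin n → ℝ := fun b => ∑ p : Walk m n L, (if p.1 0 = b then walkWeight w p else 0)
      with hW
    have hW0 : ∀ b, W b ≤ B ^ (2 * L) := sum_walkWeight_le hw hrow hcol hB0 L
    have hcard : ∑ a, ∑ r, (if (r, a) ∈ S then (1 : ℝ) else 0) = S.card := by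
      rw [Finset.sum_comm, ← Fintype.sum_prod_type (f := fun e : Fin m × Fin n =>
        if e ∈ S then (1 : ℝ) else 0)]
      simp
    have b1 : ∑ a, ∑ r, ∑ b, (if (r, a) ∈ S then w r a * w r b else 0) * W b
        ≤ S.card * (B * B ^ (2 * L)) := by
      rw [← hcard, Finset.sum_mul]
      refine Finset.sum_le_sum fun a _ => ?_
      rw [Finset.sum_mul]
      refine Finset.sum_le_sum fun r _ => ?_
      by_cases h : (r, a) ∈ S
      · simp only [h, if_true, one_mul]
        calc ∑ b, w r a * w r b * W b ≤ ∑ b, w r b * B ^ (2 * L) := by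
              refine Finset.sum_le_sum fun b _ => ?_
              refine mul_le_mul ?_ (hW0 b) ?_ (hw _ _)
              · exact mul_le_of_le_one_left (hw _ _) (hw1 _ _)
              · exact Finset.sum_nonneg fun p _ => by
                  split_ifs
                  · exact walkWeight_nonneg hw p
                  · exact le_rfl
          _ = (∑ b, w r b) * B ^ (2 * L) := by rw [Finset.sum_mul]
          _ ≤ B * B ^ (2 * L) := mul_le_mul_of_nonneg_right (hrow r) (by positivity)
      · simp [h]
    have b2 : ∑ a, ∑ r, ∑ b, (if (r, b) ∈ S then w r a * w r b else 0) * W b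
        ≤ S.card * (B * B ^ (2 * L)) := by
      have : ∑ a, ∑ r, ∑ b, (if (r, b) ∈ S then w r a * w r b else 0) * W b
          = ∑ b, ∑ r, ∑ a, (if (r, b) ∈ S then w r a * w r b else 0) * W b := by
        rw [Finset.sum_comm, Finset.sum_comm (s := (Finset.univ : Finset (Fin n)))]
        exact Finset.sum_congr rfl fun r _ => Finset.sum_comm
      rw [this, ← hcard, Finset.sum_mul]
      refine Finset.sum_le_sum fun b _ => ?_
      rw [Finset.sum_mul]
      refine Finset.sum_le_sum fun r _ => ?_
      by_cases h : (r, b) ∈ S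
      · simp only [h, if_true, one_mul]
        calc ∑ a, w r a * w r b * W b ≤ ∑ a, w r a * B ^ (2 * L) := by
              refine Finset.sum_le_sum fun a _ => ?_
              refine mul_le_mul ?_ (hW0 b) ?_ (hw _ _)
              · exact mul_le_of_le_one_right (hw _ _) (hw1 _ _)
              · exact Finset.sum_nonneg fun p _ => by
                  split_ifs
                  · exact walkWeight_nonneg hw p
                  · exact le_rfl
          _ = (∑ a, w r a) * B ^ (2 * L) := by rw [Finset.sum_mul]
          _ ≤ B * B ^ (2 * L) := mul_le_mul_of_nonneg_right (hrow r) (by positivity)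
      · simp [h]
    have b3 : ∑ a, ∑ r, ∑ p : Walk m n L, w r a * w r (p.1 0) *
        (if Hits S p then walkWeight w p else 0)
        ≤ B * B * (2 * L * S.card * B ^ (2 * L)) := by
      have : ∑ a, ∑ r, ∑ p : Walk m n L, w r a * w r (p.1 0) *
          (if Hits S p then walkWeight w p else 0)
          = ∑ p : Walk m n L, (∑ r, w r (p.1 0) * ∑ a, w r a) *
            (if Hits S p then walkWeight w p else 0) := by
        simp_rw [Finset.sum_mul, Finset.mul_sum, Finset.sum_mul]
        rw [Finset.sum_comm, Finset.sum_comm (s := (Finset.univ : Finset (Walk m n L)))]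
        refine Finset.sum_congr rfl fun r _ => ?_
        rw [Finset.sum_comm]
        refine Finset.sum_congr rfl fun p _ => Finset.sum_congr rfl fun a _ => ?_
        ring
      rw [this]
      calc _ ≤ ∑ p : Walk m n L, B * B * (if Hits S p then walkWeight w p else 0) := by
            refine Finset.sum_le_sum fun p _ => mul_le_mul_of_nonneg_right ?_ ?_
            · calc ∑ r, w r (p.1 0) * ∑ b, w r b ≤ ∑ r, w r (p.1 0) * B :=
                  Finset.sum_le_sum fun r _ => mul_le_mul_of_nonneg_left (hrow r) (hw _ _)
                _ = (∑ r, w r (p.1 0)) * B := by rw [Finset.sum_mul]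
                _ ≤ B * B := mul_le_mul_of_nonneg_right (hcol _) hB0
            · split_ifs
              · exact walkWeight_nonneg hw p
              · exact le_rfl
        _ = B * B * ∑ p : Walk m n L, (if Hits S p then walkWeight w p else 0) := by
            rw [Finset.mul_sum]
        _ ≤ _ := mul_le_mul_of_nonneg_left ih (by positivity)
    rw [sum_walk_succ]
    calc ∑ a, ∑ r, ∑ p : Walk m n L,
          (if Hits S (consWalk a r p) then walkWeight w (consWalk a r p) else 0)
        ≤ ∑ a, ∑ r, ∑ p : Walk m n L,
          (((if (r, a) ∈ S then w r a * w r (p.1 0) else 0) * walkWeight w p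
            + (if (r, p.1 0) ∈ S then w r a * w r (p.1 0) else 0) * walkWeight w p)
            + w r a * w r (p.1 0) * (if Hits S p then walkWeight w p else 0)) := by
            refine Finset.sum_le_sum fun a _ => Finset.sum_le_sum fun r _ =>
              Finset.sum_le_sum fun p _ => ?_
            rw [walkWeight_cons]
            simp only [hits_cons]
            have h1 := mul_nonneg (hw r a) (hw r (p.1 0))
            have h2 := walkWeight_nonneg hw p
            have h3 := mul_nonneg h1 h2
            by_cases c1 : (r, a) ∈ S <;> by_cases c2 : (r, p.1 0) ∈ S <;>
              by_cases c3 : Hits S p <;> simp [c1, c2, c3] <;> linarith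
      _ = (∑ a, ∑ r, ∑ b, (if (r, a) ∈ S then w r a * w r b else 0) * W b)
          + (∑ a, ∑ r, ∑ b, (if (r, b) ∈ S then w r a * w r b else 0) * W b)
          + ∑ a, ∑ r, ∑ p : Walk m n L, w r a * w r (p.1 0) *
              (if Hits S p then walkWeight w p else 0) := by
            simp_rw [Finset.sum_add_distrib]
            congr 2
            · refine Finset.sum_congr rfl fun a _ => Finset.sum_congr rfl fun r _ => ?_
              exact sum_walk_start (fun b => if (r, a) ∈ S then w r a * w r b else 0) _
            · refine Finset.sum_congr rfl fun a _ => Finset.sum_congr rfl fun r _ => ?_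
              exact sum_walk_start (fun b => if (r, b) ∈ S then w r a * w r b else 0) _
      _ ≤ S.card * (B * B ^ (2 * L)) + S.card * (B * B ^ (2 * L))
          + (B * B) * (2 * L * S.card * B ^ (2 * L)) := add_le_add (add_le_add b1 b2) b3
      _ ≤ _ := by
            push_cast
            have : (S.card : ℝ) * (B * B ^ (2 * L)) ≤ S.card * (B * (B * B ^ (2 * L))) := by
              refine mul_le_mul_of_nonneg_left ?_ (by positivity)
              refine mul_le_mul_of_nonneg_left ?_ hB0
              exact le_mul_of_one_le_left (by positivity) hB
            have e2 : B ^ (2 * (L + 1)) = B * (B * B ^ (2 * L)) := by ring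
            rw [e2]
            nlinarith

end Walks
end Perceptron

namespace Perceptron

/-! ### Paths in the complete bipartite graph -/

section Paths

variable {m n : ℕ}

/-- A walk is a path if its columns are distinct and its rows are distinct. -/
def IsPath {L : ℕ} (p : Walk m n L) : Prop := Function.Injective p.1 ∧ Function.Injective p.2

instance {L : ℕ} (p : Walk m n L) : Decidable (IsPath p) := by unfold IsPath; infer_instance

/-- The set of edges of a walk. -/
def pathEdges {L : ℕ} (p : Walk m n L) : Finset (Fin m × Fin n) :=
  Finset.univ.biUnion fun l => {(p.2 l, p.1 l.castSucc), (p.2 l, p.1 l.succ)}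

lemma mem_pathEdges {L : ℕ} {p : Walk m n L} {e : Fin m × Fin n} :
    e ∈ pathEdges p ↔ ∃ l, e = (p.2 l, p.1 l.castSucc) ∨ e = (p.2 l, p.1 l.succ) := by
  simp [pathEdges]

lemma hits_iff {S : Finset (Fin m × Fin n)} {L : ℕ} {p : Walk m n L} :
    Hits S p ↔ (S ∩ pathEdges p).Nonempty := by
  constructor
  · rintro ⟨l, h | h⟩
    · exact ⟨_, Finset.mem_inter.mpr ⟨h, mem_pathEdges.mpr ⟨l, Or.inl rfl⟩⟩⟩
    · exact ⟨_, Finset.mem_inter.mpr ⟨h, mem_pathEdges.mpr ⟨l, Or.inr rfl⟩⟩⟩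
  · rintro ⟨e, he⟩
    obtain ⟨h1, h2⟩ := Finset.mem_inter.mp he
    obtain ⟨l, rfl | rfl⟩ := mem_pathEdges.mp h2
    · exact ⟨l, Or.inl h1⟩
    · exact ⟨l, Or.inr h1⟩

lemma prod_pathEdges {L : ℕ} {p : Walk m n L} (hp : IsPath p) (f : Fin m → Fin n → ℝ) :
    ∏ e ∈ pathEdges p, f e.1 e.2 = walkWeight f p := by
  unfold pathEdges walkWeight
  rw [Finset.prod_biUnion]
  · refine Finset.prod_congr rfl fun l _ => ?_
    rw [Finset.prod_pair]
    intro h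
    have := hp.1 (Prod.mk.inj h).2
    exact absurd this (Fin.castSucc_lt_succ).ne
  · intro a _ b _ hab
    rw [Function.onFun, Finset.disjoint_left]
    intro e h1 h2
    have h3 : p.2 a = p.2 b := by
      simp only [Finset.mem_insert, Finset.mem_singleton] at h1 h2
      rcases h1 with rfl | rfl <;> rcases h2 with h | h <;> exact (Prod.mk.inj h).1
    exact hab (hp.2 h3)

lemma monom_pathEdges {L : ℕ} {p : Walk m n L} (hp : IsPath p) (x : Fin m → Fin n → ℝ) :
    monom (pathEdges p) x = walkWeight x p := prod_pathEdges hp x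

lemma card_pathEdges {L : ℕ} {p : Walk m n L} (hp : IsPath p) : (pathEdges p).card = 2 * L := by
  have h : (2 : ℝ) ^ (pathEdges p).card = 2 ^ (2 * L) := by
    have := prod_pathEdges hp (fun _ _ => 2)
    rw [Finset.prod_const] at this
    rw [this, walkWeight]
    simp [pow_mul, ← pow_two]
  exact pow_right_injective₀ (by norm_num) (by norm_num) h

lemma card_pathEdges_le {L : ℕ} (p : Walk m n L) : (pathEdges p).card ≤ 2 * L := by
  unfold pathEdges
  refine Finset.card_biUnion_le.trans ?_
  calc _ ≤ ∑ _l : Fin L, 2 := Finset.sum_le_sum fun l _ => Finset.card_le_two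
    _ = 2 * L := by simp [mul_comm]

lemma sum_ite_injective_le {α : Type*} [DecidableEq α] {L : ℕ} {f : Fin L → α}
    (hf : Function.Injective f) (a : α) : ∑ l, (if f l = a then (1 : ℝ) else 0) ≤ 1 := by
  rw [Finset.sum_boole]
  have : (Finset.univ.filter fun l => f l = a).card ≤ 1 :=
    Finset.card_le_one.mpr fun x hx y hy => hf (by simp at hx hy; rw [hx, hy])
  exact_mod_cast this

lemma ite_mem_pathEdges_le {L : ℕ} (p : Walk m n L) (r : Fin m) (c : Fin n) :
    (if (r, c) ∈ pathEdges p then (1 : ℝ) else 0)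
      ≤ ∑ l, ((if p.2 l = r then 1 else 0) * (if p.1 l.castSucc = c then 1 else 0)
        + (if p.2 l = r then 1 else 0) * (if p.1 l.succ = c then 1 else 0)) := by
  have hnn : ∀ l, (0 : ℝ) ≤ ((if p.2 l = r then 1 else 0) *
      (if p.1 l.castSucc = c then 1 else 0)
        + (if p.2 l = r then 1 else 0) * (if p.1 l.succ = c then 1 else 0)) := fun l => by
    split_ifs <;> norm_num
  split_ifs with h
  · obtain ⟨l, hl⟩ := mem_pathEdges.mp h
    refine le_trans ?_ (Finset.single_le_sum (fun l _ => hnn l) (Finset.mem_univ l))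
    rcases hl with h | h <;> obtain ⟨h1, h2⟩ := Prod.mk.inj h <;> simp only [← h1, ← h2] <;>
      split_ifs <;> simp_all
  · exact Finset.sum_nonneg fun l _ => hnn l

lemma row_degree_le {L : ℕ} {p : Walk m n L} (hp : IsPath p) (r : Fin m) :
    ∑ c, (if (r, c) ∈ pathEdges p then (1 : ℝ) else 0) ≤ 2 := by
  refine (Finset.sum_le_sum fun c _ => ite_mem_pathEdges_le p r c).trans ?_
  rw [Finset.sum_comm]
  simp_rw [Finset.sum_add_distrib, ← Finset.mul_sum, Finset.sum_ite_eq, Finset.mem_univ, if_true,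
    mul_one]
  linarith [sum_ite_injective_le hp.2 r]

lemma col_degree_le {L : ℕ} {p : Walk m n L} (hp : IsPath p) (c : Fin n) :
    ∑ r, (if (r, c) ∈ pathEdges p then (1 : ℝ) else 0) ≤ 2 := by
  refine (Finset.sum_le_sum fun r _ => ite_mem_pathEdges_le p r c).trans ?_
  rw [Finset.sum_comm]
  simp_rw [Finset.sum_add_distrib, ← Finset.sum_mul, Finset.sum_ite_eq, Finset.mem_univ, if_true,
    one_mul]
  have h1 := sum_ite_injective_le (f := fun l : Fin L => p.1 l.castSucc)
    (hp.1.comp (Fin.castSucc_injective L)) c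
  have h2 := sum_ite_injective_le (f := fun l : Fin L => p.1 l.succ)
    (hp.1.comp (Fin.succ_injective L)) c
  linarith

/-- An edge set together with the starting point determines a path. -/
lemma path_eq_of_pathEdges_eq {L : ℕ} {p q : Walk m n L} (hp : IsPath p) (hq : IsPath q)
    (h0 : p.1 0 = q.1 0) (hE : pathEdges p = pathEdges q) : p = q := by
  have key : ∀ l : ℕ, ∀ hl : l < L, p.1 ⟨l, by omega⟩ = q.1 ⟨l, by omega⟩ →
      (∀ hl0 : 0 < l, p.2 ⟨l - 1, by omega⟩ = q.2 ⟨l - 1, by omega⟩) →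
      p.2 ⟨l, hl⟩ = q.2 ⟨l, hl⟩ ∧ p.1 ⟨l + 1, by omega⟩ = q.1 ⟨l + 1, by omega⟩ := by
    intro l hl hi hJ
    have hJl : p.2 ⟨l, hl⟩ = q.2 ⟨l, hl⟩ := by
      have : (p.2 ⟨l, hl⟩, p.1 (Fin.castSucc ⟨l, hl⟩)) ∈ pathEdges q := by
        rw [← hE]; exact mem_pathEdges.mpr ⟨_, Or.inl rfl⟩
      obtain ⟨l', h | h⟩ := mem_pathEdges.mp this
      · obtain ⟨h1, h2⟩ := Prod.mk.inj h
        have h3 : q.1 ⟨l, by omega⟩ = q.1 l'.castSucc := by rw [← hi]; exact h2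
        have h4 := congrArg Fin.val (hq.1 h3)
        simp only [Fin.val_castSucc] at h4
        rw [h1, show l' = ⟨l, hl⟩ from Fin.ext h4.symm]
      · obtain ⟨h1, h2⟩ := Prod.mk.inj h
        have h3 : q.1 ⟨l, by omega⟩ = q.1 l'.succ := by rw [← hi]; exact h2
        have h4 := congrArg Fin.val (hq.1 h3)
        simp only [Fin.val_succ] at h4
        have h5 : l' = ⟨l - 1, by omega⟩ := Fin.ext (by simp; omega)
        rw [h5, ← hJ (by omega)] at h1
        have h6 := congrArg Fin.val (hp.2 h1)
        simp only at h6
        omega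
    refine ⟨hJl, ?_⟩
    have : (p.2 ⟨l, hl⟩, p.1 (Fin.succ ⟨l, hl⟩)) ∈ pathEdges q := by
      rw [← hE]; exact mem_pathEdges.mpr ⟨_, Or.inr rfl⟩
    obtain ⟨l', h | h⟩ := mem_pathEdges.mp this
    · obtain ⟨h1, h2⟩ := Prod.mk.inj h
      have h3 := hq.2 (hJl.symm.trans h1)
      rw [← h3] at h2
      have h4 : p.1 (Fin.succ ⟨l, hl⟩) = p.1 ⟨l, by omega⟩ := by rw [h2, hi]; rfl
      have h5 := congrArg Fin.val (hp.1 h4)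
      simp at h5
    · obtain ⟨h1, h2⟩ := Prod.mk.inj h
      have h3 := hq.2 (hJl.symm.trans h1)
      rw [← h3] at h2
      exact h2
  have main : ∀ l : ℕ, ∀ hl : l < L + 1, p.1 ⟨l, hl⟩ = q.1 ⟨l, hl⟩ ∧
      ∀ hl0 : 0 < l, p.2 ⟨l - 1, by omega⟩ = q.2 ⟨l - 1, by omega⟩ := by
    intro l
    induction l with
    | zero => exact fun _ => ⟨h0, fun h => absurd h (lt_irrefl 0)⟩
    | succ l ih =>
      intro hl
      have hi := ih (by omega)
      have := key l (by omega) hi.1 hi.2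
      exact ⟨this.2, fun _ => this.1⟩
  refine Prod.ext (funext fun l => (main l l.2).1) (funext fun l => ?_)
  exact (key l l.2 (main l (by omega)).1 (main l (by omega)).2).1

/-- The walk traversed backwards. -/
def revWalk {L : ℕ} (p : Walk m n L) : Walk m n L := (p.1 ∘ Fin.rev, p.2 ∘ Fin.rev)

lemma revWalk_revWalk {L : ℕ} (p : Walk m n L) : revWalk (revWalk p) = p := by
  simp [revWalk, Function.comp_assoc, Fin.rev_involutive.comp_self]

lemma isPath_revWalk {L : ℕ} {p : Walk m n L} (hp : IsPath p) : IsPath (revWalk p) :=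
  ⟨hp.1.comp Fin.rev_injective, hp.2.comp Fin.rev_injective⟩

lemma walkWeight_revWalk {L : ℕ} (p : Walk m n L) (w : Fin m → Fin n → ℝ) :
    walkWeight w (revWalk p) = walkWeight w p := by
  unfold walkWeight revWalk
  rw [← Equiv.prod_comp Fin.revPerm]
  refine Finset.prod_congr rfl fun l _ => ?_
  simp [Fin.rev_castSucc, Fin.rev_succ, mul_comm]

/-- The weight `1` on `S` and `N⁻¹` off `S`, for which a set `E` of edges has total weight
`N⁻¹ ^ |E \ S|`. -/
noncomputable def edgeWeight (N : ℝ) (S : Finset (Fin m × Fin n)) (r : Fin m) (c : Fin n) : ℝ :=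
  if (r, c) ∈ S then 1 else N⁻¹

lemma walkWeight_edgeWeight {L : ℕ} {p : Walk m n L} (hp : IsPath p) (N : ℝ)
    (S : Finset (Fin m × Fin n)) :
    walkWeight (edgeWeight N S) p = N⁻¹ ^ (pathEdges p \ S).card := by
  rw [← prod_pathEdges hp]
  unfold edgeWeight
  rw [Finset.prod_ite]
  simp [Finset.sdiff_eq_filter]

lemma edgeWeight_nonneg {N : ℝ} (hN : 1 ≤ N) (S : Finset (Fin m × Fin n)) (r : Fin m)
    (c : Fin n) : 0 ≤ edgeWeight N S r c := by
  unfold edgeWeight; split_ifs <;> positivity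

lemma edgeWeight_le_one {N : ℝ} (hN : 1 ≤ N) (S : Finset (Fin m × Fin n)) (r : Fin m)
    (c : Fin n) : edgeWeight N S r c ≤ 1 := by
  unfold edgeWeight; split_ifs
  · exact le_rfl
  · exact inv_le_one_of_one_le₀ hN

/-- Every row and every column meets `S` in at most `d` edges. -/
def DegreeLE (S : Finset (Fin m × Fin n)) (d : ℝ) : Prop :=
  (∀ r, ∑ c, (if (r, c) ∈ S then (1 : ℝ) else 0) ≤ d) ∧
    ∀ c, ∑ r, (if (r, c) ∈ S then (1 : ℝ) else 0) ≤ d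

lemma degreeLE_pathEdges {L : ℕ} {p : Walk m n L} (hp : IsPath p) : DegreeLE (pathEdges p) 2 :=
  ⟨row_degree_le hp, col_degree_le hp⟩

lemma DegreeLE.union {S T : Finset (Fin m × Fin n)} {d d' : ℝ} (hS : DegreeLE S d)
    (hT : DegreeLE T d') : DegreeLE (S ∪ T) (d + d') := by
  have h : ∀ e : Fin m × Fin n, (if e ∈ S ∪ T then (1 : ℝ) else 0)
      ≤ (if e ∈ S then 1 else 0) + (if e ∈ T then 1 else 0) := fun e => by
    by_cases h1 : e ∈ S <;> by_cases h2 : e ∈ T <;> simp [h1, h2]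
  constructor
  · intro r
    refine (Finset.sum_le_sum fun c _ => h (r, c)).trans ?_
    rw [Finset.sum_add_distrib]
    exact add_le_add (hS.1 r) (hT.1 r)
  · intro c
    refine (Finset.sum_le_sum fun r _ => h (r, c)).trans ?_
    rw [Finset.sum_add_distrib]
    exact add_le_add (hS.2 c) (hT.2 c)

lemma degreeLE_empty : DegreeLE (∅ : Finset (Fin m × Fin n)) 0 := ⟨by simp, by simp⟩

lemma edgeWeight_le {N : ℝ} (hN : 1 ≤ N) (S : Finset (Fin m × Fin n)) (r : Fin m)
    (c : Fin n) : edgeWeight N S r c ≤ (if (r, c) ∈ S then 1 else 0) + N⁻¹ := by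
  unfold edgeWeight
  have : 0 ≤ N⁻¹ := by positivity
  split_ifs <;> linarith

lemma DegreeLE.row_sum_le {S : Finset (Fin m × Fin n)} {d : ℝ} (hS : DegreeLE S d) {N : ℝ}
    (hN : 1 ≤ N) (hn : (n : ℝ) ≤ N) (r : Fin m) : ∑ c, edgeWeight N S r c ≤ d + 1 := by
  refine (Finset.sum_le_sum fun c _ => edgeWeight_le hN S r c).trans ?_
  rw [Finset.sum_add_distrib]
  refine add_le_add (hS.1 r) ?_
  simp only [Finset.sum_const, Finset.card_univ, Fintype.card_fin, nsmul_eq_mul]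
  rw [← div_eq_mul_inv, div_le_one (by linarith)]
  exact hn

lemma DegreeLE.col_sum_le {S : Finset (Fin m × Fin n)} {d : ℝ} (hS : DegreeLE S d) {N : ℝ}
    (hN : 1 ≤ N) (hm : (m : ℝ) ≤ N) (c : Fin n) : ∑ r, edgeWeight N S r c ≤ d + 1 := by
  refine (Finset.sum_le_sum fun r _ => edgeWeight_le hN S r c).trans ?_
  rw [Finset.sum_add_distrib]
  refine add_le_add (hS.2 c) ?_
  simp only [Finset.sum_const, Finset.card_univ, Fintype.card_fin, nsmul_eq_mul]
  rw [← div_eq_mul_inv, div_le_one (by linarith)]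
  exact hm

/-- Quadruples of paths, the third of which meets one of the first two, whose first and second
and whose third and fourth start at the same column: weighting by `N⁻¹ ^ |union of the edges|`,
their number is of order `N`. -/
lemma sum_quadruple_le {N : ℝ} (hN : 1 ≤ N) (hm : (m : ℝ) ≤ N) (hn : (n : ℝ) ≤ N) {L L' : ℕ}
    (A : Finset (Walk m n L)) (A' : Finset (Walk m n L')) (hA : ∀ p ∈ A, IsPath p)
    (hA' : ∀ p ∈ A', IsPath p) :
    ∑ p₁ ∈ A, ∑ p₂ ∈ A', ∑ p₃ ∈ A, ∑ p₄ ∈ A',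
      (if p₂.1 0 = p₁.1 0 ∧ p₄.1 0 = p₃.1 0 ∧ Hits (pathEdges p₁ ∪ pathEdges p₂) p₃
        then N⁻¹ ^ (pathEdges p₁ ∪ pathEdges p₂ ∪ pathEdges p₃ ∪ pathEdges p₄).card else 0)
      ≤ n * (4 * L * (L + L')) * 7 ^ (4 * (L + L')) := by
  -- The four paths are summed one after the other, from the last to the first, the edges of the
  -- preceding ones having weight `1`. As a path has at most two edges at each vertex, these edges
  -- have degree at most `6`, and the remaining ones add at most `1` to the row and column sums.
  set w := edgeWeight (m := m) (n := n) N with hw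
  have hcard : ∀ S T : Finset (Fin m × Fin n), N⁻¹ ^ (S ∪ T).card
      = N⁻¹ ^ S.card * N⁻¹ ^ (T \ S).card := fun S T => by
    rw [← pow_add, ← Finset.union_sdiff_self_eq_union, Finset.card_union_of_disjoint
      Finset.disjoint_sdiff]
  have hw0 := edgeWeight_nonneg (m := m) (n := n) hN
  have hw1 := edgeWeight_le_one (m := m) (n := n) hN
  have hdeg : ∀ S : Finset (Fin m × Fin n), ∀ d, DegreeLE S d → d ≤ 6 →
      (∀ r, ∑ c, w S r c ≤ 7) ∧ ∀ c, ∑ r, w S r c ≤ 7 := fun S d hS hd =>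
    ⟨fun r => (hS.row_sum_le hN hn r).trans (by linarith),
      fun c => (hS.col_sum_le hN hm c).trans (by linarith)⟩
  have hext : ∀ {ℓ : ℕ} (F : Finset (Walk m n ℓ)) (f : Walk m n ℓ → ℝ), (∀ p, 0 ≤ f p) →
      ∑ p ∈ F, f p ≤ ∑ p, f p := fun F f hf =>
    Finset.sum_le_sum_of_subset_of_nonneg (Finset.subset_univ _) fun p _ _ => hf p
  have hite : ∀ (P : Prop) [Decidable P] (a : ℝ), 0 ≤ a → 0 ≤ if P then a else 0 :=
    fun P _ a ha => by split_ifs <;> simp [ha]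
  have hstart : ∀ {ℓ : ℕ} (F : Finset (Walk m n ℓ)) (S : Finset (Fin m × Fin n)) (d : ℝ),
      DegreeLE S d → d ≤ 6 → ∀ a, ∑ p ∈ F, (if p.1 0 = a then walkWeight (w S) p else 0)
        ≤ 7 ^ (2 * ℓ) := fun {ℓ} F S d hS hd a =>
    (hext F _ fun p => hite _ _ (walkWeight_nonneg (hw0 S) p)).trans
      (sum_walkWeight_le (hw0 S) (hdeg S d hS hd).1 (hdeg S d hS hd).2 (by norm_num) ℓ a)
  calc _ = ∑ p₁ ∈ A, walkWeight (w ∅) p₁ * ∑ p₂ ∈ A',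
          (if p₂.1 0 = p₁.1 0 then walkWeight (w (pathEdges p₁)) p₂ else 0) *
          ∑ p₃ ∈ A, (if Hits (pathEdges p₁ ∪ pathEdges p₂) p₃
            then walkWeight (w (pathEdges p₁ ∪ pathEdges p₂)) p₃ else 0) *
          ∑ p₄ ∈ A', (if p₄.1 0 = p₃.1 0
            then walkWeight (w (pathEdges p₁ ∪ pathEdges p₂ ∪ pathEdges p₃)) p₄ else 0) := by
        simp_rw [Finset.mul_sum]
        refine Finset.sum_congr rfl fun p₁ h₁ => Finset.sum_congr rfl fun p₂ h₂ =>
          Finset.sum_congr rfl fun p₃ h₃ => Finset.sum_congr rfl fun p₄ h₄ => ?_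
        rw [hcard, hcard, hcard, hw, walkWeight_edgeWeight (hA p₁ h₁),
          walkWeight_edgeWeight (hA' p₂ h₂), walkWeight_edgeWeight (hA p₃ h₃),
          walkWeight_edgeWeight (hA' p₄ h₄), Finset.sdiff_empty]
        by_cases c1 : p₂.1 0 = p₁.1 0 <;> by_cases c2 : p₄.1 0 = p₃.1 0 <;>
          by_cases c3 : Hits (pathEdges p₁ ∪ pathEdges p₂) p₃ <;> simp [c1, c2, c3]
        ring
    _ ≤ ∑ p₁ ∈ A, walkWeight (w ∅) p₁ * ∑ p₂ ∈ A',
          (if p₂.1 0 = p₁.1 0 then walkWeight (w (pathEdges p₁)) p₂ else 0) *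
          ((2 * L * (2 * L + 2 * L') * 7 ^ (2 * L)) * 7 ^ (2 * L')) := by
        refine Finset.sum_le_sum fun p₁ h₁ => mul_le_mul_of_nonneg_left ?_
          (walkWeight_nonneg (hw0 _) _)
        refine Finset.sum_le_sum fun p₂ h₂ => mul_le_mul_of_nonneg_left ?_
          (hite _ _ (walkWeight_nonneg (hw0 _) _))
        have d12 := (degreeLE_pathEdges (hA p₁ h₁)).union (degreeLE_pathEdges (hA' p₂ h₂))
        set S := pathEdges p₁ ∪ pathEdges p₂ with hS
        calc _ ≤ ∑ p₃ ∈ A, (if Hits S p₃ then walkWeight (w S) p₃ else 0) * 7 ^ (2 * L') := by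
              refine Finset.sum_le_sum fun p₃ h₃ => mul_le_mul_of_nonneg_left ?_
                (hite _ _ (walkWeight_nonneg (hw0 _) _))
              exact hstart A' _ _ (d12.union (degreeLE_pathEdges (hA p₃ h₃))) (by norm_num) _
          _ = (∑ p₃ ∈ A, (if Hits S p₃ then walkWeight (w S) p₃ else 0)) * 7 ^ (2 * L') := by
              rw [Finset.sum_mul]
          _ ≤ (2 * L * S.card * 7 ^ (2 * L)) * 7 ^ (2 * L') := by
              refine mul_le_mul_of_nonneg_right ?_ (by positivity)
              refine (hext A _ fun p => hite _ _ (walkWeight_nonneg (hw0 S) p)).trans ?_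
              exact sum_walkWeight_hits_le (hw0 S) (hw1 S) (hdeg S _ d12 (by norm_num)).1
                (hdeg S _ d12 (by norm_num)).2 (by norm_num) S L
          _ ≤ _ := by
              have : (S.card : ℝ) ≤ 2 * L + 2 * L' := by
                have := (Finset.card_union_le (pathEdges p₁) (pathEdges p₂)).trans
                  (add_le_add (card_pathEdges_le p₁) (card_pathEdges_le p₂))
                exact_mod_cast this
              gcongr
    _ ≤ ∑ p₁ ∈ A, walkWeight (w ∅) p₁ * (7 ^ (2 * L') *
          ((2 * L * (2 * L + 2 * L') * 7 ^ (2 * L)) * 7 ^ (2 * L'))) := by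
        refine Finset.sum_le_sum fun p₁ h₁ => mul_le_mul_of_nonneg_left ?_
          (walkWeight_nonneg (hw0 _) _)
        rw [← Finset.sum_mul]
        exact mul_le_mul_of_nonneg_right
          (hstart A' _ _ (degreeLE_pathEdges (hA p₁ h₁)) (by norm_num) _) (by positivity)
    _ = (∑ p₁ ∈ A, walkWeight (w ∅) p₁) * (7 ^ (2 * L') *
          ((2 * L * (2 * L + 2 * L') * 7 ^ (2 * L)) * 7 ^ (2 * L'))) := by rw [Finset.sum_mul]
    _ ≤ (n * 7 ^ (2 * L)) * (7 ^ (2 * L') *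
          ((2 * L * (2 * L + 2 * L') * 7 ^ (2 * L)) * 7 ^ (2 * L'))) := by
        refine mul_le_mul_of_nonneg_right ?_ (by positivity)
        calc ∑ p₁ ∈ A, walkWeight (w ∅) p₁
            = ∑ a, ∑ p₁ ∈ A, (if p₁.1 0 = a then walkWeight (w ∅) p₁ else 0) := by
              rw [Finset.sum_comm]
              exact Finset.sum_congr rfl fun p _ => by simp
          _ ≤ ∑ _a : Fin n, (7 : ℝ) ^ (2 * L) :=
              Finset.sum_le_sum fun a _ => hstart A ∅ 0 degreeLE_empty (by norm_num) a
          _ = _ := by simp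
    _ = _ := by ring

end Paths
end Perceptron

namespace Perceptron

/-! ### Martingale increments of the cycle counts -/

section Increments

variable {m n : ℕ}

/-- The paths all of whose rows precede `j`. -/
def pathsBelow (n : ℕ) (L : ℕ) (j : Fin m) : Finset (Walk m n L) :=
  Finset.univ.filter fun p => IsPath p ∧ ∀ l, p.2 l < j

lemma isPath_of_mem {L : ℕ} {j : Fin m} {p : Walk m n L} (h : p ∈ pathsBelow n L j) : IsPath p :=
  (Finset.mem_filter.mp h).2.1

/-- The two columns at the ends of a walk, joined through the row `y`; for a walk with a single
column the square is centred. -/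
def endTerm {L : ℕ} (p : Walk m n L) (y : Fin n → ℝ) : ℝ :=
  y (p.1 0) * y (p.1 (Fin.last L)) - if L = 0 then 1 else 0

/-- Normalisation of the increments of the cycle count of parameter `L + 1`. -/
noncomputable def cycleCoef (m n L : ℕ) : ℝ :=
  (L + 1) * ((1 / Real.sqrt n) ^ (L + 1) * (1 / Real.sqrt m) ^ (L + 1))
    / Real.sqrt (2 * ((L : ℝ) + 1))

lemma cycleCoef_sq (m n L : ℕ) :
    cycleCoef m n L ^ 2 = ((L : ℝ) + 1) / 2 * ((1 / n) * (1 / m) : ℝ) ^ (L + 1) := by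
  unfold cycleCoef
  have h : ∀ a : ℕ, ((1 / Real.sqrt a) ^ (L + 1)) ^ 2 = (1 / a : ℝ) ^ (L + 1) := fun a => by
    rw [← pow_mul, mul_comm, pow_mul, div_pow, Real.sq_sqrt (Nat.cast_nonneg a), one_pow]
  rw [div_pow, mul_pow, mul_pow, h, h, Real.sq_sqrt (by positivity), mul_pow]
  field_simp

/-- The part of the normalised cycle count of parameter `L + 1` that comes from the cycles whose
largest row is `j`. -/
noncomputable def cycleInc (L : ℕ) (j : Fin m) (x : Fin m → Fin n → ℝ) : ℝ :=
  cycleCoef m n L * ∑ p ∈ pathsBelow n L j, walkWeight x p * endTerm p (x j)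

lemma integral_delta0_mul (a b : Fin n) :
    ∫ y, y a * y b ∂(delta0 n) = if a = b then 1 else 0 := integral_pi_gaussian_mul a b

/-- Wick's formula for four coordinates of a standard Gaussian vector. -/
lemma integral_delta0_four (a b c d : Fin n) :
    ∫ y, y a * y b * (y c * y d) ∂(delta0 n)
      = (if a = b then 1 else 0) * (if c = d then 1 else 0)
        + (if a = c then 1 else 0) * (if b = d then 1 else 0)
        + (if a = d then 1 else 0) * (if b = c then 1 else 0) := by
  have hm : HasAllMoments (delta0 n) (fun y => y a * y b * (y c * y d)) :=
    ((hasAllMoments_row a).mul (hasAllMoments_row b)).mul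
      ((hasAllMoments_row c).mul (hasAllMoments_row d))
  rw [delta0, integral_update (fun _ : Fin n => gaussianReal 0 1) a hm.integrable]
  simp only [Function.update_self, Function.update_apply]
  have i1 := integral_gaussian_id
  have i2 := integral_gaussian_sq
  have i3 := integral_gaussian_cube
  have i4 := integral_gaussian_four
  have e2 : ∀ (t : ℝ), t * t = t ^ 2 := fun t => by ring
  by_cases hb : b = a <;> by_cases hc : c = a <;> by_cases hd : d = a
  · subst hb hc hd
    simp only [if_true, show ∀ t : ℝ, t * t * (t * t) = t ^ 4 from fun t => by ring, i4]
    simp; norm_num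
  · subst hb hc
    have hd' := Ne.symm hd
    simp only [hd, hd', if_true, if_false,
      show ∀ t z : ℝ, t * t * (t * z) = t ^ 3 * z from fun t z => by ring,
      integral_mul_const, i3]
    simp
  · subst hb hd
    have hc' := Ne.symm hc
    simp only [hc, hc', if_true, if_false,
      show ∀ t z : ℝ, t * t * (z * t) = t ^ 3 * z from fun t z => by ring,
      integral_mul_const, i3]
    simp
  · subst hb
    have hc' := Ne.symm hc
    have hd' := Ne.symm hd
    simp only [hc, hc', hd, hd', if_true, if_false, e2, integral_mul_const, i2, one_mul,
      integral_pi_gaussian_mul]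
    simp
  · subst hc hd
    have hb' := Ne.symm hb
    simp only [hb, hb', if_true, if_false,
      show ∀ t z : ℝ, t * z * (t * t) = t ^ 3 * z from fun t z => by ring,
      integral_mul_const, i3]
    simp
  · subst hc
    have hb' := Ne.symm hb
    have hd' := Ne.symm hd
    simp only [hb, hb', hd, hd', if_true, if_false,
      show ∀ t z w : ℝ, t * z * (t * w) = t ^ 2 * (z * w) from fun t z w => by ring,
      integral_mul_const, i2, one_mul, integral_pi_gaussian_mul]
    simp
  · subst hd
    have hb' := Ne.symm hb
    have hc' := Ne.symm hc
    simp only [hb, hb', hc, hc', if_true, if_false,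
      show ∀ t z w : ℝ, t * z * (w * t) = t ^ 2 * (z * w) from fun t z w => by ring,
      integral_mul_const, i2, one_mul, integral_pi_gaussian_mul]
    simp
  · have hb' := Ne.symm hb
    have hc' := Ne.symm hc
    have hd' := Ne.symm hd
    simp only [hb, hb', hc, hc', hd, hd', if_false,
      show ∀ t z w : ℝ, t * z * w = t * (z * w) from fun t z w => by ring,
      integral_mul_const, i1]
    simp

lemma ends_eq_iff {L : ℕ} {p : Walk m n L} (hp : IsPath p) :
    p.1 0 = p.1 (Fin.last L) ↔ L = 0 := by
  constructor
  · intro h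
    have := congrArg Fin.val (hp.1 h)
    simpa using this.symm
  · rintro rfl; rfl

lemma hasAllMoments_endTerm {L : ℕ} (p : Walk m n L) : HasAllMoments (delta0 n) (endTerm p) :=
  ((hasAllMoments_row _).mul (hasAllMoments_row _)).sub (HasAllMoments.const _)

lemma integral_endTerm {L : ℕ} {p : Walk m n L} (hp : IsPath p) :
    ∫ y, endTerm p y ∂(delta0 n) = 0 := by
  unfold endTerm
  rw [integral_sub ((hasAllMoments_row _).mul (hasAllMoments_row _)).integrable
    (integrable_const _), integral_delta0_mul]
  simp [ends_eq_iff hp]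

lemma integral_endTerm_mul {L L' : ℕ} {p : Walk m n L} {q : Walk m n L'} (hp : IsPath p)
    (hq : IsPath q) : ∫ y, endTerm p y * endTerm q y ∂(delta0 n)
      = (if q.1 0 = p.1 0 ∧ q.1 (Fin.last L') = p.1 (Fin.last L) then 1 else 0)
        + if q.1 (Fin.last L') = p.1 0 ∧ q.1 0 = p.1 (Fin.last L) then 1 else 0 := by
  set a := p.1 0 with ha
  set b := p.1 (Fin.last L) with hb
  set c := q.1 0 with hc
  set d := q.1 (Fin.last L') with hd
  have e : ∀ y : Fin n → ℝ, endTerm p y * endTerm q y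
      = y a * y b * (y c * y d) - (if L' = 0 then 1 else 0) * (y a * y b)
        - (if L = 0 then 1 else 0) * (y c * y d)
        + (if L = 0 then 1 else 0) * (if L' = 0 then 1 else 0) := fun y => by
    unfold endTerm; ring
  have m1 : ∀ a b : Fin n, HasAllMoments (delta0 n) (fun y => y a * y b) := fun a b =>
    (hasAllMoments_row a).mul (hasAllMoments_row b)
  simp_rw [e]
  rw [integral_add ((((m1 a b).mul (m1 c d)).sub ((m1 a b).const_mul _)).sub
      ((m1 c d).const_mul _)).integrable (integrable_const _),
    integral_sub (((m1 a b).mul (m1 c d)).sub ((m1 a b).const_mul _)).integrable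
      ((m1 c d).const_mul _).integrable,
    integral_sub ((m1 a b).mul (m1 c d)).integrable ((m1 a b).const_mul _).integrable,
    integral_const_mul, integral_const_mul, integral_delta0_four, integral_delta0_mul,
    integral_delta0_mul, integral_const]
  simp only [probReal_univ, one_smul, ← ends_eq_iff hp, ← ends_eq_iff hq, ← ha, ← hb, ← hc, ← hd]
  have s1 : (a = c) ↔ (c = a) := eq_comm
  have s2 : (b = d) ↔ (d = b) := eq_comm
  have s3 : (a = d) ↔ (d = a) := eq_comm
  have s4 : (b = c) ↔ (c = b) := eq_comm
  simp only [s1, s2, s3, s4, ite_and]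
  split_ifs <;> ring

/-- Conditional covariance of the increments for the cycle parameters `L + 1` and `L' + 1`, given
the rows before `j`. -/
noncomputable def incCov (L L' : ℕ) (j : Fin m) (x : Fin m → Fin n → ℝ) : ℝ :=
  2 * (cycleCoef m n L * cycleCoef m n L') *
    ∑ t ∈ (pathsBelow n L j ×ˢ pathsBelow n L' j).filter fun t =>
        t.2.1 0 = t.1.1 0 ∧ t.2.1 (Fin.last L') = t.1.1 (Fin.last L),
      monom (pathEdges t.1) x * monom (pathEdges t.2) x

lemma revWalk_mem {L : ℕ} {j : Fin m} {p : Walk m n L} (h : p ∈ pathsBelow n L j) :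
    revWalk p ∈ pathsBelow n L j := by
  have := Finset.mem_filter.mp h
  exact Finset.mem_filter.mpr ⟨Finset.mem_univ _, isPath_revWalk this.2.1, fun l => this.2.2 _⟩

lemma walkWeight_update {L : ℕ} {j i : Fin m} (hij : j ≤ i) {p : Walk m n L}
    (h : p ∈ pathsBelow n L j) (x : Fin m → Fin n → ℝ) (y : Fin n → ℝ) :
    walkWeight (Function.update x i y) p = walkWeight x p := by
  unfold walkWeight
  refine Finset.prod_congr rfl fun l _ => ?_
  have : p.2 l ≠ i := (((Finset.mem_filter.mp h).2.2 l).trans_le hij).ne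
  rw [Function.update_of_ne this]

lemma cycleInc_update (L : ℕ) (j : Fin m) (x : Fin m → Fin n → ℝ) (y : Fin n → ℝ) :
    cycleInc L j (Function.update x j y)
      = cycleCoef m n L * ∑ p ∈ pathsBelow n L j, walkWeight x p * endTerm p y := by
  unfold cycleInc
  congr 1
  refine Finset.sum_congr rfl fun p hp => ?_
  rw [walkWeight_update le_rfl hp, Function.update_self]

lemma cycleInc_update_of_lt (L : ℕ) {j i : Fin m} (h : j < i) (x : Fin m → Fin n → ℝ)
    (y : Fin n → ℝ) : cycleInc L j (Function.update x i y) = cycleInc L j x := by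
  unfold cycleInc
  congr 1
  refine Finset.sum_congr rfl fun p hp => ?_
  rw [walkWeight_update h.le hp, Function.update_of_ne h.ne]

lemma hasAllMoments_cycleInc_update (L : ℕ) (j : Fin m) (x : Fin m → Fin n → ℝ) :
    HasAllMoments (delta0 n) (fun y => cycleInc L j (Function.update x j y)) := by
  simp_rw [cycleInc_update]
  exact (HasAllMoments.sum _ fun p _ => (hasAllMoments_endTerm p).const_mul _).const_mul _

lemma integral_cycleInc_update (L : ℕ) (j : Fin m) (x : Fin m → Fin n → ℝ) :
    ∫ y, cycleInc L j (Function.update x j y) ∂(delta0 n) = 0 := by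
  simp_rw [cycleInc_update]
  rw [integral_const_mul, integral_finsetSum _ fun p _ =>
    ((hasAllMoments_endTerm p).const_mul _).integrable]
  rw [Finset.sum_eq_zero fun p hp => ?_, mul_zero]
  rw [integral_const_mul, integral_endTerm (isPath_of_mem hp), mul_zero]

lemma integral_cycleInc_mul_update (L L' : ℕ) (j : Fin m) (x : Fin m → Fin n → ℝ) :
    ∫ y, cycleInc L j (Function.update x j y) * cycleInc L' j (Function.update x j y) ∂(delta0 n)
      = incCov L L' j x := by
  simp_rw [cycleInc_update]
  set A := pathsBelow n L j
  set A' := pathsBelow n L' j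
  have e : ∀ y : Fin n → ℝ, (cycleCoef m n L * ∑ p ∈ A, walkWeight x p * endTerm p y)
      * (cycleCoef m n L' * ∑ p ∈ A', walkWeight x p * endTerm p y)
      = cycleCoef m n L * cycleCoef m n L' * ∑ p ∈ A, ∑ q ∈ A',
        (walkWeight x p * walkWeight x q) * (endTerm p y * endTerm q y) := fun y => by
    rw [mul_mul_mul_comm, Finset.sum_mul_sum]
    congr 1
    exact Finset.sum_congr rfl fun p _ => Finset.sum_congr rfl fun q _ => by ring
  simp_rw [e]
  have hm : ∀ p : Walk m n L, ∀ q : Walk m n L', HasAllMoments (delta0 n)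
      (fun y => (walkWeight x p * walkWeight x q) * (endTerm p y * endTerm q y)) := fun p q =>
    ((hasAllMoments_endTerm p).mul (hasAllMoments_endTerm q)).const_mul _
  rw [integral_const_mul, integral_finsetSum _ fun p _ =>
    (HasAllMoments.sum _ fun q _ => hm p q).integrable]
  have e1 : ∀ p ∈ A, ∫ y, ∑ q ∈ A',
      (walkWeight x p * walkWeight x q) * (endTerm p y * endTerm q y) ∂(delta0 n)
      = ∑ q ∈ A', (if q.1 0 = p.1 0 ∧ q.1 (Fin.last L') = p.1 (Fin.last L) then
          walkWeight x p * walkWeight x q else 0)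
        + ∑ q ∈ A', (if q.1 (Fin.last L') = p.1 0 ∧ q.1 0 = p.1 (Fin.last L) then
          walkWeight x p * walkWeight x q else 0) := by
    intro p hp
    rw [integral_finsetSum _ fun q _ => (hm p q).integrable, ← Finset.sum_add_distrib]
    refine Finset.sum_congr rfl fun q hq => ?_
    rw [integral_const_mul, integral_endTerm_mul (isPath_of_mem hp) (isPath_of_mem hq)]
    split_ifs <;> ring
  -- the second pairing of the ends becomes the first one after reversing the second path
  have e2 : ∀ p : Walk m n L,
      ∑ q ∈ A', (if q.1 (Fin.last L') = p.1 0 ∧ q.1 0 = p.1 (Fin.last L) then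
          walkWeight x p * walkWeight x q else 0)
      = ∑ q ∈ A', (if q.1 0 = p.1 0 ∧ q.1 (Fin.last L') = p.1 (Fin.last L) then
          walkWeight x p * walkWeight x q else 0) := by
    intro p
    refine Finset.sum_nbij' revWalk revWalk (fun q hq => revWalk_mem hq)
      (fun q hq => revWalk_mem hq) (fun q _ => revWalk_revWalk q) (fun q _ => revWalk_revWalk q)
      fun q _ => ?_
    rw [walkWeight_revWalk]
    simp [revWalk]
  rw [Finset.sum_congr rfl e1]
  simp_rw [e2, ← two_mul, ← Finset.mul_sum]
  unfold incCov
  rw [Finset.sum_filter, Finset.sum_product, ← mul_assoc, mul_comm _ (2 : ℝ)]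
  congr 1
  refine Finset.sum_congr rfl fun p hp => Finset.sum_congr rfl fun q hq => ?_
  simp only
  rw [monom_pathEdges (isPath_of_mem hp), monom_pathEdges (isPath_of_mem hq)]

/-- The variance of the increment of the cycle count of parameter `L + 1` at row `j`. -/
noncomputable def incVar (n L : ℕ) (j : Fin m) : ℝ :=
  2 * cycleCoef m n L ^ 2 * (pathsBelow n L j).card

lemma incVar_nonneg (n L : ℕ) (j : Fin m) : 0 ≤ incVar n L j := by
  unfold incVar; positivity

lemma hasAllMoments_incCov (L L' : ℕ) (j : Fin m) :
    HasAllMoments (gaussMatrix m n) (incCov (n := n) L L' j) :=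
  (HasAllMoments.sum _ fun t _ =>
    (hasAllMoments_monom (pathEdges t.1)).mul (hasAllMoments_monom (pathEdges t.2))).const_mul _

lemma integral_incCov_self (L : ℕ) (j : Fin m) :
    ∫ x, incCov L L j x ∂(gaussMatrix m n) = incVar n L j := by
  unfold incCov incVar
  rw [integral_const_mul, integral_finsetSum _ fun t _ => ((hasAllMoments_monom (pathEdges t.1)).mul
    (hasAllMoments_monom (pathEdges t.2))).integrable, ← pow_two]
  congr 1
  simp_rw [integral_monom₂]
  rw [Finset.sum_filter, Finset.sum_product, Finset.cast_card]
  refine Finset.sum_congr rfl fun p hp => ?_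
  rw [Finset.sum_eq_single p]
  · simp
  · intro q hq hne
    by_cases h : q.1 0 = p.1 0 ∧ q.1 (Fin.last L) = p.1 (Fin.last L)
    · have : pathEdges p ≠ pathEdges q := fun hE => hne
        (path_eq_of_pathEdges_eq (isPath_of_mem hq) (isPath_of_mem hp) h.1 hE.symm)
      simp [this]
    · simp only [h, if_false]
  · exact fun h => absurd hp h

lemma integral_incCov_of_ne {L L' : ℕ} (h : L ≠ L') (j : Fin m) :
    ∫ x, incCov L L' j x ∂(gaussMatrix m n) = 0 := by
  unfold incCov
  rw [integral_const_mul, integral_finsetSum _ fun t _ => ((hasAllMoments_monom (pathEdges t.1)).mul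
    (hasAllMoments_monom (pathEdges t.2))).integrable]
  rw [Finset.sum_eq_zero fun t ht => ?_, mul_zero]
  rw [integral_monom₂, if_neg]
  intro hE
  have ht' := Finset.mem_product.mp (Finset.mem_filter.mp ht).1
  have := congrArg Finset.card hE
  rw [card_pathEdges (isPath_of_mem ht'.1), card_pathEdges (isPath_of_mem ht'.2)] at this
  omega

/-- If every element is covered an even number of times by four sets, the union has at most half
of the total number of elements. -/
lemma card_union_le_of_even {ε : Type*} [DecidableEq ε] {S₁ S₂ S₃ S₄ : Finset ε}
    (h : ∀ e, Even (mult₂ S₁ S₂ e + mult₂ S₃ S₄ e)) :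
    2 * (S₁ ∪ S₂ ∪ S₃ ∪ S₄).card ≤ S₁.card + S₂.card + S₃.card + S₄.card := by
  set U := S₁ ∪ S₂ ∪ S₃ ∪ S₄ with hU
  have hc : ∀ S ⊆ U, S.card = ∑ e ∈ U, if e ∈ S then 1 else 0 := fun S hS => by
    rw [Finset.sum_ite_mem, Finset.inter_eq_right.mpr hS]; simp
  rw [hc S₁ (by intro e; simp [hU]; tauto), hc S₂ (by intro e; simp [hU]; tauto),
    hc S₃ (by intro e; simp [hU]; tauto), hc S₄ (by intro e; simp [hU]; tauto),
    ← Finset.sum_add_distrib, ← Finset.sum_add_distrib, ← Finset.sum_add_distrib, mul_comm,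
    ← smul_eq_mul, ← Finset.sum_const]
  refine Finset.sum_le_sum fun e he => ?_
  have h1 := h e
  have h2 : e ∈ S₁ ∨ e ∈ S₂ ∨ e ∈ S₃ ∨ e ∈ S₄ := by simpa [hU, or_assoc] using he
  unfold mult₂ at h1
  by_cases c1 : e ∈ S₁ <;> by_cases c2 : e ∈ S₂ <;> by_cases c3 : e ∈ S₃ <;>
    by_cases c4 : e ∈ S₄ <;> simp_all

/-- Variance of the conditional covariance. -/
lemma integral_incCov_sub_sq_le {N : ℝ} (hN : 1 ≤ N) (hm : (m : ℝ) ≤ N) (hn : (n : ℝ) ≤ N)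
    (L L' : ℕ) (j : Fin m) :
    ∫ x, (incCov L L' j x - ∫ z, incCov L L' j z ∂(gaussMatrix m n)) ^ 2 ∂(gaussMatrix m n)
      ≤ (2 * (cycleCoef m n L * cycleCoef m n L')) ^ 2 * (3 ^ (2 * L) * N ^ (2 * (L + L')) *
        (n * (4 * (L + L') ^ 2) * 7 ^ (4 * (L + L')))) := by
  set A := pathsBelow n L j with hA
  set A' := pathsBelow n L' j with hA'
  set T := (A ×ˢ A').filter fun t =>
        t.2.1 0 = t.1.1 0 ∧ t.2.1 (Fin.last L') = t.1.1 (Fin.last L) with hT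
  set f : Walk m n L × Walk m n L' → (Fin m → Fin n → ℝ) → ℝ := fun t x =>
    monom (pathEdges t.1) x * monom (pathEdges t.2) x with hf
  have hfm : ∀ t, HasAllMoments (gaussMatrix m n) (f t) := fun t =>
    (hasAllMoments_monom (pathEdges t.1)).mul (hasAllMoments_monom (pathEdges t.2))
  set c := 2 * (cycleCoef m n L * cycleCoef m n L') with hc
  have hq : ∀ x, incCov L L' j x = c * ∑ t ∈ T, f t x := fun x => rfl
  have hint : ∫ z, incCov L L' j z ∂(gaussMatrix m n)
      = c * ∑ t ∈ T, ∫ z, f t z ∂(gaussMatrix m n) := by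
    simp_rw [hq]
    rw [integral_const_mul, integral_finsetSum _ fun t _ => (hfm t).integrable]
  rw [hint]
  have e1 : ∀ x, (incCov L L' j x - c * ∑ t ∈ T, ∫ z, f t z ∂(gaussMatrix m n)) ^ 2
      = c ^ 2 * ∑ t ∈ T, ∑ u ∈ T, (f t x - ∫ z, f t z ∂(gaussMatrix m n))
        * (f u x - ∫ z, f u z ∂(gaussMatrix m n)) := fun x => by
    rw [hq, ← mul_sub, ← Finset.sum_sub_distrib, mul_pow, pow_two (Finset.sum _ _),
      Finset.sum_mul_sum]
  simp_rw [e1]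
  have hcm : ∀ t u, HasAllMoments (gaussMatrix m n) (fun x =>
      (f t x - ∫ z, f t z ∂(gaussMatrix m n)) * (f u x - ∫ z, f u z ∂(gaussMatrix m n))) :=
    fun t u => ((hfm t).sub (HasAllMoments.const _)).mul ((hfm u).sub (HasAllMoments.const _))
  rw [integral_const_mul, integral_finsetSum _ fun t _ =>
    (HasAllMoments.sum _ fun u _ => hcm t u).integrable]
  refine mul_le_mul_of_nonneg_left ?_ (sq_nonneg _)
  have hcov : ∀ t u, ∫ x, (f t x - ∫ z, f t z ∂(gaussMatrix m n))
      * (f u x - ∫ z, f u z ∂(gaussMatrix m n)) ∂(gaussMatrix m n)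
      = ∫ x, f t x * f u x ∂(gaussMatrix m n)
        - (∫ z, f t z ∂(gaussMatrix m n)) * ∫ z, f u z ∂(gaussMatrix m n) := fun t u => by
    set a := ∫ z, f t z ∂(gaussMatrix m n)
    set b := ∫ z, f u z ∂(gaussMatrix m n)
    have : ∀ x, (f t x - a) * (f u x - b) = f t x * f u x - b * f t x - a * f u x + a * b :=
      fun x => by ring
    simp_rw [this]
    rw [integral_add ((((hfm t).mul (hfm u)).sub ((hfm t).const_mul b)).sub
        ((hfm u).const_mul a)).integrable (integrable_const _),
      integral_sub (((hfm t).mul (hfm u)).sub ((hfm t).const_mul b)).integrable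
        ((hfm u).const_mul a).integrable,
      integral_sub ((hfm t).mul (hfm u)).integrable ((hfm t).const_mul b).integrable,
      integral_const_mul, integral_const_mul, integral_const]
    simp only [probReal_univ, one_smul]
    ring
  -- A nonzero covariance requires that the second pair meets the first one, with its first path
  -- (`Q`) or with its second one (`Q'`).
  set Q : Walk m n L → Walk m n L' → Walk m n L → Walk m n L' → ℝ := fun p₁ p₂ p₃ p₄ =>
    if p₂.1 0 = p₁.1 0 ∧ p₄.1 0 = p₃.1 0 ∧ Hits (pathEdges p₁ ∪ pathEdges p₂) p₃
      then N⁻¹ ^ (pathEdges p₁ ∪ pathEdges p₂ ∪ pathEdges p₃ ∪ pathEdges p₄).card else 0 with hQ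
  set Q' : Walk m n L' → Walk m n L → Walk m n L' → Walk m n L → ℝ := fun p₂ p₁ p₄ p₃ =>
    if p₁.1 0 = p₂.1 0 ∧ p₃.1 0 = p₄.1 0 ∧ Hits (pathEdges p₂ ∪ pathEdges p₁) p₄
      then N⁻¹ ^ (pathEdges p₂ ∪ pathEdges p₁ ∪ pathEdges p₄ ∪ pathEdges p₃).card else 0 with hQ'
  have hN0 : 0 < N := by linarith
  have hQ0 : ∀ p₁ p₂ p₃ p₄, 0 ≤ Q p₁ p₂ p₃ p₄ := fun p₁ p₂ p₃ p₄ => by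
    simp only [hQ]; split_ifs <;> positivity
  have hQ'0 : ∀ p₁ p₂ p₃ p₄, 0 ≤ Q' p₁ p₂ p₃ p₄ := fun p₁ p₂ p₃ p₄ => by
    simp only [hQ']; split_ifs <;> positivity
  have key : ∀ t ∈ T, ∀ u ∈ T, ∫ x, (f t x - ∫ z, f t z ∂(gaussMatrix m n))
      * (f u x - ∫ z, f u z ∂(gaussMatrix m n)) ∂(gaussMatrix m n)
      ≤ 3 ^ (2 * L) * N ^ (2 * (L + L')) * (Q t.1 t.2 u.1 u.2 + Q' t.2 t.1 u.2 u.1) := by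
    intro t ht u hu
    have ht1 := Finset.mem_filter.mp ht
    have hu1 := Finset.mem_filter.mp hu
    have ht' := Finset.mem_product.mp ht1.1
    have hu' := Finset.mem_product.mp hu1.1
    rw [hcov]
    refine (le_abs_self _).trans ((abs_cov_monom_le _ _ _ _).trans ?_)
    have hnn : 0 ≤ (3 : ℝ) ^ (2 * L) * N ^ (2 * (L + L')) * (Q t.1 t.2 u.1 u.2 + Q' t.2 t.1 u.2 u.1) :=
      mul_nonneg (by positivity) (add_nonneg (hQ0 _ _ _ _) (hQ'0 _ _ _ _))
    split_ifs with h
    swap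
    · exact hnn
    rw [card_pathEdges (isPath_of_mem ht'.1), mul_assoc]
    refine le_mul_of_one_le_right (by positivity) ?_
    -- Every edge is covered at least twice, hence the union has at most `2 * (L + L')` edges.
    have hcard := card_union_le_of_even h.1
    rw [card_pathEdges (isPath_of_mem ht'.1), card_pathEdges (isPath_of_mem ht'.2),
      card_pathEdges (isPath_of_mem hu'.1), card_pathEdges (isPath_of_mem hu'.2)] at hcard
    set U := pathEdges t.1 ∪ pathEdges t.2 ∪ pathEdges u.1 ∪ pathEdges u.2 with hU
    have hU' : pathEdges t.2 ∪ pathEdges t.1 ∪ pathEdges u.2 ∪ pathEdges u.1 = U := by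
      ext e; simp only [hU, Finset.mem_union]; tauto
    have hpow : 1 ≤ N ^ (2 * (L + L')) * N⁻¹ ^ U.card := by
      rw [inv_pow, ← div_eq_mul_inv, one_le_div (by positivity)]
      exact pow_le_pow_right₀ hN (by omega)
    have hor : Hits (pathEdges t.1 ∪ pathEdges t.2) u.1 ∨
        Hits (pathEdges t.2 ∪ pathEdges t.1) u.2 := by
      obtain ⟨e, he⟩ := h.2
      obtain ⟨h1, h2⟩ := Finset.mem_inter.mp he
      rcases Finset.mem_union.mp h2 with h3 | h3
      · exact Or.inl (hits_iff.mpr ⟨e, Finset.mem_inter.mpr ⟨h1, h3⟩⟩)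
      · exact Or.inr (hits_iff.mpr ⟨e, Finset.mem_inter.mpr
          ⟨by rw [Finset.union_comm]; exact h1, h3⟩⟩)
    refine hpow.trans (mul_le_mul_of_nonneg_left ?_ (by positivity))
    rcases hor with h3 | h3
    · have : Q t.1 t.2 u.1 u.2 = N⁻¹ ^ U.card := if_pos ⟨ht1.2.1, hu1.2.1, h3⟩
      linarith [hQ'0 t.2 t.1 u.2 u.1]
    · have : Q' t.2 t.1 u.2 u.1 = N⁻¹ ^ U.card := by
        rw [← hU']; exact if_pos ⟨ht1.2.1.symm, hu1.2.1.symm, h3⟩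
      linarith [hQ0 t.1 t.2 u.1 u.2]
  calc _ ≤ ∑ t ∈ T, ∑ u ∈ T, 3 ^ (2 * L) * N ^ (2 * (L + L')) *
          (Q t.1 t.2 u.1 u.2 + Q' t.2 t.1 u.2 u.1) := by
        refine Finset.sum_le_sum fun t ht => ?_
        rw [integral_finsetSum _ fun u _ => (hcm t u).integrable]
        exact Finset.sum_le_sum fun u hu => key t ht u hu
    _ ≤ ∑ t ∈ A ×ˢ A', ∑ u ∈ A ×ˢ A', 3 ^ (2 * L) * N ^ (2 * (L + L')) *
          (Q t.1 t.2 u.1 u.2 + Q' t.2 t.1 u.2 u.1) := by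
        have hnn : ∀ t u : Walk m n L × Walk m n L', 0 ≤ (3 : ℝ) ^ (2 * L) * N ^ (2 * (L + L')) *
          (Q t.1 t.2 u.1 u.2 + Q' t.2 t.1 u.2 u.1) := fun t u =>
          mul_nonneg (by positivity) (add_nonneg (hQ0 _ _ _ _) (hQ'0 _ _ _ _))
        refine (Finset.sum_le_sum_of_subset_of_nonneg (Finset.filter_subset _ _) fun t _ _ =>
          Finset.sum_nonneg fun u _ => hnn t u).trans ?_
        refine Finset.sum_le_sum fun t _ => ?_
        exact Finset.sum_le_sum_of_subset_of_nonneg (Finset.filter_subset _ _) fun u _ _ => hnn t u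
    _ = 3 ^ (2 * L) * N ^ (2 * (L + L')) *
          ((∑ p₁ ∈ A, ∑ p₂ ∈ A', ∑ p₃ ∈ A, ∑ p₄ ∈ A', Q p₁ p₂ p₃ p₄)
          + ∑ p₂ ∈ A', ∑ p₁ ∈ A, ∑ p₄ ∈ A', ∑ p₃ ∈ A, Q' p₂ p₁ p₄ p₃) := by
        simp_rw [← Finset.mul_sum, Finset.sum_add_distrib]
        congr 2
        · rw [Finset.sum_product]
          simp_rw [Finset.sum_product]
        · rw [Finset.sum_product_right]
          simp_rw [Finset.sum_product_right]
    _ ≤ 3 ^ (2 * L) * N ^ (2 * (L + L')) *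
          (n * (4 * L * (L + L')) * 7 ^ (4 * (L + L'))
            + n * (4 * L' * (L' + L)) * 7 ^ (4 * (L' + L))) := by
        refine mul_le_mul_of_nonneg_left (add_le_add ?_ ?_) (by positivity)
        · exact sum_quadruple_le hN hm hn A A' (fun p hp => isPath_of_mem hp)
            fun p hp => isPath_of_mem hp
        · exact sum_quadruple_le hN hm hn A' A (fun p hp => isPath_of_mem hp)
            fun p hp => isPath_of_mem hp
    _ = _ := by
        rw [add_comm L' L]
        ring

end Increments
end Perceptron

namespace Perceptron

section IncrementBounds

variable {m n : ℕ}

lemma cycleCoef_sq_le {N A : ℝ} (hN : 1 ≤ N) (hNm : N ≤ A * m) (hNn : N ≤ A * n) (hA : 1 ≤ A)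
    (L : ℕ) : cycleCoef m n L ^ 2 ≤ ((L : ℝ) + 1) / 2 * ((A / N) ^ 2) ^ (L + 1) := by
  rw [cycleCoef_sq]
  have hn : (0 : ℝ) < n := by
    by_contra h
    have : (n : ℝ) = 0 := le_antisymm (not_lt.mp h) (Nat.cast_nonneg _)
    rw [this] at hNn; linarith
  have hm : (0 : ℝ) < m := by
    by_contra h
    have : (m : ℝ) = 0 := le_antisymm (not_lt.mp h) (Nat.cast_nonneg _)
    rw [this] at hNm; linarith
  have hN0 : 0 < N := by linarith
  have h1 : 1 / (n : ℝ) ≤ A / N := by rw [div_le_div_iff₀ hn hN0]; linarith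
  have h2 : 1 / (m : ℝ) ≤ A / N := by rw [div_le_div_iff₀ hm hN0]; linarith
  rw [pow_two]
  gcongr

/-- The conditional covariances concentrate around their means. -/
lemma integral_abs_incCov_sub_le {N A : ℝ} (hN : 1 ≤ N) (hm : (m : ℝ) ≤ N) (hn : (n : ℝ) ≤ N)
    (hNm : N ≤ A * m) (hNn : N ≤ A * n) (hA : 1 ≤ A) (L L' : ℕ) (j : Fin m) :
    ∫ x, |incCov L L' j x - (if L = L' then incVar n L j else 0)| ∂(gaussMatrix m n)
      ≤ (416 * A) ^ (L + L' + 2) / (N * Real.sqrt N) := by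
  have hN0 : 0 < N := by linarith
  have hmean : (if L = L' then incVar n L j else 0) = ∫ z, incCov L L' j z ∂(gaussMatrix m n) := by
    split_ifs with h
    · subst h; rw [integral_incCov_self]
    · rw [integral_incCov_of_ne h]
  rw [hmean]
  have hmom : HasAllMoments (gaussMatrix m n)
      (fun x => incCov L L' j x - ∫ z, incCov L L' j z ∂(gaussMatrix m n)) :=
    (hasAllMoments_incCov L L' j).sub (HasAllMoments.const _)
  have hvar := integral_incCov_sub_sq_le hN hm hn L L' j
  set X : (Fin m → Fin n → ℝ) → ℝ :=
    fun x => incCov L L' j x - ∫ z, incCov L L' j z ∂(gaussMatrix m n)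
  have hcs : (∫ x, |X x| ∂(gaussMatrix m n)) ^ 2 ≤ ∫ x, X x ^ 2 ∂(gaussMatrix m n) := by
    have := sq_integral_mul_le (F := fun x => |X x|) (G := fun _ => (1 : ℝ)) (μ := gaussMatrix m n)
      hmom.memLp_two.abs (memLp_const 1)
    have hp : (gaussMatrix m n).real Set.univ = 1 := probReal_univ
    simpa [hp] using this
  refine le_of_sq_le_sq (hcs.trans (hvar.trans ?_)) (by positivity)
  have hc := cycleCoef_sq_le hN hNm hNn hA L
  have hc' := cycleCoef_sq_le hN hNm hNn hA L'
  set s := L + L' + 2 with hs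
  have hAN : ((A / N) ^ 2) ^ (L + 1) * ((A / N) ^ 2) ^ (L' + 1) = (A ^ 2) ^ s / N ^ (2 * s) := by
    rw [← pow_add, ← pow_mul, div_pow, ← pow_mul, show L + 1 + (L' + 1) = s by omega]
  have hk : ((L : ℝ) + 1) * (L' + 1) ≤ 2 ^ s := by
    have h1 : ((L + 1 : ℕ) : ℝ) ≤ 2 ^ (L + 1) := by exact_mod_cast (Nat.lt_two_pow_self).le
    have h2 : ((L' + 1 : ℕ) : ℝ) ≤ 2 ^ (L' + 1) := by exact_mod_cast (Nat.lt_two_pow_self).le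
    push_cast at h1 h2
    calc _ ≤ (2 : ℝ) ^ (L + 1) * 2 ^ (L' + 1) := by gcongr
      _ = 2 ^ s := by rw [← pow_add]; congr 1; omega
  have hs2 : 4 * ((L : ℝ) + L') ^ 2 ≤ 4 ^ s := by
    have h1 : (L + L' + 1 : ℕ) ≤ 2 ^ (L + L' + 1) := (Nat.lt_two_pow_self).le
    have h2 : (2 * (L + L') : ℕ) ≤ 2 ^ s := by
      have : 2 ^ s = 2 * 2 ^ (L + L' + 1) := by rw [hs]; ring
      omega
    have h3 : 2 * ((L : ℝ) + L') ≤ 2 ^ s := by exact_mod_cast h2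
    calc 4 * ((L : ℝ) + L') ^ 2 = (2 * ((L : ℝ) + L')) ^ 2 := by ring
      _ ≤ (2 ^ s) ^ 2 := by gcongr
      _ = 4 ^ s := by rw [← pow_mul, mul_comm, pow_mul]; norm_num
  have h9 : (3 : ℝ) ^ (2 * L) ≤ 9 ^ s := by
    rw [pow_mul]; norm_num
    exact pow_le_pow_right₀ (by norm_num) (by omega)
  have h7 : (7 : ℝ) ^ (4 * (L + L')) ≤ 2401 ^ s := by
    rw [pow_mul]; norm_num
    exact pow_le_pow_right₀ (by norm_num) (by omega)
  have hsq : Real.sqrt N ^ 2 = N := Real.sq_sqrt hN0.le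
  calc (2 * (cycleCoef m n L * cycleCoef m n L')) ^ 2 * (3 ^ (2 * L) * N ^ (2 * (L + L')) *
        (n * (4 * (L + L') ^ 2) * 7 ^ (4 * (L + L'))))
      = (4 * (cycleCoef m n L ^ 2 * cycleCoef m n L' ^ 2)) * (3 ^ (2 * L) * N ^ (2 * (L + L')) *
        (n * (4 * (L + L') ^ 2) * 7 ^ (4 * (L + L')))) := by ring
    _ ≤ (4 * ((((L : ℝ) + 1) / 2 * ((A / N) ^ 2) ^ (L + 1)) *
          (((L' : ℝ) + 1) / 2 * ((A / N) ^ 2) ^ (L' + 1)))) * (9 ^ s * N ^ (2 * (L + L')) *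
        (N * 4 ^ s * 2401 ^ s)) := by gcongr
    _ = (((L : ℝ) + 1) * (L' + 1)) * ((A ^ 2) ^ s / N ^ (2 * s)) * (9 ^ s * N ^ (2 * (L + L')) *
        (N * 4 ^ s * 2401 ^ s)) := by rw [← hAN]; ring
    _ ≤ 2 ^ s * ((A ^ 2) ^ s / N ^ (2 * s)) * (9 ^ s * N ^ (2 * (L + L')) *
        (N * 4 ^ s * 2401 ^ s)) := by gcongr
    _ = (172872 * A ^ 2) ^ s / N ^ 3 := by
        rw [show (172872 : ℝ) = 2 * 9 * 4 * 2401 by norm_num, mul_pow, mul_pow, mul_pow, mul_pow,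
          show 2 * s = 2 * (L + L') + 4 by omega, pow_add]
        field_simp
        ring
    _ ≤ ((416 * A) ^ 2) ^ s / N ^ 3 := by
        gcongr
        nlinarith
    _ = ((416 * A) ^ s / (N * Real.sqrt N)) ^ 2 := by
        rw [div_pow, mul_pow N, hsq, ← pow_mul, ← pow_mul, mul_comm 2 s]
        ring

/-! ### Cyclic symmetry -/

lemma sum_embedding_eq {α β : Type*} [Fintype α] [DecidableEq α] [Fintype β] [DecidableEq β]
    (f : (α → β) → ℝ) :
    ∑ i : α ↪ β, f i = ∑ i : α → β, if Function.Injective i then f i else 0 := by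
  rw [← Finset.sum_filter, ← (Equiv.subtypeInjectiveEquivEmbedding α β).sum_comp]
  exact (Finset.sum_subtype (Finset.univ.filter fun i : α → β => Function.Injective i)
    (by simp) f).symm

lemma snoc_injective_iff_lt {L : ℕ} (J : Fin L → Fin m) (j : Fin m) :
    (Function.Injective (Fin.snoc J j : Fin (L + 1) → Fin m) ∧
      ∀ l, (Fin.snoc J j : Fin (L + 1) → Fin m) l
        ≤ (Fin.snoc J j : Fin (L + 1) → Fin m) (Fin.last L))
      ↔ Function.Injective J ∧ ∀ l, J l < j := by
  constructor
  · rintro ⟨h1, h2⟩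
    refine ⟨fun a b hab => ?_, fun l => lt_of_le_of_ne ?_ ?_⟩
    · have := @h1 a.castSucc b.castSucc (by simpa using hab)
      exact Fin.castSucc_injective L this
    · simpa using h2 l.castSucc
    · intro h
      have := @h1 l.castSucc (Fin.last L) (by simpa using h)
      exact absurd this (Fin.castSucc_lt_last l).ne
  · rintro ⟨h1, h2⟩
    refine ⟨fun a b => ?_, fun l => ?_⟩
    · refine Fin.lastCases ?_ (fun a => ?_) a <;> refine Fin.lastCases ?_ (fun b => ?_) b
      · simp
      · simp only [Fin.snoc_last, Fin.snoc_castSucc]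
        exact fun h => absurd h (h2 b).ne'
      · simp only [Fin.snoc_last, Fin.snoc_castSucc]
        exact fun h => absurd h (h2 a).ne
      · simp only [Fin.snoc_castSucc]
        exact fun h => congrArg _ (h1 h)
    · refine Fin.lastCases ?_ (fun a => ?_) l
      · simp
      · simpa using (h2 a).le

/-- Cyclically invariant sums over pairs of injective sequences: the largest row can be moved to
the last position. -/
lemma sum_embedding_eq_sum_pathsBelow {L : ℕ}
    (F : (Fin (L + 1) → Fin n) → (Fin (L + 1) → Fin m) → ℝ)
    (hF : ∀ c i J, F (fun l => i (l + c)) (fun l => J (l + c)) = F i J) :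
    ∑ i : Fin (L + 1) ↪ Fin n, ∑ J : Fin (L + 1) ↪ Fin m, F i J
      = (L + 1) * ∑ j : Fin m, ∑ p ∈ pathsBelow n L j, F p.1 (Fin.snoc p.2 j) := by
  set G : Fin (L + 1) → (Fin (L + 1) → Fin n) → (Fin (L + 1) → Fin m) → ℝ := fun r i J =>
    if Function.Injective i then
      (if Function.Injective J ∧ ∀ l, J l ≤ J r then F i J else 0) else 0 with hG
  have h1 : ∑ i : Fin (L + 1) ↪ Fin n, ∑ J : Fin (L + 1) ↪ Fin m, F i J
      = ∑ r, ∑ i, ∑ J, G r i J := by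
    rw [sum_embedding_eq (fun i => ∑ J : Fin (L + 1) ↪ Fin m, F i J), Finset.sum_comm]
    refine Finset.sum_congr rfl fun i _ => ?_
    rw [sum_embedding_eq (fun J => F i J), Finset.sum_comm]
    by_cases hi : Function.Injective i
    swap
    · simp [hG, hi]
    simp only [hG, hi, if_true]
    refine Finset.sum_congr rfl fun J _ => ?_
    by_cases hJ : Function.Injective J
    swap
    · simp [hJ]
    simp only [hJ, true_and, if_true]
    obtain ⟨r, -, hr⟩ := Finset.exists_max_image Finset.univ J Finset.univ_nonempty
    rw [Finset.sum_eq_single r, if_pos fun l => hr l (Finset.mem_univ l)]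
    · intro r' _ hne
      rw [if_neg]
      exact fun h => hne (hJ (le_antisymm (hr r' (Finset.mem_univ _)) (h r)))
    · simp
  have h2 : ∀ r, ∑ i, ∑ J, G r i J = ∑ i, ∑ J, G (Fin.last L) i J := by
    intro r
    set c : Fin (L + 1) := r - Fin.last L with hc
    have hlast : Fin.last L + c = r := by simp [hc]
    refine Fintype.sum_equiv (Equiv.arrowCongr (Equiv.addRight c).symm (Equiv.refl (Fin n))) _ _
      fun i => Fintype.sum_equiv (Equiv.arrowCongr (Equiv.addRight c).symm (Equiv.refl (Fin m))) _ _
        fun J => ?_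
    have ei : (Equiv.arrowCongr (Equiv.addRight c).symm (Equiv.refl (Fin n))) i
        = i ∘ Equiv.addRight c := by ext l; simp
    have eJ : (Equiv.arrowCongr (Equiv.addRight c).symm (Equiv.refl (Fin m))) J
        = J ∘ Equiv.addRight c := by ext l; simp
    rw [ei, eJ]
    have j1 : Function.Injective (i ∘ Equiv.addRight c) ↔ Function.Injective i :=
      (Equiv.addRight c).injective_comp i
    have j2 : Function.Injective (J ∘ Equiv.addRight c) ↔ Function.Injective J :=
      (Equiv.addRight c).injective_comp J
    have e1 : (∀ l, (J ∘ Equiv.addRight c) l ≤ (J ∘ Equiv.addRight c) (Fin.last L))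
        ↔ ∀ l, J l ≤ J r := by
      simp only [Function.comp_apply, Equiv.coe_addRight, hlast]
      exact ⟨fun h l => by simpa using h (l - c), fun h l => h _⟩
    have e2 : F (i ∘ Equiv.addRight c) (J ∘ Equiv.addRight c) = F i J := hF c i J
    simp only [hG, j1, j2, e1, e2]
  rw [h1, Finset.sum_congr rfl fun r _ => h2 r, Finset.sum_const, Finset.card_univ,
    Fintype.card_fin, nsmul_eq_mul]
  push_cast
  congr 1
  rw [Finset.sum_congr rfl fun i _ => sum_snoc (fun J => G (Fin.last L) i J), Finset.sum_comm]
  refine Finset.sum_congr rfl fun j _ => ?_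
  unfold pathsBelow
  rw [Finset.sum_filter, Fintype.sum_prod_type]
  refine Finset.sum_congr rfl fun i _ => Finset.sum_congr rfl fun J _ => ?_
  simp only [hG, snoc_injective_iff_lt, IsPath]
  by_cases a1 : Function.Injective i <;> by_cases a2 : Function.Injective J <;>
    by_cases a3 : ∀ l, J l < j <;> simp [a1, a2, a3]

end IncrementBounds
end Perceptron

namespace Perceptron

section CycleCounts

variable {m n : ℕ}

lemma prod_cycle_shift {L : ℕ} (f : Fin (L + 1) → ℝ) (c : Fin (L + 1)) :
    ∏ l, f (l + c) = ∏ l, f l := Equiv.prod_comp (Equiv.addRight c) f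

/-- The cycle count is the sum of the increments over the largest row of a cycle. -/
lemma cycleCount_eq_sum (L : ℕ) (M : ℕ → Fin n → ℝ) :
    cycleCount (L + 1) m M / Real.sqrt (2 * ((L : ℝ) + 1))
      = ∑ j : Fin m, cycleInc L j (fun j : Fin m => M j) := by
  set x : Fin m → Fin n → ℝ := fun j => M j with hx
  have h := sum_embedding_eq_sum_pathsBelow (m := m) (n := n) (L := L)
    (fun i J => ∏ l, x (J l) (i l) * x (J l) (i (l + 1))) (fun c i J => by
      simp only
      rw [← prod_cycle_shift (fun l => x (J l) (i l) * x (J l) (i (l + 1))) c]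
      exact Finset.prod_congr rfl fun l _ => by rw [add_right_comm])
  have hp : ∀ j, ∀ p : Walk m n L,
      ∏ l, x ((Fin.snoc p.2 j : Fin (L + 1) → Fin m) l) (p.1 l)
        * x ((Fin.snoc p.2 j : Fin (L + 1) → Fin m) l) (p.1 (l + 1))
      = walkWeight x p * (x j (p.1 0) * x j (p.1 (Fin.last L))) := fun j p => by
    rw [Fin.prod_univ_castSucc]
    simp only [Fin.snoc_castSucc, Fin.snoc_last, Fin.last_add_one, Fin.coeSucc_eq_succ]
    unfold walkWeight
    ring
  simp_rw [hp] at h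
  have hmain : cycleCount (L + 1) m M / Real.sqrt (2 * ((L : ℝ) + 1))
      = cycleCoef m n L * ∑ j : Fin m, ∑ p ∈ pathsBelow n L j,
          walkWeight x p * (x j (p.1 0) * x j (p.1 (Fin.last L)))
        - (if L + 1 = 1 then Real.sqrt ((m : ℝ) * n) else 0) / Real.sqrt (2 * ((L : ℝ) + 1)) := by
    unfold cycleCount cycleCoef
    simp_rw [finRotate_apply]
    rw [sub_div]
    congr 1
    have e : ∑ i : Fin (L + 1) ↪ Fin n, ∑ j : Fin (L + 1) ↪ Fin m,
        ∏ l, M (j l) (i l) * M (j l) (i (l + 1))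
        = ((L : ℝ) + 1) * ∑ j : Fin m, ∑ p ∈ pathsBelow n L j,
          walkWeight x p * (x j (p.1 0) * x j (p.1 (Fin.last L))) := h
    rw [e]
    ring
  have hsum : ∑ j : Fin m, cycleInc L j x
      = cycleCoef m n L * ∑ j : Fin m, ∑ p ∈ pathsBelow n L j,
          walkWeight x p * (x j (p.1 0) * x j (p.1 (Fin.last L)))
        - cycleCoef m n L * ∑ j : Fin m, ∑ p ∈ pathsBelow n L j,
          walkWeight x p * (if L = 0 then 1 else 0) := by
    unfold cycleInc endTerm
    rw [← Finset.mul_sum, ← mul_sub, ← Finset.sum_sub_distrib]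
    simp_rw [← Finset.sum_sub_distrib, mul_sub]
  rw [hmain, hsum]
  congr 1
  by_cases hL : L = 0
  swap
  · simp [hL]
  subst hL
  have hcard : ∀ j : Fin m, pathsBelow n 0 j = Finset.univ := fun j => by
    refine Finset.filter_true_of_mem fun p _ => ⟨⟨?_, ?_⟩, fun l => l.elim0⟩
    · exact fun a b _ => Subsingleton.elim (α := Fin 1) a b
    · exact fun l => l.elim0
  simp only [hcard, if_true, zero_add, CharP.cast_eq_zero, mul_one, walkWeight,
    Finset.univ_eq_empty, Finset.prod_empty, Finset.sum_const, Finset.card_univ, nsmul_eq_mul,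
    Fintype.card_prod, Fintype.card_fun, Fintype.card_fin, pow_zero, pow_one]
  unfold cycleCoef
  have a1 : (n : ℝ) * (1 / Real.sqrt n) = Real.sqrt n := by rw [mul_one_div, Real.div_sqrt]
  have a2 : (m : ℝ) * (1 / Real.sqrt m) = Real.sqrt m := by rw [mul_one_div, Real.div_sqrt]
  rw [Real.sqrt_mul (Nat.cast_nonneg m)]
  conv_lhs => rw [← a1, ← a2]
  simp
  ring

lemma descFactorial_mul_eq (L : ℕ) :
    ((n.descFactorial (L + 1) : ℝ) * (m.descFactorial (L + 1) : ℝ))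
      = (L + 1) * ∑ j : Fin m, ((pathsBelow n L j).card : ℝ) := by
  have h := sum_embedding_eq_sum_pathsBelow (m := m) (n := n) (L := L)
    (fun _ _ => (1 : ℝ)) (fun _ _ _ => rfl)
  simp only [Finset.sum_const, Finset.card_univ, Fintype.card_embedding_eq, Fintype.card_fin,
    nsmul_eq_mul, mul_one] at h
  exact_mod_cast h

/-- Variance of the normalised cycle count of parameter `L + 1`. -/
noncomputable def cycleVar (m n L : ℕ) : ℝ :=
  (n.descFactorial (L + 1) / (n : ℝ) ^ (L + 1)) * (m.descFactorial (L + 1) / (m : ℝ) ^ (L + 1))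

lemma sum_incVar (L : ℕ) : ∑ j : Fin m, incVar n L j = cycleVar m n L := by
  unfold incVar cycleVar
  rw [← Finset.mul_sum, cycleCoef_sq]
  have h := descFactorial_mul_eq (m := m) (n := n) L
  have h0 : (L : ℝ) + 1 ≠ 0 := by positivity
  rw [show ∑ j : Fin m, ((pathsBelow n L j).card : ℝ)
    = (n.descFactorial (L + 1) : ℝ) * (m.descFactorial (L + 1) : ℝ) / (L + 1) by
      rw [h]; field_simp]
  rw [mul_pow, one_div, one_div, inv_pow, inv_pow]
  field_simp

lemma descFactorial_div_pow_le (n k : ℕ) : (n.descFactorial k : ℝ) / (n : ℝ) ^ k ≤ 1 :=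
  div_le_one_of_le₀ (by exact_mod_cast Nat.descFactorial_le_pow n k) (by positivity)

lemma le_descFactorial_div_pow {n : ℕ} (hn : 0 < n) (k : ℕ) :
    1 - (k : ℝ) ^ 2 / n ≤ (n.descFactorial k : ℝ) / (n : ℝ) ^ k := by
  have hn' : (0 : ℝ) < n := by exact_mod_cast hn
  by_cases hk : k ≤ n
  swap
  · have h1 : (n : ℝ) ≤ k := by exact_mod_cast (not_le.mp hk).le
    have h2 : (1 : ℝ) ≤ k := by
      have : 1 ≤ k := by omega
      exact_mod_cast this
    have : 1 ≤ (k : ℝ) ^ 2 / n := by rw [le_div_iff₀ hn']; nlinarith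
    have : 0 ≤ (n.descFactorial k : ℝ) / (n : ℝ) ^ k := by positivity
    linarith
  · have h1 : (n - k : ℕ) ^ k ≤ n.descFactorial k :=
      (Nat.pow_le_pow_left (by omega) k).trans (Nat.pow_sub_le_descFactorial n k)
    have h2 : ((n : ℝ) - k) ^ k ≤ n.descFactorial k := by
      rw [← Nat.cast_sub hk]; exact_mod_cast h1
    have h3 : (1 : ℝ) + k * (-(k / n : ℝ)) ≤ (1 + -(k / n : ℝ)) ^ k := by
      refine one_add_mul_le_pow ?_ k
      have : (k : ℝ) / n ≤ 1 := div_le_one_of_le₀ (by exact_mod_cast hk) hn'.le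
      linarith
    calc 1 - (k : ℝ) ^ 2 / n = 1 + k * (-(k / n : ℝ)) := by ring
      _ ≤ (1 + -(k / n : ℝ)) ^ k := h3
      _ = ((n : ℝ) - k) ^ k / (n : ℝ) ^ k := by rw [← div_pow]; congr 1; field_simp; ring
      _ ≤ _ := by gcongr

lemma cycleVar_nonneg (m n L : ℕ) : 0 ≤ cycleVar m n L := by unfold cycleVar; positivity

lemma cycleVar_le_one (m n L : ℕ) : cycleVar m n L ≤ 1 :=
  mul_le_one₀ (descFactorial_div_pow_le _ _) (by positivity) (descFactorial_div_pow_le _ _)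

lemma one_sub_cycleVar_le {m n : ℕ} (hm : 0 < m) (hn : 0 < n) (L : ℕ) :
    1 - cycleVar m n L ≤ ((L : ℝ) + 1) ^ 2 * (1 / n + 1 / m) := by
  have h1 := le_descFactorial_div_pow hn (L + 1)
  have h2 := le_descFactorial_div_pow hm (L + 1)
  have h3 := descFactorial_div_pow_le n (L + 1)
  have h4 := descFactorial_div_pow_le m (L + 1)
  unfold cycleVar
  push_cast at h1 h2
  have : ((L : ℝ) + 1) ^ 2 * (1 / n + 1 / m)
    = ((L : ℝ) + 1) ^ 2 / n + ((L : ℝ) + 1) ^ 2 / m := by ring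
  rw [this]
  nlinarith [mul_nonneg (sub_nonneg.mpr h3) (sub_nonneg.mpr h4)]

lemma card_pathsBelow_le (L : ℕ) (j : Fin m) :
    ((pathsBelow n L j).card : ℝ) ≤ (n : ℝ) ^ (L + 1) * (m : ℝ) ^ L := by
  have : (pathsBelow n L j).card ≤ Fintype.card (Walk m n L) := Finset.card_le_univ _
  rw [Fintype.card_prod, Fintype.card_fun, Fintype.card_fun, Fintype.card_fin, Fintype.card_fin,
    Fintype.card_fin, Fintype.card_fin] at this
  exact_mod_cast this

lemma incVar_le (L : ℕ) (j : Fin m) : incVar n L j ≤ ((L : ℝ) + 1) / m := by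
  have hm : (0 : ℝ) < m := by exact_mod_cast j.pos
  unfold incVar
  rw [cycleCoef_sq]
  calc _ ≤ 2 * (((L : ℝ) + 1) / 2 * (1 / n * (1 / m)) ^ (L + 1)) *
        ((n : ℝ) ^ (L + 1) * (m : ℝ) ^ L) :=
        mul_le_mul_of_nonneg_left (card_pathsBelow_le L j) (by positivity)
    _ = ((L : ℝ) + 1) / m * ((1 / n * n) ^ (L + 1) * (1 / m * m) ^ L) := by
        rw [mul_pow, mul_pow, mul_pow, pow_succ (1 / (m : ℝ)) L]; ring
    _ ≤ ((L : ℝ) + 1) / m * 1 := by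
        refine mul_le_mul_of_nonneg_left ?_ (by positivity)
        rw [one_div_mul_cancel hm.ne', one_pow, mul_one]
        refine pow_le_one₀ (by positivity) ?_
        rw [one_div]
        exact inv_mul_le_one
    _ = _ := mul_one _

/-! ### Fourth moments of the increments -/

lemma measurePreserving_curry_gaussian :
    MeasurePreserving (fun (x : Fin m × Fin n → ℝ) (j : Fin m) (i : Fin n) => x (j, i))
      (Measure.pi fun _ => gaussianReal 0 1) (gaussMatrix m n) := by
  refine ⟨by fun_prop, ?_⟩
  have h := Measure.infinitePi_map_curry (fun (_ : Fin m) (_ : Fin n) => gaussianReal 0 1)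
  simp_rw [Measure.infinitePi_eq_pi] at h
  exact h

lemma hasAllMoments_cycleInc (L : ℕ) (j : Fin m) :
    HasAllMoments (gaussMatrix m n) (cycleInc (n := n) L j) := by
  unfold cycleInc walkWeight endTerm
  refine (HasAllMoments.sum _ fun p _ => ?_).const_mul _
  refine (HasAllMoments.prod _ fun l _ => ?_).mul ?_
  · exact (hasAllMoments_entry _ _).mul (hasAllMoments_entry _ _)
  · exact ((hasAllMoments_entry _ _).mul (hasAllMoments_entry _ _)).sub (HasAllMoments.const _)

lemma integral_cycleInc_sq (L : ℕ) (j : Fin m) :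
    ∫ x, cycleInc L j x ^ 2 ∂(gaussMatrix m n) = incVar n L j := by
  rw [← integral_incCov_self, gaussMatrix, integral_update (fun _ : Fin m => delta0 n) j
    ((hasAllMoments_cycleInc L j).pow 2).integrable]
  refine integral_congr_ae (Filter.Eventually.of_forall fun x => ?_)
  simp only
  rw [← integral_cycleInc_mul_update]
  simp_rw [pow_two]

/-- The constant in the fourth moment bound for the increments. -/
lemma exists_integral_cycleInc_four_le : ∃ C : ℝ, 1 ≤ C ∧ ∀ (m n L : ℕ) (j : Fin m),
    ∫ x, cycleInc L j x ^ 4 ∂(gaussMatrix m n) ≤ C ^ (L + 1) * incVar n L j ^ 2 := by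
  have h2 : Real.sqrt 2 ^ 2 = 2 := Real.sq_sqrt (by norm_num)
  have h20 : Real.sqrt 2 ≠ 0 := by positivity
  set φ : ℝ → ℝ := fun t => (Real.sqrt 2)⁻¹ * (t ^ 2 - 1) with hφ
  have hs : HasAllMoments (gaussianReal 0 1) (fun t => t ^ 2 - 1) :=
    (hasAllMoments_gaussian.pow 2).sub (HasAllMoments.const 1)
  have hφm : HasAllMoments (gaussianReal 0 1) φ := hs.const_mul _
  have hφ1 : ∫ t, φ t ∂(gaussianReal 0 1) = 0 := by
    simp only [hφ]
    rw [integral_const_mul, integral_sub (hasAllMoments_gaussian.pow 2).integrable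
      (integrable_const _), integral_gaussian_sq]
    simp
  have hφ2 : ∫ t, φ t ^ 2 ∂(gaussianReal 0 1) = 1 := by
    have e : ∀ t, φ t ^ 2 = 1 / 2 * (t ^ 4 - 2 * t ^ 2 + 1) := fun t => by
      simp only [hφ]
      rw [mul_pow, inv_pow, h2]; ring
    simp_rw [e]
    rw [integral_const_mul, integral_add ((hasAllMoments_gaussian.pow 4).sub
      ((hasAllMoments_gaussian.pow 2).const_mul 2)).integrable (integrable_const _),
      integral_sub (hasAllMoments_gaussian.pow 4).integrable
      ((hasAllMoments_gaussian.pow 2).const_mul 2).integrable, integral_const_mul,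
      integral_gaussian_sq, integral_gaussian_four]
    simp; norm_num
  set t := |∫ t, φ t ^ 3 ∂(gaussianReal 0 1)| with ht
  set b := ∫ t, φ t ^ 4 ∂(gaussianReal 0 1) with hb
  have ht0 : 0 ≤ t := abs_nonneg _
  have hb0 : 0 ≤ b := integral_nonneg fun t => by positivity
  set β := 3 + 3 * t + b with hβ
  have hβ1 : 3 ≤ β := by linarith
  refine ⟨max 81 (β ^ 2), le_max_of_le_left (by norm_num), fun m n L j => ?_⟩
  have tr : ∀ r : ℕ, ∫ x, cycleInc L j x ^ r ∂(gaussMatrix m n)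
      = ∫ z : Fin m × Fin n → ℝ, cycleInc L j (fun (j : Fin m) (i : Fin n) => z (j, i)) ^ r
        ∂(Measure.pi fun _ => gaussianReal 0 1) := fun r =>
    (integral_comp_measurePreserving measurePreserving_curry_gaussian
      ((hasAllMoments_cycleInc L j).pow r 1).aestronglyMeasurable).symm
  have hvar := integral_cycleInc_sq (n := n) L j
  rw [tr] at hvar
  rw [tr, ← hvar]
  by_cases hL : L = 0
  · subst hL
    have e : ∀ z : Fin m × Fin n → ℝ, cycleInc 0 j (fun (j : Fin m) (i : Fin n) => z (j, i))
        = ∑ p ∈ pathsBelow n 0 j, cycleCoef m n 0 * Real.sqrt 2 *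
          ∏ e ∈ {(j, p.1 0)}, φ (z e) := fun z => by
      unfold cycleInc endTerm walkWeight
      rw [Finset.mul_sum]
      refine Finset.sum_congr rfl fun p _ => ?_
      simp [hφ]
      field_simp
    simp_rw [e]
    refine (integral_pow_four_le (gaussianReal 0 1) hφm hφ1 hφ2 (β := β) (by linarith)
      (by nlinarith) Finset.univ 1 (pathsBelow n 0 j) (fun _ => cycleCoef m n 0 * Real.sqrt 2)
      (fun p => {(j, p.1 0)}) (fun p _ => Finset.subset_univ _) (fun p _ => by simp)).trans ?_
    refine mul_le_mul_of_nonneg_right ?_ (sq_nonneg _)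
    simp
  · have hd : ∀ p ∈ pathsBelow n L j,
        Disjoint (pathEdges p) {(j, p.1 0), (j, p.1 (Fin.last L))} := by
      intro p hp
      rw [Finset.disjoint_left]
      intro e he1 he2
      have hlt := (Finset.mem_filter.mp hp).2.2
      have : e.1 = j := by
        simp only [Finset.mem_insert, Finset.mem_singleton] at he2
        rcases he2 with rfl | rfl <;> rfl
      obtain ⟨l, rfl | rfl⟩ := mem_pathEdges.mp he1
      · exact (hlt l).ne this
      · exact (hlt l).ne this
    have e : ∀ z : Fin m × Fin n → ℝ, cycleInc L j (fun (j : Fin m) (i : Fin n) => z (j, i))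
        = ∑ p ∈ pathsBelow n L j, cycleCoef m n L *
          ∏ e ∈ pathEdges p ∪ {(j, p.1 0), (j, p.1 (Fin.last L))}, z e := fun z => by
      unfold cycleInc endTerm
      rw [Finset.mul_sum]
      refine Finset.sum_congr rfl fun p hp => ?_
      have hpp := isPath_of_mem hp
      rw [Finset.prod_union (hd p hp), Finset.prod_pair, if_neg hL, sub_zero]
      · congr 2
        exact (monom_pathEdges hpp (fun j i => z (j, i))).symm
      · intro h
        exact hL ((ends_eq_iff hpp).mp (Prod.mk.inj h).2)
    simp_rw [e]
    refine (integral_pow_four_le (gaussianReal 0 1) hasAllMoments_gaussian integral_gaussian_id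
      integral_gaussian_sq (β := 3) (by rw [integral_gaussian_cube]; norm_num)
      (by rw [integral_gaussian_cube, integral_gaussian_four]; norm_num) Finset.univ (2 * L + 2)
      (pathsBelow n L j) (fun _ => cycleCoef m n L)
      (fun p => pathEdges p ∪ {(j, p.1 0), (j, p.1 (Fin.last L))})
      (fun p _ => Finset.subset_univ _) (fun p hp => ?_)).trans ?_
    · refine (Finset.card_union_le _ _).trans ?_
      exact add_le_add (card_pathEdges_le p) Finset.card_le_two
    · refine mul_le_mul_of_nonneg_right ?_ (sq_nonneg _)
      rw [show 2 * L + 2 = 2 * (L + 1) by ring, pow_mul]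
      exact pow_le_pow_left₀ (by norm_num) ((by norm_num : ((3 : ℝ) ^ 2) ^ 2 ≤ 81).trans
        (le_max_left _ _)) _

end CycleCounts
end Perceptron

namespace Perceptron

/-! ### Gaussian approximation for the unconditioned matrix -/

section GaussianApprox

variable {K : ℕ}

lemma integral_norm_cube_le {α : Type*} [MeasurableSpace α] {μ : Measure α} [IsFiniteMeasure μ]
    {Y : α → EuclideanSpace ℝ (Fin K)} (hY : ∀ k, HasAllMoments μ (fun a => Y a k)) {v c : ℝ}
    (hv : 0 < v) (hc : 1 ≤ c) (h2 : ∀ k, ∫ a, Y a k ^ 2 ∂μ ≤ v)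
    (h4 : ∀ k, ∫ a, Y a k ^ 4 ∂μ ≤ c * v ^ 2) :
    ∫ a, ‖Y a‖ ^ 3 ∂μ ≤ (K : ℝ) ^ 2 * c * (v * Real.sqrt v) := by
  set s := Real.sqrt v with hs
  have hs0 : 0 < s := Real.sqrt_pos.mpr hv
  have hs2 : s ^ 2 = v := Real.sq_sqrt hv.le
  have hnorm : ∀ a, ‖Y a‖ ^ 2 = ∑ k, Y a k ^ 2 := fun a => by
    rw [EuclideanSpace.norm_sq_eq]
    exact Finset.sum_congr rfl fun k _ => by simp
  have hle : ∀ a, ‖Y a‖ ^ 3 ≤ 1 / 2 * (s * ∑ k, Y a k ^ 2 + s⁻¹ * (K * ∑ k, Y a k ^ 4)) := by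
    intro a
    have h4 : ‖Y a‖ ^ 4 ≤ K * ∑ k, Y a k ^ 4 := by
      have := sq_sum_le_card_mul_sum_sq (s := (Finset.univ : Finset (Fin K)))
        (f := fun k => Y a k ^ 2)
      rw [← hnorm a, Finset.card_univ, Fintype.card_fin] at this
      calc ‖Y a‖ ^ 4 = (‖Y a‖ ^ 2) ^ 2 := by ring
        _ ≤ _ := this
        _ = _ := by congr 1; exact Finset.sum_congr rfl fun k _ => by ring
    rw [← hnorm a]
    set t := ‖Y a‖
    have ht : 0 ≤ t := norm_nonneg _
    have h1 : t ^ 3 ≤ 1 / 2 * (s * t ^ 2 + s⁻¹ * t ^ 4) := by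
      have e : 1 / 2 * (s * t ^ 2 + s⁻¹ * t ^ 4) - t ^ 3 = 1 / 2 * s⁻¹ * (t * (s - t)) ^ 2 := by
        field_simp; ring
      have : 0 ≤ 1 / 2 * s⁻¹ * (t * (s - t)) ^ 2 := by positivity
      linarith
    refine h1.trans ?_
    gcongr
  have i2 : HasAllMoments μ (fun a => ∑ k, Y a k ^ 2) := HasAllMoments.sum _ fun k _ => (hY k).pow 2
  have i4 : HasAllMoments μ (fun a => ∑ k, Y a k ^ 4) := HasAllMoments.sum _ fun k _ => (hY k).pow 4
  have hK : (K : ℝ) ≤ (K : ℝ) ^ 2 := by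
    exact_mod_cast (Nat.le_self_pow (by norm_num) K)
  calc ∫ a, ‖Y a‖ ^ 3 ∂μ
      ≤ ∫ a, 1 / 2 * (s * ∑ k, Y a k ^ 2 + s⁻¹ * (K * ∑ k, Y a k ^ 4)) ∂μ := by
        refine integral_mono_of_nonneg (Filter.Eventually.of_forall fun a => by positivity)
          (((i2.const_mul s).add ((i4.const_mul _).const_mul _)).const_mul _).integrable
          (Filter.Eventually.of_forall hle)
    _ = 1 / 2 * (s * ∑ k, ∫ a, Y a k ^ 2 ∂μ + s⁻¹ * (K * ∑ k, ∫ a, Y a k ^ 4 ∂μ)) := by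
        rw [integral_const_mul, integral_add (i2.const_mul s).integrable
          ((i4.const_mul _).const_mul _).integrable, integral_const_mul, integral_const_mul,
          integral_const_mul, integral_finsetSum _ fun k _ => ((hY k).pow 2).integrable,
          integral_finsetSum _ fun k _ => ((hY k).pow 4).integrable]
    _ ≤ 1 / 2 * (s * ∑ _k : Fin K, v + s⁻¹ * (K * ∑ _k : Fin K, c * v ^ 2)) := by
        gcongr with k _ k _
        · exact h2 k
        · exact h4 k
    _ = 1 / 2 * (K * (v * s) + (K : ℝ) ^ 2 * c * (v * s)) := by
        simp only [Finset.sum_const, Finset.card_univ, Fintype.card_fin, nsmul_eq_mul, ← hs2]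
        field_simp
    _ ≤ _ := by
        have h0 : 0 ≤ v * s := by positivity
        have : (K : ℝ) * (v * s) ≤ (K : ℝ) ^ 2 * c * (v * s) := by
          refine mul_le_mul_of_nonneg_right (hK.trans ?_) h0
          exact le_mul_of_one_le_right (by positivity) hc
        linarith

lemma integral_stdGaussian_pow_four (k : Fin K) :
    ∫ z, z k ^ 4 ∂(stdGaussian (EuclideanSpace ℝ (Fin K))) = 3 := by
  rw [integral_stdGaussian_comp (by fun_prop)]
  have := integral_comp_measurePreserving
    (measurePreserving_eval (fun _ : Fin K => gaussianReal 0 1) k)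
    (f := fun x => x ^ 4) (by fun_prop)
  rw [integral_gaussian_four] at this
  exact this

lemma integral_norm_diagMul_le (s : Fin K → ℝ) :
    ∫ z, ‖diagMul s z‖ ∂(stdGaussian (EuclideanSpace ℝ (Fin K))) ≤ ∑ k, |s k| := by
  have hm : ∀ k, HasAllMoments (stdGaussian (EuclideanSpace ℝ (Fin K))) (fun z => |z k|) :=
    fun k p => (hasAllMoments_stdGaussian k p).abs
  have h1 : ∀ k : Fin K, ∫ z, |z k| ∂(stdGaussian (EuclideanSpace ℝ (Fin K))) ≤ 1 := by
    intro k
    have hp : (stdGaussian (EuclideanSpace ℝ (Fin K))).real Set.univ = 1 := probReal_univ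
    have := sq_integral_mul_le (hm k).memLp_two
      (memLp_const (1 : ℝ) (μ := stdGaussian (EuclideanSpace ℝ (Fin K))))
    have h2 := integral_stdGaussian_mul k k
    simp only [← pow_two, if_true] at h2
    simp only [mul_one, sq_abs, h2, one_pow, integral_const, hp, one_smul] at this
    nlinarith
  calc ∫ z, ‖diagMul s z‖ ∂(stdGaussian (EuclideanSpace ℝ (Fin K)))
      ≤ ∫ z, ∑ k, |s k| * |z k| ∂(stdGaussian (EuclideanSpace ℝ (Fin K))) := by
        refine integral_mono_of_nonneg (Filter.Eventually.of_forall fun z => norm_nonneg _)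
          (HasAllMoments.sum _ fun k _ => (hm k).const_mul _).integrable
          (Filter.Eventually.of_forall fun z => ?_)
        simp only
        refine le_of_sq_le_sq ?_ (by positivity)
        rw [norm_diagMul_sq]
        calc ∑ k, s k ^ 2 * z k ^ 2 = ∑ k, (|s k| * |z k|) ^ 2 := by
              refine Finset.sum_congr rfl fun k _ => ?_
              rw [mul_pow, sq_abs, sq_abs]
          _ ≤ _ := Finset.sum_sq_le_sq_sum_of_nonneg fun k _ => by positivity
    _ = ∑ k, |s k| * ∫ z, |z k| ∂(stdGaussian (EuclideanSpace ℝ (Fin K))) := by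
        rw [integral_finsetSum _ fun k _ => ((hm k).const_mul _).integrable]
        simp_rw [integral_const_mul]
    _ ≤ ∑ k, |s k| := Finset.sum_le_sum fun k _ =>
        mul_le_of_le_one_right (abs_nonneg _) (h1 k)

lemma natCast_pow_le_pow_four (K : ℕ) {r : ℕ} (hr : 0 < r) (hr4 : r ≤ 4) :
    (K : ℝ) ^ r ≤ (K : ℝ) ^ 4 := by
  rcases Nat.eq_zero_or_pos K with h | h
  · simp [h, hr.ne']
  · exact pow_le_pow_right₀ (by exact_mod_cast h) hr4

lemma covariance_error_le (K : ℕ) {C A N m : ℝ} (hC : 416 ≤ C) (hA : 1 ≤ A) (hN : 0 < N)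
    (hm : 0 ≤ m) (hmN : m ≤ N) :
    1 / 2 * ((K : ℝ) ^ 2 * (416 * A) ^ (2 * K) * (m / N) / Real.sqrt N)
      ≤ (K : ℝ) ^ 4 * (C * A) ^ (2 * K + 1) / Real.sqrt N := by
  have h1 : m / N ≤ 1 := by rw [div_le_one hN]; exact hmN
  have hCA : 416 * A ≤ C * A := mul_le_mul_of_nonneg_right hC (by linarith)
  have h2 : (416 * A) ^ (2 * K) ≤ (C * A) ^ (2 * K + 1) :=
    (pow_le_pow_left₀ (by linarith) hCA _).trans (pow_le_pow_right₀ (by linarith) (by omega))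
  have h3 := natCast_pow_le_pow_four K (r := 2) (by norm_num) (by norm_num)
  have h4 : (K : ℝ) ^ 2 * (416 * A) ^ (2 * K) * (m / N) / Real.sqrt N
      ≤ (K : ℝ) ^ 4 * (C * A) ^ (2 * K + 1) / Real.sqrt N := by
    refine div_le_div_of_nonneg_right ?_ (Real.sqrt_nonneg _)
    calc _ ≤ (K : ℝ) ^ 2 * (416 * A) ^ (2 * K) * 1 :=
          mul_le_mul_of_nonneg_left h1 (by positivity)
      _ = (K : ℝ) ^ 2 * (416 * A) ^ (2 * K) := mul_one _
      _ ≤ _ := mul_le_mul h3 h2 (by positivity) (by positivity)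
  have h5 : 0 ≤ (K : ℝ) ^ 2 * (416 * A) ^ (2 * K) * (m / N) / Real.sqrt N := by positivity
  linarith

lemma cube_error_le (K : ℕ) {C A N m : ℝ} (hC : 1 ≤ C) (hA : 1 ≤ A) (hN : 1 ≤ N)
    (h7 : 1 / m ≤ A / N) :
    (K : ℝ) ^ 3 * C ^ K * Real.sqrt ((K : ℝ) / m)
      ≤ (K : ℝ) ^ 4 * (C * A) ^ (2 * K + 1) / Real.sqrt N := by
  have hN0 : 0 < N := by linarith
  have hCA : C ≤ C * A := le_mul_of_one_le_right (by linarith) hA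
  have hAC : A ≤ C * A := le_mul_of_one_le_left (by linarith) hC
  have h3 : Real.sqrt ((K : ℝ) / m) ≤ K * (A / Real.sqrt N) := by
    refine Real.sqrt_le_iff.mpr ⟨by positivity, ?_⟩
    rw [mul_pow, div_pow, Real.sq_sqrt hN0.le]
    have hK : (K : ℝ) ≤ (K : ℝ) ^ 2 := by exact_mod_cast (Nat.le_self_pow (by norm_num) K)
    have h8 : A / N ≤ A ^ 2 / N := by
      refine div_le_div_of_nonneg_right ?_ hN0.le
      nlinarith
    calc (K : ℝ) / m = K * (1 / m) := by ring
      _ ≤ K * (A ^ 2 / N) := mul_le_mul_of_nonneg_left (h7.trans h8) (Nat.cast_nonneg K)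
      _ ≤ K ^ 2 * (A ^ 2 / N) := mul_le_mul_of_nonneg_right hK (by positivity)
  have h4 : C ^ K * A ≤ (C * A) ^ (2 * K + 1) := by
    rw [pow_succ]
    refine mul_le_mul ?_ hAC (by linarith) (by positivity)
    exact (pow_le_pow_left₀ (by linarith) hCA _).trans
      (pow_le_pow_right₀ (by linarith) (by omega))
  calc (K : ℝ) ^ 3 * C ^ K * Real.sqrt ((K : ℝ) / m)
      ≤ (K : ℝ) ^ 3 * C ^ K * (K * (A / Real.sqrt N)) :=
        mul_le_mul_of_nonneg_left h3 (by positivity)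
    _ = (K : ℝ) ^ 4 * (C ^ K * A) / Real.sqrt N := by ring
    _ ≤ _ := div_le_div_of_nonneg_right (mul_le_mul_of_nonneg_left h4 (by positivity))
        (Real.sqrt_nonneg _)

set_option maxHeartbeats 400000 in
/-- Normalised cycle counts of a standard Gaussian matrix are close to a standard Gaussian
vector. -/
theorem exists_gaussMatrix_close : ∃ C : ℝ, 1 ≤ C ∧ ∀ (m n K : ℕ) (N A : ℝ), 1 ≤ N → (m : ℝ) ≤ N →
    (n : ℝ) ≤ N → N ≤ A * m → N ≤ A * n → 1 ≤ A →
    ∀ g : EuclideanSpace ℝ (Fin K) → ℝ, ContDiff ℝ 3 g → ∀ M₁ M₂ M₃ : ℝ,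
    (∀ x, ‖iteratedFDeriv ℝ 1 g x‖ ≤ M₁) → (∀ x, ‖iteratedFDeriv ℝ 2 g x‖ ≤ M₂) →
    (∀ x, ‖iteratedFDeriv ℝ 3 g x‖ ≤ M₃) →
    |∫ x, g (WithLp.toLp 2 fun k : Fin K => ∑ j, cycleInc (k : ℕ) j x) ∂(gaussMatrix m n)
      - ∫ z, g z ∂(stdGaussian (EuclideanSpace ℝ (Fin K)))|
    ≤ (M₁ + M₂ + M₃) * ((K : ℝ) ^ 4 * (C * A) ^ (2 * K + 1) / Real.sqrt N) := by
  obtain ⟨C₀, hC₀1, hC₀⟩ := exists_integral_cycleInc_four_le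
  refine ⟨max C₀ 416, le_max_of_le_left hC₀1, ?_⟩
  intro m n K N A hN hmN hnN hNm hNn hA g hg M₁ M₂ M₃ hM₁ hM₂ hM₃
  set C := max C₀ 416 with hC
  have hC416 : 416 ≤ C := le_max_right _ _
  have hCC₀ : C₀ ≤ C := le_max_left _ _
  have hC1 : 1 ≤ C := by linarith
  have hN0 : 0 < N := by linarith
  have hM₁0 : 0 ≤ M₁ := (norm_nonneg _).trans (hM₁ 0)
  have hM₂0 : 0 ≤ M₂ := (norm_nonneg _).trans (hM₂ 0)
  have hM₃0 : 0 ≤ M₃ := (norm_nonneg _).trans (hM₃ 0)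
  have hn : (0 : ℝ) < n := by
    by_contra h
    have : (n : ℝ) = 0 := le_antisymm (not_lt.mp h) (Nat.cast_nonneg _)
    rw [this] at hNn; linarith
  have hm : (0 : ℝ) < m := by
    by_contra h
    have : (m : ℝ) = 0 := le_antisymm (not_lt.mp h) (Nat.cast_nonneg _)
    rw [this] at hNm; linarith
  have hsN : 0 < Real.sqrt N := Real.sqrt_pos.mpr hN0
  have hsN2 : Real.sqrt N ^ 2 = N := Real.sq_sqrt hN0.le
  have hsN1 : 1 ≤ Real.sqrt N := Real.one_le_sqrt.mpr hN
  set D : Fin m → (Fin m → Fin n → ℝ) → EuclideanSpace ℝ (Fin K) := fun j x =>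
    WithLp.toLp 2 fun k => cycleInc (k : ℕ) j x with hD
  set σ : Fin K → ℝ := fun k => Real.sqrt (cycleVar m n k) with hσ
  set s : Fin m → Fin K → ℝ := fun j k => Real.sqrt (incVar n k j) with hs
  have hs2 : ∀ j k, s j k ^ 2 = incVar n k j := fun j k => Real.sq_sqrt (incVar_nonneg _ _ _)
  have hDm : ∀ j k, HasAllMoments (gaussMatrix m n) (fun x => D j x k) := fun j k =>
    hasAllMoments_cycleInc (k : ℕ) j
  have hlin := lindeberg_le (delta0 n) (D := D) (m := m) (K := K)
    (fun j => memLp_euclidean fun k => by simpa using hDm j k 3)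
    (fun j i hij x y => by simp only [hD, cycleInc_update_of_lt _ hij])
    (fun j x k => (hasAllMoments_cycleInc_update (k : ℕ) j x).memLp_two)
    (fun j x k => integral_cycleInc_update (k : ℕ) j x)
    (q := fun j k l x => incCov (k : ℕ) (l : ℕ) j x)
    (fun j x k l => integral_cycleInc_mul_update (k : ℕ) (l : ℕ) j x)
    (fun j k l => (hasAllMoments_incCov (k : ℕ) (l : ℕ) j).integrable)
    s σ (fun k => by
      simp_rw [hs2]
      rw [sum_incVar, hσ]
      exact Real.sq_sqrt (cycleVar_nonneg _ _ _)) hg hM₁ hM₂ hM₃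
  have hDsum : ∀ x, ∑ j, D j x = WithLp.toLp 2 fun k : Fin K => ∑ j, cycleInc (k : ℕ) j x :=
    fun x => by ext k; simp [hD]
  simp_rw [hDsum] at hlin
  rw [← gaussMatrix] at hlin
  -- replacing the variances of the limit by `1`
  have hT3 : |∫ z, g (diagMul σ z) ∂(stdGaussian (EuclideanSpace ℝ (Fin K)))
      - ∫ z, g z ∂(stdGaussian (EuclideanSpace ℝ (Fin K)))|
      ≤ M₁ * ((K : ℝ) ^ 4 * (C * A) ^ (2 * K + 1) / Real.sqrt N) := by
    have hz : Integrable (fun z : EuclideanSpace ℝ (Fin K) => z)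
        (stdGaussian (EuclideanSpace ℝ (Fin K))) :=
      (memLp_euclidean (p := 1) fun k => by
        simpa using hasAllMoments_stdGaussian k 1).integrable le_rfl
    have hσz : ∀ τ : Fin K → ℝ, Integrable (fun z : EuclideanSpace ℝ (Fin K) => diagMul τ z)
        (stdGaussian (EuclideanSpace ℝ (Fin K))) := fun τ =>
      (memLp_euclidean (p := 1) fun k => by
        simpa [diagMul] using (hasAllMoments_stdGaussian k).const_mul (τ k) 1).integrable le_rfl
    rw [← integral_sub (integrable_comp_of_lipschitz hg hM₁ (hσz σ))
      (integrable_comp_of_lipschitz hg hM₁ hz)]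
    have hσ1 : ∀ k : Fin K, |σ k - 1| ≤ (K : ℝ) ^ 2 * (2 * A / N) := by
      intro k
      have h0 := cycleVar_nonneg m n k
      have h1 := cycleVar_le_one m n k
      have h2 := one_sub_cycleVar_le (m := m) (n := n) (by exact_mod_cast hm) (by exact_mod_cast hn)
        (k : ℕ)
      have h3 : cycleVar m n k ≤ σ k := Real.le_sqrt_of_sq_le (by nlinarith)
      have h4 : σ k ≤ 1 := Real.sqrt_le_one.mpr h1
      have h5 : ((k : ℕ) : ℝ) + 1 ≤ K := by exact_mod_cast k.2
      have h6 : 1 / (n : ℝ) ≤ A / N := by rw [div_le_div_iff₀ hn hN0]; linarith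
      have h7 : 1 / (m : ℝ) ≤ A / N := by rw [div_le_div_iff₀ hm hN0]; linarith
      rw [abs_of_nonpos (by linarith)]
      calc -(σ k - 1) ≤ 1 - cycleVar m n k := by linarith
        _ ≤ ((k : ℕ) + 1 : ℝ) ^ 2 * (1 / n + 1 / m) := h2
        _ ≤ (K : ℝ) ^ 2 * (A / N + A / N) := by gcongr
        _ = _ := by ring
    calc _ ≤ ∫ z, |g (diagMul σ z) - g z| ∂(stdGaussian (EuclideanSpace ℝ (Fin K))) :=
          abs_integral_le_integral_abs
      _ ≤ ∫ z, M₁ * ‖diagMul (fun k => σ k - 1) z‖ ∂(stdGaussian (EuclideanSpace ℝ (Fin K))) := by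
          refine integral_mono_of_nonneg (Filter.Eventually.of_forall fun z => abs_nonneg _)
            ((hσz _).norm.const_mul _) (Filter.Eventually.of_forall fun z => ?_)
          refine (lipschitz_of_iteratedFDeriv hg hM₁ _ _).trans_eq ?_
          congr 2
          ext k
          simp [diagMul]; ring
      _ ≤ M₁ * ∑ k, |σ k - 1| := by
          rw [integral_const_mul]
          exact mul_le_mul_of_nonneg_left (integral_norm_diagMul_le _) hM₁0
      _ ≤ M₁ * ∑ _k : Fin K, (K : ℝ) ^ 2 * (2 * A / N) := by
          gcongr with k _
          exact hσ1 k
      _ = M₁ * ((K : ℝ) ^ 3 * (2 * A) / N) := by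
          simp only [Finset.sum_const, Finset.card_univ, Fintype.card_fin, nsmul_eq_mul]
          ring
      _ ≤ _ := by
          refine mul_le_mul_of_nonneg_left ?_ hM₁0
          have h1 : (K : ℝ) ^ 3 ≤ (K : ℝ) ^ 4 := by
            rcases Nat.eq_zero_or_pos K with h | h
            · simp [h]
            · exact pow_le_pow_right₀ (by exact_mod_cast h) (by norm_num)
          have h2 : 2 * A ≤ (C * A) ^ (2 * K + 1) := by
            have h3 : 1 ≤ C * A := by nlinarith
            calc 2 * A ≤ C * A := by nlinarith
              _ ≤ _ := le_self_pow₀ h3 (by omega)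
          have h3 : Real.sqrt N ≤ N := by nlinarith
          gcongr
  -- the conditional covariances
  have hT1 : ∀ j : Fin m, ∑ k : Fin K, ∑ l : Fin K,
      ∫ x, |incCov (k : ℕ) (l : ℕ) j x - (if k = l then s j k ^ 2 else 0)| ∂(gaussMatrix m n)
      ≤ (K : ℝ) ^ 2 * ((416 * A) ^ (2 * K) / (N * Real.sqrt N)) := by
    intro j
    calc _ ≤ ∑ _k : Fin K, ∑ _l : Fin K, (416 * A) ^ (2 * K) / (N * Real.sqrt N) := by
          refine Finset.sum_le_sum fun k _ => Finset.sum_le_sum fun l _ => ?_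
          have := integral_abs_incCov_sub_le hN hmN hnN hNm hNn hA (k : ℕ) (l : ℕ) j
          simp_rw [hs2]
          simp only [Fin.val_inj] at this
          refine this.trans ?_
          gcongr
          · nlinarith
          · have := k.2; have := l.2; omega
      _ = _ := by simp; ring
  have hv : ∀ k : Fin K, ∀ j : Fin m, incVar n k j ≤ (K : ℝ) / m := fun k j =>
    (incVar_le (k : ℕ) j).trans (by
      have h5 : ((k : ℕ) : ℝ) + 1 ≤ K := by exact_mod_cast k.2
      gcongr)
  have hT2 : ∀ j : Fin m, ∫ x, ‖D j x‖ ^ 3 ∂(gaussMatrix m n)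
      + ∫ z, ‖diagMul (s j) z‖ ^ 3 ∂(stdGaussian (EuclideanSpace ℝ (Fin K)))
      ≤ 2 * ((K : ℝ) ^ 2 * C ^ K * ((K : ℝ) / m * Real.sqrt ((K : ℝ) / m))) := by
    intro j
    rcases Nat.eq_zero_or_pos K with h | hK
    · subst h
      have h1 : ∀ x, ‖D j x‖ = 0 := fun x => by rw [norm_eq_zero]; exact Subsingleton.elim _ _
      have h2 : ∀ z, ‖diagMul (s j) z‖ = 0 := fun x => by
        rw [norm_eq_zero]; exact Subsingleton.elim _ _
      simp [h1, h2]
    have hK' : (0 : ℝ) < K := by exact_mod_cast hK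
    have hvpos : 0 < (K : ℝ) / m := by positivity
    have hsq : ∀ k : Fin K, incVar n k j ^ 2 ≤ ((K : ℝ) / m) ^ 2 := fun k =>
      pow_le_pow_left₀ (incVar_nonneg _ _ _) (hv k j) 2
    have hCK : 1 ≤ C ^ K := one_le_pow₀ hC1
    rw [two_mul]
    refine add_le_add ?_ ?_
    · refine integral_norm_cube_le (hDm j) hvpos hCK (fun k => ?_) fun k => ?_
      · have := integral_cycleInc_sq (n := n) (k : ℕ) j
        exact this.le.trans (hv k j)
      · refine (hC₀ m n (k : ℕ) j).trans ?_
        have h1 : C₀ ^ ((k : ℕ) + 1) ≤ C ^ K :=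
          (pow_le_pow_left₀ (by linarith) hCC₀ _).trans (pow_le_pow_right₀ hC1 k.2)
        exact mul_le_mul h1 (hsq k) (sq_nonneg _) (by positivity)
    · refine integral_norm_cube_le (fun k => (hasAllMoments_stdGaussian k).const_mul (s j k)) hvpos
        hCK (fun k => ?_) fun k => ?_
      · have h2 := integral_stdGaussian_mul k k
        simp only [← pow_two, if_true] at h2
        simp only [diagMul, mul_pow]
        rw [integral_const_mul, h2, hs2, mul_one]
        exact hv k j
      · simp only [diagMul, mul_pow]
        rw [integral_const_mul, integral_stdGaussian_pow_four]
        have h3 : 3 ≤ C ^ K := by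
          calc (3 : ℝ) ≤ C := by linarith
            _ ≤ C ^ K := le_self_pow₀ hC1 (by omega)
        calc s j k ^ 4 * 3 = 3 * incVar n k j ^ 2 := by rw [← hs2]; ring
          _ ≤ _ := mul_le_mul h3 (hsq k) (sq_nonneg _) (by positivity)
  have hE : |∫ x, g (WithLp.toLp 2 fun k : Fin K => ∑ j, cycleInc (k : ℕ) j x) ∂(gaussMatrix m n)
      - ∫ z, g (diagMul σ z) ∂(stdGaussian (EuclideanSpace ℝ (Fin K)))|
      ≤ (M₂ + M₃) * ((K : ℝ) ^ 4 * (C * A) ^ (2 * K + 1) / Real.sqrt N) := by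
    refine hlin.trans ?_
    calc _ ≤ ∑ _j : Fin m, (1 / 2 * M₂ * ((K : ℝ) ^ 2 * ((416 * A) ^ (2 * K) / (N * Real.sqrt N)))
          + 1 / 2 * M₃ * (2 * ((K : ℝ) ^ 2 * C ^ K *
            ((K : ℝ) / m * Real.sqrt ((K : ℝ) / m))))) := by
          refine Finset.sum_le_sum fun j _ => add_le_add ?_ ?_
          · exact mul_le_mul_of_nonneg_left (hT1 j) (by positivity)
          · exact mul_le_mul_of_nonneg_left (hT2 j) (by positivity)
      _ = 1 / 2 * M₂ * ((K : ℝ) ^ 2 * (416 * A) ^ (2 * K) * (m / N) / Real.sqrt N)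
          + M₃ * ((K : ℝ) ^ 3 * C ^ K * Real.sqrt ((K : ℝ) / m)) := by
          simp only [Finset.sum_const, Finset.card_univ, Fintype.card_fin, nsmul_eq_mul]
          field_simp
      _ ≤ M₂ * ((K : ℝ) ^ 4 * (C * A) ^ (2 * K + 1) / Real.sqrt N)
          + M₃ * ((K : ℝ) ^ 4 * (C * A) ^ (2 * K + 1) / Real.sqrt N) := by
          have h7 : 1 / (m : ℝ) ≤ A / N := by rw [div_le_div_iff₀ hm hN0]; linarith
          refine add_le_add ?_ ?_
          · calc 1 / 2 * M₂ * ((K : ℝ) ^ 2 * (416 * A) ^ (2 * K) * (m / N) / Real.sqrt N)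
                = M₂ * (1 / 2 * ((K : ℝ) ^ 2 * (416 * A) ^ (2 * K) * (m / N) / Real.sqrt N)) := by
                  ring
              _ ≤ _ := mul_le_mul_of_nonneg_left
                  (covariance_error_le K hC416 hA hN0 (Nat.cast_nonneg m) hmN) hM₂0
          · exact mul_le_mul_of_nonneg_left (cube_error_le K hC1 hA hN h7) hM₃0
      _ = _ := by ring
  calc _ ≤ _ := abs_sub_le _ (∫ z, g (diagMul σ z) ∂(stdGaussian (EuclideanSpace ℝ (Fin K)))) _
    _ ≤ _ := add_le_add hE hT3
    _ = _ := by ring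

end GaussianApprox
end Perceptron

namespace Perceptron

/-! ### Cycle sums with independent rows -/

section Rows

variable {E : Type*} [MeasurableSpace E] {ρ : Measure E} [IsProbabilityMeasure ρ] {m n : ℕ}

/-- Two products of centred functions of distinct independent rows are correlated only if they use
the same rows, and the expectation then factorises. -/
lemma abs_integral_prod_mul_prod_le {κ : Type*} [Fintype κ] [DecidableEq κ] (P : Finset κ)
    (J J' : κ ↪ Fin m) (f g : κ → E → ℝ)
    (hg : ∀ l ∈ P, ∫ e, g l e ∂ρ = 0) :
    |∫ z : Fin m → E, (∏ l ∈ P, f l (z (J l))) * ∏ l ∈ P, g l (z (J' l)) ∂(Measure.pi fun _ => ρ)|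
      ≤ ∏ l ∈ P, ∑ l' ∈ P, if J l' = J' l then |∫ e, f l' e * g l e ∂ρ| else 0 := by
  have hRHS : 0 ≤ ∏ l ∈ P, ∑ l' ∈ P, if J l' = J' l then |∫ e, f l' e * g l e ∂ρ| else 0 :=
    Finset.prod_nonneg fun l _ => Finset.sum_nonneg fun l' _ => by split_ifs <;> positivity
  set F : Fin m → E → ℝ := fun r e => (∏ l ∈ P, if J l = r then f l e else 1) *
    ∏ l ∈ P, if J' l = r then g l e else 1 with hF
  have hprod : ∀ z : Fin m → E, (∏ l ∈ P, f l (z (J l))) * ∏ l ∈ P, g l (z (J' l))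
      = ∏ r, F r (z r) := by
    intro z
    simp only [hF]
    rw [Finset.prod_mul_distrib]
    congr 1
    · rw [Finset.prod_comm]
      exact Finset.prod_congr rfl fun l _ => by simp
    · rw [Finset.prod_comm]
      exact Finset.prod_congr rfl fun l _ => by simp
  simp_rw [hprod]
  rw [integral_fintype_prod_eq_prod (𝕜 := ℝ) (μ := fun _ : Fin m => ρ) F]
  -- the factor of a row used by a single index of each of the two families
  have e1 : ∀ (H : κ ↪ Fin m) (h : κ → E → ℝ) (e : E), ∀ l ∈ P,
      (∏ l' ∈ P, if H l' = H l then h l' e else 1) = h l e := by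
    intro H h e l hl
    rw [Finset.prod_eq_single l]
    · simp
    · exact fun l' _ hne => if_neg fun h => hne (H.injective h)
    · exact fun h => absurd hl h
  have e2 : ∀ (H : κ ↪ Fin m) (h : κ → E → ℝ) (e : E) (r : Fin m), (∀ l ∈ P, H l ≠ r) →
      (∏ l' ∈ P, if H l' = r then h l' e else 1) = 1 := fun H h e r hr =>
    Finset.prod_eq_one fun l hl => if_neg (hr l hl)
  by_cases hcase : ∃ l ∈ P, ∀ l' ∈ P, J l' ≠ J' l
  · obtain ⟨l, hl, hne⟩ := hcase
    rw [Finset.prod_eq_zero (Finset.mem_univ (J' l)), abs_zero]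
    · exact hRHS
    · simp only [hF]
      simp_rw [e2 J f _ (J' l) hne, e1 J' g _ l hl, one_mul]
      exact hg l hl
  · push Not at hcase
    have hsub : P.map J' ⊆ P.map J := by
      intro r hr
      obtain ⟨l, hl, rfl⟩ := Finset.mem_map.mp hr
      obtain ⟨l', hl', h⟩ := hcase l hl
      exact Finset.mem_map.mpr ⟨l', hl', h⟩
    have hmap : P.map J' = P.map J := Finset.eq_of_subset_of_card_le hsub (by simp)
    rw [← Finset.prod_subset (Finset.subset_univ (P.map J')), Finset.prod_map, Finset.abs_prod]
    · refine Finset.prod_le_prod (fun l _ => abs_nonneg _) fun l hl => ?_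
      obtain ⟨l', hl', h⟩ := hcase l hl
      have h1 : ∫ e, F (J' l) e ∂ρ = ∫ e, f l' e * g l e ∂ρ := by
        refine integral_congr_ae (Filter.Eventually.of_forall fun e => ?_)
        simp only [hF]
        rw [e1 J' g e l hl, ← h, e1 J f e l' hl']
      rw [h1]
      have := Finset.single_le_sum (f := fun l' => if J l' = J' l then
        |∫ e, f l' e * g l e ∂ρ| else 0) (fun l' _ => by split_ifs <;> positivity) hl'
      simpa [h] using this
    · intro r _ hr
      have hr2 : r ∉ P.map J := by rwa [← hmap]
      have a1 : ∀ l ∈ P, J l ≠ r := fun l hl h => hr2 (Finset.mem_map.mpr ⟨l, hl, h⟩)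
      have a2 : ∀ l ∈ P, J' l ≠ r := fun l hl h => hr (Finset.mem_map.mpr ⟨l, hl, h⟩)
      simp only [hF]
      simp_rw [e2 J f _ r a1, e2 J' g _ r a2]
      simp

lemma sum_prod_path_le {n L : ℕ} (v : Fin (L + 1) → Fin n → Fin n → ℝ)
    (hv : ∀ l b c, 0 ≤ v l b c) {T R : ℝ} (hT : ∑ b, ∑ c, v 0 b c ≤ T)
    (hR : ∀ l b, ∑ c, v l b c ≤ R) (hR0 : 0 ≤ R) :
    ∑ i : Fin (L + 2) → Fin n, ∏ l : Fin (L + 1), v l (i l.castSucc) (i l.succ) ≤ T * R ^ L := by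
  induction L with
  | zero =>
    rw [sum_cons]
    simp only [pow_zero, mul_one]
    refine le_of_eq_of_le ?_ hT
    refine Finset.sum_congr rfl fun b _ => ?_
    rw [sum_cons]
    refine Finset.sum_congr rfl fun c _ => ?_
    rw [Finset.univ_unique, Finset.sum_singleton]
    simp
  | succ L ih =>
    have ih' := ih (fun l => v l.castSucc) (fun l => hv _) hT (fun l => hR _)
    rw [sum_snoc, Finset.sum_comm]
    calc ∑ i : Fin (L + 2) → Fin n, ∑ c, ∏ l : Fin (L + 2),
          v l ((Fin.snoc i c : Fin (L + 3) → Fin n) l.castSucc)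
            ((Fin.snoc i c : Fin (L + 3) → Fin n) l.succ)
        = ∑ i : Fin (L + 2) → Fin n,
            (∏ l : Fin (L + 1), v l.castSucc (i l.castSucc) (i l.succ)) *
              ∑ c, v (Fin.last _) (i (Fin.last _)) c := by
          refine Finset.sum_congr rfl fun i _ => ?_
          rw [Finset.mul_sum]
          refine Finset.sum_congr rfl fun c _ => ?_
          rw [Fin.prod_univ_castSucc]
          congr 1
          · refine Finset.prod_congr rfl fun l _ => ?_
            rw [Fin.snoc_castSucc, Fin.succ_castSucc, Fin.snoc_castSucc]
          · rw [Fin.snoc_castSucc, Fin.succ_last, Fin.snoc_last]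
      _ ≤ ∑ i : Fin (L + 2) → Fin n,
            (∏ l : Fin (L + 1), v l.castSucc (i l.castSucc) (i l.succ)) * R :=
          Finset.sum_le_sum fun i _ => mul_le_mul_of_nonneg_left (hR _ _)
            (Finset.prod_nonneg fun l _ => hv _ _ _)
      _ ≤ T * R ^ L * R := by
          rw [← Finset.sum_mul]
          exact mul_le_mul_of_nonneg_right ih' hR0
      _ = _ := by ring

/-- A cyclic sum of products of nonnegative weights, of which the first one has total mass `T`, the
last one is bounded by `q` and all have row sums at most `R`. -/
lemma sum_prod_cycle_le {n L : ℕ} (v : Fin (L + 1) → Fin n → Fin n → ℝ)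
    (hv : ∀ l b c, 0 ≤ v l b c) {T R q : ℝ} (hT : ∑ b, ∑ c, v 0 b c ≤ T)
    (hR : ∀ l b, ∑ c, v l b c ≤ R) (hR1 : 1 ≤ R) (hq : ∀ b c, v (Fin.last L) b c ≤ q)
    (hq0 : 0 ≤ q)
    (hdiag : L = 0 → ∑ b, v (Fin.last L) b b ≤ q) (hT1 : 1 ≤ T) :
    ∑ i : Fin (L + 1) → Fin n, ∏ l, v l (i l) (i (l + 1)) ≤ T * R ^ L * q := by
  cases L with
  | zero =>
    rw [sum_cons]
    have h1 := hdiag rfl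
    calc _ = ∑ b, v (Fin.last 0) b b := by
          refine Finset.sum_congr rfl fun b _ => ?_
          rw [Finset.univ_unique, Finset.sum_singleton]
          simp
      _ ≤ q := h1
      _ ≤ _ := by
          rw [pow_zero, mul_one]
          exact le_mul_of_one_le_left hq0 hT1
  | succ L =>
    calc ∑ i : Fin (L + 2) → Fin n, ∏ l, v l (i l) (i (l + 1))
        ≤ ∑ i : Fin (L + 2) → Fin n,
            (∏ l : Fin (L + 1), v l.castSucc (i l.castSucc) (i l.succ)) * q := by
          refine Finset.sum_le_sum fun i _ => ?_
          rw [Fin.prod_univ_castSucc]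
          simp only [Fin.coeSucc_eq_succ]
          exact mul_le_mul_of_nonneg_left (hq _ _) (Finset.prod_nonneg fun l _ => hv _ _ _)
      _ ≤ T * R ^ L * q := by
          rw [← Finset.sum_mul]
          exact mul_le_mul_of_nonneg_right (sum_prod_path_le (fun l => v l.castSucc)
            (fun l => hv _) hT (fun l => hR _) (by linarith)) hq0
      _ ≤ T * R ^ (L + 1) * q := by
          gcongr
          · omega

end Rows

/-! ### Low-rank perturbations of the rows -/

section Perturbation

variable {E : Type*} {m n : ℕ}

/-- The three possible factors for a row of a cycle: `none` stands for the deterministic part. -/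
def stepVal (A : Fin n → Fin n → ℝ) (S : Bool → Fin n → Fin n → E → ℝ) :
    Option Bool → Fin n → Fin n → E → ℝ
  | none, c, d, _ => A c d
  | some s, c, d, e => S s c d e

/-- The part of the cycle sum in which the factors are of the prescribed types `τ`. -/
noncomputable def typeSum (A : Fin n → Fin n → ℝ) (S : Bool → Fin n → Fin n → E → ℝ) {L : ℕ}
    (τ : Fin (L + 1) → Option Bool) (z : Fin m → E) : ℝ :=
  ∑ i : Fin (L + 1) ↪ Fin n, ∑ J : Fin (L + 1) ↪ Fin m,
    ∏ l, stepVal A S (τ l) (i l) (i (l + 1)) (z (J l))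

lemma typeSum_shift (A : Fin n → Fin n → ℝ) (S : Bool → Fin n → Fin n → E → ℝ) {L : ℕ}
    (τ : Fin (L + 1) → Option Bool) (z : Fin m → E) (c : Fin (L + 1)) :
    typeSum A S (fun l => τ (l + c)) z = typeSum A S τ z := by
  unfold typeSum
  refine (Fintype.sum_equiv ((Equiv.addRight c).symm.embeddingCongr (Equiv.refl (Fin n))) _ _
    fun i => Fintype.sum_equiv ((Equiv.addRight c).symm.embeddingCongr (Equiv.refl (Fin m))) _ _
      fun J => ?_).symm
  rw [← Equiv.prod_comp (Equiv.addRight c)]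
  refine Finset.prod_congr rfl fun l _ => ?_
  simp [Equiv.embeddingCongr, add_right_comm]

open Fin.NatCast Fin.CommRing in
/-- A cyclic sequence of types that is neither constantly `none` nor constantly `some false` can
be rotated such that the first type is not `none` and the last one is not `some false`. -/
lemma exists_shift {L : ℕ} (τ : Fin (L + 1) → Option Bool) (h1 : ∃ l, τ l ≠ none)
    (h2 : ∃ l, τ l ≠ some false) : ∃ c, τ (0 + c) ≠ none ∧ τ (Fin.last L + c) ≠ some false := by
  have hlast : Fin.last L + 1 = 0 := Fin.last_add_one L
  by_cases h : ∃ l, τ l = none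
  · obtain ⟨l₀, hl₀⟩ := h
    by_contra hcon
    push Not at hcon
    have step : ∀ l, τ l = none → τ (l + 1) = none := by
      intro l hl
      by_contra hne
      have := hcon (l + 1) (by rwa [zero_add])
      rw [add_comm l 1, ← add_assoc, hlast, zero_add, hl] at this
      exact absurd this (by simp)
    have all : ∀ j : ℕ, τ (l₀ + (j : Fin (L + 1))) = none := by
      intro j
      induction j with
      | zero => simpa using hl₀
      | succ j ih => rw [Nat.cast_succ, ← add_assoc]; exact step _ ih
    obtain ⟨l, hl⟩ := h1
    apply hl
    have := all (l - l₀ : Fin (L + 1))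
    simpa using this
  · push Not at h
    obtain ⟨l, hl⟩ := h2
    refine ⟨l + 1, h _, ?_⟩
    rw [add_comm l 1, ← add_assoc, hlast, zero_add]
    exact hl

variable [MeasurableSpace E]

/-- Bound for the covariance of `S s a b` and `S s' c d` in a perturbation `S` of a Gaussian row:
`false` stands for a product `y a * y b` of two Gaussian coordinates, `true` for the fluctuation of
the perturbation. -/
noncomputable def stepKernel (n : ℕ) (C : ℝ) (s s' : Bool) (a b c d : Fin n) : ℝ :=
  if s = false ∧ s' = false then
    (if a = c then 1 else 0) * (if b = d then 1 else 0)
      + (if a = d then 1 else 0) * (if b = c then 1 else 0)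
  else C / n * ((if a = c then 1 else 0) + (if a = d then 1 else 0) + (if b = c then 1 else 0)
    + (if b = d then 1 else 0)) + C / n ^ 2

/-- A decomposition `x c * x d = S false c d + A c d + S true c d` of the products of two coordinates
of a random row: `S false` is the same product for a standard Gaussian row, `A` is deterministic, and
`S true` is centred and small in the sense of covariances. -/
structure IsPerturbation (ρ : Measure E) (A : Fin n → Fin n → ℝ)
    (S : Bool → Fin n → Fin n → E → ℝ) (C : ℝ) : Prop where
  moments : ∀ s c d, HasAllMoments ρ (S s c d)
  abs_le : ∀ c d, |A c d| ≤ C / n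
  integral_eq_zero : ∀ s c d, (s = false → c ≠ d) → ∫ e, S s c d e ∂ρ = 0
  abs_integral_le : ∀ s s' a b c d, (s = false → a ≠ b) → (s' = false → c ≠ d) →
    |∫ e, S s a b e * S s' c d e ∂ρ| ≤ stepKernel n C s s' a b c d

end Perturbation
end Perceptron

namespace Perceptron

section PerturbationVariance

variable {m n : ℕ}

lemma stepKernel_nonneg {C : ℝ} (hC : 0 ≤ C) (s s' : Bool) (a b c d : Fin n) :
    0 ≤ stepKernel n C s s' a b c d := by
  unfold stepKernel
  have h : ∀ a b : Fin n, (0 : ℝ) ≤ if a = b then 1 else 0 := fun a b => by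
    split_ifs <;> norm_num
  split_ifs
  all_goals positivity

lemma sum_stepKernel_le {C : ℝ} (hC : 1 ≤ C) (s s' : Bool) (a b c : Fin n) :
    ∑ d, stepKernel n C s s' a b c d
      ≤ C * ((if a = c then 1 else 0) + (if b = c then 1 else 0)) + 3 * C / n := by
  have hn : (0 : ℝ) < n := by exact_mod_cast a.pos
  have h0 : ∀ a b : Fin n, (0 : ℝ) ≤ if a = b then 1 else 0 := fun a b => by
    split_ifs <;> norm_num
  unfold stepKernel
  split_ifs with h
  all_goals
    simp only [Finset.sum_add_distrib, ← Finset.mul_sum, Finset.sum_const, Finset.card_univ,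
      Fintype.card_fin, nsmul_eq_mul, Finset.sum_ite_eq, Finset.mem_univ, if_true,
      ← Finset.sum_mul]
    first
    | (have : 0 ≤ 3 * C / n := by positivity
       norm_num
       linarith)
    | (apply le_of_eq; field_simp; ring)

lemma stepKernel_le {C : ℝ} (s : Bool) (a b c d : Fin n) :
    stepKernel n C s true a b c d = C / n * ((if a = c then 1 else 0) + (if a = d then 1 else 0)
      + (if b = c then 1 else 0) + (if b = d then 1 else 0)) + C / n ^ 2 := by
  unfold stepKernel
  simp

/-- `stepKernel` for types that include the deterministic one. -/
noncomputable def typeKernel (n : ℕ) (C : ℝ) : Option Bool → Option Bool → Fin n → Fin n → Fin n →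
    Fin n → ℝ
  | some s, some s' => stepKernel n C s s'
  | _, _ => fun _ _ _ _ => 0

lemma typeKernel_nonneg {C : ℝ} (hC : 0 ≤ C) (s s' : Option Bool) (a b c d : Fin n) :
    0 ≤ typeKernel n C s s' a b c d := by
  rcases s with _ | s <;> rcases s' with _ | s' <;> simp [typeKernel]
  exact stepKernel_nonneg hC _ _ _ _ _ _

lemma sum_typeKernel_le {C : ℝ} (hC : 1 ≤ C) (s s' : Option Bool) (a b c : Fin n) :
    ∑ d, typeKernel n C s s' a b c d
      ≤ C * ((if a = c then 1 else 0) + (if b = c then 1 else 0)) + 3 * C / n := by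
  have h : (0 : ℝ) ≤ C * ((if a = c then 1 else 0) + (if b = c then 1 else 0)) + 3 * C / n := by
    have h0 : ∀ a b : Fin n, (0 : ℝ) ≤ if a = b then 1 else 0 := fun a b => by
      split_ifs <;> norm_num
    have := h0 a c
    have := h0 b c
    positivity
  rcases s with _ | s <;> rcases s' with _ | s'
  · simpa [typeKernel] using h
  · simpa [typeKernel] using h
  · simpa [typeKernel] using h
  · exact sum_stepKernel_le hC s s' a b c

lemma typeKernel_some_true_le {C : ℝ} (hC : 0 ≤ C) (s : Option Bool) (a b c d : Fin n) :
    typeKernel n C s (some true) a b c d ≤ C / n * ((if a = c then 1 else 0)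
      + (if a = d then 1 else 0) + (if b = c then 1 else 0) + (if b = d then 1 else 0))
      + C / n ^ 2 := by
  rcases s with _ | s
  · have h0 : ∀ a b : Fin n, (0 : ℝ) ≤ if a = b then 1 else 0 := fun a b => by
      split_ifs <;> norm_num
    have := h0 a c
    have := h0 a d
    have := h0 b c
    have := h0 b d
    simp only [typeKernel]
    positivity
  · exact (stepKernel_le s a b c d).le

/-- The weight of a step of the second copy of a cycle relative to a fixed first copy `i`, summed
over the row used by the step. -/
noncomputable def stepWeight (m : ℕ) (C : ℝ) {L : ℕ} (τ : Fin (L + 1) → Option Bool)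
    (i : Fin (L + 1) → Fin n) (l : Fin (L + 1)) (b c : Fin n) : ℝ :=
  if τ l = none then m * (C / n) ^ 2
  else ∑ l', typeKernel n C (τ l') (τ l) (i l') (i (l' + 1)) b c

lemma stepWeight_nonneg {C : ℝ} (hC : 0 ≤ C) {L : ℕ} (τ : Fin (L + 1) → Option Bool)
    (i : Fin (L + 1) → Fin n) (l : Fin (L + 1)) (b c : Fin n) :
    0 ≤ stepWeight m C τ i l b c := by
  unfold stepWeight
  split_ifs
  · positivity
  · exact Finset.sum_nonneg fun l' _ => typeKernel_nonneg hC _ _ _ _ _ _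

lemma injective_add_one {L : ℕ} {i : Fin (L + 1) → Fin n} (hi : Function.Injective i) :
    Function.Injective fun l => i (l + 1) := fun a b h => by simpa using hi h

/-- The sum of the weights over the columns of the second copy of a cycle: each step costs at most a
constant factor, and the last one gains `1 / n`, because it is deterministic or belongs to the
fluctuation of the perturbation. -/
lemma sum_cycle_stepWeight_le {C A₀ : ℝ} (hC : 1 ≤ C) (hA₀ : 1 ≤ A₀) (hm : (m : ℝ) ≤ A₀ * n)
    {L : ℕ} (hL : L + 1 ≤ n) (τ : Fin (L + 1) → Option Bool) (h0 : τ 0 ≠ none)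
    (hlast : τ (Fin.last L) ≠ some false) (i : Fin (L + 1) → Fin n) (hi : Function.Injective i) :
    ∑ i' : Fin (L + 1) → Fin n, ∏ l, stepWeight m C τ i l (i' l) (i' (l + 1))
      ≤ (5 * C ^ 2 * A₀ * (L + 1)) * (5 * C ^ 2 * A₀) ^ L * (5 * C ^ 2 * A₀ / n) := by
  have hn : (0 : ℝ) < n := by exact_mod_cast (by omega : 0 < n)
  have hC0 : 0 ≤ C := by linarith
  have hLn : (L : ℝ) + 1 ≤ n := by exact_mod_cast hL
  have hLn' : ((L : ℝ) + 1) / n ≤ 1 := by rw [div_le_one hn]; exact hLn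
  set R := 5 * C ^ 2 * A₀ with hR
  have hCR : 5 * C ≤ R := by
    have : C * 1 ≤ C ^ 2 * A₀ := by
      rw [pow_two, mul_assoc]
      exact mul_le_mul_of_nonneg_left (one_le_mul_of_one_le_of_one_le hC hA₀) hC0
    linarith
  have hCR2 : C ^ 2 * A₀ ≤ R := by
    have : 0 ≤ C ^ 2 * A₀ := by positivity
    linarith
  have hR1 : 1 ≤ R := by linarith
  have hmn : (m : ℝ) / n ≤ A₀ := by rw [div_le_iff₀ hn]; exact hm
  have hi1 := sum_ite_injective_le hi
  have hi2 := sum_ite_injective_le (injective_add_one hi)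
  have hnone : n * (m * (C / n) ^ 2) ≤ R := by
    calc n * (m * (C / n) ^ 2) = C ^ 2 * (m / n) := by field_simp
      _ ≤ C ^ 2 * A₀ := by gcongr
      _ ≤ R := hCR2
  have hrow : ∀ l, τ l ≠ none → ∀ b, ∑ c, stepWeight m C τ i l b c ≤
      ∑ l', (C * ((if i l' = b then 1 else 0) + (if i (l' + 1) = b then 1 else 0))
        + 3 * C / n) := by
    intro l hl b
    simp only [stepWeight, hl, if_false]
    rw [Finset.sum_comm]
    exact Finset.sum_le_sum fun l' _ => sum_typeKernel_le hC _ _ _ _ _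
  refine sum_prod_cycle_le (fun l => stepWeight m C τ i l) (stepWeight_nonneg hC0 τ i)
    ?_ ?_ hR1 ?_ (by positivity) ?_ ?_
  · calc ∑ b, ∑ c, stepWeight m C τ i 0 b c
        ≤ ∑ b, ∑ l', (C * ((if i l' = b then 1 else 0) + (if i (l' + 1) = b then 1 else 0))
        + 3 * C / n) := Finset.sum_le_sum fun b _ => hrow 0 h0 b
      _ = 5 * C * (L + 1) := by
          rw [Finset.sum_comm]
          simp only [Finset.sum_add_distrib, ← Finset.mul_sum, Finset.sum_const, Finset.card_univ,
            Fintype.card_fin, nsmul_eq_mul, Finset.sum_ite_eq, Finset.mem_univ, if_true]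
          push_cast
          field_simp
          ring
      _ ≤ R * (L + 1) := by gcongr
  · intro l b
    by_cases hl : τ l = none
    · simp only [stepWeight, hl, if_true, Finset.sum_const, Finset.card_univ, Fintype.card_fin,
        nsmul_eq_mul]
      exact hnone
    · refine (hrow l hl b).trans ?_
      rw [Finset.sum_add_distrib, ← Finset.mul_sum, Finset.sum_add_distrib]
      simp only [Finset.sum_const, Finset.card_univ, Fintype.card_fin, nsmul_eq_mul]
      push_cast
      have h1 := hi1 b
      have h2 := hi2 b
      calc _ ≤ C * (1 + 1) + 3 * C * (((L : ℝ) + 1) / n) := by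
            refine add_le_add (mul_le_mul_of_nonneg_left (add_le_add h1 h2) hC0) (le_of_eq ?_)
            ring
        _ ≤ C * (1 + 1) + 3 * C * 1 := by gcongr
        _ = 5 * C := by ring
        _ ≤ R := hCR
  · intro b c
    rcases hτ : τ (Fin.last L) with _ | _ | _
    · simp only [stepWeight, hτ, if_true]
      rw [le_div_iff₀ hn]
      linarith
    · exact absurd hτ hlast
    · simp only [stepWeight, hτ]
      rw [if_neg (by simp)]
      calc ∑ l', typeKernel n C (τ l') (some true) (i l') (i (l' + 1)) b c
          ≤ ∑ l', (C / n * ((if i l' = b then 1 else 0)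
            + (if i l' = c then 1 else 0) + (if i (l' + 1) = b then 1 else 0)
            + (if i (l' + 1) = c then 1 else 0)) + C / n ^ 2) :=
            Finset.sum_le_sum fun l' _ => typeKernel_some_true_le hC0 _ _ _ _ _
        _ = C / n * (∑ l', (if i l' = b then 1 else 0) + ∑ l', (if i l' = c then 1 else 0)
            + ∑ l', (if i (l' + 1) = b then 1 else 0) + ∑ l', (if i (l' + 1) = c then 1 else 0))
            + C / n * (((L : ℝ) + 1) / n) := by
            simp only [Finset.sum_add_distrib, ← Finset.mul_sum, Finset.sum_const,
              Finset.card_univ, Fintype.card_fin, nsmul_eq_mul]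
            push_cast
            ring
        _ ≤ C / n * (1 + 1 + 1 + 1) + C / n * 1 := by
            have h1 := hi1 b
            have h2 := hi2 b
            have h3 := hi1 c
            have h4 := hi2 c
            gcongr
        _ = 5 * C / n := by ring
        _ ≤ R / n := by gcongr
  · rintro rfl
    rcases hτ : τ (Fin.last 0) with _ | _ | _
    · exact absurd hτ h0
    · exact absurd hτ hlast
    · simp only [stepWeight, hτ]
      rw [Finset.sum_congr rfl fun b _ => if_neg (by simp)]
      calc ∑ b, ∑ l', typeKernel n C (τ l') (some true) (i l') (i (l' + 1)) b b
          ≤ ∑ b, ∑ l', (C / n * ((if i l' = b then 1 else 0)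
            + (if i l' = b then 1 else 0) + (if i (l' + 1) = b then 1 else 0)
            + (if i (l' + 1) = b then 1 else 0)) + C / n ^ 2) :=
            Finset.sum_le_sum fun b _ => Finset.sum_le_sum fun l' _ =>
              typeKernel_some_true_le hC0 _ _ _ _ _
        _ = 5 * C / n := by
            rw [Finset.sum_comm]
            simp only [Finset.sum_add_distrib, ← Finset.mul_sum, Finset.sum_const,
              Finset.card_univ, Fintype.card_fin, nsmul_eq_mul, Finset.sum_ite_eq,
              Finset.mem_univ, if_true]
            field_simp
            push_cast
            ring
        _ ≤ R / n := by gcongr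
  · have h1 : (1 : ℝ) ≤ (L : ℝ) + 1 := by
      have : (0 : ℝ) ≤ L := Nat.cast_nonneg L
      linarith
    exact one_le_mul_of_one_le_of_one_le hR1 h1

variable {E : Type*} [MeasurableSpace E] {ρ : Measure E} [IsProbabilityMeasure ρ]
  {A : Fin n → Fin n → ℝ} {S : Bool → Fin n → Fin n → E → ℝ} {C : ℝ}

lemma IsPerturbation.hasAllMoments_stepVal (h : IsPerturbation ρ A S C) (s : Option Bool)
    (c d : Fin n) : HasAllMoments ρ (stepVal A S s c d) := by
  rcases s with _ | s
  · exact HasAllMoments.const _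
  · exact h.moments s c d

lemma IsPerturbation.hasAllMoments_prod (h : IsPerturbation ρ A S C) {L : ℕ}
    (τ : Fin (L + 1) → Option Bool) (i : Fin (L + 1) → Fin n) (J : Fin (L + 1) → Fin m) :
    HasAllMoments (Measure.pi fun _ : Fin m => ρ)
      (fun z => ∏ l, stepVal A S (τ l) (i l) (i (l + 1)) (z (J l))) :=
  HasAllMoments.prod _ fun l _ =>
    (h.hasAllMoments_stepVal _ _ _).comp (measurePreserving_eval (fun _ : Fin m => ρ) (J l))

lemma IsPerturbation.hasAllMoments_typeSum (h : IsPerturbation ρ A S C) {L : ℕ}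
    (τ : Fin (L + 1) → Option Bool) :
    HasAllMoments (Measure.pi fun _ : Fin m => ρ) (typeSum A S τ) :=
  HasAllMoments.sum _ fun i _ => HasAllMoments.sum _ fun J _ => h.hasAllMoments_prod τ i J

lemma IsPerturbation.abs_integral_mul_le (h : IsPerturbation ρ A S C) (hC : 0 ≤ C) {L : ℕ}
    (τ : Fin (L + 1) → Option Bool) (h0 : τ 0 ≠ none)
    (hlast : τ (Fin.last L) ≠ some false) (i i' : Fin (L + 1) ↪ Fin n)
    (J J' : Fin (L + 1) ↪ Fin m) :
    |∫ z, (∏ l, stepVal A S (τ l) (i l) (i (l + 1)) (z (J l)))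
        * ∏ l, stepVal A S (τ l) (i' l) (i' (l + 1)) (z (J' l)) ∂(Measure.pi fun _ : Fin m => ρ)|
      ≤ ∏ l, if τ l = none then (C / n) ^ 2 else
        ∑ l', if J l' = J' l then typeKernel n C (τ l') (τ l) (i l') (i (l' + 1)) (i' l)
          (i' (l + 1)) else 0 := by
  set P := Finset.univ.filter fun l => τ l ≠ none with hP
  have hne : ∀ (i : Fin (L + 1) ↪ Fin n) l, τ l = some false → i l ≠ i (l + 1) := by
    intro i l hl hil
    have h1 := i.injective hil
    rcases Nat.eq_zero_or_pos L with rfl | hL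
    · have : l = Fin.last 0 := Subsingleton.elim (α := Fin 1) _ _
      rw [this] at hl
      exact hlast hl
    · have h2 : (1 : Fin (L + 1)) = 0 := by simpa using h1.symm
      have h3 := congrArg Fin.val h2
      rw [Fin.val_one' (L + 1), Nat.mod_eq_of_lt (by omega)] at h3
      simp at h3
  have hmean : ∀ (i : Fin (L + 1) ↪ Fin n) l, l ∈ P →
      ∫ e, stepVal A S (τ l) (i l) (i (l + 1)) e ∂ρ = 0 := by
    intro i l hl
    have hl' := (Finset.mem_filter.mp hl).2
    rcases hτ : τ l with _ | s
    · exact absurd hτ hl'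
    · exact h.integral_eq_zero s _ _ fun hs => hne i l (by rw [hτ, hs])
  have hsplit : ∀ (i : Fin (L + 1) ↪ Fin n) (J : Fin (L + 1) ↪ Fin m) (z : Fin m → E),
      ∏ l, stepVal A S (τ l) (i l) (i (l + 1)) (z (J l))
      = (∏ l ∈ P, stepVal A S (τ l) (i l) (i (l + 1)) (z (J l)))
        * ∏ l ∈ Finset.univ.filter (fun l => ¬ τ l ≠ none), A (i l) (i (l + 1)) := by
    intro i J z
    rw [← Finset.prod_filter_mul_prod_filter_not Finset.univ (fun l => τ l ≠ none)]
    congr 1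
    refine Finset.prod_congr rfl fun l hl => ?_
    have := not_not.mp (Finset.mem_filter.mp hl).2
    rw [this]
    rfl
  simp_rw [hsplit]
  have e : ∀ z : Fin m → E,
      ((∏ l ∈ P, stepVal A S (τ l) (i l) (i (l + 1)) (z (J l)))
        * ∏ l ∈ Finset.univ.filter (fun l => ¬ τ l ≠ none), A (i l) (i (l + 1)))
      * ((∏ l ∈ P, stepVal A S (τ l) (i' l) (i' (l + 1)) (z (J' l)))
        * ∏ l ∈ Finset.univ.filter (fun l => ¬ τ l ≠ none), A (i' l) (i' (l + 1)))
      = (∏ l ∈ Finset.univ.filter (fun l => ¬ τ l ≠ none),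
          A (i l) (i (l + 1)) * A (i' l) (i' (l + 1)))
        * ((∏ l ∈ P, stepVal A S (τ l) (i l) (i (l + 1)) (z (J l)))
          * ∏ l ∈ P, stepVal A S (τ l) (i' l) (i' (l + 1)) (z (J' l))) := fun z => by
    rw [Finset.prod_mul_distrib]; ring
  simp_rw [e]
  rw [integral_const_mul, abs_mul, Finset.abs_prod,
    ← Finset.prod_filter_mul_prod_filter_not Finset.univ (fun l => τ l ≠ none), mul_comm]
  refine mul_le_mul ?_ ?_ (Finset.prod_nonneg fun l _ => abs_nonneg _)
    (Finset.prod_nonneg fun l _ => ?_)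
  · refine (abs_integral_prod_mul_prod_le P J J'
      (fun l => stepVal A S (τ l) (i l) (i (l + 1)))
      (fun l => stepVal A S (τ l) (i' l) (i' (l + 1))) (hmean i')).trans ?_
    refine Finset.prod_le_prod (fun l _ => Finset.sum_nonneg fun l' _ => by
      split_ifs <;> positivity) fun l hl => ?_
    have hl' := (Finset.mem_filter.mp hl).2
    rw [if_neg hl']
    refine (Finset.sum_le_sum fun l' hl'' => ?_).trans (Finset.sum_le_sum_of_subset_of_nonneg
      (Finset.subset_univ P) fun l' _ _ => ?_)
    · split_ifs
      · have hl3 := (Finset.mem_filter.mp hl'').2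
        rcases hτ : τ l with _ | s
        · exact absurd hτ hl'
        rcases hτ' : τ l' with _ | s'
        · exact absurd hτ' hl3
        exact h.abs_integral_le s' s _ _ _ _ (fun hs => hne i l' (by rw [hτ', hs]))
          fun hs => hne i' l (by rw [hτ, hs])
      · exact le_rfl
    · split_ifs
      · exact typeKernel_nonneg hC _ _ _ _ _ _
      · exact le_rfl
  · refine Finset.prod_le_prod (fun l _ => abs_nonneg _) fun l hl => ?_
    have := not_not.mp (Finset.mem_filter.mp hl).2
    rw [if_pos this, abs_mul, pow_two]
    exact mul_le_mul (h.abs_le _ _) (h.abs_le _ _) (abs_nonneg _) (by positivity)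
  · split_ifs
    · positivity
    · exact Finset.sum_nonneg fun l' _ => by
        split_ifs
        · exact typeKernel_nonneg hC _ _ _ _ _ _
        · exact le_rfl

lemma sum_embedding_le {α β : Type*} [Fintype α] [DecidableEq α] [Fintype β] [DecidableEq β]
    {f : (α → β) → ℝ} (hf : ∀ i, 0 ≤ f i) : ∑ i : α ↪ β, f i ≤ ∑ i, f i := by
  rw [sum_embedding_eq]
  exact Finset.sum_le_sum fun i _ => by split_ifs <;> simp [hf i]

/-- Second moment of the sum of the cycles of given types, in a rotation of the types for which the
first type is random and the last one is not a product of Gaussian coordinates. -/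
lemma IsPerturbation.integral_typeSum_sq_le_of_shift (h : IsPerturbation ρ A S C) (hC : 1 ≤ C)
    {A₀ : ℝ} (hA₀ : 1 ≤ A₀) (hm : (m : ℝ) ≤ A₀ * n) {L : ℕ} (hL : L + 1 ≤ n)
    (τ : Fin (L + 1) → Option Bool) (h0 : τ 0 ≠ none) (hlast : τ (Fin.last L) ≠ some false) :
    ∫ z, typeSum A S τ z ^ 2 ∂(Measure.pi fun _ : Fin m => ρ)
      ≤ (n : ℝ) ^ (L + 1) * (m : ℝ) ^ (L + 1) *
        ((5 * C ^ 2 * A₀ * (L + 1)) * (5 * C ^ 2 * A₀) ^ L * (5 * C ^ 2 * A₀ / n)) := by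
  have hC0 : 0 ≤ C := by linarith
  set T : (Fin (L + 1) ↪ Fin n) × (Fin (L + 1) ↪ Fin m) → (Fin m → E) → ℝ := fun p z =>
    ∏ l, stepVal A S (τ l) (p.1 l) (p.1 (l + 1)) (z (p.2 l)) with hT
  have hTm : ∀ p, HasAllMoments (Measure.pi fun _ : Fin m => ρ) (T p) := fun p =>
    h.hasAllMoments_prod τ _ _
  have e1 : ∀ z, typeSum A S τ z ^ 2 = ∑ p, ∑ p', T p z * T p' z := fun z => by
    unfold typeSum
    rw [← Fintype.sum_prod_type' (f := fun (i : Fin (L + 1) ↪ Fin n) (J : Fin (L + 1) ↪ Fin m) =>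
      ∏ l, stepVal A S (τ l) (i l) (i (l + 1)) (z (J l))), pow_two, Finset.sum_mul_sum]
  simp_rw [e1]
  rw [integral_finsetSum _ fun p _ => (HasAllMoments.sum _ fun p' _ =>
    (hTm p).mul (hTm p')).integrable]
  set B := (5 * C ^ 2 * A₀ * (L + 1)) * (5 * C ^ 2 * A₀) ^ L * (5 * C ^ 2 * A₀ / n) with hB
  have hB0 : 0 ≤ B := by positivity
  calc ∑ p, ∫ z, ∑ p', T p z * T p' z ∂(Measure.pi fun _ : Fin m => ρ)
      ≤ ∑ _p : (Fin (L + 1) ↪ Fin n) × (Fin (L + 1) ↪ Fin m), B := by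
        refine Finset.sum_le_sum fun p _ => ?_
        rw [integral_finsetSum _ fun p' _ => ((hTm p).mul (hTm p')).integrable]
        -- For a fixed first copy `p`, the second copy is summed first over its rows, then its columns.
        set ω : Fin (L + 1) → Fin m → Fin n → Fin n → ℝ := fun l r b c =>
          if τ l = none then (C / n) ^ 2 else
          ∑ l', if p.2 l' = r then typeKernel n C (τ l') (τ l) (p.1 l') (p.1 (l' + 1)) b c
            else 0 with hω
        have hω0 : ∀ l r b c, 0 ≤ ω l r b c := fun l r b c => by
          simp only [hω]
          split_ifs
          · positivity
          · exact Finset.sum_nonneg fun l' _ => by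
              split_ifs
              · exact typeKernel_nonneg hC0 _ _ _ _ _ _
              · exact le_rfl
        have hωsum : ∀ l b c, ∑ r, ω l r b c = stepWeight m C τ p.1 l b c := by
          intro l b c
          simp only [hω, stepWeight]
          split_ifs with hl
          · simp
          · rw [Finset.sum_comm]
            exact Finset.sum_congr rfl fun l' _ => by simp
        calc ∑ p', ∫ z, T p z * T p' z ∂(Measure.pi fun _ : Fin m => ρ)
            ≤ ∑ p' : (Fin (L + 1) ↪ Fin n) × (Fin (L + 1) ↪ Fin m),
              ∏ l, ω l (p'.2 l) (p'.1 l) (p'.1 (l + 1)) :=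
              Finset.sum_le_sum fun p' _ => (le_abs_self _).trans
                (h.abs_integral_mul_le hC0 τ h0 hlast p.1 p'.1 p.2 p'.2)
          _ = ∑ i' : Fin (L + 1) ↪ Fin n, ∑ J' : Fin (L + 1) ↪ Fin m,
              ∏ l, ω l (J' l) (i' l) (i' (l + 1)) := Fintype.sum_prod_type _
          _ ≤ ∑ i' : Fin (L + 1) ↪ Fin n, ∑ J' : Fin (L + 1) → Fin m,
              ∏ l, ω l (J' l) (i' l) (i' (l + 1)) :=
              Finset.sum_le_sum fun i' _ => sum_embedding_le
                (f := fun J' => ∏ l, ω l (J' l) (i' l) (i' (l + 1)))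
                fun J' => Finset.prod_nonneg fun l _ => hω0 _ _ _ _
          _ = ∑ i' : Fin (L + 1) ↪ Fin n, ∏ l, stepWeight m C τ p.1 l (i' l) (i' (l + 1)) := by
              refine Finset.sum_congr rfl fun i' _ => ?_
              simp_rw [← hωsum]
              rw [Finset.prod_univ_sum, Fintype.piFinset_univ]
          _ ≤ ∑ i' : Fin (L + 1) → Fin n, ∏ l, stepWeight m C τ p.1 l (i' l) (i' (l + 1)) :=
              sum_embedding_le
                (f := fun i' => ∏ l, stepWeight m C τ p.1 l (i' l) (i' (l + 1)))
                fun i' => Finset.prod_nonneg fun l _ => stepWeight_nonneg hC0 _ _ _ _ _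
          _ ≤ B := sum_cycle_stepWeight_le hC hA₀ hm hL τ h0 hlast p.1 p.1.injective
    _ ≤ _ := by
        rw [Finset.sum_const, nsmul_eq_mul]
        refine mul_le_mul_of_nonneg_right ?_ hB0
        rw [Finset.card_univ, Fintype.card_prod, Fintype.card_embedding_eq,
          Fintype.card_embedding_eq, Fintype.card_fin, Fintype.card_fin, Fintype.card_fin]
        exact_mod_cast Nat.mul_le_mul (Nat.descFactorial_le_pow _ _) (Nat.descFactorial_le_pow _ _)

lemma IsPerturbation.integral_typeSum_sq_le (h : IsPerturbation ρ A S C) (hC : 1 ≤ C)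
    {A₀ : ℝ} (hA₀ : 1 ≤ A₀) (hm : (m : ℝ) ≤ A₀ * n) {L : ℕ} (hL : L + 1 ≤ n)
    (τ : Fin (L + 1) → Option Bool) (h1 : ∃ l, τ l ≠ none) (h2 : ∃ l, τ l ≠ some false) :
    ∫ z, typeSum A S τ z ^ 2 ∂(Measure.pi fun _ : Fin m => ρ)
      ≤ (n : ℝ) ^ (L + 1) * (m : ℝ) ^ (L + 1) *
        ((5 * C ^ 2 * A₀ * (L + 1)) * (5 * C ^ 2 * A₀) ^ L * (5 * C ^ 2 * A₀ / n)) := by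
  obtain ⟨c, hc0, hc1⟩ := exists_shift τ h1 h2
  have := h.integral_typeSum_sq_le_of_shift hC hA₀ hm hL (fun l => τ (l + c)) hc0 hc1
  simp_rw [typeSum_shift] at this
  exact this

/-- Second moment of the difference between the cycle sum of the perturbed rows, that of the
Gaussian rows, and the deterministic contribution. -/
lemma IsPerturbation.integral_cycle_diff_sq_le (h : IsPerturbation ρ A S C) (hC : 1 ≤ C)
    {A₀ : ℝ} (hA₀ : 1 ≤ A₀) (hm : (m : ℝ) ≤ A₀ * n) {L : ℕ} (hL : L + 1 ≤ n) :
    ∫ z, ((∑ i : Fin (L + 1) ↪ Fin n, ∑ J : Fin (L + 1) ↪ Fin m, ∏ l,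
          (S false (i l) (i (l + 1)) (z (J l)) + A (i l) (i (l + 1))
            + S true (i l) (i (l + 1)) (z (J l))))
        - (∑ i : Fin (L + 1) ↪ Fin n, ∑ J : Fin (L + 1) ↪ Fin m, ∏ l,
            S false (i l) (i (l + 1)) (z (J l)))
        - ∑ i : Fin (L + 1) ↪ Fin n, ∑ _J : Fin (L + 1) ↪ Fin m, ∏ l, A (i l) (i (l + 1))) ^ 2
        ∂(Measure.pi fun _ : Fin m => ρ)
      ≤ 9 ^ (L + 1) * ((n : ℝ) ^ (L + 1) * (m : ℝ) ^ (L + 1) *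
        ((5 * C ^ 2 * A₀ * (L + 1)) * (5 * C ^ 2 * A₀) ^ L * (5 * C ^ 2 * A₀ / n))) := by
  set B := (n : ℝ) ^ (L + 1) * (m : ℝ) ^ (L + 1) *
        ((5 * C ^ 2 * A₀ * (L + 1)) * (5 * C ^ 2 * A₀) ^ L * (5 * C ^ 2 * A₀ / n)) with hB
  have hB0 : 0 ≤ B := by positivity
  set τY : Fin (L + 1) → Option Bool := fun _ => some false with hτY
  set τA : Fin (L + 1) → Option Bool := fun _ => none with hτA
  -- The types other than the two constant ones that give the subtracted sums.
  set Θ : Finset (Fin (L + 1) → Option Bool) := (Finset.univ.erase τY).erase τA with hΘ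
  have hne : τA ≠ τY := fun h => by
    have := congrFun h 0
    simp [hτA, hτY] at this
  have hexp : ∀ z : Fin m → E, (∑ i : Fin (L + 1) ↪ Fin n, ∑ J : Fin (L + 1) ↪ Fin m, ∏ l,
          (S false (i l) (i (l + 1)) (z (J l)) + A (i l) (i (l + 1))
            + S true (i l) (i (l + 1)) (z (J l))))
        - (∑ i : Fin (L + 1) ↪ Fin n, ∑ J : Fin (L + 1) ↪ Fin m, ∏ l,
            S false (i l) (i (l + 1)) (z (J l)))
        - ∑ i : Fin (L + 1) ↪ Fin n, ∑ _J : Fin (L + 1) ↪ Fin m, ∏ l, A (i l) (i (l + 1))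
      = ∑ τ ∈ Θ, typeSum A S τ z := by
    intro z
    have h1 : ∑ i : Fin (L + 1) ↪ Fin n, ∑ J : Fin (L + 1) ↪ Fin m, ∏ l,
          (S false (i l) (i (l + 1)) (z (J l)) + A (i l) (i (l + 1))
            + S true (i l) (i (l + 1)) (z (J l)))
          = ∑ τ : Fin (L + 1) → Option Bool, typeSum A S τ z := by
      unfold typeSum
      conv_rhs => rw [Finset.sum_comm]
      refine Finset.sum_congr rfl fun i _ => ?_
      conv_rhs => rw [Finset.sum_comm]
      refine Finset.sum_congr rfl fun J _ => ?_
      have : ∀ l, S false (i l) (i (l + 1)) (z (J l)) + A (i l) (i (l + 1))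
            + S true (i l) (i (l + 1)) (z (J l))
          = ∑ s, stepVal A S s (i l) (i (l + 1)) (z (J l)) := fun l => by
        rw [Fintype.sum_option, Fintype.sum_bool]
        simp only [stepVal]
        ring
      simp_rw [this]
      rw [Finset.prod_univ_sum, Fintype.piFinset_univ]
    rw [h1, ← Finset.add_sum_erase _ _ (Finset.mem_univ τY),
      ← Finset.add_sum_erase (Finset.univ.erase τY) _
        (Finset.mem_erase.mpr ⟨hne, Finset.mem_univ τA⟩)]
    have e1 : typeSum A S τY z = ∑ i : Fin (L + 1) ↪ Fin n, ∑ J : Fin (L + 1) ↪ Fin m, ∏ l,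
            S false (i l) (i (l + 1)) (z (J l)) := rfl
    have e2 : typeSum A S τA z = ∑ i : Fin (L + 1) ↪ Fin n, ∑ _J : Fin (L + 1) ↪ Fin m, ∏ l,
            A (i l) (i (l + 1)) := rfl
    rw [e1, e2]
    ring
  simp_rw [hexp]
  have hcard : (Θ.card : ℝ) ≤ 3 ^ (L + 1) := by
    have : Θ.card ≤ Fintype.card (Fin (L + 1) → Option Bool) := Finset.card_le_univ _
    rw [Fintype.card_fun, Fintype.card_option, Fintype.card_bool, Fintype.card_fin] at this
    exact_mod_cast this
  calc ∫ z, (∑ τ ∈ Θ, typeSum A S τ z) ^ 2 ∂(Measure.pi fun _ : Fin m => ρ)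
      ≤ ∫ z, Θ.card * ∑ τ ∈ Θ, typeSum A S τ z ^ 2 ∂(Measure.pi fun _ : Fin m => ρ) := by
        refine integral_mono ((HasAllMoments.sum _ fun τ _ =>
          h.hasAllMoments_typeSum τ).pow 2).integrable
          ((HasAllMoments.sum _ fun τ _ => (h.hasAllMoments_typeSum τ).pow 2).const_mul _).integrable
          fun z => sq_sum_le_card_mul_sum_sq
    _ = Θ.card * ∑ τ ∈ Θ, ∫ z, typeSum A S τ z ^ 2 ∂(Measure.pi fun _ : Fin m => ρ) := by
        rw [integral_const_mul, integral_finsetSum _ fun τ _ =>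
          ((h.hasAllMoments_typeSum τ).pow 2).integrable]
    _ ≤ Θ.card * ∑ _τ ∈ Θ, B := by
        gcongr with τ hτ
        have h3 := Finset.mem_erase.mp hτ
        have h4 := Finset.mem_erase.mp h3.2
        refine h.integral_typeSum_sq_le hC hA₀ hm hL τ ?_ ?_
        · by_contra hcon
          push Not at hcon
          exact h3.1 (funext hcon)
        · by_contra hcon
          push Not at hcon
          exact h4.1 (funext hcon)
    _ = Θ.card * Θ.card * B := by rw [Finset.sum_const, nsmul_eq_mul, mul_assoc]
    _ ≤ 3 ^ (L + 1) * 3 ^ (L + 1) * B := by gcongr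
    _ = 9 ^ (L + 1) * B := by rw [← mul_pow]; norm_num

end PerturbationVariance
end Perceptron

namespace Perceptron

/-! ### Projections of standard Gaussian rows -/

section Projection

variable {r n : ℕ}

/-- The linear form with coefficients `a`. -/
def linForm (a y : Fin n → ℝ) : ℝ := ∑ c, a c * y c

lemma measurable_linForm (a : Fin n → ℝ) : Measurable (linForm a) := by
  unfold linForm; fun_prop

lemma hasAllMoments_linForm (a : Fin n → ℝ) : HasAllMoments (delta0 n) (linForm a) :=
  HasAllMoments.sum _ fun c _ => (hasAllMoments_row c).const_mul _

lemma measurePreserving_neg_delta0 : MeasurePreserving (fun y : Fin n → ℝ => -y)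
    (delta0 n) (delta0 n) := by
  have h : MeasurePreserving (fun x : ℝ => -x) (gaussianReal 0 1) (gaussianReal 0 1) :=
    ⟨by fun_prop, by rw [gaussianReal_map_neg]; simp⟩
  exact measurePreserving_pi (fun _ : Fin n => gaussianReal 0 1) (fun _ => gaussianReal 0 1)
    fun _ => h

lemma integral_delta0_odd {f : (Fin n → ℝ) → ℝ} (hf : HasAllMoments (delta0 n) f)
    (h : ∀ y, f (-y) = -f y) : ∫ y, f y ∂(delta0 n) = 0 := by
  have h1 := integral_comp_measurePreserving measurePreserving_neg_delta0
    (hf 1).aestronglyMeasurable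
  simp_rw [h, integral_neg] at h1
  linarith

lemma linForm_neg (a y : Fin n → ℝ) : linForm a (-y) = -linForm a y := by
  simp [linForm]

lemma integral_linForm_mul (a b : Fin n → ℝ) :
    ∫ y, linForm a y * linForm b y ∂(delta0 n) = ∑ c, a c * b c := by
  have e : ∀ y, linForm a y * linForm b y = ∑ c, ∑ d, (a c * b d) * (y c * y d) := fun y => by
    unfold linForm
    rw [Finset.sum_mul_sum]
    exact Finset.sum_congr rfl fun c _ => Finset.sum_congr rfl fun d _ => by ring
  have hm : ∀ c d : Fin n, HasAllMoments (delta0 n) (fun y => (a c * b d) * (y c * y d)) :=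
    fun c d => ((hasAllMoments_row c).mul (hasAllMoments_row d)).const_mul _
  simp_rw [e]
  rw [integral_finsetSum _ fun c _ => (HasAllMoments.sum _ fun d _ => hm c d).integrable]
  refine Finset.sum_congr rfl fun c _ => ?_
  rw [integral_finsetSum _ fun d _ => (hm c d).integrable]
  simp_rw [integral_const_mul, integral_delta0_mul]
  simp

lemma integral_linForm_pow_four_le {a : Fin n → ℝ} (ha : ∑ c, a c * a c = 1) :
    ∫ y, linForm a y ^ 4 ∂(delta0 n) ≤ 9 := by
  have h := integral_pow_four_le (gaussianReal 0 1) hasAllMoments_gaussian integral_gaussian_id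
    integral_gaussian_sq (β := 3) (by rw [integral_gaussian_cube]; norm_num)
    (by rw [integral_gaussian_cube, integral_gaussian_four]; norm_num)
    (Finset.univ : Finset (Fin n)) 1 (Finset.univ : Finset (Fin n)) a (fun c => {c})
    (fun c _ => Finset.subset_univ _) (fun c _ => by simp)
  simp only [Finset.prod_singleton] at h
  have h2 := integral_linForm_mul a a
  rw [ha] at h2
  simp_rw [← pow_two] at h2
  have h3 : ∫ y : Fin n → ℝ, (∑ c, a c * y c) ^ 2 ∂(Measure.pi fun _ => gaussianReal 0 1) = 1 := h2
  rw [h3] at h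
  norm_num at h
  exact h

lemma integral_exp_linForm (a : Fin n → ℝ) :
    ∫ y, Complex.exp ((linForm a y : ℝ) * Complex.I) ∂(delta0 n)
      = Complex.exp (-(∑ c, a c ^ 2 : ℝ) / 2) := by
  have e : ∀ y : Fin n → ℝ, Complex.exp ((linForm a y : ℝ) * Complex.I)
      = ∏ c, Complex.exp ((a c : ℂ) * (y c : ℂ) * Complex.I) := fun y => by
    rw [← Complex.exp_sum, linForm]
    push_cast
    rw [Finset.sum_mul]
  simp_rw [e]
  rw [delta0, integral_fintype_prod_eq_prod (𝕜 := ℂ) (μ := fun _ : Fin n => gaussianReal 0 1)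
    (fun c (t : ℝ) => Complex.exp ((a c : ℂ) * (t : ℂ) * Complex.I))]
  have h1 : ∀ c, ∫ t : ℝ, Complex.exp ((a c : ℂ) * (t : ℂ) * Complex.I) ∂(gaussianReal 0 1)
      = Complex.exp (-(a c : ℂ) ^ 2 / 2) := fun c => by
    have := charFun_gaussianReal (μ := 0) (v := 1) (a c)
    rw [charFun_apply_real] at this
    rw [this]
    simp
    ring_nf
  simp_rw [h1]
  rw [← Complex.exp_sum]
  congr 1
  push_cast
  rw [← Finset.sum_neg_distrib, Finset.sum_div]

/-- Orthogonal projection onto the span of the orthonormal vectors `u p`. -/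
def rowProj (u : Fin r → Fin n → ℝ) (y : Fin n → ℝ) (c : Fin n) : ℝ :=
  ∑ p, linForm (u p) y * u p c

/-- `rowMix u (y, y')` has the orthogonal part of `y` and the projection of `y'`. -/
def rowMix (u : Fin r → Fin n → ℝ) (w : (Fin n → ℝ) × (Fin n → ℝ)) (c : Fin n) : ℝ :=
  w.1 c - rowProj u w.1 c + rowProj u w.2 c

/-- Orthonormality of the vectors `u p`. -/
def IsOrthonormal (u : Fin r → Fin n → ℝ) : Prop :=
  ∀ p q, ∑ c, u p c * u q c = if p = q then 1 else 0

lemma measurable_rowProj (u : Fin r → Fin n → ℝ) : Measurable (rowProj u) := by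
  unfold rowProj linForm; fun_prop

lemma measurable_rowMix (u : Fin r → Fin n → ℝ) : Measurable (rowMix u) := by
  unfold rowMix rowProj linForm; fun_prop

lemma rowProj_eq_linForm (u : Fin r → Fin n → ℝ) (y : Fin n → ℝ) (c : Fin n) :
    rowProj u y c = linForm (fun d => ∑ p, u p c * u p d) y := by
  unfold rowProj linForm
  simp_rw [Finset.sum_mul]
  rw [Finset.sum_comm]
  exact Finset.sum_congr rfl fun d _ => Finset.sum_congr rfl fun p _ => by ring

lemma linForm_rowProj {u : Fin r → Fin n → ℝ} (hu : IsOrthonormal u) (y : Fin n → ℝ) (p : Fin r) :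
    linForm (u p) (rowProj u y) = linForm (u p) y := by
  conv_lhs => unfold linForm rowProj
  simp_rw [Finset.mul_sum]
  rw [Finset.sum_comm]
  have : ∀ q, ∑ c, u p c * (linForm (u q) y * u q c) = linForm (u q) y * if p = q then 1 else 0 :=
    fun q => by
      rw [← hu p q, Finset.mul_sum]
      exact Finset.sum_congr rfl fun c _ => by ring
  simp_rw [this]
  simp

lemma linForm_rowMix {u : Fin r → Fin n → ℝ} (hu : IsOrthonormal u)
    (w : (Fin n → ℝ) × (Fin n → ℝ)) (p : Fin r) :
    linForm (u p) (rowMix u w) = linForm (u p) w.2 := by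
  have h1 := linForm_rowProj hu w.1 p
  have h2 := linForm_rowProj hu w.2 p
  unfold linForm rowMix at *
  simp_rw [mul_add, mul_sub, Finset.sum_add_distrib, Finset.sum_sub_distrib]
  rw [h1, h2]
  ring

/-- Mixing the orthogonal components of two independent standard Gaussian vectors gives a standard
Gaussian vector. -/
lemma measurePreserving_rowMix {u : Fin r → Fin n → ℝ} (hu : IsOrthonormal u) :
    MeasurePreserving (rowMix u) ((delta0 n).prod (delta0 n)) (delta0 n) := by
  refine ⟨measurable_rowMix u, ?_⟩
  have := Measure.isProbabilityMeasure_map (μ := (delta0 n).prod (delta0 n))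
    (measurable_rowMix u).aemeasurable
  refine Measure.ext_of_charFunDual ?_
  ext ℒ
  set ℓ : Fin n → ℝ := fun c => ℒ (Pi.single c 1) with hℓ
  have hL : ∀ y, ℒ y = linForm ℓ y := fun y => by
    conv_lhs => rw [← Finset.univ_sum_single y]
    rw [map_sum]
    refine Finset.sum_congr rfl fun c _ => ?_
    rw [show (Pi.single c (y c) : Fin n → ℝ) = y c • Pi.single c 1 by
      rw [← Pi.single_smul]; simp, map_smul]
    simp [hℓ, mul_comm]
  rw [charFunDual_apply, charFunDual_apply, integral_map (measurable_rowMix u).aemeasurable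
    (by fun_prop)]
  simp_rw [hL]
  set b : Fin n → ℝ := rowProj u ℓ with hb
  have hsym : ∀ y, linForm ℓ (rowProj u y) = linForm b y := fun y => by
    rw [hb]
    conv_lhs => unfold linForm
    simp only [rowProj, Finset.mul_sum]
    conv_rhs => unfold linForm
    simp only [rowProj, Finset.sum_mul]
    rw [Finset.sum_comm]
    conv_rhs => rw [Finset.sum_comm]
    refine Finset.sum_congr rfl fun p _ => ?_
    have e1 : ∑ c, ℓ c * (linForm (u p) y * u p c) = linForm (u p) y * linForm (u p) ℓ := by
      conv_rhs => rw [linForm.eq_1 (u p) ℓ]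
      rw [Finset.mul_sum]
      exact Finset.sum_congr rfl fun c _ => by ring
    have e2 : ∑ c, linForm (u p) ℓ * u p c * y c = linForm (u p) ℓ * linForm (u p) y := by
      conv_rhs => rw [linForm.eq_1 (u p) y]
      rw [Finset.mul_sum]
      exact Finset.sum_congr rfl fun c _ => by ring
    rw [e1, e2, mul_comm]
  have hsplit : ∀ w, linForm ℓ (rowMix u w) = linForm (fun c => ℓ c - b c) w.1 + linForm b w.2 :=
    fun w => by
      have e1 := hsym w.1
      have e2 := hsym w.2
      unfold linForm rowMix at *
      simp_rw [mul_add, mul_sub, sub_mul, Finset.sum_add_distrib, Finset.sum_sub_distrib]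
      rw [e1, e2]
  have e : ∀ w : (Fin n → ℝ) × (Fin n → ℝ), Complex.exp ((linForm ℓ (rowMix u w) : ℝ) * Complex.I)
      = Complex.exp ((linForm (fun c => ℓ c - b c) w.1 : ℝ) * Complex.I)
        * Complex.exp ((linForm b w.2 : ℝ) * Complex.I) := fun w => by
    rw [hsplit, ← Complex.exp_add]
    push_cast
    ring_nf
  simp_rw [e]
  rw [integral_prod_mul (fun y => Complex.exp ((linForm (fun c => ℓ c - b c) y : ℝ) * Complex.I))
    (fun y => Complex.exp ((linForm b y : ℝ) * Complex.I)), integral_exp_linForm,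
    integral_exp_linForm, integral_exp_linForm, ← Complex.exp_add]
  congr 1
  -- Pythagoras
  have hbb : ∑ c, ℓ c * b c = ∑ c, b c ^ 2 := by
    have e1 := hsym b
    have e2 : rowProj u b = b := by
      ext c
      rw [hb]
      conv_lhs => rw [rowProj]
      simp_rw [linForm_rowProj hu]
      rfl
    rw [e2] at e1
    unfold linForm at e1
    rw [e1]
    exact Finset.sum_congr rfl fun c _ => by ring
  have : (∑ c, (ℓ c - b c) ^ 2) + ∑ c, b c ^ 2 = ∑ c, ℓ c ^ 2 := by
    have e3 : ∀ c, (ℓ c - b c) ^ 2 = ℓ c ^ 2 - 2 * (ℓ c * b c) + b c ^ 2 := fun c => by ring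
    simp_rw [e3, Finset.sum_add_distrib, Finset.sum_sub_distrib, ← Finset.mul_sum]
    rw [hbb]
    ring
  rw [← this]
  push_cast
  ring

/-- If the second vector is conditioned on an event that depends on its projection only, mixing gives
a standard Gaussian vector with the same conditioning. -/
lemma measurePreserving_rowMix_cond {u : Fin r → Fin n → ℝ} (hu : IsOrthonormal u)
    {S : Set (Fin n → ℝ)} (hSm : MeasurableSet S)
    (hS : ∀ y y', (∀ p, linForm (u p) y = linForm (u p) y') → (y ∈ S ↔ y' ∈ S)) :
    MeasurePreserving (rowMix u) ((delta0 n).prod (cond (delta0 n) S)) (cond (delta0 n) S) := by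
  refine ⟨measurable_rowMix u, ?_⟩
  have hpre : rowMix u ⁻¹' S = Set.univ ×ˢ S := by
    ext w
    simp only [Set.mem_preimage, Set.mem_prod, Set.mem_univ, true_and]
    exact hS _ _ fun p => linForm_rowMix hu w p
  have h1 : ((delta0 n).prod ((delta0 n).restrict S)).map (rowMix u) = (delta0 n).restrict S := by
    have : (delta0 n).prod ((delta0 n).restrict S)
        = ((delta0 n).prod (delta0 n)).restrict (rowMix u ⁻¹' S) := by
      rw [hpre, ← Measure.prod_restrict, Measure.restrict_univ]
    rw [this, ← Measure.restrict_map (measurable_rowMix u) hSm, (measurePreserving_rowMix hu).map_eq]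
  unfold ProbabilityTheory.cond
  rw [Measure.prod_smul_right, Measure.map_smul, h1]

end Projection
end Perceptron

namespace Perceptron

/-! ### Coupling of a row with a row that has a different law of the projection -/

section Quadratic

variable {X Y ι : Type*} [MeasurableSpace X] [MeasurableSpace Y] {μ : Measure X} {ν : Measure Y}
  [IsProbabilityMeasure μ] [IsProbabilityMeasure ν]

/-- Covariance of two expressions that are quadratic in a random vector `h` without first and third
moments, with independent random coefficients. -/
lemma integral_quadratic_mul {h : ι → X → ℝ} {p q : ι → Y → ℝ} {γ₁ γ₂ : Y → ℝ}
    (hh : ∀ a, HasAllMoments μ (h a)) (hp : ∀ a, HasAllMoments ν (p a))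
    (hq : ∀ a, HasAllMoments ν (q a)) (hγ₁ : HasAllMoments ν γ₁) (hγ₂ : HasAllMoments ν γ₂)
    (h1 : ∀ a, ∫ x, h a x ∂μ = 0) (h3 : ∀ a b c, ∫ x, h a x * h b x * h c x ∂μ = 0)
    (hz : ∫ y, γ₂ y ∂ν = 0) (θ : ℝ) (a b c d : ι) :
    ∫ w : X × Y, (θ * (h a w.1 * h b w.1) + h a w.1 * p b w.2 + h b w.1 * p a w.2 + γ₁ w.2)
        * (h c w.1 * q d w.2 + h d w.1 * q c w.2 + γ₂ w.2) ∂(μ.prod ν)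
      = (∫ x, h a x * h c x ∂μ) * (∫ y, p b y * q d y ∂ν)
        + (∫ x, h a x * h d x ∂μ) * (∫ y, p b y * q c y ∂ν)
        + (∫ x, h b x * h c x ∂μ) * (∫ y, p a y * q d y ∂ν)
        + (∫ x, h b x * h d x ∂μ) * (∫ y, p a y * q c y ∂ν)
        + ∫ y, γ₁ y * γ₂ y ∂ν := by
  set F : Fin 4 → X → ℝ := ![fun x => h a x * h b x, h a, h b, fun _ => 1] with hF
  set P : Fin 4 → Y → ℝ := ![fun _ => θ, p b, p a, γ₁] with hP
  set G : Fin 3 → X → ℝ := ![h c, h d, fun _ => 1] with hG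
  set Q : Fin 3 → Y → ℝ := ![q d, q c, γ₂] with hQ
  have mF : ∀ i, HasAllMoments μ (F i) := fun i => by
    fin_cases i
    exacts [(hh a).mul (hh b), hh a, hh b, .const 1]
  have mP : ∀ i, HasAllMoments ν (P i) := fun i => by
    fin_cases i
    exacts [.const θ, hp b, hp a, hγ₁]
  have mG : ∀ i, HasAllMoments μ (G i) := fun i => by
    fin_cases i
    exacts [hh c, hh d, .const 1]
  have mQ : ∀ i, HasAllMoments ν (Q i) := fun i => by
    fin_cases i
    exacts [hq d, hq c, hγ₂]
  have e : ∀ w : X × Y,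
      (θ * (h a w.1 * h b w.1) + h a w.1 * p b w.2 + h b w.1 * p a w.2 + γ₁ w.2)
        * (h c w.1 * q d w.2 + h d w.1 * q c w.2 + γ₂ w.2)
      = ∑ i, ∑ j, (F i w.1 * G j w.1) * (P i w.2 * Q j w.2) := fun w => by
    simp only [Fin.sum_univ_succ, Fin.sum_univ_zero, hF, hG, hP, hQ]
    simp
    ring
  have mm : ∀ i j, HasAllMoments (μ.prod ν)
      (fun w : X × Y => (F i w.1 * G j w.1) * (P i w.2 * Q j w.2)) := fun i j =>
    (((mF i).mul (mG j)).comp measurePreserving_fst).mul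
      (((mP i).mul (mQ j)).comp measurePreserving_snd)
  simp_rw [e]
  rw [integral_finsetSum _ fun i _ => (HasAllMoments.sum _ fun j _ => mm i j).integrable]
  have : ∀ i, ∫ w : X × Y, ∑ j, (F i w.1 * G j w.1) * (P i w.2 * Q j w.2) ∂(μ.prod ν)
      = ∑ j, (∫ x, F i x * G j x ∂μ) * ∫ y, P i y * Q j y ∂ν := fun i => by
    rw [integral_finsetSum _ fun j _ => (mm i j).integrable]
    exact Finset.sum_congr rfl fun j _ =>
      integral_prod_mul (fun x => F i x * G j x) (fun y => P i y * Q j y)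
  simp_rw [this]
  simp only [Fin.sum_univ_succ, Fin.sum_univ_zero, hF, hG, hP, hQ]
  simp [h1, h3, hz, integral_const_mul]
  ring

end Quadratic

section Coupling

variable {r n : ℕ}

/-- The component of `y` orthogonal to the vectors `u p`. -/
def rowRes (u : Fin r → Fin n → ℝ) (c : Fin n) (y : Fin n → ℝ) : ℝ := y c - rowProj u y c

lemma hasAllMoments_rowProj (u : Fin r → Fin n → ℝ) (c : Fin n) :
    HasAllMoments (delta0 n) (fun y => rowProj u y c) := by
  simp_rw [rowProj_eq_linForm]
  exact hasAllMoments_linForm _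

lemma hasAllMoments_rowRes (u : Fin r → Fin n → ℝ) (c : Fin n) :
    HasAllMoments (delta0 n) (rowRes u c) :=
  (hasAllMoments_row c).sub (hasAllMoments_rowProj u c)

lemma rowRes_neg (u : Fin r → Fin n → ℝ) (c : Fin n) (y : Fin n → ℝ) :
    rowRes u c (-y) = -rowRes u c y := by
  unfold rowRes
  rw [rowProj_eq_linForm, rowProj_eq_linForm, linForm_neg, Pi.neg_apply]
  ring

/-- The difference of the covariances of the projections of `Δ` and of a standard Gaussian. -/
noncomputable def covShift (Δ : Measure (Fin n → ℝ)) (u : Fin r → Fin n → ℝ) (c d : Fin n) : ℝ :=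
  ∫ x, rowProj u x c * rowProj u x d ∂Δ - ∫ y, rowProj u y c * rowProj u y d ∂(delta0 n)

/-- For a triple `w` of rows, the Gaussian row `rowMix u (w.1, w.2.1)` and the row
`rowMix u (w.1, w.2.2)` share their orthogonal component. `rowStep` gives, for `false`, the product
of two coordinates of the first row, and for `true` the difference to the product for the second row,
centred. -/
noncomputable def rowStep (Δ : Measure (Fin n → ℝ)) (u : Fin r → Fin n → ℝ) (s : Bool)
    (c d : Fin n) (w : (Fin n → ℝ) × ((Fin n → ℝ) × (Fin n → ℝ))) : ℝ :=
  if s then rowMix u (w.1, w.2.2) c * rowMix u (w.1, w.2.2) d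
      - rowMix u (w.1, w.2.1) c * rowMix u (w.1, w.2.1) d - covShift Δ u c d
    else rowMix u (w.1, w.2.1) c * rowMix u (w.1, w.2.1) d

lemma abs_rowProj_le {u : Fin r → Fin n → ℝ} {B : ℝ} (hu : ∀ p c, |u p c| ≤ B / √n)
    (y : Fin n → ℝ) (c : Fin n) :
    |rowProj u y c| ≤ (∑ p, |linForm (u p) y|) * (B / √n) := by
  unfold rowProj
  refine (Finset.abs_sum_le_sum_abs _ _).trans ?_
  rw [Finset.sum_mul]
  refine Finset.sum_le_sum fun p _ => ?_
  rw [abs_mul]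
  exact mul_le_mul_of_nonneg_left (hu p c) (abs_nonneg _)

lemma abs_projKernel_le {u : Fin r → Fin n → ℝ} {B : ℝ} (hu : ∀ p c, |u p c| ≤ B / √n)
    (c d : Fin n) : |∑ p, u p c * u p d| ≤ r * B ^ 2 / n := by
  refine (Finset.abs_sum_le_sum_abs _ _).trans ?_
  have : ∀ p ∈ Finset.univ, |u p c * u p d| ≤ B ^ 2 / n := fun p _ => by
    rw [abs_mul]
    refine (mul_le_mul (hu p c) (hu p d) (abs_nonneg _) ((abs_nonneg _).trans (hu p c))).trans ?_
    rw [div_mul_div_comm, Real.mul_self_sqrt (Nat.cast_nonneg n), pow_two]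
  refine (Finset.sum_le_sum this).trans ?_
  simp [mul_div_assoc]

lemma abs_sum_projKernel_mul_le {u : Fin r → Fin n → ℝ} {B : ℝ} (hu : ∀ p c, |u p c| ≤ B / √n)
    (c d : Fin n) :
    |∑ e, (∑ p, u p c * u p e) * (∑ p, u p d * u p e)| ≤ (r * B ^ 2) ^ 2 / n := by
  have hn : (0 : ℝ) < n := by exact_mod_cast c.pos
  refine (Finset.abs_sum_le_sum_abs _ _).trans ?_
  have : ∀ e ∈ Finset.univ, |(∑ p, u p c * u p e) * (∑ p, u p d * u p e)|
      ≤ (r * B ^ 2 / n) * (r * B ^ 2 / n) := fun e _ => by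
    rw [abs_mul]
    exact mul_le_mul (abs_projKernel_le hu c e) (abs_projKernel_le hu d e) (abs_nonneg _)
      (by positivity)
  refine (Finset.sum_le_sum this).trans (le_of_eq ?_)
  simp
  field_simp

lemma abs_integral_rowProj_mul_le {u : Fin r → Fin n → ℝ} {B : ℝ}
    (hu : ∀ p c, |u p c| ≤ B / √n) (c d : Fin n) :
    |∫ y, rowProj u y c * rowProj u y d ∂(delta0 n)| ≤ (r * B ^ 2) ^ 2 / n := by
  simp_rw [rowProj_eq_linForm]
  rw [integral_linForm_mul]
  exact abs_sum_projKernel_mul_le hu c d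

lemma abs_integral_rowRes_mul_le {u : Fin r → Fin n → ℝ} {B : ℝ}
    (hu : ∀ p c, |u p c| ≤ B / √n) (c d : Fin n) :
    |∫ y, rowRes u c y * rowRes u d y ∂(delta0 n)|
      ≤ (if c = d then 1 else 0) + (2 * (r * B ^ 2) + (r * B ^ 2) ^ 2) / n := by
  have hc : ∀ (c : Fin n) (y : Fin n → ℝ), y c = linForm (fun e => if e = c then 1 else 0) y :=
    fun c y => by simp [linForm]
  have e : ∀ y : Fin n → ℝ, rowRes u c y * rowRes u d y
      = linForm (fun e => (if e = c then 1 else 0) - ∑ p, u p c * u p e) y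
        * linForm (fun e => (if e = d then 1 else 0) - ∑ p, u p d * u p e) y := fun y => by
    unfold rowRes
    rw [rowProj_eq_linForm, rowProj_eq_linForm, hc c y, hc d y]
    unfold linForm
    simp_rw [sub_mul, Finset.sum_sub_distrib]
    ring
  simp_rw [e]
  rw [integral_linForm_mul]
  have e2 : ∑ e, (((if e = c then 1 else 0) - ∑ p, u p c * u p e)
        * ((if e = d then 1 else 0) - ∑ p, u p d * u p e))
      = (if c = d then 1 else 0) - ∑ p, u p d * u p c - ∑ p, u p c * u p d
        + ∑ e, (∑ p, u p c * u p e) * (∑ p, u p d * u p e) := by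
    simp_rw [sub_mul, mul_sub, Finset.sum_sub_distrib]
    simp only [mul_ite, mul_one, mul_zero, ite_mul, one_mul, zero_mul, Finset.sum_ite_eq',
      Finset.mem_univ, if_true]
    rw [if_congr (eq_comm (a := d) (b := c)) rfl rfl]
    ring
  rw [e2]
  have b1 := abs_le.mp (abs_projKernel_le hu d c)
  have b2 := abs_le.mp (abs_projKernel_le hu c d)
  have b3 := abs_le.mp (abs_sum_projKernel_mul_le hu c d)
  have b4 : (0 : ℝ) ≤ if c = d then 1 else 0 := by split_ifs <;> simp
  rw [add_div, mul_div_assoc, abs_le]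
  constructor <;> linarith

/-- A random variable that dominates the projections of both rows of the coupling. -/
noncomputable def projDom (u : Fin r → Fin n → ℝ) (B : ℝ) (y : Fin n → ℝ) : ℝ :=
  (∑ p, |linForm (u p) y|) + (r * B + 1)

lemma one_le_projDom (u : Fin r → Fin n → ℝ) {B : ℝ} (hB : 0 ≤ B) (y : Fin n → ℝ) :
    1 ≤ projDom u B y := by
  have : 0 ≤ ∑ p, |linForm (u p) y| := Finset.sum_nonneg fun p _ => abs_nonneg _
  have : 0 ≤ r * B := by positivity
  unfold projDom
  linarith

lemma projDom_pow_four_le (u : Fin r → Fin n → ℝ) {B : ℝ} (hB : 0 ≤ B) (y : Fin n → ℝ) :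
    projDom u B y ^ 4 ≤ 8 * (r ^ 3 * ∑ p, linForm (u p) y ^ 4 + (r * B + 1) ^ 4) := by
  have h1 : (∑ p, |linForm (u p) y|) ^ 4 ≤ r ^ 3 * ∑ p, linForm (u p) y ^ 4 := by
    rcases Nat.eq_zero_or_pos r with rfl | hr
    · simp
    have := pow_sum_div_card_le_sum_pow (s := (Finset.univ : Finset (Fin r)))
      (f := fun p => |linForm (u p) y|) (n := 3) fun p _ => abs_nonneg _
    rw [div_le_iff₀ (by simp only [Finset.card_univ, Fintype.card_fin]; positivity)] at this
    simp only [Finset.card_univ, Fintype.card_fin] at this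
    simp_rw [show (3 + 1 : ℕ) = 4 from rfl, Even.pow_abs (show Even 4 by decide)] at this
    linarith
  have h2 := add_pow_le (Finset.sum_nonneg fun p (_ : p ∈ Finset.univ) =>
    abs_nonneg (linForm (u p) y)) (show 0 ≤ r * B + 1 by positivity) 4
  unfold projDom
  norm_num at h2
  linarith

lemma hasAllMoments_abs {α : Type*} [MeasurableSpace α] {μ : Measure α} {f : α → ℝ}
    (hf : HasAllMoments μ f) : HasAllMoments μ (fun x => |f x|) := fun p => (hf p).abs

lemma hasAllMoments_projDom (u : Fin r → Fin n → ℝ) (B : ℝ) :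
    HasAllMoments (delta0 n) (projDom u B) :=
  (HasAllMoments.sum _ fun p _ => hasAllMoments_abs (hasAllMoments_linForm (u p))).add (.const _)

lemma integral_projDom_pow_four_le {u : Fin r → Fin n → ℝ} (hu : IsOrthonormal u) {B : ℝ}
    (hB : 0 ≤ B) :
    ∫ y, projDom u B y ^ 4 ∂(delta0 n) ≤ 8 * (9 * r ^ 4 + (r * B + 1) ^ 4) := by
  have hm : ∀ p, HasAllMoments (delta0 n) (fun y => linForm (u p) y ^ 4) := fun p =>
    (hasAllMoments_linForm (u p)).pow 4
  refine (integral_mono ((hasAllMoments_projDom u B).pow 4).integrable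
    ((((HasAllMoments.sum _ fun p _ => hm p).const_mul (r ^ 3)).add
      (.const ((r * B + 1) ^ 4))).const_mul 8).integrable
    fun y => projDom_pow_four_le u hB y).trans ?_
  rw [integral_const_mul, HasAllMoments.integral_add
    ((HasAllMoments.sum _ fun p _ => hm p).const_mul (r ^ 3)) (.const _), integral_const_mul,
    integral_finsetSum _ fun p _ => (hm p).integrable]
  have : ∑ p, ∫ y, linForm (u p) y ^ 4 ∂(delta0 n) ≤ ∑ _p : Fin r, (9 : ℝ) :=
    Finset.sum_le_sum fun p _ => integral_linForm_pow_four_le (by simpa using hu p p)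
  simp at this
  have h3 : (0 : ℝ) ≤ r ^ 3 := by positivity
  have := mul_le_mul_of_nonneg_left this h3
  simp
  nlinarith

/-- The constant of the perturbation given by the coupling of rows. -/
noncomputable def couplingConst (r : ℕ) (B : ℝ) : ℝ :=
  2 * (r * B ^ 2) ^ 2 + (B ^ 2 + 4 * (2 * (r * B ^ 2) + (r * B ^ 2) ^ 2) * B ^ 2 + 9 * B ^ 4)
    * (8 * (9 * r ^ 4 + (r * B + 1) ^ 4)) + 1

lemma one_le_couplingConst (r : ℕ) (B : ℝ) (hB : 0 ≤ B) : 1 ≤ couplingConst r B := by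
  unfold couplingConst
  have : 0 ≤ 2 * (r * B ^ 2) ^ 2 + (B ^ 2 + 4 * (2 * (r * B ^ 2) + (r * B ^ 2) ^ 2) * B ^ 2
    + 9 * B ^ 4) * (8 * (9 * r ^ 4 + (r * B + 1) ^ 4)) := by positivity
  linarith

section Bounded

variable {u : Fin r → Fin n → ℝ} {B : ℝ} {Δ : Measure (Fin n → ℝ)} [IsProbabilityMeasure Δ]

lemma abs_rowProj_le_of_bounded (hB : 0 ≤ B) (huB : ∀ p c, |u p c| ≤ B / √n) {x : Fin n → ℝ}
    (hx : ∀ p, |linForm (u p) x| ≤ B) (c : Fin n) : |rowProj u x c| ≤ (r * B) * (B / √n) := by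
  refine (abs_rowProj_le huB x c).trans (mul_le_mul_of_nonneg_right ?_ (by positivity))
  refine (Finset.sum_le_sum fun p _ => hx p).trans (le_of_eq ?_)
  simp

lemma hasAllMoments_rowProj_of_bounded (hB : 0 ≤ B) (huB : ∀ p c, |u p c| ≤ B / √n)
    (hΔ : ∀ᵐ x ∂Δ, ∀ p, |linForm (u p) x| ≤ B) (c : Fin n) :
    HasAllMoments Δ (fun x => rowProj u x c) := fun _ =>
  MemLp.of_bound ((measurable_pi_iff.mp (measurable_rowProj u) c).aestronglyMeasurable)
    ((r * B) * (B / √n)) (hΔ.mono fun _ hx => abs_rowProj_le_of_bounded hB huB hx c)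

lemma div_sqrt_mul_self (B : ℝ) (n : ℕ) : B / √n * (B / √n) = B ^ 2 / n := by
  rw [div_mul_div_comm, Real.mul_self_sqrt (Nat.cast_nonneg n), pow_two]

lemma abs_covShift_le (hB : 0 ≤ B) (huB : ∀ p c, |u p c| ≤ B / √n)
    (hΔ : ∀ᵐ x ∂Δ, ∀ p, |linForm (u p) x| ≤ B) (c d : Fin n) :
    |covShift Δ u c d| ≤ 2 * (r * B ^ 2) ^ 2 / n := by
  have h1 := abs_integral_rowProj_mul_le huB c d
  have h2 : |∫ x, rowProj u x c * rowProj u x d ∂Δ| ≤ (r * B ^ 2) ^ 2 / n := by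
    have := norm_integral_le_of_norm_le_const (μ := Δ) (C := (r * B ^ 2) ^ 2 / n)
      (f := fun x => rowProj u x c * rowProj u x d) (hΔ.mono fun x hx => by
        rw [Real.norm_eq_abs, abs_mul]
        refine (mul_le_mul (abs_rowProj_le_of_bounded hB huB hx c)
          (abs_rowProj_le_of_bounded hB huB hx d) (abs_nonneg _) (by positivity)).trans
          (le_of_eq ?_)
        rw [mul_mul_mul_comm, div_sqrt_mul_self]
        ring)
    simpa using this
  unfold covShift
  refine (abs_sub _ _).trans ?_
  rw [mul_div_assoc]
  linarith

/-- The coupling of a standard Gaussian row with a row of which the projection to the span of the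
`u p` has the law of that of `Δ` is a perturbation, if the vectors `u p` are delocalised and the
projection under `Δ` is bounded. -/
lemma isPerturbation_rowStep (hu : IsOrthonormal u) (hB : 0 ≤ B)
    (huB : ∀ p c, |u p c| ≤ B / √n) (hΔ : ∀ᵐ x ∂Δ, ∀ p, |linForm (u p) x| ≤ B) :
    IsPerturbation ((delta0 n).prod ((delta0 n).prod Δ)) (covShift Δ u) (rowStep Δ u)
      (couplingConst r B) := by
  set D : ℝ := 8 * (9 * r ^ 4 + (r * B + 1) ^ 4) with hD
  set R : ℝ := 2 * (r * B ^ 2) + (r * B ^ 2) ^ 2 with hR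
  have hD0 : 0 ≤ D := by positivity
  have hR0 : 0 ≤ R := by positivity
  have hCdef : couplingConst r B
      = 2 * (r * B ^ 2) ^ 2 + (B ^ 2 + 4 * R * B ^ 2 + 9 * B ^ 4) * D + 1 := rfl
  set ν := (delta0 n).prod Δ with hν
  -- projections of the two rows
  set g : Fin n → (Fin n → ℝ) × (Fin n → ℝ) → ℝ := fun c y => rowProj u y.1 c with hg
  set x : Fin n → (Fin n → ℝ) × (Fin n → ℝ) → ℝ := fun c y => rowProj u y.2 c with hx
  set α : Fin n → (Fin n → ℝ) × (Fin n → ℝ) → ℝ := fun c y => x c y - g c y with hα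
  set γ : Fin n → Fin n → (Fin n → ℝ) × (Fin n → ℝ) → ℝ := fun c d y =>
    x c y * x d y - g c y * g d y - covShift Δ u c d with hγ
  have mg : ∀ c, HasAllMoments ν (g c) := fun c =>
    (hasAllMoments_rowProj u c).comp measurePreserving_fst
  have mx : ∀ c, HasAllMoments ν (x c) := fun c =>
    (hasAllMoments_rowProj_of_bounded hB huB hΔ c).comp measurePreserving_snd
  have mα : ∀ c, HasAllMoments ν (α c) := fun c => (mx c).sub (mg c)
  have mγ : ∀ c d, HasAllMoments ν (γ c d) := fun c d =>
    (((mx c).mul (mx d)).sub ((mg c).mul (mg d))).sub (.const _)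
  have mh := hasAllMoments_rowRes u
  have h1 : ∀ c, ∫ y, rowRes u c y ∂(delta0 n) = 0 := fun c =>
    integral_delta0_odd (mh c) (rowRes_neg u c)
  have h3 : ∀ a b c, ∫ y, rowRes u a y * rowRes u b y * rowRes u c y ∂(delta0 n) = 0 :=
    fun a b c => integral_delta0_odd (((mh a).mul (mh b)).mul (mh c)) fun y => by
      simp only [rowRes_neg]; ring
  have hγ0 : ∀ c d, ∫ y, γ c d y ∂ν = 0 := fun c d => by
    simp only [hγ]
    rw [integral_sub (((mx c).mul (mx d)).sub ((mg c).mul (mg d))).integrable (integrable_const _),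
      integral_sub ((mx c).mul (mx d)).integrable ((mg c).mul (mg d)).integrable]
    have e1 : ∫ y, x c y * x d y ∂ν = ∫ y, rowProj u y c * rowProj u y d ∂Δ :=
      integral_comp_measurePreserving (measurePreserving_snd (μ := delta0 n) (ν := Δ))
        (((hasAllMoments_rowProj_of_bounded hB huB hΔ c).mul
          (hasAllMoments_rowProj_of_bounded hB huB hΔ d)) 1).aestronglyMeasurable
    have e2 : ∫ y, g c y * g d y ∂ν = ∫ y, rowProj u y c * rowProj u y d ∂(delta0 n) :=
      integral_comp_measurePreserving (measurePreserving_fst (μ := delta0 n) (ν := Δ))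
        (((hasAllMoments_rowProj u c).mul
          (hasAllMoments_rowProj u d)) 1).aestronglyMeasurable
    rw [e1, e2]
    simp [covShift]
  -- domination
  set Ψ : (Fin n → ℝ) × (Fin n → ℝ) → ℝ := fun y => projDom u B y.1 with hΨ
  have mΨ : HasAllMoments ν (fun y => Ψ y ^ 4) :=
    ((hasAllMoments_projDom u B).comp measurePreserving_fst).pow 4
  have hΨ1 : ∀ y, 1 ≤ Ψ y := fun y => one_le_projDom u hB _
  have hΨD : ∫ y, Ψ y ^ 4 ∂ν ≤ D := by
    refine le_of_eq_of_le ?_ (integral_projDom_pow_four_le hu hB)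
    exact integral_comp_measurePreserving (measurePreserving_fst (μ := delta0 n) (ν := Δ))
        (((hasAllMoments_projDom u B).pow 4) 1).aestronglyMeasurable
  have dom : ∀ (f : (Fin n → ℝ) × (Fin n → ℝ) → ℝ) (q : ℝ), 0 ≤ q →
      (∀ᵐ y ∂ν, |f y| ≤ q * Ψ y ^ 4) → |∫ y, f y ∂ν| ≤ q * D := fun f q hq hf => by
    have := norm_integral_le_of_norm_le (f := f) (mΨ.const_mul q).integrable hf
    rw [integral_const_mul] at this
    exact this.trans (mul_le_mul_of_nonneg_left hΨD hq)
  have hx' : ∀ᵐ y ∂ν, ∀ c, |x c y| ≤ (r * B) * (B / √n) :=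
    (measurePreserving_snd (μ := delta0 n) (ν := Δ)).quasiMeasurePreserving.ae
      (hΔ.mono fun z hz c => abs_rowProj_le_of_bounded hB huB hz c)
  have hrB : 0 ≤ r * B := by positivity
  have hBn : 0 ≤ B / √n := by positivity
  have dg : ∀ y c, |g c y| ≤ Ψ y * (B / √n) := fun y c =>
    (abs_rowProj_le huB y.1 c).trans (mul_le_mul_of_nonneg_right (by
      simp only [hΨ, projDom]; linarith) hBn)
  have dα : ∀ᵐ y ∂ν, ∀ c, |α c y| ≤ Ψ y * (B / √n) := hx'.mono fun y hy c => by
    have := hy c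
    have h2 := abs_rowProj_le huB y.1 c
    refine (abs_sub _ _).trans ?_
    simp only [hΨ, projDom]
    simp only [hg]
    linarith
  have dγ : ∀ᵐ y ∂ν, ∀ c d, |γ c d y| ≤ 3 * Ψ y ^ 2 * (B ^ 2 / n) := hx'.mono fun y hy c d => by
    have a1 : |x c y * x d y| ≤ (r * B) ^ 2 * (B ^ 2 / n) := by
      rw [abs_mul]
      refine (mul_le_mul (hy c) (hy d) (abs_nonneg _) (by positivity)).trans (le_of_eq ?_)
      rw [mul_mul_mul_comm, div_sqrt_mul_self]; ring
    have a2 : |g c y * g d y| ≤ (∑ p, |linForm (u p) y.1|) ^ 2 * (B ^ 2 / n) := by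
      rw [abs_mul]
      refine (mul_le_mul (abs_rowProj_le huB y.1 c) (abs_rowProj_le huB y.1 d) (abs_nonneg _)
        ((abs_nonneg _).trans (abs_rowProj_le huB y.1 c))).trans (le_of_eq ?_)
      rw [mul_mul_mul_comm, div_sqrt_mul_self]; ring
    have a3 := abs_covShift_le hB huB hΔ c d
    have a4 : 2 * (r * B ^ 2) ^ 2 / n = 2 * (r * B) ^ 2 * (B ^ 2 / n) := by ring
    have t1 : |γ c d y| ≤ |x c y * x d y| + |g c y * g d y| + |covShift Δ u c d| :=
      (abs_sub _ _).trans (by gcongr; exact abs_sub _ _)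
    have t2 : 3 * (r * B) ^ 2 + (∑ p, |linForm (u p) y.1|) ^ 2 ≤ 3 * Ψ y ^ 2 := by
      have : 0 ≤ ∑ p, |linForm (u p) y.1| := Finset.sum_nonneg fun p _ => abs_nonneg _
      simp only [hΨ, projDom]
      nlinarith
    have t3 : 0 ≤ B ^ 2 / n := by positivity
    have := mul_le_mul_of_nonneg_right t2 t3
    linarith
  have hΨ24 : ∀ y, Ψ y ^ 2 ≤ Ψ y ^ 4 := fun y => pow_le_pow_right₀ (hΨ1 y) (by norm_num)
  have ipq : ∀ p q : Fin n → (Fin n → ℝ) × (Fin n → ℝ) → ℝ,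
      (∀ᵐ y ∂ν, ∀ c, |p c y| ≤ Ψ y * (B / √n)) → (∀ᵐ y ∂ν, ∀ c, |q c y| ≤ Ψ y * (B / √n)) →
      ∀ c d, |∫ y, p c y * q d y ∂ν| ≤ B ^ 2 / n * D := fun p q hp hq c d => by
    refine dom _ _ (by positivity) ?_
    filter_upwards [hp, hq] with y hp hq
    rw [abs_mul]
    have := hΨ1 y
    refine (mul_le_mul (hp c) (hq d) (abs_nonneg _) (by positivity)).trans ?_
    rw [mul_mul_mul_comm, div_sqrt_mul_self, ← pow_two, mul_comm]
    exact mul_le_mul_of_nonneg_left (hΨ24 y) (by positivity)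
  have iγ : ∀ (γ₁ : (Fin n → ℝ) × (Fin n → ℝ) → ℝ) (c d : Fin n),
      (∀ᵐ y ∂ν, |γ₁ y| ≤ 3 * Ψ y ^ 2 * (B ^ 2 / n)) →
      |∫ y, γ₁ y * γ c d y ∂ν| ≤ 9 * B ^ 4 / n ^ 2 * D := fun γ₁ c d hγ₁ => by
    refine dom _ _ (by positivity) ?_
    filter_upwards [hγ₁, dγ] with y h1 h2
    rw [abs_mul]
    refine (mul_le_mul h1 (h2 c d) (abs_nonneg _) (by positivity)).trans (le_of_eq ?_)
    ring
  -- the covariance of a general step with a centred difference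
  have key : ∀ (θ : ℝ) (p : Fin n → (Fin n → ℝ) × (Fin n → ℝ) → ℝ)
      (γ₁ : (Fin n → ℝ) × (Fin n → ℝ) → ℝ) (a b c d : Fin n),
      (∀ c, HasAllMoments ν (p c)) → HasAllMoments ν γ₁ →
      (∀ᵐ y ∂ν, ∀ c, |p c y| ≤ Ψ y * (B / √n)) → (∀ᵐ y ∂ν, |γ₁ y| ≤ 3 * Ψ y ^ 2 * (B ^ 2 / n)) →
      |∫ w, (θ * (rowRes u a w.1 * rowRes u b w.1) + rowRes u a w.1 * p b w.2
          + rowRes u b w.1 * p a w.2 + γ₁ w.2)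
          * (rowRes u c w.1 * α d w.2 + rowRes u d w.1 * α c w.2 + γ c d w.2)
          ∂((delta0 n).prod ν)|
        ≤ couplingConst r B / n * ((if a = c then 1 else 0) + (if a = d then 1 else 0)
          + (if b = c then 1 else 0) + (if b = d then 1 else 0)) + couplingConst r B / n ^ 2 := by
    intro θ p γ₁ a b c d mp mγ₁ dp dγ₁
    rw [integral_quadratic_mul mh mp mα mγ₁ (mγ c d) h1 h3 (hγ0 c d)]
    have bb : ∀ a c : Fin n, ∀ I : ℝ, |I| ≤ B ^ 2 / n * D →
        |(∫ y, rowRes u a y * rowRes u c y ∂(delta0 n)) * I|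
          ≤ ((if a = c then 1 else 0) + R / n) * (B ^ 2 / n * D) := fun a c I hI => by
      rw [abs_mul]
      exact mul_le_mul (abs_integral_rowRes_mul_le huB a c) hI (abs_nonneg _)
        ((abs_nonneg _).trans (abs_integral_rowRes_mul_le huB a c))
    have b1 := bb a c _ (ipq p α dp dα b d)
    have b2 := bb a d _ (ipq p α dp dα b c)
    have b3 := bb b c _ (ipq p α dp dα a d)
    have b4 := bb b d _ (ipq p α dp dα a c)
    have b5 := iγ γ₁ c d dγ₁
    refine ((abs_add_le _ _).trans (add_le_add ((abs_add_le _ _).trans (add_le_add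
      ((abs_add_le _ _).trans (add_le_add ((abs_add_le _ _).trans (add_le_add b1 b2)) b3)) b4))
      b5)).trans ?_
    set δ : ℝ := (if a = c then 1 else 0) + (if a = d then 1 else 0)
          + (if b = c then 1 else 0) + (if b = d then 1 else 0) with hδ
    have hδ0 : 0 ≤ δ := by rw [hδ]; positivity
    have e : ((if a = c then 1 else 0) + R / n) * (B ^ 2 / n * D)
        + ((if a = d then 1 else 0) + R / n) * (B ^ 2 / n * D)
        + ((if b = c then 1 else 0) + R / n) * (B ^ 2 / n * D)
        + ((if b = d then 1 else 0) + R / n) * (B ^ 2 / n * D) + 9 * B ^ 4 / n ^ 2 * D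
        = B ^ 2 * D / n * δ + (4 * R * B ^ 2 + 9 * B ^ 4) * D / n ^ 2 := by
      rw [hδ]; ring
    rw [e]
    have c1 : B ^ 2 * D ≤ couplingConst r B := by
      rw [hCdef]
      have : 0 ≤ 2 * (r * B ^ 2) ^ 2 + (4 * R * B ^ 2 + 9 * B ^ 4) * D + 1 := by positivity
      linarith
    have c2 : (4 * R * B ^ 2 + 9 * B ^ 4) * D ≤ couplingConst r B := by
      rw [hCdef]
      have : 0 ≤ 2 * (r * B ^ 2) ^ 2 + B ^ 2 * D + 1 := by positivity
      linarith
    gcongr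
  -- the steps in terms of residuals and projections
  have sF : ∀ c d w, rowStep Δ u false c d w = 1 * (rowRes u c w.1 * rowRes u d w.1)
      + rowRes u c w.1 * g d w.2 + rowRes u d w.1 * g c w.2 + g c w.2 * g d w.2 := fun c d w => by
    simp only [rowStep, rowMix, rowRes, hg]
    simp only [Bool.false_eq_true, if_false]
    ring
  have sT : ∀ c d w, rowStep Δ u true c d w = rowRes u c w.1 * α d w.2 + rowRes u d w.1 * α c w.2
      + γ c d w.2 := fun c d w => by
    simp only [rowStep, rowMix, rowRes, hg, hα, hγ, hx]
    simp only [if_true]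
    ring
  have sT' : ∀ c d w, rowStep Δ u true c d w = 0 * (rowRes u c w.1 * rowRes u d w.1)
      + rowRes u c w.1 * α d w.2 + rowRes u d w.1 * α c w.2 + γ c d w.2 := fun c d w => by
    rw [sT]; ring
  have key1 : ∀ s a b c d, |∫ w, rowStep Δ u s a b w * rowStep Δ u true c d w
      ∂((delta0 n).prod ν)| ≤ couplingConst r B / n * ((if a = c then 1 else 0)
        + (if a = d then 1 else 0) + (if b = c then 1 else 0) + (if b = d then 1 else 0))
        + couplingConst r B / n ^ 2 := by
    intro s a b c d
    simp_rw [sT c d]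
    cases s
    · simp_rw [sF a b]
      refine key 1 g _ a b c d mg ((mg a).mul (mg b)) (.of_forall dg) (.of_forall fun y => ?_)
      rw [abs_mul]
      have := hΨ1 y
      refine (mul_le_mul (dg y a) (dg y b) (abs_nonneg _) (by positivity)).trans ?_
      rw [mul_mul_mul_comm, div_sqrt_mul_self]
      refine mul_le_mul_of_nonneg_right ?_ (by positivity)
      nlinarith
    · simp_rw [sT' a b]
      exact key 0 α _ a b c d mα (mγ a b) dα (dγ.mono fun y hy => hy a b)
  have hG : MeasurePreserving (fun w : (Fin n → ℝ) × ((Fin n → ℝ) × (Fin n → ℝ)) =>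
      rowMix u (w.1, w.2.1)) ((delta0 n).prod ν) (delta0 n) :=
    (measurePreserving_rowMix hu).comp
      ((MeasurePreserving.id (delta0 n)).prod (measurePreserving_fst (μ := delta0 n) (ν := Δ)))
  have mm : ∀ s c d, HasAllMoments ((delta0 n).prod ν) (rowStep Δ u s c d) := by
    intro s c d
    cases s
    · exact ((hasAllMoments_row c).mul (hasAllMoments_row d)).comp hG
    · rw [show rowStep Δ u true c d = _ from funext (sT c d)]
      exact ((((mh c).comp measurePreserving_fst).mul ((mα d).comp measurePreserving_snd)).add
        (((mh d).comp measurePreserving_fst).mul ((mα c).comp measurePreserving_snd))).add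
        ((mγ c d).comp measurePreserving_snd)
  refine ⟨mm, fun c d => ?_, fun s c d hs => ?_, fun s s' a b c d hs hs' => ?_⟩
  · refine (abs_covShift_le hB huB hΔ c d).trans ?_
    have : 2 * (r * B ^ 2) ^ 2 ≤ couplingConst r B := by
      rw [hCdef]
      have : 0 ≤ (B ^ 2 + 4 * R * B ^ 2 + 9 * B ^ 4) * D + 1 := by positivity
      linarith
    gcongr
  · cases s
    · have := integral_comp_measurePreserving hG
        (((hasAllMoments_row c).mul (hasAllMoments_row d)) 1).aestronglyMeasurable
      rw [integral_delta0_mul, if_neg (hs rfl)] at this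
      exact this
    · simp_rw [sT]
      have i1 : ∀ c d, ∫ w, rowRes u c w.1 * α d w.2 ∂((delta0 n).prod ν) = 0 := fun c d => by
        rw [integral_prod_mul (fun y => rowRes u c y) (fun y => α d y), h1, zero_mul]
      have i2 : ∫ w : (Fin n → ℝ) × ((Fin n → ℝ) × (Fin n → ℝ)), γ c d w.2 ∂((delta0 n).prod ν) = 0 := by
        rw [← hγ0 c d]
        exact integral_comp_measurePreserving (measurePreserving_snd (μ := delta0 n) (ν := ν))
          ((mγ c d) 1).aestronglyMeasurable
      have m1 : ∀ c d, HasAllMoments ((delta0 n).prod ν)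
          (fun w : (Fin n → ℝ) × ((Fin n → ℝ) × (Fin n → ℝ)) => rowRes u c w.1 * α d w.2) :=
        fun c d => ((mh c).comp measurePreserving_fst).mul ((mα d).comp measurePreserving_snd)
      rw [HasAllMoments.integral_add ((m1 c d).add (m1 d c))
        ((mγ c d).comp measurePreserving_snd), HasAllMoments.integral_add (m1 c d) (m1 d c), i1, i1,
        i2]
      simp
  · cases s'
    · cases s
      · have := integral_comp_measurePreserving hG
          ((((hasAllMoments_row a).mul (hasAllMoments_row b)).mul
            ((hasAllMoments_row c).mul (hasAllMoments_row d))) 1).aestronglyMeasurable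
        rw [integral_delta0_four, if_neg (hs rfl)] at this
        have e : ∫ w, rowStep Δ u false a b w * rowStep Δ u false c d w ∂((delta0 n).prod ν)
            = _ := this
        rw [e]
        refine le_of_eq ?_
        simp only [stepKernel, and_self, if_true, zero_mul, zero_add]
        exact abs_of_nonneg (by positivity)
      · simp_rw [mul_comm (rowStep Δ u true a b _)]
        refine (key1 false c d a b).trans (le_of_eq ?_)
        simp only [stepKernel, Bool.true_eq_false, false_and, if_false, eq_comm (a := c),
          eq_comm (a := d)]
        ring
    · refine (key1 s a b c d).trans (le_of_eq ?_)
      simp [stepKernel]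

end Bounded

end Coupling
end Perceptron

namespace Perceptron

/-! ### Truncated Gaussians -/

section Truncated

lemma measurableSet_abs_le (κ : ℝ) : MeasurableSet {z : ℝ | |z| ≤ κ} :=
  measurableSet_le (by fun_prop) measurable_const

lemma gaussProb_pos {κ : ℝ} (hκ : 0 < κ) : 0 < gaussProb κ := by
  unfold gaussProb
  rw [measureReal_def, ENNReal.toReal_pos_iff]
  refine ⟨pos_iff_ne_zero.mpr fun h => ?_, measure_lt_top _ _⟩
  have h2 := gaussianReal_absolutelyContinuous' 0 (one_ne_zero (α := NNReal)) h
  have h3 : Set.Icc (-κ) κ ⊆ {z : ℝ | |z| ≤ κ} := fun z hz => abs_le.mpr hz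
  have h4 := measure_mono_null h3 h2
  rw [Real.volume_Icc, ENNReal.ofReal_eq_zero] at h4
  linarith

lemma gaussProb_lt_one (κ : ℝ) : gaussProb κ < 1 := by
  unfold gaussProb
  have h := probReal_add_probReal_compl (μ := gaussianReal 0 1) (measurableSet_abs_le κ)
  have : 0 < (gaussianReal 0 1).real {z : ℝ | |z| ≤ κ}ᶜ := by
    rw [measureReal_def, ENNReal.toReal_pos_iff]
    refine ⟨pos_iff_ne_zero.mpr fun h => ?_, measure_lt_top _ _⟩
    have h2 := gaussianReal_absolutelyContinuous' 0 (one_ne_zero (α := NNReal)) h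
    have h3 : Set.Ioo κ (κ + 1) ⊆ {z : ℝ | |z| ≤ κ}ᶜ := fun z hz => by
      simp only [Set.mem_compl_iff, Set.mem_ofPred_eq, not_le]
      exact hz.1.trans_le (le_abs_self z)
    have h4 := measure_mono_null h3 h2
    rw [Real.volume_Ioo, ENNReal.ofReal_eq_zero] at h4
    linarith
  linarith

lemma alphaC_pos {κ : ℝ} (hκ : 0 < κ) : 0 < alphaC κ :=
  div_pos_of_neg_of_neg (by have := Real.log_pos one_lt_two; linarith)
    (Real.log_neg (gaussProb_pos hκ) (gaussProb_lt_one κ))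

/-- The law of a standard Gaussian variable conditioned on `|z| ≤ κ`. -/
noncomputable def truncGauss (κ : ℝ) : Measure ℝ := cond (gaussianReal 0 1) {z | |z| ≤ κ}

lemma integral_cond {α : Type*} [MeasurableSpace α] (μ : Measure α) (T : Set α) (f : α → ℝ) :
    ∫ x, f x ∂(cond μ T) = (∫ x in T, f x ∂μ) / μ.real T := by
  unfold ProbabilityTheory.cond
  rw [integral_smul_measure, ENNReal.toReal_inv, ← measureReal_def, smul_eq_mul, inv_mul_eq_div]

lemma isProbabilityMeasure_truncGauss {κ : ℝ} (hκ : 0 < κ) :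
    IsProbabilityMeasure (truncGauss κ) := by
  refine cond_isProbabilityMeasure fun h => (gaussProb_pos hκ).ne' ?_
  rw [gaussProb, measureReal_def, h, ENNReal.toReal_zero]

lemma integral_truncGauss_sq (κ : ℝ) : ∫ z, z ^ 2 ∂(truncGauss κ) = mu2 κ := integral_cond _ _ _

lemma integral_truncGauss_id (κ : ℝ) : ∫ z, z ∂(truncGauss κ) = 0 := by
  have h : MeasurePreserving (fun x : ℝ => -x) (gaussianReal 0 1) (gaussianReal 0 1) :=
    ⟨by fun_prop, by rw [gaussianReal_map_neg]; simp⟩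
  have h2 := integral_comp_measurePreserving (h.restrict_preimage (measurableSet_abs_le κ))
    (f := fun z : ℝ => z) measurable_id.aestronglyMeasurable
  rw [show (fun x : ℝ => -x) ⁻¹' {z : ℝ | |z| ≤ κ} = {z : ℝ | |z| ≤ κ} by ext; simp,
    integral_neg] at h2
  rw [truncGauss, integral_cond, show ∫ z in {z : ℝ | |z| ≤ κ}, z ∂(gaussianReal 0 1) = 0 by
    linarith, zero_div]

lemma mu2_nonneg (κ : ℝ) : 0 ≤ mu2 κ := by
  rw [← integral_truncGauss_sq]
  exact integral_nonneg fun z => sq_nonneg z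

lemma ae_truncGauss (κ : ℝ) : ∀ᵐ z ∂(truncGauss κ), |z| ≤ κ :=
  ae_cond_mem (measurableSet_abs_le κ)

lemma mu2_le {κ : ℝ} (hκ : 0 < κ) : mu2 κ ≤ κ ^ 2 := by
  have := isProbabilityMeasure_truncGauss hκ
  rw [← integral_truncGauss_sq]
  have h := norm_integral_le_of_norm_le_const (μ := truncGauss κ) (C := κ ^ 2)
    (f := fun z : ℝ => z ^ 2) ((ae_truncGauss κ).mono fun z hz => by
      rw [Real.norm_eq_abs, abs_pow]
      exact pow_le_pow_left₀ (abs_nonneg _) hz 2)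
  simp at h
  exact (le_abs_self _).trans h

/-- The cube `[-κ, κ] ^ r`. -/
def cube (κ : ℝ) (r : ℕ) : Set (Fin r → ℝ) := Set.univ.pi fun _ => {z | |z| ≤ κ}

lemma measurableSet_cube (κ : ℝ) (r : ℕ) : MeasurableSet (cube κ r) :=
  MeasurableSet.univ_pi fun _ => measurableSet_abs_le κ

lemma delta0_real_cube (κ : ℝ) (r : ℕ) : (delta0 r).real (cube κ r) = gaussProb κ ^ r := by
  unfold delta0 cube gaussProb
  rw [measureReal_def, Measure.pi_pi, ENNReal.toReal_prod]
  simp [measureReal_def]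

lemma cond_delta0_cube {κ : ℝ} (hκ : 0 < κ) (r : ℕ) :
    cond (delta0 r) (cube κ r) = Measure.pi fun _ => truncGauss κ := by
  have := isProbabilityMeasure_truncGauss hκ
  refine (Measure.pi_eq fun s hs => ?_).symm
  rw [cond_apply (measurableSet_cube κ r), cube, ← Set.pi_inter_distrib]
  unfold delta0
  rw [Measure.pi_pi, Measure.pi_pi]
  unfold truncGauss
  simp_rw [cond_apply (measurableSet_abs_le κ)]
  rw [Finset.prod_mul_distrib, ENNReal.prod_inv_distrib]
  intro i _ j _ _
  exact Or.inr (measure_ne_top _ _)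

lemma integral_cube_mul {κ : ℝ} (hκ : 0 < κ) {r : ℕ} (p q : Fin r) :
    ∫ z, z p * z q ∂(cond (delta0 r) (cube κ r)) = if p = q then mu2 κ else 0 := by
  have := isProbabilityMeasure_truncGauss hκ
  rw [cond_delta0_cube hκ]
  split_ifs with h
  · subst h
    rw [← integral_truncGauss_sq]
    simp_rw [← pow_two]
    exact integral_comp_measurePreserving
      (measurePreserving_eval (fun _ : Fin r => truncGauss κ) p)
      (f := fun z : ℝ => z ^ 2) (by fun_prop)
  · have e : ∀ z : Fin r → ℝ, z p * z q
        = ∏ i, (fun i (t : ℝ) => (if i = p then t else 1) * (if i = q then t else 1)) i (z i) :=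
      fun z => by
        rw [Finset.prod_mul_distrib]
        simp
    rw [integral_congr_ae (.of_forall e), integral_fintype_prod_eq_prod (𝕜 := ℝ)
      (μ := fun _ : Fin r => truncGauss κ)
      (fun i (t : ℝ) => (if i = p then t else 1) * (if i = q then t else 1))]
    refine Finset.prod_eq_zero (Finset.mem_univ p) ?_
    simp [h, integral_truncGauss_id]

/-- The density of the standard Gaussian distribution is at most one. -/
lemma gaussianReal_le_volume : gaussianReal 0 1 ≤ volume := by
  rw [gaussianReal_of_var_ne_zero _ one_ne_zero]
  conv_rhs => rw [← withDensity_one (μ := (volume : Measure ℝ))]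
  refine withDensity_mono (.of_forall fun x => ?_)
  rw [gaussianPDF_def, Pi.one_apply, ENNReal.ofReal_le_one, gaussianPDFReal_def]
  refine mul_le_one₀ (inv_le_one_of_one_le₀ ?_) (Real.exp_nonneg _) (Real.exp_le_one_iff.mpr ?_)
  · rw [Real.one_le_sqrt]
    have := Real.pi_gt_three
    simp
    linarith
  · exact div_nonpos_of_nonpos_of_nonneg (neg_nonpos.mpr (sq_nonneg _)) (by positivity)

lemma delta0_abs_sub_le {r : ℕ} (p : Fin r) (κ : ℝ) {δ : ℝ} (hδ : 0 ≤ δ) :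
    (delta0 r).real {z | |(|z p| - κ)| ≤ δ} ≤ 4 * δ := by
  have hW : MeasurableSet {x : ℝ | |(|x| - κ)| ≤ δ} := measurableSet_le (by fun_prop) (by fun_prop)
  have h1 : (delta0 r).real {z | |(|z p| - κ)| ≤ δ} = (gaussianReal 0 1).real {x | |(|x| - κ)| ≤ δ} := by
    have := (measurePreserving_eval (fun _ : Fin r => gaussianReal 0 1) p).measureReal_preimage
      hW.nullMeasurableSet
    exact this
  rw [h1]
  have h2 : {x : ℝ | |(|x| - κ)| ≤ δ} ⊆ Set.Icc (κ - δ) (κ + δ) ∪ Set.Icc (-κ - δ) (-κ + δ) := by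
    intro x hx
    have : |(|x| - κ)| ≤ δ := hx
    have := abs_le.mp this
    rcases abs_cases x with h | h
    · exact Or.inl ⟨by linarith, by linarith⟩
    · exact Or.inr ⟨by linarith, by linarith⟩
  have h3 : gaussianReal 0 1 {x : ℝ | |(|x| - κ)| ≤ δ} ≤ ENNReal.ofReal (4 * δ) := by
    refine (gaussianReal_le_volume _).trans ((measure_mono h2).trans
      ((measure_union_le _ _).trans ?_))
    rw [Real.volume_Icc, Real.volume_Icc, ← ENNReal.ofReal_add (by linarith) (by linarith)]
    exact ENNReal.ofReal_le_ofReal (by linarith)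
  rw [measureReal_def]
  exact ENNReal.toReal_le_of_le_ofReal (by linarith) h3

end Truncated

section Conditional

lemma MeasurePreserving.cond {α β : Type*} [MeasurableSpace α] [MeasurableSpace β] {μ : Measure α}
    {ν : Measure β} {φ : α → β} (hφ : MeasurePreserving φ μ ν) {T : Set β} (hT : MeasurableSet T) :
    MeasurePreserving φ (ProbabilityTheory.cond μ (φ ⁻¹' T)) (ProbabilityTheory.cond ν T) := by
  unfold ProbabilityTheory.cond
  rw [hφ.measure_preimage hT.nullMeasurableSet]
  exact (hφ.restrict_preimage hT).smul_measure _

lemma measurePreserving_linForms {r n : ℕ} {u : Fin r → Fin n → ℝ} (hu : IsOrthonormal u) :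
    MeasurePreserving (fun y p => linForm (u p) y) (delta0 n) (delta0 r) := by
  have hm : Measurable fun (y : Fin n → ℝ) p => linForm (u p) y :=
    measurable_pi_iff.mpr fun p => measurable_linForm _
  refine ⟨hm, ?_⟩
  have := Measure.isProbabilityMeasure_map (μ := delta0 n) hm.aemeasurable
  refine Measure.ext_of_charFunDual ?_
  ext ℒ
  set ℓ : Fin r → ℝ := fun c => ℒ (Pi.single c 1) with hℓ
  have hL : ∀ y, ℒ y = linForm ℓ y := fun y => by
    conv_lhs => rw [← Finset.univ_sum_single y]
    rw [map_sum]
    refine Finset.sum_congr rfl fun c _ => ?_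
    rw [show (Pi.single c (y c) : Fin r → ℝ) = y c • Pi.single c 1 by
      rw [← Pi.single_smul]; simp, map_smul]
    simp [hℓ, mul_comm]
  rw [charFunDual_apply, charFunDual_apply, integral_map hm.aemeasurable (by fun_prop)]
  simp_rw [hL]
  have e : ∀ y : Fin n → ℝ, linForm ℓ (fun p => linForm (u p) y)
      = linForm (fun c => ∑ p, ℓ p * u p c) y := fun y => by
    unfold linForm
    simp_rw [Finset.sum_mul, Finset.mul_sum]
    rw [Finset.sum_comm]
    exact Finset.sum_congr rfl fun _ _ => Finset.sum_congr rfl fun _ _ => by ring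
  simp_rw [e]
  rw [integral_exp_linForm, integral_exp_linForm]
  congr 3
  norm_cast
  simp_rw [pow_two, Finset.sum_mul_sum]
  rw [Finset.sum_comm]
  refine Finset.sum_congr rfl fun p _ => ?_
  rw [Finset.sum_comm]
  have : ∀ q, ∑ c, ℓ p * u p c * (ℓ q * u q c) = ℓ p * ℓ q * if p = q then 1 else 0 := fun q => by
    rw [← hu p q, Finset.mul_sum]
    exact Finset.sum_congr rfl fun c _ => by ring
  simp_rw [this]
  simp

/-- If the law of a row is that of a standard Gaussian row conditioned on an event `T` for its
coefficients with respect to orthonormal vectors, the shift of the covariance is determined by the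
second moments of these coefficients. -/
lemma covShift_cond {r n : ℕ} {u : Fin r → Fin n → ℝ} (hu : IsOrthonormal u)
    {T : Set (Fin r → ℝ)} (hT : MeasurableSet T) {b : ℝ} (hb : ∀ z ∈ T, ∀ p, |z p| ≤ b)
    (c d : Fin n) :
    covShift (cond (delta0 n) ((fun y p => linForm (u p) y) ⁻¹' T)) u c d
      = ∑ p, ∑ q, u p c * u q d
          * (∫ z, z p * z q ∂(cond (delta0 r) T) - if p = q then 1 else 0) := by
  have hφ := measurePreserving_linForms hu
  have hφT := MeasurePreserving.cond hφ hT
  have hsum : ∀ y : Fin n → ℝ, rowProj u y c * rowProj u y d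
      = ∑ p, ∑ q, u p c * u q d * (linForm (u p) y * linForm (u q) y) := fun y => by
    unfold rowProj
    rw [Finset.sum_mul_sum]
    exact Finset.sum_congr rfl fun _ _ => Finset.sum_congr rfl fun _ _ => by ring
  have hint : ∀ (Δ : Measure (Fin n → ℝ)), (∀ p, HasAllMoments Δ (linForm (u p))) →
      ∫ y, rowProj u y c * rowProj u y d ∂Δ
        = ∑ p, ∑ q, u p c * u q d * ∫ y, linForm (u p) y * linForm (u q) y ∂Δ := fun Δ hΔ => by
    simp_rw [hsum]
    rw [integral_finsetSum _ fun p _ => (HasAllMoments.sum _ fun q _ =>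
      ((hΔ p).mul (hΔ q)).const_mul _).integrable]
    refine Finset.sum_congr rfl fun p _ => ?_
    rw [integral_finsetSum _ fun q _ => (((hΔ p).mul (hΔ q)).const_mul _).integrable]
    exact Finset.sum_congr rfl fun q _ => integral_const_mul _ _
  have hmom : ∀ p, HasAllMoments (cond (delta0 n) ((fun y p => linForm (u p) y) ⁻¹' T))
      (linForm (u p)) := fun p k => by
    have h2 : HasAllMoments (cond (delta0 r) T) (fun z => z p) := fun k =>
      MemLp.of_bound (measurable_pi_apply p).aestronglyMeasurable b
        ((ae_cond_mem hT).mono fun z hz => hb z hz p)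
    exact (h2.comp hφT) k
  unfold covShift
  rw [hint _ hmom, hint _ fun p => hasAllMoments_linForm _, ← Finset.sum_sub_distrib]
  refine Finset.sum_congr rfl fun p _ => ?_
  rw [← Finset.sum_sub_distrib]
  refine Finset.sum_congr rfl fun q _ => ?_
  rw [← mul_sub, integral_linForm_mul, hu p q]
  congr 2
  exact integral_comp_measurePreserving hφT (f := fun z : Fin r → ℝ => z p * z q) (by fun_prop)

lemma abs_setIntegral_sub_le {α : Type*} [MeasurableSpace α] {μ : Measure α} [IsFiniteMeasure μ]
    {T T₀ W : Set α} (hT : MeasurableSet T) (hT₀ : MeasurableSet T₀) (hW : MeasurableSet W)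
    {f : α → ℝ} (hf : Measurable f) {b : ℝ} (hb : 0 ≤ b) (hfT : ∀ x ∈ T, |f x| ≤ b)
    (hfT₀ : ∀ x ∈ T₀, |f x| ≤ b) (h1 : T \ T₀ ⊆ W) (h2 : T₀ \ T ⊆ W) :
    |∫ x in T, f x ∂μ - ∫ x in T₀, f x ∂μ| ≤ b * μ.real W := by
  have i1 : IntegrableOn f T μ := Measure.integrableOn_of_bounded (M := b) (measure_ne_top _ _)
    hf.aestronglyMeasurable ((ae_restrict_mem hT).mono fun x hx => hfT x hx)
  have i2 : IntegrableOn f T₀ μ := Measure.integrableOn_of_bounded (M := b) (measure_ne_top _ _)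
    hf.aestronglyMeasurable ((ae_restrict_mem hT₀).mono fun x hx => hfT₀ x hx)
  rw [← integral_indicator hT, ← integral_indicator hT₀, ← integral_sub
    (i1.integrable_indicator hT) (i2.integrable_indicator hT₀)]
  have h := norm_integral_le_of_norm_le (μ := μ) (f := fun x => T.indicator f x - T₀.indicator f x)
    (g := W.indicator fun _ => b) ((integrable_const b).indicator hW) (.of_forall fun x => by
      by_cases hx : x ∈ T <;> by_cases hx₀ : x ∈ T₀
      · simp [hx, hx₀, Set.indicator_nonneg (fun _ _ => hb)]
      · simpa [hx, hx₀, h1 ⟨hx, hx₀⟩] using hfT x hx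
      · simpa [hx, hx₀, h2 ⟨hx₀, hx⟩] using hfT₀ x hx₀
      · simp [hx, hx₀, Set.indicator_nonneg (fun _ _ => hb)])
  rw [integral_indicator hW] at h
  simpa [mul_comm] using h

lemma abs_integral_cond_sub_le {α : Type*} [MeasurableSpace α] {μ : Measure α}
    [IsFiniteMeasure μ] {T T₀ W : Set α} (hT : MeasurableSet T) (hT₀ : MeasurableSet T₀)
    (hW : MeasurableSet W) {f : α → ℝ} (hf : Measurable f) {b : ℝ} (hb : 0 ≤ b)
    (hfT : ∀ x ∈ T, |f x| ≤ b) (hfT₀ : ∀ x ∈ T₀, |f x| ≤ b) (h1 : T \ T₀ ⊆ W) (h2 : T₀ \ T ⊆ W)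
    (hpos : 0 < μ.real T) (hpos₀ : 0 < μ.real T₀) :
    |∫ x, f x ∂(cond μ T) - ∫ x, f x ∂(cond μ T₀)| ≤ 2 * b * μ.real W / μ.real T₀ := by
  have e1 := abs_setIntegral_sub_le (μ := μ) hT hT₀ hW hf hb hfT hfT₀ h1 h2
  have e2 := abs_setIntegral_sub_le (μ := μ) (f := fun _ => (1 : ℝ)) hT hT₀ hW measurable_const
    zero_le_one (fun _ _ => by simp) (fun _ _ => by simp) h1 h2
  simp only [integral_const, measureReal_restrict_apply_univ, smul_eq_mul, mul_one, one_mul] at e2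
  have e3 : |∫ x in T, f x ∂μ| ≤ b * μ.real T := by
    have := norm_setIntegral_le_of_norm_le_const (f := f) (measure_lt_top μ T) hfT
    rwa [Real.norm_eq_abs] at this
  rw [integral_cond, integral_cond]
  set P := μ.real T
  set P₀ := μ.real T₀
  set I := ∫ x in T, f x ∂μ
  set I₀ := ∫ x in T₀, f x ∂μ
  have e : I / P - I₀ / P₀ = ((I - I₀) + I / P * (P₀ - P)) / P₀ := by field_simp; ring
  rw [e, abs_div, abs_of_pos hpos₀]
  refine div_le_div_of_nonneg_right ?_ hpos₀.le
  have e4 : |I / P| ≤ b := by rw [abs_div, abs_of_pos hpos, div_le_iff₀ hpos]; exact e3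
  refine (abs_add_le _ _).trans ?_
  rw [abs_mul, abs_sub_comm P₀]
  have := mul_le_mul e4 e2 (abs_nonneg _) hb
  linarith

end Conditional
end Perceptron

namespace Perceptron

/-! ### The conditioned laws of the rows -/

section Rows

variable {r n : ℕ}

/-- `Δ` is a standard Gaussian vector conditioned on an event for its coefficients with respect to
delocalised orthonormal vectors `u p`, on which these coefficients are bounded by `B`; the covariance
matrix of `Δ` is `1 + (μ₂ - 1) M / n` up to an error of `ε / n` in each entry. -/
structure IsConditioned (κ : ℝ) (Δ : Measure (Fin n → ℝ)) (u : Fin r → Fin n → ℝ) (B : ℝ)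
    (M : Fin n → Fin n → ℝ) (ε : ℝ) : Prop where
  orthonormal : IsOrthonormal u
  abs_le : ∀ p c, |u p c| ≤ B / √n
  exists_eq_cond : ∃ T : Set (Fin r → ℝ), MeasurableSet T ∧ (∀ z ∈ T, ∀ p, |z p| ≤ B) ∧
    delta0 r T ≠ 0 ∧ Δ = cond (delta0 n) ((fun y p => linForm (u p) y) ⁻¹' T)
  abs_covShift_sub_le : ∀ c d, |covShift Δ u c d - (mu2 κ - 1) * M c d / n| ≤ ε / n

namespace IsConditioned

variable {κ B ε : ℝ} {Δ : Measure (Fin n → ℝ)} {u : Fin r → Fin n → ℝ} {M : Fin n → Fin n → ℝ}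

lemma isProbabilityMeasure (h : IsConditioned κ Δ u B M ε) : IsProbabilityMeasure Δ := by
  obtain ⟨T, hT, -, h0, rfl⟩ := h.exists_eq_cond
  refine cond_isProbabilityMeasure ?_
  rwa [(measurePreserving_linForms h.orthonormal).measure_preimage hT.nullMeasurableSet]

lemma measurable_linForms (u : Fin r → Fin n → ℝ) :
    Measurable fun (y : Fin n → ℝ) p => linForm (u p) y :=
  measurable_pi_iff.mpr fun _ => measurable_linForm _

lemma ae_abs_linForm_le (h : IsConditioned κ Δ u B M ε) : ∀ᵐ x ∂Δ, ∀ p, |linForm (u p) x| ≤ B := by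
  obtain ⟨T, hT, hb, -, rfl⟩ := h.exists_eq_cond
  exact (ae_cond_mem (measurable_linForms u hT)).mono fun _ hx => hb _ hx

lemma measurePreserving_rowMix (h : IsConditioned κ Δ u B M ε) :
    MeasurePreserving (rowMix u) ((delta0 n).prod Δ) Δ := by
  obtain ⟨T, hT, -, -, rfl⟩ := h.exists_eq_cond
  refine measurePreserving_rowMix_cond h.orthonormal (measurable_linForms u hT) fun y y' hy => ?_
  have : (fun p => linForm (u p) y) = fun p => linForm (u p) y' := funext hy
  simp only [Set.mem_preimage, this]

end IsConditioned

lemma signVec_self (i : Fin n) : signVec n n i = 1 := by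
  unfold signVec
  rw [if_pos]
  have := i.2
  omega

lemma signVec_mul_self (t : ℤ) (i : Fin n) : signVec n t i * signVec n t i = 1 := by
  unfold signVec
  split_ifs <;> norm_num

lemma abs_signVec (t : ℤ) (i : Fin n) : |signVec n t i| = 1 := by
  unfold signVec
  split_ifs <;> norm_num

lemma sum_signVec {t : ℤ} (ht : t ≡ n [ZMOD 2]) (htn : |t| ≤ n) :
    ∑ i, signVec n t i = t := by
  have h1 := abs_le.mp htn
  have h2 := ht.dvd
  obtain ⟨a, ha⟩ : ∃ a : ℕ, (n : ℤ) + t = 2 * a := ⟨((n + t) / 2).toNat, by omega⟩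
  obtain ⟨b, hb⟩ : ∃ b : ℕ, n = a + b := ⟨n - a, by omega⟩
  have e : ∀ i : Fin n, signVec n t i = (fun j : ℕ => if j < a then (1 : ℝ) else -1) i := fun i => by
    unfold signVec
    refine if_congr ?_ rfl rfl
    omega
  simp_rw [e]
  rw [Fin.sum_univ_eq_sum_range (fun j : ℕ => if j < a then (1 : ℝ) else -1) n, hb,
    Finset.sum_range_add]
  have e1 : ∑ x ∈ Finset.range a, (if x < a then (1 : ℝ) else -1) = a := by
    rw [Finset.sum_congr rfl fun x hx => if_pos (Finset.mem_range.mp hx)]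
    simp
  have e2 : ∑ x ∈ Finset.range b, (if a + x < a then (1 : ℝ) else -1) = -b := by
    simp
  rw [e1, e2]
  have : (t : ℝ) = 2 * a - n := by
    have : t = 2 * a - n := by omega
    rw [this]; push_cast; ring
  rw [this, hb]
  push_cast
  ring

lemma sqrt_inv_mul_self (n : ℕ) : (1 / √(n : ℝ)) * (1 / √n) = 1 / n := by
  rw [div_mul_div_comm, Real.mul_self_sqrt (Nat.cast_nonneg n), one_mul]

lemma isConditioned_delta1 {κ : ℝ} (hκ : 0 < κ) (hn : 0 < n) :
    IsConditioned κ (delta1 κ n) (fun (_ : Fin 1) (_ : Fin n) => 1 / √(n : ℝ)) (3 * κ + 2)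
      (fun _ _ => 1) 0 := by
  have hn' : (0 : ℝ) < n := by exact_mod_cast hn
  have hu : IsOrthonormal (fun (_ : Fin 1) (_ : Fin n) => 1 / √(n : ℝ)) := fun p q => by
    rw [if_pos (Subsingleton.elim p q)]
    simp only [sqrt_inv_mul_self n]
    simp [hn'.ne']
  have hb : ∀ z ∈ cube κ 1, ∀ p, |z p| ≤ 3 * κ + 2 := fun z hz p => by
    have : |z p| ≤ κ := hz p (Set.mem_univ p)
    linarith
  have hΔ : delta1 κ n = cond (delta0 n)
      ((fun y p => linForm ((fun (_ : Fin 1) (_ : Fin n) => 1 / √(n : ℝ)) p) y) ⁻¹' cube κ 1) := by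
    unfold delta1
    congr 1
    ext y
    have hs : 0 < √(n : ℝ) := Real.sqrt_pos.mpr hn'
    have : linForm (fun _ : Fin n => 1 / √(n : ℝ)) y = (∑ i, y i) / √n := by
      unfold linForm
      rw [Finset.sum_div]
      exact Finset.sum_congr rfl fun i _ => by ring
    simp only [slab, cube, Set.mem_preimage, Set.mem_univ_pi, signVec_self, mul_one]
    change |∑ i, y i| ≤ κ * √n ↔ ∀ _ : Fin 1, |linForm (fun _ : Fin n => 1 / √(n : ℝ)) y| ≤ κ
    rw [this, abs_div, abs_of_pos hs, div_le_iff₀ hs]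
    exact ⟨fun h _ => h, fun h => h 0⟩
  refine ⟨hu, fun _ _ => ?_, ⟨cube κ 1, measurableSet_cube κ 1, hb, fun h => ?_, hΔ⟩,
    fun c d => ?_⟩
  · rw [abs_of_nonneg (by positivity)]
    gcongr
    linarith
  · have h1 := delta0_real_cube κ 1
    rw [measureReal_def, h, pow_one] at h1
    exact (gaussProb_pos hκ).ne h1
  · rw [hΔ, covShift_cond hu (measurableSet_cube κ 1) hb]
    simp only [integral_cube_mul hκ, sqrt_inv_mul_self n]
    simp
    ring_nf

/-- The unit vector orthogonal to the constant vectors in the plane spanned by these and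
`signVec n t`. -/
noncomputable def signRes (n : ℕ) (t : ℤ) (c : Fin n) : ℝ :=
  (signVec n t c - t / n) / (√n * √(1 - ((t : ℝ) / n) ^ 2))

/-- Orthonormal basis of the plane spanned by the constant vectors and `signVec n t`. -/
noncomputable def planeBasis (n : ℕ) (t : ℤ) : Fin 2 → Fin n → ℝ :=
  ![fun _ => 1 / √(n : ℝ), signRes n t]

/-- The conditioning event of `delta2` in the coordinates of `planeBasis`. -/
def tiltedCube (κ ρ : ℝ) : Set (Fin 2 → ℝ) :=
  {z | |z 0| ≤ κ ∧ |ρ * z 0 + √(1 - ρ ^ 2) * z 1| ≤ κ}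

lemma measurableSet_tiltedCube (κ ρ : ℝ) : MeasurableSet (tiltedCube κ ρ) := by
  have h1 : MeasurableSet {z : Fin 2 → ℝ | |z 0| ≤ κ} :=
    measurableSet_le (by fun_prop) measurable_const
  have h2 : MeasurableSet {z : Fin 2 → ℝ | |ρ * z 0 + √(1 - ρ ^ 2) * z 1| ≤ κ} :=
    measurableSet_le (by fun_prop) measurable_const
  exact h1.inter h2

section Tilt

variable {κ ρ : ℝ}

lemma sqrt_one_sub_sq_bounds (hρ : |ρ| ≤ 1 / 2) :
    3 / 4 ≤ √(1 - ρ ^ 2) ∧ √(1 - ρ ^ 2) ≤ 1 ∧ 1 - √(1 - ρ ^ 2) ≤ |ρ| / 2 := by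
  have h1 : ρ ^ 2 ≤ |ρ| / 2 := by
    rw [← sq_abs]
    nlinarith [abs_nonneg ρ]
  have h2 : √(1 - ρ ^ 2) ≤ 1 := Real.sqrt_le_one.mpr (by nlinarith)
  have h3 : √(1 - ρ ^ 2) ^ 2 = 1 - ρ ^ 2 := Real.sq_sqrt (by nlinarith)
  have h4 : 1 - ρ ^ 2 ≤ √(1 - ρ ^ 2) := by nlinarith [Real.sqrt_nonneg (1 - ρ ^ 2)]
  exact ⟨by linarith, h2, by linarith⟩

lemma abs_one_le_of_mem_tiltedCube (hκ : 0 < κ) (hρ : |ρ| ≤ 1 / 2) {z : Fin 2 → ℝ}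
    (hz : z ∈ tiltedCube κ ρ) : |z 1| ≤ κ + 4 * κ * |ρ| := by
  obtain ⟨q1, q2, q3⟩ := sqrt_one_sub_sq_bounds hρ
  obtain ⟨h0, h1⟩ := hz
  set q := √(1 - ρ ^ 2)
  have h2 : q * |z 1| ≤ κ + |ρ| * κ := by
    have e : q * |z 1| = |(ρ * z 0 + q * z 1) - ρ * z 0| := by
      rw [add_sub_cancel_left, abs_mul, abs_of_nonneg (show 0 ≤ q by linarith)]
    rw [e]
    refine (abs_sub _ _).trans ?_
    rw [abs_mul ρ]
    have := mul_le_mul_of_nonneg_left h0 (abs_nonneg ρ)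
    linarith
  have h3 : |z 1| ≤ 3 * κ := by nlinarith [abs_nonneg (z 1), abs_nonneg ρ]
  nlinarith [abs_nonneg (z 1), abs_nonneg ρ]

lemma abs_le_of_mem_tiltedCube (hκ : 0 < κ) (hρ : |ρ| ≤ 1 / 2) {z : Fin 2 → ℝ}
    (hz : z ∈ tiltedCube κ ρ) (p : Fin 2) : |z p| ≤ 3 * κ := by
  fin_cases p
  · have : |z 0| ≤ κ := hz.1
    change |z 0| ≤ _
    linarith
  · have := abs_one_le_of_mem_tiltedCube hκ hρ hz
    change |z 1| ≤ _
    nlinarith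

lemma tiltedCube_diff_subset (hκ : 0 < κ) (hρ : |ρ| ≤ 1 / 2) :
    tiltedCube κ ρ \ cube κ 2 ⊆ {z | |(|z 1| - κ)| ≤ 4 * κ * |ρ|} := by
  rintro z ⟨h1, h2⟩
  have h3 := abs_one_le_of_mem_tiltedCube hκ hρ h1
  have h4 : κ < |z 1| := by
    by_contra hcon
    refine h2 fun p _ => ?_
    fin_cases p
    · exact h1.1
    · exact not_lt.mp hcon
  change |(|z 1| - κ)| ≤ 4 * κ * |ρ|
  rw [abs_of_pos (by linarith)]
  linarith

lemma cube_diff_tiltedCube_subset (hκ : 0 < κ) (hρ : |ρ| ≤ 1 / 2) :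
    cube κ 2 \ tiltedCube κ ρ ⊆ {z | |(|z 1| - κ)| ≤ 4 * κ * |ρ|} := by
  rintro z ⟨h1, h2⟩
  obtain ⟨q1, q2, q3⟩ := sqrt_one_sub_sq_bounds hρ
  have h0 : |z 0| ≤ κ := h1 0 (Set.mem_univ _)
  have h1' : |z 1| ≤ κ := h1 1 (Set.mem_univ _)
  have h3 : κ < |ρ * z 0 + √(1 - ρ ^ 2) * z 1| := by
    by_contra hcon
    exact h2 ⟨h0, not_lt.mp hcon⟩
  have h4 : |ρ * z 0 + √(1 - ρ ^ 2) * z 1| ≤ |ρ| * κ + |z 1| := by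
    refine (abs_add_le _ _).trans ?_
    rw [abs_mul, abs_mul, abs_of_nonneg (Real.sqrt_nonneg _)]
    have := mul_le_mul_of_nonneg_left h0 (abs_nonneg ρ)
    nlinarith [abs_nonneg (z 1)]
  change |(|z 1| - κ)| ≤ 4 * κ * |ρ|
  have := mul_nonneg hκ.le (abs_nonneg ρ)
  rw [abs_of_nonpos (by linarith)]
  linarith

lemma measurableSet_shell (κ δ : ℝ) :
    MeasurableSet {z : Fin 2 → ℝ | |(|z 1| - κ)| ≤ δ} :=
  measurableSet_le (by fun_prop) measurable_const

lemma le_delta0_real_tiltedCube (hκ : 0 < κ) (hρ : |ρ| ≤ 1 / 2) :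
    gaussProb κ ^ 2 - 16 * κ * |ρ| ≤ (delta0 2).real (tiltedCube κ ρ) := by
  have h1 : cube κ 2 ⊆ tiltedCube κ ρ ∪ {z | |(|z 1| - κ)| ≤ 4 * κ * |ρ|} := fun z hz => by
    by_cases h : z ∈ tiltedCube κ ρ
    · exact Or.inl h
    · exact Or.inr (cube_diff_tiltedCube_subset hκ hρ ⟨hz, h⟩)
  have h2 := (measureReal_mono (μ := delta0 2) h1).trans (measureReal_union_le _ _)
  rw [delta0_real_cube] at h2
  have h3 := delta0_abs_sub_le (1 : Fin 2) κ (δ := 4 * κ * |ρ|) (by positivity)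
  linarith

lemma abs_integral_tiltedCube_sub_le (hκ : 0 < κ) (hρ : |ρ| ≤ 1 / 2)
    (hpos : 0 < (delta0 2).real (tiltedCube κ ρ)) (p q : Fin 2) :
    |∫ z, z p * z q ∂(cond (delta0 2) (tiltedCube κ ρ)) - if p = q then mu2 κ else 0|
      ≤ 288 * κ ^ 3 * |ρ| / gaussProb κ ^ 2 := by
  have hb : ∀ a b : ℝ, |a| ≤ 3 * κ → |b| ≤ 3 * κ → |a * b| ≤ 9 * κ ^ 2 := fun a b ha hb => by
    rw [abs_mul]
    refine (mul_le_mul ha hb (abs_nonneg _) (by positivity)).trans (le_of_eq (by ring))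
  have hp := pow_pos (gaussProb_pos hκ) 2
  have h := abs_integral_cond_sub_le (μ := delta0 2) (measurableSet_tiltedCube κ ρ)
    (measurableSet_cube κ 2) (measurableSet_shell κ (4 * κ * |ρ|))
    (f := fun z => z p * z q) (by fun_prop) (b := 9 * κ ^ 2) (by positivity)
    (fun z hz => hb _ _ (abs_le_of_mem_tiltedCube hκ hρ hz p) (abs_le_of_mem_tiltedCube hκ hρ hz q))
    (fun z hz => hb _ _ ((hz p (Set.mem_univ _) : |z p| ≤ κ).trans (by linarith))
      ((hz q (Set.mem_univ _) : |z q| ≤ κ).trans (by linarith)))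
    (tiltedCube_diff_subset hκ hρ) (cube_diff_tiltedCube_subset hκ hρ) hpos
    (by rwa [delta0_real_cube])
  rw [integral_cube_mul hκ, delta0_real_cube] at h
  refine h.trans (div_le_div_of_nonneg_right ?_ hp.le)
  have h3 := delta0_abs_sub_le (1 : Fin 2) κ (δ := 4 * κ * |ρ|) (by positivity)
  have := mul_le_mul_of_nonneg_left h3 (show 0 ≤ 2 * (9 * κ ^ 2) by positivity)
  linarith

end Tilt

section Plane

variable {t : ℤ}

lemma isOrthonormal_planeBasis (hn : 0 < n) (ht : t ≡ n [ZMOD 2]) (hρ : |(t : ℝ) / n| ≤ 1 / 2) :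
    IsOrthonormal (planeBasis n t) := by
  have hn' : (0 : ℝ) < n := by exact_mod_cast hn
  have hs : 0 < √(n : ℝ) := Real.sqrt_pos.mpr hn'
  have htn : |t| ≤ n := by
    rw [abs_div, abs_of_pos hn', div_le_iff₀ hn'] at hρ
    have : |(t : ℝ)| ≤ n := by linarith
    exact_mod_cast this
  obtain ⟨q1, -, -⟩ := sqrt_one_sub_sq_bounds hρ
  have hq0 : 0 < √(1 - ((t : ℝ) / n) ^ 2) := by linarith
  have hq2 : √(1 - ((t : ℝ) / n) ^ 2) ^ 2 = 1 - ((t : ℝ) / n) ^ 2 := by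
    refine Real.sq_sqrt ?_
    have := abs_le.mp hρ
    nlinarith
  have hsum := sum_signVec ht htn
  have h00 : ∑ c : Fin n, (1 / √(n : ℝ)) * (1 / √n) = 1 := by
    simp only [sqrt_inv_mul_self n]
    simp [hn'.ne']
  have h01 : ∑ c, (1 / √(n : ℝ)) * signRes n t c = 0 := by
    unfold signRes
    rw [← Finset.mul_sum, ← Finset.sum_div, Finset.sum_sub_distrib, hsum]
    simp [mul_div_cancel₀ _ hn'.ne']
  have h11 : ∑ c, signRes n t c * signRes n t c = 1 := by
    unfold signRes
    have e : ∀ c, (signVec n t c - t / n) / (√n * √(1 - ((t : ℝ) / n) ^ 2))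
        * ((signVec n t c - t / n) / (√n * √(1 - ((t : ℝ) / n) ^ 2)))
        = (1 - 2 * (t / n) * signVec n t c + (t / n) ^ 2) / (n * (1 - ((t : ℝ) / n) ^ 2)) := fun c => by
      rw [div_mul_div_comm, mul_mul_mul_comm, Real.mul_self_sqrt hn'.le, ← pow_two (√(1 - _)), hq2]
      congr 1
      linear_combination signVec_mul_self t c
    simp_rw [e]
    rw [← Finset.sum_div, Finset.sum_add_distrib, Finset.sum_sub_distrib, ← Finset.mul_sum, hsum]
    have : 1 - ((t : ℝ) / n) ^ 2 ≠ 0 := by rw [← hq2]; positivity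
    rw [div_eq_one_iff_eq (mul_ne_zero hn'.ne' this)]
    simp
    field_simp
    ring
  intro p q
  fin_cases p <;> fin_cases q
  · simpa [planeBasis] using h00
  · simpa [planeBasis] using h01
  · simpa [planeBasis, mul_comm] using h01
  · simpa [planeBasis] using h11

lemma abs_planeBasis_le (hρ : |(t : ℝ) / n| ≤ 1 / 2) (p : Fin 2) (c : Fin n) :
    |planeBasis n t p c| ≤ 2 / √n := by
  obtain ⟨q1, -, -⟩ := sqrt_one_sub_sq_bounds hρ
  fin_cases p
  · change |1 / √(n : ℝ)| ≤ _
    rw [abs_of_nonneg (by positivity)]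
    gcongr
    norm_num
  · change |signRes n t c| ≤ _
    unfold signRes
    have hs : 0 < √(n : ℝ) := Real.sqrt_pos.mpr (by exact_mod_cast c.pos)
    rw [abs_div, abs_of_pos (show 0 < √n * √(1 - ((t : ℝ) / n) ^ 2) by positivity),
      div_le_div_iff₀ (by positivity) hs]
    have h1 : |signVec n t c - t / n| ≤ 3 / 2 := by
      refine (abs_sub _ _).trans ?_
      rw [abs_signVec]
      linarith
    nlinarith

lemma abs_sum_planeBasis_mul_sub_le (hρ : |(t : ℝ) / n| ≤ 1 / 2) (c d : Fin n) :
    |∑ p, planeBasis n t p c * planeBasis n t p d - (1 + signVec n t c * signVec n t d) / n|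
      ≤ 4 * |(t : ℝ) / n| / n := by
  have hn' : (0 : ℝ) < n := by exact_mod_cast c.pos
  set ρ := (t : ℝ) / n with hρd
  set s := signVec n t c
  set s' := signVec n t d
  have hρ2 : ρ ^ 2 ≤ |ρ| / 2 := by rw [← sq_abs]; nlinarith [abs_nonneg ρ]
  have hD : 3 / 4 ≤ 1 - ρ ^ 2 := by linarith
  have e : ∑ p, planeBasis n t p c * planeBasis n t p d - (1 + s * s') / n
      = ((-ρ * (s + s') + ρ ^ 2 + ρ ^ 2 * (s * s')) / (1 - ρ ^ 2)) / n := by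
    rw [Fin.sum_univ_two]
    change (1 / √(n : ℝ)) * (1 / √n) + signRes n t c * signRes n t d - (1 + s * s') / n = _
    rw [sqrt_inv_mul_self n]
    unfold signRes
    rw [div_mul_div_comm, mul_mul_mul_comm, Real.mul_self_sqrt hn'.le,
      Real.mul_self_sqrt (by linarith), ← hρd]
    have : 1 - ρ ^ 2 ≠ 0 := by linarith
    field_simp
    ring
  rw [e, abs_div, abs_of_pos hn', abs_div, abs_of_pos (show 0 < 1 - ρ ^ 2 by linarith)]
  refine div_le_div_of_nonneg_right ?_ hn'.le
  rw [div_le_iff₀ (by linarith)]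
  have hs : |s| = 1 := abs_signVec t c
  have hs' : |s'| = 1 := abs_signVec t d
  have b1 : |-ρ * (s + s')| ≤ 2 * |ρ| := by
    rw [abs_mul, abs_neg]
    have := abs_add_le s s'
    nlinarith [abs_nonneg ρ]
  have b2 : |ρ ^ 2 * (s * s')| = ρ ^ 2 := by
    rw [abs_mul, abs_mul, hs, hs', abs_of_nonneg (sq_nonneg ρ)]; ring
  have b3 : |ρ ^ 2| = ρ ^ 2 := abs_of_nonneg (sq_nonneg ρ)
  have := (abs_add_le (-ρ * (s + s') + ρ ^ 2) (ρ ^ 2 * (s * s'))).trans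
    (add_le_add_left (abs_add_le (-ρ * (s + s')) (ρ ^ 2)) _)
  nlinarith [abs_nonneg ρ]

lemma isConditioned_delta2 {κ : ℝ} (hκ : 0 < κ) (hn : 0 < n) (ht : t ≡ n [ZMOD 2])
    (hρ : |(t : ℝ) / n| ≤ 1 / 2) (hρ2 : 16 * κ * |(t : ℝ) / n| < gaussProb κ ^ 2) :
    IsConditioned κ (delta2 κ n t) (planeBasis n t) (3 * κ + 2)
      (fun c d => 1 + signVec n t c * signVec n t d)
      ((16 * (288 * κ ^ 3 / gaussProb κ ^ 2) + 4 * (1 + κ ^ 2)) * |(t : ℝ) / n|) := by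
  have hn' : (0 : ℝ) < n := by exact_mod_cast hn
  have hs : 0 < √(n : ℝ) := Real.sqrt_pos.mpr hn'
  set ρ := (t : ℝ) / n with hρd
  have hu := isOrthonormal_planeBasis hn ht hρ
  have hT := measurableSet_tiltedCube κ ρ
  obtain ⟨q1, -, -⟩ := sqrt_one_sub_sq_bounds hρ
  have hb : ∀ z ∈ tiltedCube κ ρ, ∀ p, |z p| ≤ 3 * κ + 2 := fun z hz p => by
    have := abs_le_of_mem_tiltedCube hκ hρ hz p
    linarith
  have hpos : 0 < (delta0 2).real (tiltedCube κ ρ) := by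
    have := le_delta0_real_tiltedCube hκ hρ
    linarith
  have hm : ∀ t, MeasurableSet (slab κ n t) := fun t =>
    measurableSet_le (by fun_prop) measurable_const
  have hΔ : delta2 κ n t = cond (delta0 n)
      ((fun y p => linForm (planeBasis n t p) y) ⁻¹' tiltedCube κ ρ) := by
    unfold delta2 delta1
    have hprob : IsProbabilityMeasure (delta0 n) := inferInstance
    rw [cond_cond_eq_cond_inter (hm _) (hm _)]
    congr 1
    ext y
    have e0 : linForm (planeBasis n t 0) y = (∑ i, y i) / √n := by
      unfold linForm
      rw [Finset.sum_div]
      refine Finset.sum_congr rfl fun i _ => ?_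
      change 1 / √(n : ℝ) * y i = _
      ring
    have e1 : ρ * linForm (planeBasis n t 0) y + √(1 - ρ ^ 2) * linForm (planeBasis n t 1) y
        = (∑ i, y i * signVec n t i) / √n := by
      unfold linForm
      rw [Finset.sum_div, Finset.mul_sum, Finset.mul_sum, ← Finset.sum_add_distrib]
      refine Finset.sum_congr rfl fun i _ => ?_
      change ρ * (1 / √(n : ℝ) * y i) + √(1 - ρ ^ 2) * (signRes n t i * y i) = _
      unfold signRes
      rw [← hρd]
      field_simp
      ring
    simp only [slab, tiltedCube, Set.mem_preimage, Set.mem_inter_iff, Set.mem_ofPred_eq]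
    rw [e1, e0, abs_div, abs_div, abs_of_pos hs, div_le_iff₀ hs, div_le_iff₀ hs]
    simp only [signVec_self, mul_one]
  refine ⟨hu, fun p c => ?_, ⟨tiltedCube κ ρ, hT, hb, fun h => ?_, hΔ⟩, fun c d => ?_⟩
  · refine (abs_planeBasis_le hρ p c).trans ?_
    gcongr
    linarith
  · rw [measureReal_def, h] at hpos
    exact lt_irrefl _ hpos
  · rw [hΔ, covShift_cond hu hT hb]
    set u := planeBasis n t
    set E : Fin 2 → Fin 2 → ℝ := fun p q =>
      ∫ z, z p * z q ∂(cond (delta0 2) (tiltedCube κ ρ)) - if p = q then mu2 κ else 0 with hE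
    have hEb : ∀ p q, |E p q| ≤ 288 * κ ^ 3 * |ρ| / gaussProb κ ^ 2 := fun p q =>
      abs_integral_tiltedCube_sub_le hκ hρ hpos p q
    have e : ∑ p, ∑ q, u p c * u q d * (∫ z, z p * z q ∂(cond (delta0 2) (tiltedCube κ ρ))
          - if p = q then 1 else 0) - (mu2 κ - 1) * (1 + signVec n t c * signVec n t d) / n
        = ∑ p, ∑ q, u p c * u q d * E p q + (mu2 κ - 1) * (∑ p, u p c * u p d
          - (1 + signVec n t c * signVec n t d) / n) := by
      have : ∀ p q, u p c * u q d * (∫ z, z p * z q ∂(cond (delta0 2) (tiltedCube κ ρ))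
          - if p = q then 1 else 0) = u p c * u q d * E p q
            + if p = q then u p c * u q d * (mu2 κ - 1) else 0 := fun p q => by
        simp only [hE]
        split_ifs <;> ring
      simp_rw [this, Finset.sum_add_distrib]
      simp only [Finset.sum_ite_eq, Finset.mem_univ, if_true]
      rw [← Finset.sum_mul]
      ring
    rw [e]
    have b1 : |∑ p, ∑ q, u p c * u q d * E p q|
        ≤ 4 * (4 / n * (288 * κ ^ 3 * |ρ| / gaussProb κ ^ 2)) := by
      have hterm : ∀ p q, |u p c * u q d * E p q| ≤ 4 / n * (288 * κ ^ 3 * |ρ| / gaussProb κ ^ 2) :=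
        fun p q => by
          rw [abs_mul]
          refine mul_le_mul ?_ (hEb p q) (abs_nonneg _) (by positivity)
          rw [abs_mul]
          refine (mul_le_mul (abs_planeBasis_le hρ p c) (abs_planeBasis_le hρ q d) (abs_nonneg _)
            (by positivity)).trans (le_of_eq ?_)
          rw [div_sqrt_mul_self]
          norm_num
      refine (Finset.abs_sum_le_sum_abs _ _).trans ((Finset.sum_le_sum fun p _ =>
        (Finset.abs_sum_le_sum_abs _ _).trans (Finset.sum_le_sum fun q _ => hterm p q)).trans
        (le_of_eq ?_))
      simp
      ring
    have b2 : |mu2 κ - 1| ≤ 1 + κ ^ 2 := by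
      have h1 := mu2_nonneg κ
      have h2 := mu2_le hκ
      rw [abs_le]
      constructor <;> nlinarith
    have b3 := mul_le_mul b2 (abs_sum_planeBasis_mul_sub_le hρ c d) (abs_nonneg _) (by positivity)
    rw [← abs_mul] at b3
    refine (abs_add_le _ _).trans ((add_le_add b1 b3).trans (le_of_eq ?_))
    ring

end Plane

end Rows
end Perceptron

namespace Perceptron

/-! ### Expected cycle counts -/

section Mean

lemma abs_prod_sub_prod_le {ι : Type*} (s : Finset ι) (f g : ι → ℝ) {q e : ℝ} (hq : 0 ≤ q)
    (he : 0 ≤ e) (hf : ∀ i, |f i| ≤ q) (hg : ∀ i, |g i| ≤ q) (hfg : ∀ i, |f i - g i| ≤ q * e) :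
    |∏ i ∈ s, f i - ∏ i ∈ s, g i| ≤ s.card * q ^ s.card * e := by
  classical
  induction s using Finset.induction_on with
  | empty => simp
  | insert a s ha ih =>
    rw [Finset.prod_insert ha, Finset.prod_insert ha, Finset.card_insert_of_notMem ha]
    have e1 : f a * ∏ i ∈ s, f i - g a * ∏ i ∈ s, g i
        = (f a - g a) * ∏ i ∈ s, f i + g a * (∏ i ∈ s, f i - ∏ i ∈ s, g i) := by ring
    have h1 : |∏ i ∈ s, f i| ≤ q ^ s.card := by
      rw [Finset.abs_prod]
      exact (Finset.prod_le_prod (fun i _ => abs_nonneg _) fun i _ => hf i).trans (by simp)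
    rw [e1]
    refine (abs_add_le _ _).trans ?_
    rw [abs_mul, abs_mul]
    have h2 := mul_le_mul (hfg a) h1 (abs_nonneg _) (by positivity)
    have h3 := mul_le_mul (hg a) ih (abs_nonneg _) hq
    refine (add_le_add h2 h3).trans (le_of_eq ?_)
    push_cast
    ring

variable {n : ℕ}

/-- A cyclic sum over distinct indices is close to the sum over all indices, and insensitive to
small changes of the weights. -/
lemma abs_sum_cycle_sub_le (hn : 0 < n) {A M : Fin n → Fin n → ℝ} {a θ ε : ℝ} (ha : 1 ≤ a)
    (hε : 0 ≤ ε) (hA : ∀ c d, |A c d| ≤ a / n) (hM : ∀ c d, |θ * M c d| ≤ a)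
    (hAM : ∀ c d, |A c d - θ * M c d / n| ≤ ε / n) (L : ℕ) :
    |∑ i : Fin (L + 1) ↪ Fin n, ∏ l, A (i l) (i (l + 1))
        - θ ^ (L + 1) * ((∑ i : Fin (L + 1) → Fin n, ∏ l, M (i l) (i (l + 1))) / n ^ (L + 1))|
      ≤ (L + 1) * a ^ (L + 1) * ε + (L + 1) ^ 2 * a ^ (L + 1) / n := by
  have hn' : (0 : ℝ) < n := by exact_mod_cast hn
  have hq : 0 ≤ a / n := by positivity
  set inj : (Fin (L + 1) → Fin n) → ℝ := fun i => if Function.Injective i then 1 else 0 with hinj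
  have h1 : ∑ i : Fin (L + 1) ↪ Fin n, ∏ l, A (i l) (i (l + 1))
      = ∑ i : Fin (L + 1) → Fin n, inj i * ∏ l, A (i l) (i (l + 1)) := by
    rw [sum_embedding_eq fun i : Fin (L + 1) → Fin n => ∏ l, A (i l) (i (l + 1))]
    exact Finset.sum_congr rfl fun i _ => by simp [hinj]
  have h2 : θ ^ (L + 1) * ((∑ i : Fin (L + 1) → Fin n, ∏ l, M (i l) (i (l + 1))) / n ^ (L + 1))
      = ∑ i : Fin (L + 1) → Fin n, ∏ l, (θ * M (i l) (i (l + 1)) / n) := by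
    rw [Finset.sum_div, Finset.mul_sum]
    refine Finset.sum_congr rfl fun i _ => ?_
    rw [Finset.prod_div_distrib, Finset.prod_mul_distrib]
    simp
    ring
  have hcard : ∑ i : Fin (L + 1) → Fin n, (1 - inj i) = n ^ (L + 1) - n.descFactorial (L + 1) := by
    rw [Finset.sum_sub_distrib]
    have := sum_embedding_eq fun _ : Fin (L + 1) → Fin n => (1 : ℝ)
    simp only [hinj]
    rw [← this]
    simp [Fintype.card_embedding_eq]
  have e : ∑ i : Fin (L + 1) → Fin n, inj i * ∏ l, A (i l) (i (l + 1))
        - ∑ i : Fin (L + 1) → Fin n, ∏ l, (θ * M (i l) (i (l + 1)) / n)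
      = ∑ i : Fin (L + 1) → Fin n, (∏ l, A (i l) (i (l + 1)) - ∏ l, (θ * M (i l) (i (l + 1)) / n))
        - ∑ i : Fin (L + 1) → Fin n, (1 - inj i) * ∏ l, A (i l) (i (l + 1)) := by
    rw [← Finset.sum_sub_distrib, ← Finset.sum_sub_distrib]
    exact Finset.sum_congr rfl fun i _ => by ring
  have b1 : |∑ i : Fin (L + 1) → Fin n, (∏ l, A (i l) (i (l + 1))
      - ∏ l, (θ * M (i l) (i (l + 1)) / n))| ≤ (L + 1) * a ^ (L + 1) * ε := by
    have hterm : ∀ i : Fin (L + 1) → Fin n, |∏ l, A (i l) (i (l + 1))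
        - ∏ l, (θ * M (i l) (i (l + 1)) / n)| ≤ (L + 1) * (a / n) ^ (L + 1) * ε := fun i => by
      have := abs_prod_sub_prod_le Finset.univ (fun l => A (i l) (i (l + 1)))
        (fun l => θ * M (i l) (i (l + 1)) / n) hq hε (fun l => hA _ _)
        (fun l => by rw [abs_div, abs_of_pos hn']; gcongr; exact hM _ _)
        (fun l => (hAM _ _).trans (by
          rw [div_mul_eq_mul_div]
          gcongr
          exact le_mul_of_one_le_left hε ha))
      simpa using this
    refine (Finset.abs_sum_le_sum_abs _ _).trans ((Finset.sum_le_sum fun i _ => hterm i).trans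
      (le_of_eq ?_))
    simp only [Finset.sum_const, Finset.card_univ, Fintype.card_fun, Fintype.card_fin, nsmul_eq_mul]
    push_cast
    rw [div_pow]
    field_simp
  have b2 : |∑ i : Fin (L + 1) → Fin n, (1 - inj i) * ∏ l, A (i l) (i (l + 1))|
      ≤ (L + 1) ^ 2 * a ^ (L + 1) / n := by
    have hterm : ∀ i : Fin (L + 1) → Fin n, |(1 - inj i) * ∏ l, A (i l) (i (l + 1))|
        ≤ (1 - inj i) * (a / n) ^ (L + 1) := fun i => by
      have h0 : 0 ≤ 1 - inj i := by simp only [hinj]; split_ifs <;> norm_num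
      rw [abs_mul, abs_of_nonneg h0, Finset.abs_prod]
      refine mul_le_mul_of_nonneg_left ?_ h0
      exact (Finset.prod_le_prod (fun i _ => abs_nonneg _) fun l _ => hA _ _).trans
        (le_of_eq (by rw [Finset.prod_const, Finset.card_univ, Fintype.card_fin]))
    refine (Finset.abs_sum_le_sum_abs _ _).trans ((Finset.sum_le_sum fun i _ => hterm i).trans ?_)
    rw [← Finset.sum_mul, hcard]
    have h := le_descFactorial_div_pow hn (L + 1)
    rw [le_div_iff₀ (by positivity)] at h
    have h3 : (n : ℝ) ^ (L + 1) - n.descFactorial (L + 1) ≤ (L + 1) ^ 2 / n * n ^ (L + 1) := by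
      push_cast at h
      linarith
    refine (mul_le_mul_of_nonneg_right h3 (by positivity)).trans (le_of_eq ?_)
    rw [div_pow]
    field_simp
  rw [h1, h2, e]
  exact (abs_sub _ _).trans (add_le_add b1 b2)

/-- Around a cycle of signs, the product of the factors `1 + s s'` vanishes unless all the signs
agree. -/
lemma prod_one_add_sign (L : ℕ) (s : Fin (L + 1) → ℝ) (hs : ∀ l, s l = 1 ∨ s l = -1) :
    ∏ l, (1 + s l * s (l + 1)) = ∏ l, (1 + s l) + ∏ l, (1 - s l) := by
  by_cases h : ∀ l, s (l + 1) = s l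
  · have hc : ∀ l, s l = s 0 := by
      intro l
      induction l using Fin.induction with
      | zero => rfl
      | succ l ih => rw [← ih, ← h l.castSucc, Fin.coeSucc_eq_succ]
    simp_rw [hc]
    rcases hs 0 with h0 | h0 <;> simp [h0]
  · push Not at h
    obtain ⟨l, hl⟩ := h
    have hs1 := hs l
    have hs2 := hs (l + 1)
    rcases hs1 with h1 | h1 <;> rcases hs2 with h2 | h2
    · exact absurd (h2.trans h1.symm) hl
    · rw [Finset.prod_eq_zero (Finset.mem_univ l) (by rw [h1, h2]; norm_num),
        Finset.prod_eq_zero (Finset.mem_univ (l + 1)) (by rw [h2]; norm_num),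
        Finset.prod_eq_zero (Finset.mem_univ l) (by rw [h1]; norm_num), add_zero]
    · rw [Finset.prod_eq_zero (Finset.mem_univ l) (by rw [h1, h2]; norm_num),
        Finset.prod_eq_zero (Finset.mem_univ l) (by rw [h1]; norm_num),
        Finset.prod_eq_zero (Finset.mem_univ (l + 1)) (by rw [h2]; norm_num), add_zero]
    · exact absurd (h2.trans h1.symm) hl

lemma abs_one_add_pow_sub_one_le {x : ℝ} (hx : |x| ≤ 1) (k : ℕ) :
    |(1 + x) ^ k - 1| ≤ k * 2 ^ k * |x| := by
  have := abs_prod_sub_prod_le (Finset.univ : Finset (Fin k)) (fun _ => 1 + x) (fun _ => 1)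
    (q := 2) (e := |x|) (by norm_num) (abs_nonneg x)
    (fun _ => (abs_add_le _ _).trans (by rw [abs_one]; linarith)) (fun _ => by norm_num)
    (fun _ => by rw [add_sub_cancel_left]; linarith [abs_nonneg x])
  simpa using this

lemma sum_prod_signVec {t : ℤ} (ht : t ≡ n [ZMOD 2]) (htn : |t| ≤ n) (L : ℕ) :
    ∑ i : Fin (L + 1) → Fin n, ∏ l, (1 + signVec n t (i l) * signVec n t (i (l + 1)))
      = (n + t) ^ (L + 1) + (n - t) ^ (L + 1) := by
  have hs : ∀ i, signVec n t i = 1 ∨ signVec n t i = -1 := fun i => by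
    unfold signVec
    split_ifs <;> simp
  simp_rw [fun i : Fin (L + 1) → Fin n => prod_one_add_sign L (fun l => signVec n t (i l))
    fun l => hs _]
  rw [Finset.sum_add_distrib, ← Fintype.sum_pow (fun i => 1 + signVec n t i),
    ← Fintype.sum_pow (fun i => 1 - signVec n t i), Finset.sum_add_distrib,
    Finset.sum_sub_distrib, sum_signVec ht htn]
  simp

lemma abs_sum_prod_signVec_sub_le (hn : 0 < n) {t : ℤ} (ht : t ≡ n [ZMOD 2])
    (hρ : |(t : ℝ) / n| ≤ 1) (L : ℕ) :
    |(∑ i : Fin (L + 1) → Fin n, ∏ l, (1 + signVec n t (i l) * signVec n t (i (l + 1))))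
      / n ^ (L + 1) - 2| ≤ 2 * (L + 1) * 2 ^ (L + 1) * |(t : ℝ) / n| := by
  have hn' : (0 : ℝ) < n := by exact_mod_cast hn
  have htn : |t| ≤ n := by
    rw [abs_div, abs_of_pos hn', div_le_iff₀ hn', one_mul] at hρ
    exact_mod_cast hρ
  rw [sum_prod_signVec ht htn]
  have e : (((n : ℝ) + t) ^ (L + 1) + (n - t) ^ (L + 1)) / n ^ (L + 1) - 2
      = ((1 + (t : ℝ) / n) ^ (L + 1) - 1) + ((1 + -((t : ℝ) / n)) ^ (L + 1) - 1) := by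
    rw [add_div, ← div_pow, ← div_pow, add_div, sub_div, div_self hn'.ne']
    ring
  rw [e]
  refine (abs_add_le _ _).trans ?_
  have h1 := abs_one_add_pow_sub_one_le hρ (L + 1)
  have h2 := abs_one_add_pow_sub_one_le (x := -((t : ℝ) / n)) (by rwa [abs_neg]) (L + 1)
  rw [abs_neg] at h2
  push_cast at h1 h2
  linarith

/-- The normalised expectation of a cycle count is close to its limit. -/
lemma abs_mean_sub_le {m : ℕ} (hn : 0 < n) (hm : 0 < m) {A M : Fin n → Fin n → ℝ}
    {a θ ε Q w T σ e : ℝ} (ha : 1 ≤ a) (hε : 0 ≤ ε) (hA : ∀ c d, |A c d| ≤ a / n)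
    (hM : ∀ c d, |θ * M c d| ≤ a) (hAM : ∀ c d, |A c d - θ * M c d / n| ≤ ε / n) (hθ : |θ| ≤ a)
    (hQ : 1 ≤ Q) (hw : |w| ≤ Q) (hqw : |√m / √n - w| ≤ e) (hq : √m / √n ≤ Q) (hT : |T| ≤ 2)
    (hσ : 0 ≤ σ) (L : ℕ) (hMT : |(∑ i : Fin (L + 1) → Fin n, ∏ l, M (i l) (i (l + 1)))
      / n ^ (L + 1) - T| ≤ 2 * (L + 1) * 2 ^ (L + 1) * σ) :
    |(1 / √n) ^ (L + 1) * (1 / √m) ^ (L + 1) * (∑ i : Fin (L + 1) ↪ Fin n,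
        ∑ _J : Fin (L + 1) ↪ Fin m, ∏ l, A (i l) (i (l + 1))) - T * (w * θ) ^ (L + 1)|
      ≤ (L + 1) ^ 2 * (2 * Q * a) ^ (L + 1) * (1 / m + 1 / n + ε + 2 * σ + 2 * e) := by
  have hn' : (0 : ℝ) < n := by exact_mod_cast hn
  have hm' : (0 : ℝ) < m := by exact_mod_cast hm
  have hsn : 0 < √(n : ℝ) := Real.sqrt_pos.mpr hn'
  have hsm : 0 < √(m : ℝ) := Real.sqrt_pos.mpr hm'
  have he : 0 ≤ e := (abs_nonneg _).trans hqw
  set k := L + 1 with hk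
  have hkc : ((L : ℝ) + 1) = (k : ℝ) := by rw [hk]; push_cast; ring
  have hk1 : (1 : ℝ) ≤ k := by rw [← hkc]; linarith [(Nat.cast_nonneg L : (0 : ℝ) ≤ L)]
  have ha0 : 0 ≤ a := by linarith
  set S := ∑ i : Fin k ↪ Fin n, ∏ l, A (i l) (i (l + 1)) with hS
  set q := √(m : ℝ) / √n with hqd
  have hq0 : 0 ≤ q := by positivity
  set D : ℝ := m.descFactorial k / (m : ℝ) ^ k with hD
  set U := (∑ i : Fin k → Fin n, ∏ l, M (i l) (i (l + 1))) / (n : ℝ) ^ k with hU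
  have hSU : |S - θ ^ k * U| ≤ k * a ^ k * ε + k ^ 2 * a ^ k / n := by
    have := abs_sum_cycle_sub_le hn ha hε hA hM hAM L
    rwa [hkc] at this
  rw [hkc] at hMT ⊢
  -- the rows contribute the number of injections
  have e1 : (1 / √(n : ℝ)) ^ k * (1 / √(m : ℝ)) ^ k * (∑ i : Fin k ↪ Fin n,
      ∑ _J : Fin k ↪ Fin m, ∏ l, A (i l) (i (l + 1))) = q ^ k * D * S := by
    simp only [Finset.sum_const, Finset.card_univ, Fintype.card_embedding_eq, Fintype.card_fin,
      nsmul_eq_mul]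
    rw [← Finset.mul_sum, ← hS, hD, hqd]
    have : (m : ℝ) ^ k = √(m : ℝ) ^ k * √(m : ℝ) ^ k := by
      rw [← mul_pow, Real.mul_self_sqrt hm'.le]
    rw [this, div_pow, div_pow, div_pow, one_pow]
    field_simp
  have hSa : |S| ≤ a ^ k := by
    refine (Finset.abs_sum_le_sum_abs _ _).trans ?_
    have : ∀ i : Fin k ↪ Fin n, |∏ l, A (i l) (i (l + 1))| ≤ (a / n) ^ k := fun i => by
      rw [Finset.abs_prod]
      exact (Finset.prod_le_prod (fun i _ => abs_nonneg _) fun l _ => hA _ _).trans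
        (le_of_eq (by rw [Finset.prod_const, Finset.card_univ, Fintype.card_fin]))
    refine (Finset.sum_le_sum fun i _ => this i).trans ?_
    simp only [Finset.sum_const, Finset.card_univ, Fintype.card_embedding_eq, Fintype.card_fin,
      nsmul_eq_mul]
    have h2 : ((n.descFactorial k : ℕ) : ℝ) ≤ n ^ k := by
      exact_mod_cast Nat.descFactorial_le_pow n k
    refine (mul_le_mul_of_nonneg_right h2 (by positivity)).trans (le_of_eq ?_)
    rw [div_pow]
    field_simp
  have hD1 : |D - 1| ≤ k ^ 2 / m := by
    have h1 := le_descFactorial_div_pow hm k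
    have h2 : D ≤ 1 := by
      rw [hD, div_le_one (by positivity)]
      exact_mod_cast Nat.descFactorial_le_pow m k
    rw [abs_le]
    constructor
    · linarith
    · have : (0 : ℝ) ≤ k ^ 2 / m := by positivity
      linarith
  have hqk : q ^ k ≤ Q ^ k := pow_le_pow_left₀ hq0 hq k
  have hQk : 0 ≤ Q ^ k := by positivity
  have hak : 0 ≤ a ^ k := by positivity
  have hqwk : |q ^ k - w ^ k| ≤ k * Q ^ k * e := by
    have := abs_prod_sub_prod_le (Finset.univ : Finset (Fin k)) (fun _ => q) (fun _ => w)
      (q := Q) (e := e) (by linarith) he (fun _ => by rwa [abs_of_nonneg hq0]) (fun _ => hw)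
      (fun _ => hqw.trans (le_mul_of_one_le_left he hQ))
    simpa using this
  have hθk : |θ ^ k| ≤ a ^ k := by
    rw [abs_pow]; exact pow_le_pow_left₀ (abs_nonneg _) hθ k
  rw [e1]
  have e2 : q ^ k * D * S - T * (w * θ) ^ k = q ^ k * ((D - 1) * S) + q ^ k * (S - θ ^ k * U)
      + q ^ k * (θ ^ k * (U - T)) + (q ^ k - w ^ k) * (θ ^ k * T) := by
    rw [mul_pow]; ring
  rw [e2]
  have hqk0 : |q ^ k| ≤ Q ^ k := by rwa [abs_of_nonneg (by positivity)]
  have b1 : |q ^ k * ((D - 1) * S)| ≤ Q ^ k * (k ^ 2 / m * a ^ k) := by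
    rw [abs_mul, abs_mul]
    exact mul_le_mul hqk0 (mul_le_mul hD1 hSa (abs_nonneg _) (by positivity)) (by positivity) hQk
  have b2 : |q ^ k * (S - θ ^ k * U)| ≤ Q ^ k * (k * a ^ k * ε + k ^ 2 * a ^ k / n) := by
    rw [abs_mul]
    exact mul_le_mul hqk0 hSU (abs_nonneg _) hQk
  have b3 : |q ^ k * (θ ^ k * (U - T))| ≤ Q ^ k * (a ^ k * (2 * k * 2 ^ k * σ)) := by
    rw [abs_mul, abs_mul]
    exact mul_le_mul hqk0 (mul_le_mul hθk hMT (abs_nonneg _) hak) (by positivity) hQk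
  have b4 : |(q ^ k - w ^ k) * (θ ^ k * T)| ≤ k * Q ^ k * e * (a ^ k * 2) := by
    rw [abs_mul, abs_mul]
    exact mul_le_mul hqwk (mul_le_mul hθk hT (abs_nonneg _) hak) (by positivity) (by positivity)
  have tot := (abs_add_le (q ^ k * ((D - 1) * S) + q ^ k * (S - θ ^ k * U)
      + q ^ k * (θ ^ k * (U - T))) ((q ^ k - w ^ k) * (θ ^ k * T))).trans (add_le_add
    ((abs_add_le _ _).trans (add_le_add ((abs_add_le _ _).trans (add_le_add b1 b2)) b3)) b4)
  refine tot.trans ?_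
  have h2k : (1 : ℝ) ≤ 2 ^ k := one_le_pow₀ (by norm_num)
  have hkk : (k : ℝ) ≤ k ^ 2 := by nlinarith
  have e3 : (k : ℝ) ^ 2 * (2 * Q * a) ^ k * (1 / m + 1 / n + ε + 2 * σ + 2 * e)
      = (Q ^ k * a ^ k) * ((k ^ 2 * 2 ^ k) * (1 / m) + (k ^ 2 * 2 ^ k) * (1 / n)
        + (k ^ 2 * 2 ^ k) * ε + (k ^ 2 * 2 ^ k) * (2 * σ) + (k ^ 2 * 2 ^ k) * (2 * e)) := by
    rw [mul_pow, mul_pow]; ring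
  have e4 : Q ^ k * (k ^ 2 / m * a ^ k) + Q ^ k * (k * a ^ k * ε + k ^ 2 * a ^ k / n)
      + Q ^ k * (a ^ k * (2 * k * 2 ^ k * σ)) + k * Q ^ k * e * (a ^ k * 2)
      = (Q ^ k * a ^ k) * (k ^ 2 * (1 / m) + k ^ 2 * (1 / n) + k * ε + (k * 2 ^ k) * (2 * σ)
        + k * (2 * e)) := by ring
  rw [e3, e4]
  refine mul_le_mul_of_nonneg_left ?_ (mul_nonneg hQk hak)
  have c1 : (k : ℝ) ^ 2 ≤ k ^ 2 * 2 ^ k := le_mul_of_one_le_right (by positivity) h2k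
  have c2 : (k : ℝ) ≤ k ^ 2 * 2 ^ k := hkk.trans c1
  have c3 : (k : ℝ) * 2 ^ k ≤ k ^ 2 * 2 ^ k := mul_le_mul_of_nonneg_right hkk (by positivity)
  exact add_le_add (add_le_add (add_le_add (add_le_add
    (mul_le_mul_of_nonneg_right c1 (by positivity)) (mul_le_mul_of_nonneg_right c1 (by positivity)))
    (mul_le_mul_of_nonneg_right c2 hε)) (mul_le_mul_of_nonneg_right c3 (by positivity)))
    (mul_le_mul_of_nonneg_right c2 (by positivity))

end Mean
end Perceptron

namespace Perceptron

/-! ### Comparison of conditioned and Gaussian rows -/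

section Vectors

variable {m n K : ℕ}

/-- The vector of the normalised cycle counts of a matrix. -/
noncomputable def countVec (K : ℕ) (x : Fin m → Fin n → ℝ) : EuclideanSpace ℝ (Fin K) :=
  WithLp.toLp 2 fun k => ∑ j, cycleInc (k : ℕ) j x

lemma cycleVec_eq_countVec (κ η : ℝ) (n : ℕ) (M : ℕ → Fin n → ℝ) :
    cycleVec κ η n M = countVec (maxLen η n) (fun j : Fin (tauPre κ η n) => M j) := by
  unfold cycleVec countVec
  congr 1
  funext k
  exact cycleCount_eq_sum (k : ℕ) M

/-- The vector with coordinates `a ^ k / √(2k)`. -/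
noncomputable def powVec (K : ℕ) (a : ℝ) : EuclideanSpace ℝ (Fin K) :=
  WithLp.toLp 2 fun k => a ^ ((k : ℕ) + 1) / √(2 * ((k : ℝ) + 1))

/-- The sum over the cycles of length `2 (L + 1)`, without normalisation. -/
noncomputable def cycleSum (L : ℕ) (x : Fin m → Fin n → ℝ) : ℝ :=
  ∑ i : Fin (L + 1) ↪ Fin n, ∑ J : Fin (L + 1) ↪ Fin m,
    ∏ l, x (J l) (i l) * x (J l) (i (l + 1))

lemma sum_cycleInc_eq (L : ℕ) (x : Fin m → Fin n → ℝ) :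
    ∑ j, cycleInc L j x = ((1 / √n) ^ (L + 1) * (1 / √m) ^ (L + 1) * cycleSum L x
      - (if L + 1 = 1 then √((m : ℝ) * n) else 0)) / √(2 * ((L : ℝ) + 1)) := by
  set M : ℕ → Fin n → ℝ := fun j => if h : j < m then x ⟨j, h⟩ else 0 with hM
  have hx : (fun j : Fin m => M j) = x := funext fun j => by simp [hM]
  have h := cycleCount_eq_sum (m := m) L M
  rw [hx] at h
  rw [← h]
  unfold cycleCount cycleSum
  simp [hM]

lemma measurePreserving_firstRows {Ω : Type*} [MeasurableSpace Ω] {P : Measure Ω}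
    [IsProbabilityMeasure P] {Δ : Measure (Fin n → ℝ)} {M : ℕ → Ω → Fin n → ℝ}
    (h : IsSample P Δ M) (m : ℕ) :
    MeasurePreserving (fun ω (j : Fin m) => M j ω) P (Measure.pi fun _ : Fin m => Δ) := by
  refine ⟨measurable_pi_iff.mpr fun j => h.measurable j, ?_⟩
  have h1 : iIndepFun (fun j : Fin m => M j) P := h.indep.precomp Fin.val_injective
  rw [iIndepFun_iff_map_fun_eq_pi_map (f := fun j : Fin m => M j)
    fun j => (h.measurable j).aemeasurable] at h1
  rw [h1]
  simp_rw [h.law]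

lemma norm_euclidean_le (v : EuclideanSpace ℝ (Fin K)) : ‖v‖ ≤ ∑ k, |v k| := by
  conv_lhs => rw [euclidean_eq_sum v]
  refine (norm_sum_le _ _).trans (le_of_eq (Finset.sum_congr rfl fun k _ => ?_))
  rw [norm_smul, (EuclideanSpace.basisFun (Fin K) ℝ).norm_eq_one, mul_one, Real.norm_eq_abs]

variable {Δ : Measure (Fin n → ℝ)} [IsProbabilityMeasure Δ]

lemma hasAllMoments_cycleSum (hΔ : ∀ c, HasAllMoments Δ fun y => y c) (L : ℕ) :
    HasAllMoments (Measure.pi fun _ : Fin m => Δ) (cycleSum L) := by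
  have h : ∀ (j : Fin m) (c : Fin n),
      HasAllMoments (Measure.pi fun _ : Fin m => Δ) (fun x => x j c) := fun j c =>
    (hΔ c).comp (measurePreserving_eval (fun _ : Fin m => Δ) j)
  exact HasAllMoments.sum _ fun i _ => HasAllMoments.sum _ fun J _ => HasAllMoments.prod _ fun l _ =>
    (h _ _).mul (h _ _)

lemma hasAllMoments_sum_cycleInc (hΔ : ∀ c, HasAllMoments Δ fun y => y c) (L : ℕ) :
    HasAllMoments (Measure.pi fun _ : Fin m => Δ) (fun x => ∑ j, cycleInc L j x) := by
  simp_rw [sum_cycleInc_eq, div_eq_inv_mul]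
  exact (((hasAllMoments_cycleSum hΔ L).const_mul _).sub (.const _)).const_mul _

lemma integrable_countVec (hΔ : ∀ c, HasAllMoments Δ fun y => y c) :
    Integrable (countVec K) (Measure.pi fun _ : Fin m => Δ) :=
  memLp_one_iff_integrable.mp (memLp_euclidean fun k => by
    have := hasAllMoments_sum_cycleInc (m := m) hΔ (k : ℕ) 1
    exact_mod_cast this)

end Vectors

section Compare

variable {r m n K : ℕ} {κ B ε : ℝ} {Δ : Measure (Fin n → ℝ)} {u : Fin r → Fin n → ℝ}
  {M : Fin n → Fin n → ℝ}

lemma IsConditioned.hasAllMoments (h : IsConditioned κ Δ u B M ε) (c : Fin n) :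
    HasAllMoments Δ (fun y => y c) := by
  have hm := measurePreserving_linForms h.orthonormal
  obtain ⟨T, hT, -, h0, rfl⟩ := h.exists_eq_cond
  refine HasAllMoments.mono_measure (delta0 n ((fun y p => linForm (u p) y) ⁻¹' T))⁻¹
    (ENNReal.inv_ne_top.mpr ?_) ?_ (hasAllMoments_row c)
  · rwa [hm.measure_preimage hT.nullMeasurableSet]
  · unfold ProbabilityTheory.cond
    refine Measure.le_iff'.mpr fun s => ?_
    rw [Measure.smul_apply, Measure.smul_apply]
    exact mul_le_mul' le_rfl (Measure.le_iff'.mp Measure.restrict_le_self s)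

/-- The mean of the square bounds the square of the mean of the absolute value. -/
lemma integral_abs_le_sqrt {α : Type*} [MeasurableSpace α] {μ : Measure α}
    [IsProbabilityMeasure μ] {f : α → ℝ} (hf : MemLp f 2 μ) :
    ∫ x, |f x| ∂μ ≤ √(∫ x, f x ^ 2 ∂μ) := by
  refine Real.le_sqrt_of_sq_le ?_
  have := sq_integral_mul_le hf.abs (memLp_const (1 : ℝ))
  simpa using this

/-- Matrices with conditioned and with Gaussian rows can be coupled such that the vectors of cycle
counts differ by a deterministic vector, up to an error that is small in mean. -/
lemma IsConditioned.exists_coupling (h : IsConditioned κ Δ u B M ε) (hB : 0 ≤ B) (hn : 0 < n)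
    (hm : 0 < m) {A₀ : ℝ} (hA₀ : 1 ≤ A₀) (hmA : (m : ℝ) ≤ A₀ * n) (hK : K ≤ n)
    {a Q w T σ e : ℝ} (ha : couplingConst r B ≤ a) (hε : 0 ≤ ε)
    (hM : ∀ c d, |(mu2 κ - 1) * M c d| ≤ a) (hθ : |mu2 κ - 1| ≤ a)
    (hQ : 1 ≤ Q) (hw : |w| ≤ Q) (hqw : |√m / √n - w| ≤ e) (hq : √m / √n ≤ Q) (hT : |T| ≤ 2)
    (hσ : 0 ≤ σ) (hMT : ∀ L : ℕ, |(∑ i : Fin (L + 1) → Fin n, ∏ l, M (i l) (i (l + 1)))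
      / n ^ (L + 1) - T| ≤ 2 * (L + 1) * 2 ^ (L + 1) * σ) :
    ∃ (E : Type) (_ : MeasurableSpace E) (ρ : Measure E) (X G : E → Fin m → Fin n → ℝ),
      MeasurePreserving X ρ (Measure.pi fun _ => Δ) ∧ MeasurePreserving G ρ (gaussMatrix m n) ∧
      ∫ z, ‖countVec K (X z) - T • powVec K (w * (mu2 κ - 1)) - countVec K (G z)‖ ∂ρ
        ≤ K * ((45 * a ^ 2 * A₀) ^ (K + 1) / √n
          + K ^ 2 * (2 * Q * a) ^ K * (1 / m + 1 / n + ε + 2 * σ + 2 * e)) := by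
  have hΔ := h.isProbabilityMeasure
  have hn' : (0 : ℝ) < n := by exact_mod_cast hn
  have hm' : (0 : ℝ) < m := by exact_mod_cast hm
  have hC := one_le_couplingConst r B hB
  have ha1 : 1 ≤ a := hC.trans ha
  have he : 0 ≤ e := (abs_nonneg _).trans hqw
  set θ := mu2 κ - 1 with hθd
  set δ := 1 / (m : ℝ) + 1 / n + ε + 2 * σ + 2 * e with hδ
  have hδ0 : 0 ≤ δ := by positivity
  set ρ := (delta0 n).prod ((delta0 n).prod Δ) with hρ
  have hpert := isPerturbation_rowStep h.orthonormal hB h.abs_le h.ae_abs_linForm_le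
  set X : (Fin m → (Fin n → ℝ) × ((Fin n → ℝ) × (Fin n → ℝ))) → Fin m → Fin n → ℝ :=
    fun z j => rowMix u ((z j).1, (z j).2.2) with hX
  set G : (Fin m → (Fin n → ℝ) × ((Fin n → ℝ) × (Fin n → ℝ))) → Fin m → Fin n → ℝ :=
    fun z j => rowMix u ((z j).1, (z j).2.1) with hG
  have mX : MeasurePreserving X (Measure.pi fun _ => ρ) (Measure.pi fun _ => Δ) :=
    measurePreserving_pi (fun _ : Fin m => ρ) (fun _ => Δ)
      (f := fun _ w => rowMix u (w.1, w.2.2)) fun _ => h.measurePreserving_rowMix.comp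
      ((MeasurePreserving.id (delta0 n)).prod (measurePreserving_snd (μ := delta0 n) (ν := Δ)))
  have mG : MeasurePreserving G (Measure.pi fun _ => ρ) (gaussMatrix m n) :=
    measurePreserving_pi (fun _ : Fin m => ρ) (fun _ => delta0 n)
      (f := fun _ w => rowMix u (w.1, w.2.1)) fun _ =>
      (_root_.Perceptron.measurePreserving_rowMix h.orthonormal).comp
      ((MeasurePreserving.id (delta0 n)).prod (measurePreserving_fst (μ := delta0 n) (ν := Δ)))
  refine ⟨_, inferInstance, Measure.pi fun _ => ρ, X, G, mX, mG, ?_⟩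
  set A := covShift Δ u with hA
  -- fluctuation of a coordinate
  set W : ℕ → (Fin m → (Fin n → ℝ) × ((Fin n → ℝ) × (Fin n → ℝ))) → ℝ := fun L z =>
    (1 / √n) ^ (L + 1) * (1 / √m) ^ (L + 1) / √(2 * ((L : ℝ) + 1)) * (cycleSum L (X z)
      - cycleSum L (G z)
      - ∑ i : Fin (L + 1) ↪ Fin n, ∑ _J : Fin (L + 1) ↪ Fin m, ∏ l, A (i l) (i (l + 1))) with hW
  have momW : ∀ L, HasAllMoments (Measure.pi fun _ => ρ) (W L) := fun L =>
    ((((hasAllMoments_cycleSum h.hasAllMoments L).comp mX).sub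
      ((hasAllMoments_cycleSum hasAllMoments_row L).comp mG)).sub (.const _)).const_mul _
  set R := 5 * a ^ 2 * A₀ with hR
  have hR1 : 1 ≤ R := by
    have : 1 ≤ a ^ 2 := one_le_pow₀ ha1
    nlinarith
  have hWL : ∀ L, L + 1 ≤ K → ∫ z, |W L z| ∂(Measure.pi fun _ => ρ) ≤ (9 * R) ^ (K + 1) / √n := by
    intro L hL
    refine (integral_abs_le_sqrt (momW L).memLp_two).trans ?_
    refine Real.sqrt_le_iff.mpr ⟨by positivity, ?_⟩
    have h1 := hpert.integral_cycle_diff_sq_le (m := m) hC hA₀ hmA (L := L) (by omega)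
    have h2 : ∀ z : Fin m → (Fin n → ℝ) × ((Fin n → ℝ) × (Fin n → ℝ)),
        W L z ^ 2 = ((1 / n) ^ (L + 1) * (1 / m) ^ (L + 1) / (2 * ((L : ℝ) + 1))) *
        ((∑ i : Fin (L + 1) ↪ Fin n, ∑ J : Fin (L + 1) ↪ Fin m, ∏ l,
          (rowStep Δ u false (i l) (i (l + 1)) (z (J l)) + A (i l) (i (l + 1))
            + rowStep Δ u true (i l) (i (l + 1)) (z (J l))))
        - (∑ i : Fin (L + 1) ↪ Fin n, ∑ J : Fin (L + 1) ↪ Fin m, ∏ l,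
            rowStep Δ u false (i l) (i (l + 1)) (z (J l)))
        - ∑ i : Fin (L + 1) ↪ Fin n, ∑ _J : Fin (L + 1) ↪ Fin m, ∏ l, A (i l) (i (l + 1))) ^ 2 := by
      intro z
      have s1 : ∀ c d v, rowStep Δ u false c d v + A c d + rowStep Δ u true c d v
          = rowMix u (v.1, v.2.2) c * rowMix u (v.1, v.2.2) d := fun c d v => by
        simp only [rowStep, hA, if_true, Bool.false_eq_true, if_false]
        ring
      have s2 : ∀ c d v, rowStep Δ u false c d v
          = rowMix u (v.1, v.2.1) c * rowMix u (v.1, v.2.1) d := fun c d v => by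
        simp only [rowStep, Bool.false_eq_true, if_false]
      simp_rw [s1, s2]
      simp only [hW]
      rw [mul_pow]
      congr 1
      rw [div_pow, mul_pow, Real.sq_sqrt (by positivity), ← pow_mul, ← pow_mul, mul_comm (L + 1) 2,
        pow_mul, pow_mul, pow_two (1 / √(n : ℝ)), pow_two (1 / √(m : ℝ)), sqrt_inv_mul_self,
        sqrt_inv_mul_self]
    simp_rw [h2]
    rw [integral_const_mul]
    refine (mul_le_mul_of_nonneg_left h1 (by positivity)).trans ?_
    have hCR : 5 * couplingConst r B ^ 2 * A₀ ≤ R := by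
      rw [hR]
      gcongr
    have hC0 : 0 ≤ 5 * couplingConst r B ^ 2 * A₀ := by positivity
    calc ((1 / (n : ℝ)) ^ (L + 1) * (1 / (m : ℝ)) ^ (L + 1) / (2 * ((L : ℝ) + 1))) *
        (9 ^ (L + 1) * ((n : ℝ) ^ (L + 1) * (m : ℝ) ^ (L + 1) *
          ((5 * couplingConst r B ^ 2 * A₀ * (L + 1)) * (5 * couplingConst r B ^ 2 * A₀) ^ L
            * (5 * couplingConst r B ^ 2 * A₀ / n))))
        = (9 ^ (L + 1) * (5 * couplingConst r B ^ 2 * A₀) ^ (L + 2)) / (2 * n) := by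
          rw [one_div_pow, one_div_pow]
          have : ((L : ℝ) + 1) ≠ 0 := by positivity
          field_simp
          ring
      _ ≤ (9 ^ (L + 2) * R ^ (L + 2)) / n := by
          refine div_le_div₀ (by positivity) (mul_le_mul (pow_le_pow_right₀ (by norm_num) (by omega))
            (pow_le_pow_left₀ hC0 hCR _) (by positivity) (by positivity)) hn' (by linarith)
      _ ≤ ((9 * R) ^ (K + 1) / √n) ^ 2 := by
          rw [div_pow, Real.sq_sqrt hn'.le, ← mul_pow, ← pow_mul]
          have : 1 ≤ 9 * R := by linarith
          gcongr
          omega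
  -- decomposition of the coordinates
  set D : ℕ → ℝ := fun L => ((1 / √n) ^ (L + 1) * (1 / √m) ^ (L + 1) * (∑ i : Fin (L + 1) ↪ Fin n,
        ∑ _J : Fin (L + 1) ↪ Fin m, ∏ l, A (i l) (i (l + 1))) - T * (w * θ) ^ (L + 1))
        / √(2 * ((L : ℝ) + 1)) with hD
  have hDL : ∀ L, L + 1 ≤ K → |D L| ≤ K ^ 2 * (2 * Q * a) ^ K * δ := by
    intro L hL
    have hA' : ∀ c d, |A c d| ≤ a / n := fun c d =>
      (hpert.abs_le c d).trans (by gcongr)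
    have h1 := abs_mean_sub_le hn hm ha1 hε hA' hM h.abs_covShift_sub_le hθ hQ hw hqw hq hT hσ L
      (hMT L)
    simp only [hD]
    rw [abs_div]
    have h2 : 1 ≤ |√(2 * ((L : ℝ) + 1))| := by
      rw [abs_of_nonneg (Real.sqrt_nonneg _), Real.one_le_sqrt]
      linarith [(Nat.cast_nonneg L : (0 : ℝ) ≤ L)]
    refine (div_le_self (abs_nonneg _) h2).trans (h1.trans ?_)
    have h3 : ((L : ℝ) + 1) ≤ K := by exact_mod_cast hL
    have h4 : 1 ≤ 2 * Q * a := by nlinarith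
    gcongr
  have hcoord : ∀ (z) (k : Fin K), (countVec K (X z) - T • powVec K (w * θ) - countVec K (G z)) k
      = W k z + D k := fun z k => by
    simp only [countVec, powVec, PiLp.sub_apply, PiLp.smul_apply, smul_eq_mul]
    rw [sum_cycleInc_eq, sum_cycleInc_eq]
    simp only [hW, hD]
    ring
  have hnorm : ∀ z, ‖countVec K (X z) - T • powVec K (w * θ) - countVec K (G z)‖
      ≤ ∑ k : Fin K, (|W k z| + K ^ 2 * (2 * Q * a) ^ K * δ) := fun z => by
    refine (norm_euclidean_le _).trans (Finset.sum_le_sum fun k _ => ?_)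
    rw [hcoord]
    exact (abs_add_le _ _).trans (add_le_add le_rfl (hDL k k.2))
  have iW : ∀ k : Fin K, Integrable (fun z => |W k z|) (Measure.pi fun _ : Fin m => ρ) := fun k =>
    (momW k).integrable.abs
  refine (integral_mono_of_nonneg (.of_forall fun z => norm_nonneg _)
    (integrable_finsetSum _ fun k _ => (iW k).add (integrable_const _)) (.of_forall hnorm)).trans ?_
  rw [integral_finsetSum _ fun k _ => (iW k).add (integrable_const _)]
  have : ∀ k ∈ (Finset.univ : Finset (Fin K)),
      ∫ z, (|W k z| + K ^ 2 * (2 * Q * a) ^ K * δ) ∂(Measure.pi fun _ : Fin m => ρ)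
      ≤ (45 * a ^ 2 * A₀) ^ (K + 1) / √n + K ^ 2 * (2 * Q * a) ^ K * δ := fun k _ => by
    rw [integral_add (iW k) (integrable_const _)]
    have := hWL k k.2
    rw [show 9 * R = 45 * a ^ 2 * A₀ by rw [hR]; ring] at this
    simpa using this
  refine (Finset.sum_le_sum this).trans (le_of_eq ?_)
  rw [Finset.sum_const, Finset.card_univ, Fintype.card_fin, nsmul_eq_mul]

end Compare
end Perceptron

namespace Perceptron

/-! ### Asymptotics of the error terms -/

section Asymptotics

open Filter Topology

lemma exists_log_le (x : ℝ) (hx : 0 < x) : ∃ N : ℕ, ∀ n : ℕ, N ≤ n → Real.log n ≤ x * √n := by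
  have h := (isLittleO_log_rpow_atTop (show (0 : ℝ) < 1 / 2 by norm_num)).bound hx
  have h2 := tendsto_natCast_atTop_atTop (R := ℝ) |>.eventually h
  obtain ⟨N, hN⟩ := eventually_atTop.mp h2
  refine ⟨N, fun n hn => ?_⟩
  have := hN n hn
  rw [Real.norm_eq_abs, Real.norm_eq_abs, ← Real.sqrt_eq_rpow, abs_of_nonneg (Real.sqrt_nonneg _)]
    at this
  exact (le_abs_self _).trans this

lemma exists_log_pow_le (c : ℝ) :
    ∃ N : ℕ, ∀ n : ℕ, N ≤ n → c * (1 + Real.log n) ^ 5 ≤ (n : ℝ) ^ (1 / 5 : ℝ) := by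
  set d := |c| + 1 with hd
  have hd0 : 0 < d := by positivity
  have h := (isLittleO_log_rpow_atTop (show (0 : ℝ) < 1 / 25 by norm_num)).bound
    (show (0 : ℝ) < 1 / (2 * d) by positivity)
  have h2 := tendsto_natCast_atTop_atTop (R := ℝ) |>.eventually h
  have h3 : ∀ᶠ n : ℕ in atTop, 2 * d ≤ (n : ℝ) ^ (1 / 25 : ℝ) :=
    ((tendsto_rpow_atTop (show (0 : ℝ) < 1 / 25 by norm_num)).comp
      (tendsto_natCast_atTop_atTop (R := ℝ))).eventually_ge_atTop _
  obtain ⟨N, hN⟩ := eventually_atTop.mp (h2.and (h3.and (eventually_ge_atTop 1)))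
  refine ⟨N, fun n hn => ?_⟩
  obtain ⟨h4, h5, h6⟩ := hN n hn
  have hn1 : (1 : ℝ) ≤ n := by exact_mod_cast h6
  have hlog : 0 ≤ Real.log n := Real.log_nonneg hn1
  rw [Real.norm_eq_abs, Real.norm_eq_abs, abs_of_nonneg hlog, abs_of_nonneg (by positivity)] at h4
  set y := (n : ℝ) ^ (1 / 25 : ℝ) with hy
  have hy0 : 0 ≤ y := by positivity
  have e : (n : ℝ) ^ (1 / 5 : ℝ) = y ^ 5 := by
    rw [hy, ← Real.rpow_natCast, ← Real.rpow_mul (by positivity)]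
    norm_num
  have h7 : d * (1 + Real.log n) ≤ y := by
    have : d * (1 / (2 * d) * y) = y / 2 := by field_simp
    nlinarith [mul_le_mul_of_nonneg_left h4 hd0.le]
  rw [e]
  refine le_trans ?_ (pow_le_pow_left₀ (by positivity) h7 5)
  rw [mul_pow]
  refine mul_le_mul_of_nonneg_right ?_ (by positivity)
  have h8 : 1 ≤ d := by rw [hd]; linarith [abs_nonneg c]
  calc c ≤ d := by rw [hd]; linarith [le_abs_self c]
    _ ≤ d ^ 5 := le_self_pow₀ h8 (by norm_num)

lemma maxLen_le {η : ℝ} (hη : 0 < η) {n : ℕ} (hn : 1 ≤ n) :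
    (maxLen η n : ℝ) ≤ η * Real.log n + 1 := by
  have : 0 ≤ η * Real.log n := mul_nonneg hη.le (Real.log_nonneg (by exact_mod_cast hn))
  exact (Nat.ceil_lt_add_one this).le

/-- For cycle lengths up to a small multiple of `log n`, exponential factors are small powers of
`n`. -/
lemma exists_error_le {Λ : ℝ} (hΛ : 1 ≤ Λ) {c : ℝ} (hc : 0 ≤ c) :
    ∃ η₀ : ℝ, 0 < η₀ ∧ η₀ ≤ 1 ∧ ∃ N : ℕ, ∀ η : ℝ, 0 < η → η ≤ η₀ → ∀ n : ℕ, N ≤ n →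
      Λ ^ (2 * maxLen η n + 1) * (c * ((maxLen η n : ℝ) + 1) ^ 4 * ((1 + Real.log n) / √n))
        ≤ (n : ℝ) ^ (-(1 / 5 : ℝ)) := by
  have hlΛ : 0 ≤ Real.log Λ := Real.log_nonneg hΛ
  obtain ⟨N, hN⟩ := exists_log_pow_le (16 * Λ ^ 3 * c)
  refine ⟨min 1 (1 / (20 * (Real.log Λ + 1))), lt_min one_pos (by positivity), min_le_left _ _,
    max N 1, fun η hη hη₀ n hn => ?_⟩
  have hn1 : 1 ≤ n := le_trans (le_max_right _ _) hn
  have hn1' : (1 : ℝ) ≤ n := by exact_mod_cast hn1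
  have hn0 : (0 : ℝ) < n := by linarith
  have hlog : 0 ≤ Real.log n := Real.log_nonneg hn1'
  have hη1 : η ≤ 1 := hη₀.trans (min_le_left _ _)
  have hη2 : η * Real.log Λ ≤ 1 / 20 := by
    have h1 : η ≤ 1 / (20 * (Real.log Λ + 1)) := hη₀.trans (min_le_right _ _)
    rw [le_div_iff₀ (by positivity)] at h1
    nlinarith
  set K := maxLen η n with hK
  have hKle : (K : ℝ) ≤ η * Real.log n + 1 := maxLen_le hη hn1
  -- The choice of `η₀` makes the exponential factor `n ^ (1 / 10)`; the powers of `log n` cost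
  -- `n ^ (1 / 5)`, and `1 / 10 + 1 / 5 - 1 / 2 = -1 / 5`.
  have h1 : Λ ^ (2 * K + 1) ≤ Λ ^ 3 * (n : ℝ) ^ (1 / 10 : ℝ) := by
    have e1 : Λ ^ (2 * K + 1) = Real.exp ((2 * K + 1) * Real.log Λ) := by
      rw [← Real.rpow_natCast, Real.rpow_def_of_pos (by linarith)]
      push_cast
      ring_nf
    have e2 : Λ ^ 3 * (n : ℝ) ^ (1 / 10 : ℝ)
        = Real.exp (3 * Real.log Λ + 1 / 10 * Real.log n) := by
      rw [Real.exp_add, Real.rpow_def_of_pos hn0, ← Real.rpow_natCast, Real.rpow_def_of_pos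
        (show 0 < Λ by linarith)]
      push_cast
      ring_nf
    rw [e1, e2, Real.exp_le_exp]
    have h3 := mul_le_mul_of_nonneg_right hKle hlΛ
    have h4 := mul_le_mul_of_nonneg_right hη2 hlog
    nlinarith
  have h2 : ((K : ℝ) + 1) ^ 4 ≤ 16 * (1 + Real.log n) ^ 4 := by
    have : (K : ℝ) + 1 ≤ 2 * (1 + Real.log n) := by nlinarith
    refine (pow_le_pow_left₀ (by positivity) this 4).trans (le_of_eq ?_)
    ring
  have h3 := hN n (le_trans (le_max_left _ _) hn)
  calc Λ ^ (2 * K + 1) * (c * ((K : ℝ) + 1) ^ 4 * ((1 + Real.log n) / √n))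
      ≤ (Λ ^ 3 * (n : ℝ) ^ (1 / 10 : ℝ))
          * (c * (16 * (1 + Real.log n) ^ 4) * ((1 + Real.log n) / √n)) := by gcongr
    _ = (16 * Λ ^ 3 * c * (1 + Real.log n) ^ 5) * ((n : ℝ) ^ (1 / 10 : ℝ) / √n) := by ring
    _ ≤ (n : ℝ) ^ (1 / 5 : ℝ) * ((n : ℝ) ^ (1 / 10 : ℝ) / √n) := by gcongr
    _ = (n : ℝ) ^ (-(1 / 5 : ℝ)) := by
        rw [Real.sqrt_eq_rpow, ← Real.rpow_sub hn0, ← Real.rpow_add hn0]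
        norm_num

/-- The number of rows is proportional to the dimension. -/
lemma tauPre_bounds {κ η : ℝ} (hκ : 0 < κ) (hη : 0 < η) (hη1 : η ≤ 1) {n : ℕ} (hn : 1 ≤ n)
    (hlog : Real.log n + 1 ≤ alphaC κ / 2 * n) :
    alphaC κ / 2 * n ≤ tauPre κ η n ∧ (tauPre κ η n : ℝ) ≤ alphaC κ * n ∧
      |√(tauPre κ η n) / √n - √(alphaC κ)| ≤ (1 + Real.log n) / √n / √(alphaC κ) := by
  have hα := alphaC_pos hκ
  have hn1 : (1 : ℝ) ≤ n := by exact_mod_cast hn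
  have hn0 : (0 : ℝ) < n := by linarith
  have hl : 0 ≤ Real.log n := Real.log_nonneg hn1
  have hηl : η * Real.log n ≤ Real.log n := by nlinarith
  have hηl0 : 0 ≤ η * Real.log n := by positivity
  have hpos : 0 ≤ alphaC κ * n - η * Real.log n := by linarith
  have h1 : (tauPre κ η n : ℝ) ≤ alphaC κ * n - η * Real.log n := Nat.floor_le hpos
  have h2 : alphaC κ * n - η * Real.log n < tauPre κ η n + 1 := Nat.lt_floor_add_one _
  refine ⟨by linarith, by linarith, ?_⟩
  set m : ℝ := (tauPre κ η n : ℝ)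
  have hm0 : 0 ≤ m := Nat.cast_nonneg _
  have hsα : 0 < √(alphaC κ) := Real.sqrt_pos.mpr hα
  have hsn : 0 < √(n : ℝ) := Real.sqrt_pos.mpr hn0
  have hq : √m / √n = √(m / n) := (Real.sqrt_div hm0 _).symm
  rw [hq, le_div_iff₀ hsα]
  have h3 : |√(m / n) - √(alphaC κ)| * √(alphaC κ) ≤ |m / n - alphaC κ| := by
    have e : m / n - alphaC κ = (√(m / n) - √(alphaC κ)) * (√(m / n) + √(alphaC κ)) := by
      have h1 := Real.mul_self_sqrt (show 0 ≤ m / n by positivity)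
      have h2 := Real.mul_self_sqrt hα.le
      linear_combination h2 - h1
    rw [e, abs_mul]
    refine mul_le_mul_of_nonneg_left ?_ (abs_nonneg _)
    exact (le_add_of_nonneg_left (Real.sqrt_nonneg _)).trans (le_abs_self _)
  refine h3.trans ?_
  have e : m / n - alphaC κ = (m - alphaC κ * n) / n := by field_simp
  rw [e, abs_div, abs_of_pos hn0]
  have h4 : |m - alphaC κ * n| ≤ 1 + Real.log n := by
    rw [abs_le]
    constructor <;> linarith
  have h5 : √(n : ℝ) ≤ n := by
    rw [Real.sqrt_le_iff]
    exact ⟨hn0.le, by nlinarith⟩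
  exact div_le_div₀ (by linarith) h4 hsn h5

end Asymptotics

/-! ### Gaussian approximation -/

section Approximation

variable {K : ℕ}

lemma norm_iteratedFDeriv_le_toReal {g : EuclideanSpace ℝ (Fin K) → ℝ} {r : ℕ}
    (h : supDeriv r g < ∞) (x : EuclideanSpace ℝ (Fin K)) :
    ‖iteratedFDeriv ℝ r g x‖ ≤ (supDeriv r g).toReal := by
  have h1 : ‖iteratedFDeriv ℝ r g x‖ₑ ≤ supDeriv r g := le_iSup (fun x => ‖iteratedFDeriv ℝ r g x‖ₑ) x
  have := ENNReal.toReal_mono h.ne h1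
  simpa using this

/-- It suffices to prove a bound in terms of finite bounds on the derivatives. -/
lemma closeToGaussian_of_forall {Ω : Type*} [MeasurableSpace Ω] {P : Measure Ω}
    [IsProbabilityMeasure P] {X : Ω → EuclideanSpace ℝ (Fin K)} (hX : Integrable X P)
    {g : EuclideanSpace ℝ (Fin K) → ℝ} (hg : ContDiff ℝ 3 g) {ε : ℝ} (hε : 0 < ε)
    (h : ∀ M₁ M₂ M₃ : ℝ, (∀ x, ‖iteratedFDeriv ℝ 1 g x‖ ≤ M₁) →
      (∀ x, ‖iteratedFDeriv ℝ 2 g x‖ ≤ M₂) → (∀ x, ‖iteratedFDeriv ℝ 3 g x‖ ≤ M₃) →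
      |∫ ω, g (X ω) ∂P - ∫ z, g z ∂(stdGaussian (EuclideanSpace ℝ (Fin K)))|
        ≤ (M₁ + M₂ + M₃) * ε) :
    CloseToGaussian P X g ε := by
  refine ⟨fun h1 => ⟨integrable_comp_of_lipschitz hg (norm_iteratedFDeriv_le_toReal h1) hX,
    integrable_comp_of_lipschitz hg (norm_iteratedFDeriv_le_toReal h1)
      (memLp_one_iff_integrable.mp (IsGaussian.memLp_id _ 1 (by simp)))⟩, ?_⟩
  by_cases hfin : supDeriv 1 g < ∞ ∧ supDeriv 2 g < ∞ ∧ supDeriv 3 g < ∞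
  · obtain ⟨h1, h2, h3⟩ := hfin
    have := h _ _ _ (norm_iteratedFDeriv_le_toReal h1) (norm_iteratedFDeriv_le_toReal h2)
      (norm_iteratedFDeriv_le_toReal h3)
    refine (ENNReal.ofReal_le_ofReal this).trans (le_of_eq ?_)
    rw [ENNReal.ofReal_mul (by positivity), ENNReal.ofReal_add (by positivity) (by positivity),
      ENNReal.ofReal_add (by positivity) (by positivity), ENNReal.ofReal_toReal h1.ne,
      ENNReal.ofReal_toReal h2.ne, ENNReal.ofReal_toReal h3.ne]
  · have : supDeriv 1 g + supDeriv 2 g + supDeriv 3 g = ∞ := by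
      by_contra hcon
      have hlt := lt_top_iff_ne_top.mpr hcon
      rw [ENNReal.add_lt_top, ENNReal.add_lt_top] at hlt
      exact hfin ⟨hlt.1.1, hlt.1.2, hlt.2⟩
    rw [this, ENNReal.top_mul (by simpa using hε)]
    exact le_top

/-- Transfer of a Gaussian approximation along a coupling. -/
lemma abs_integral_sub_le_of_coupling {α β E : Type*} [MeasurableSpace α] [MeasurableSpace β]
    [MeasurableSpace E] {μ : Measure α} {ν : Measure β} {ρ : Measure E} [IsProbabilityMeasure ρ]
    {X : E → α} {Y : E → β} (hX : MeasurePreserving X ρ μ) (hY : MeasurePreserving Y ρ ν)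
    {F : α → EuclideanSpace ℝ (Fin K)} {G : β → EuclideanSpace ℝ (Fin K)} (hF : Integrable F μ)
    (hG : Integrable G ν) {g : EuclideanSpace ℝ (Fin K) → ℝ} (hg : ContDiff ℝ 3 g) {M₁ b : ℝ}
    (hM : ∀ x, ‖iteratedFDeriv ℝ 1 g x‖ ≤ M₁) (h : ∫ z, ‖F (X z) - G (Y z)‖ ∂ρ ≤ b) :
    |∫ x, g (F x) ∂μ - ∫ y, g (G y) ∂ν| ≤ M₁ * b := by
  have hM0 : 0 ≤ M₁ := (norm_nonneg _).trans (hM 0)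
  have iF : Integrable (fun z => F (X z)) ρ := hX.integrable_comp_of_integrable hF
  have iG : Integrable (fun z => G (Y z)) ρ := hY.integrable_comp_of_integrable hG
  rw [← integral_comp_measurePreserving hX (f := fun x => g (F x))
      (hg.continuous.comp_aestronglyMeasurable hF.aestronglyMeasurable),
    ← integral_comp_measurePreserving hY (f := fun y => g (G y))
      (hg.continuous.comp_aestronglyMeasurable hG.aestronglyMeasurable),
    ← integral_sub (integrable_comp_of_lipschitz hg hM iF) (integrable_comp_of_lipschitz hg hM iG)]
  have h1 := norm_integral_le_of_norm_le (μ := ρ) (f := fun z => g (F (X z)) - g (G (Y z)))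
    ((iF.sub iG).norm.const_mul M₁)
    (.of_forall fun z => lipschitz_of_iteratedFDeriv hg hM (F (X z)) (G (Y z)))
  refine h1.trans ?_
  rw [integral_const_mul]
  exact mul_le_mul_of_nonneg_left h hM0

end Approximation
end Perceptron

namespace Perceptron

/-! ### The three laws of the rows -/

section Final

variable {n : ℕ} {Ω : Type*} [MeasurableSpace Ω] {P : Measure Ω} [IsProbabilityMeasure P]
  {M : ℕ → Ω → Fin n → ℝ} {κ η : ℝ}

lemma shiftVec_eq_powVec (κ η : ℝ) (n : ℕ) :
    shiftVec κ η n = powVec (maxLen η n) (√(alphaC κ) * (mu2 κ - 1)) := by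
  unfold shiftVec powVec beta
  congr 1
  funext k
  congr 2
  ring

/-- The Gaussian approximation for Gaussian matrices of bounded aspect ratio. -/
lemma exists_countVec_close : ∃ C : ℝ, 1 ≤ C ∧ ∀ α : ℝ, 0 < α → ∀ (m n K : ℕ), 1 ≤ n →
    α / 2 * n ≤ m → (m : ℝ) ≤ α * n →
    ∀ g : EuclideanSpace ℝ (Fin K) → ℝ, ContDiff ℝ 3 g → ∀ M₁ M₂ M₃ : ℝ,
    (∀ x, ‖iteratedFDeriv ℝ 1 g x‖ ≤ M₁) → (∀ x, ‖iteratedFDeriv ℝ 2 g x‖ ≤ M₂) →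
    (∀ x, ‖iteratedFDeriv ℝ 3 g x‖ ≤ M₃) →
    |∫ x, g (countVec K x) ∂(gaussMatrix m n)
      - ∫ z, g z ∂(stdGaussian (EuclideanSpace ℝ (Fin K)))|
    ≤ (M₁ + M₂ + M₃) * ((C * (1 + α + 2 / α)) ^ (2 * K + 1) * (((K : ℝ) + 1) ^ 4 * (1 / √n))) := by
  obtain ⟨C, hC1, hC⟩ := exists_gaussMatrix_close
  refine ⟨C, hC1, fun α hα m n K hn1 hm1 hm2 g hg M₁ M₂ M₃ h₁ h₂ h₃ => ?_⟩
  have h2α : 0 < 2 / α := by positivity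
  set A := 1 + α + 2 / α with hA
  have hA1 : 1 ≤ A := by linarith
  have hn1' : (1 : ℝ) ≤ n := by exact_mod_cast hn1
  have hn0' : (0 : ℝ) < n := by linarith
  have hsn : 0 < √(n : ℝ) := Real.sqrt_pos.mpr hn0'
  have hm0' : (0 : ℝ) < m := lt_of_lt_of_le (by positivity) hm1
  have hM : 0 ≤ M₁ + M₂ + M₃ := add_nonneg (add_nonneg ((norm_nonneg _).trans (h₁ 0))
    ((norm_nonneg _).trans (h₂ 0))) ((norm_nonneg _).trans (h₃ 0))
  have hnA : (n : ℝ) ≤ A * m := by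
    have h1 : (n : ℝ) ≤ 2 / α * m := by
      rw [div_mul_eq_mul_div, le_div_iff₀ hα]
      linarith
    exact h1.trans (mul_le_mul_of_nonneg_right (by linarith) hm0'.le)
  have h := hC m n K (max m n) A (le_max_of_le_right hn1') (le_max_left _ _) (le_max_right _ _)
    (max_le (le_mul_of_one_le_left hm0'.le hA1) hnA)
    (max_le (hm2.trans (mul_le_mul_of_nonneg_right (by linarith) hn0'.le))
      (le_mul_of_one_le_left hn0'.le hA1)) hA1 g hg M₁ M₂ M₃ h₁ h₂ h₃
  refine h.trans (mul_le_mul_of_nonneg_left ?_ hM)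
  have h2 : (K : ℝ) ^ 4 ≤ (K + 1) ^ 4 := pow_le_pow_left₀ (Nat.cast_nonneg _) (by linarith) 4
  have h3 : 1 / √(max (m : ℝ) n) ≤ 1 / √n :=
    one_div_le_one_div_of_le hsn (Real.sqrt_le_sqrt (le_max_right _ _))
  calc (K : ℝ) ^ 4 * (C * A) ^ (2 * K + 1) / √(max (m : ℝ) n)
      = (C * A) ^ (2 * K + 1) * ((K : ℝ) ^ 4 * (1 / √(max (m : ℝ) n))) := by ring
    _ ≤ (C * A) ^ (2 * K + 1) * (((K : ℝ) + 1) ^ 4 * (1 / √n)) := by gcongr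

lemma closeToGaussian_cycleVec (hS : IsSample P (delta0 n) M)
    {g : EuclideanSpace ℝ (Fin (maxLen η n)) → ℝ} (hg : ContDiff ℝ 3 g) {E : ℝ} (hE : 0 < E)
    (h : ∀ M₁ M₂ M₃ : ℝ, (∀ x, ‖iteratedFDeriv ℝ 1 g x‖ ≤ M₁) →
      (∀ x, ‖iteratedFDeriv ℝ 2 g x‖ ≤ M₂) → (∀ x, ‖iteratedFDeriv ℝ 3 g x‖ ≤ M₃) →
      |∫ x, g (countVec (maxLen η n) x) ∂(gaussMatrix (tauPre κ η n) n)
        - ∫ z, g z ∂(stdGaussian (EuclideanSpace ℝ (Fin (maxLen η n))))| ≤ (M₁ + M₂ + M₃) * E) :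
    CloseToGaussian P (fun ω => cycleVec κ η n (fun j => M j ω)) g E := by
  have hP := measurePreserving_firstRows hS (tauPre κ η n)
  have hI : Integrable (countVec (maxLen η n))
      (Measure.pi fun _ : Fin (tauPre κ η n) => delta0 n) :=
    integrable_countVec hasAllMoments_row
  simp_rw [cycleVec_eq_countVec]
  refine closeToGaussian_of_forall (hP.integrable_comp_of_integrable hI) hg hE
    fun M₁ M₂ M₃ h₁ h₂ h₃ => ?_
  have e := integral_comp_measurePreserving hP (f := fun x => g (countVec (maxLen η n) x))
    (hg.continuous.comp_aestronglyMeasurable hI.aestronglyMeasurable)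
  simp only [Function.comp_apply, e]
  exact h M₁ M₂ M₃ h₁ h₂ h₃

lemma closeToGaussian_cycleVec_sub {Δ : Measure (Fin n → ℝ)} [IsProbabilityMeasure Δ]
    (hΔ : ∀ c, HasAllMoments Δ fun y => y c) (hS : IsSample P Δ M)
    {g : EuclideanSpace ℝ (Fin (maxLen η n)) → ℝ} (hg : ContDiff ℝ 3 g) {T b b' E : ℝ} (hE : 0 < E)
    (hcoup : ∃ (E : Type) (_ : MeasurableSpace E) (ρ : Measure E)
      (X G : E → Fin (tauPre κ η n) → Fin n → ℝ),
      MeasurePreserving X ρ (Measure.pi fun _ => Δ) ∧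
      MeasurePreserving G ρ (gaussMatrix (tauPre κ η n) n) ∧
      ∫ z, ‖countVec (maxLen η n) (X z) - T • shiftVec κ η n - countVec (maxLen η n) (G z)‖ ∂ρ ≤ b)
    (h : ∀ M₁ M₂ M₃ : ℝ, (∀ x, ‖iteratedFDeriv ℝ 1 g x‖ ≤ M₁) →
      (∀ x, ‖iteratedFDeriv ℝ 2 g x‖ ≤ M₂) → (∀ x, ‖iteratedFDeriv ℝ 3 g x‖ ≤ M₃) →
      |∫ x, g (countVec (maxLen η n) x) ∂(gaussMatrix (tauPre κ η n) n)
        - ∫ z, g z ∂(stdGaussian (EuclideanSpace ℝ (Fin (maxLen η n))))| ≤ (M₁ + M₂ + M₃) * b')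
    (hb : b + b' ≤ E) :
    CloseToGaussian P (fun ω => cycleVec κ η n (fun j => M j ω) - T • shiftVec κ η n) g E := by
  obtain ⟨A, _, ρ, X, G, hX, hG, hXG⟩ := hcoup
  have hρ : IsProbabilityMeasure ρ := ⟨by
    rw [← Set.preimage_univ (f := X), hX.measure_preimage MeasurableSet.univ.nullMeasurableSet]
    exact measure_univ⟩
  have hP := measurePreserving_firstRows hS (tauPre κ η n)
  have hI : Integrable (fun x => countVec (maxLen η n) x - T • shiftVec κ η n)
      (Measure.pi fun _ : Fin (tauPre κ η n) => Δ) :=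
    (integrable_countVec hΔ).sub (integrable_const _)
  have hI₀ : Integrable (countVec (maxLen η n)) (gaussMatrix (tauPre κ η n) n) :=
    integrable_countVec hasAllMoments_row
  simp_rw [cycleVec_eq_countVec]
  refine closeToGaussian_of_forall (hP.integrable_comp_of_integrable hI) hg hE
    fun M₁ M₂ M₃ h₁ h₂ h₃ => ?_
  have e := integral_comp_measurePreserving hP
    (f := fun x => g (countVec (maxLen η n) x - T • shiftVec κ η n))
    (hg.continuous.comp_aestronglyMeasurable hI.aestronglyMeasurable)
  simp only [Function.comp_apply, e]
  have c1 := abs_integral_sub_le_of_coupling hX hG hI hI₀ hg h₁ hXG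
  have c2 := h M₁ M₂ M₃ h₁ h₂ h₃
  have hM₂ : 0 ≤ M₂ := (norm_nonneg _).trans (h₂ 0)
  have hM₃ : 0 ≤ M₃ := (norm_nonneg _).trans (h₃ 0)
  have hM₁ : 0 ≤ M₁ := (norm_nonneg _).trans (h₁ 0)
  have hb0 : 0 ≤ b := (integral_nonneg fun z => norm_nonneg _).trans hXG
  refine (abs_sub_le _ (∫ x, g (countVec (maxLen η n) x) ∂(gaussMatrix (tauPre κ η n) n)) _).trans
    ((add_le_add c1 c2).trans ?_)
  have := mul_le_mul_of_nonneg_left hb (show 0 ≤ M₁ + M₂ + M₃ by positivity)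
  nlinarith [mul_nonneg hM₂ hb0, mul_nonneg hM₃ hb0]

/-- Collects the error terms of the coupling and of the Gaussian approximation. -/
lemma coupling_error_le {K : ℕ} {m n α s R₁ R₂ Λ c₂ ε σ lam : ℝ} (hΛ1 : 1 ≤ Λ) (hL1 : 1 ≤ R₁)
    (hR₁ : R₁ ≤ Λ) (hL2 : 1 ≤ R₂) (hR₂ : R₂ ≤ Λ) (hn1 : 1 ≤ n) (hα : 0 < α) (hm1 : α / 2 * n ≤ m)
    (hlam1 : 1 / √n ≤ lam) (hs : 0 < s) (hc₂ : 0 ≤ c₂) (hε0 : 0 ≤ ε)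
    (hε : ε ≤ c₂ * lam) (hσ0 : 0 ≤ σ) (hσ : σ ≤ lam) :
    K * (R₁ ^ (K + 1) / √n + K ^ 2 * R₂ ^ K * (1 / m + 1 / n + ε + 2 * σ + 2 * (lam / s)))
      + Λ ^ (2 * K + 1) * (((K : ℝ) + 1) ^ 4 * lam)
    ≤ Λ ^ (2 * K + 1) * ((2 + (2 / α + 1 + c₂ + 2 + 2 / s)) * ((K : ℝ) + 1) ^ 4 * lam) := by
  set cc := 2 / α + 1 + c₂ + 2 + 2 / s with hcc
  have hcc0 : 0 ≤ cc := by positivity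
  have hK0 : (0 : ℝ) ≤ K := Nat.cast_nonneg _
  have hn0' : 0 < n := by linarith
  have hsn : 0 < √n := Real.sqrt_pos.mpr hn0'
  have hlam0 : 0 ≤ lam := le_trans (by positivity) hlam1
  have hm0' : 0 < m := lt_of_lt_of_le (by positivity) hm1
  have hsnn : √n ≤ n := by
    rw [Real.sqrt_le_iff]
    exact ⟨hn0'.le, by nlinarith⟩
  have hpowΛ : ∀ x : ℝ, 1 ≤ x → x ≤ Λ → ∀ k, k ≤ 2 * K + 1 → x ^ k ≤ Λ ^ (2 * K + 1) :=
    fun x hx hxΛ k hk => (pow_le_pow_left₀ (by linarith) hxΛ k).trans (pow_le_pow_right₀ hΛ1 hk)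
  have hδ : 1 / m + 1 / n + ε + 2 * σ + 2 * (lam / s) ≤ cc * lam := by
    have hn : 1 / n ≤ lam := (one_div_le_one_div_of_le hsn hsnn).trans hlam1
    have hm : 1 / m ≤ 2 / α * lam := by
      calc 1 / m ≤ 1 / (α / 2 * n) := one_div_le_one_div_of_le (by positivity) hm1
        _ = 2 / α * (1 / n) := by field_simp
        _ ≤ 2 / α * lam := by gcongr
    have e : cc * lam = 2 / α * lam + lam + c₂ * lam + 2 * lam + 2 * (lam / s) := by
      rw [hcc]; ring
    rw [e]
    linarith
  have h1 : (R₁) ^ (K + 1) / √n ≤ Λ ^ (2 * K + 1) * lam := by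
    rw [div_eq_mul_one_div]
    exact mul_le_mul (hpowΛ _ hL1 (by linarith) _ (by omega)) hlam1 (by positivity)
      (by positivity)
  have h2 : (R₂) ^ K ≤ Λ ^ (2 * K + 1) := hpowΛ _ hL2 (by linarith) _ (by omega)
  have hK4 : (K : ℝ) ≤ (K + 1) ^ 4 := by
    have : (K : ℝ) + 1 ≤ (K + 1) ^ 4 := le_self_pow₀ (by linarith) (by norm_num)
    linarith
  have hK43 : (K : ℝ) * K ^ 2 ≤ (K + 1) ^ 4 := by
    have h3 : (K : ℝ) ^ 3 ≤ (K + 1) ^ 3 := pow_le_pow_left₀ hK0 (by linarith) 3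
    have h4 : ((K : ℝ) + 1) ^ 3 ≤ (K + 1) ^ 4 :=
      pow_le_pow_right₀ (by linarith) (by norm_num)
    have : (K : ℝ) * K ^ 2 = K ^ 3 := by ring
    linarith
  calc K * ((R₁) ^ (K + 1) / √n + K ^ 2 * (R₂) ^ K
        * (1 / m + 1 / n + ε + 2 * σ + 2 * (lam / s)))
        + Λ ^ (2 * K + 1) * (((K : ℝ) + 1) ^ 4 * lam)
      ≤ K * (Λ ^ (2 * K + 1) * lam + K ^ 2 * Λ ^ (2 * K + 1) * (cc * lam))
        + Λ ^ (2 * K + 1) * (((K : ℝ) + 1) ^ 4 * lam) := by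
        gcongr
    _ = Λ ^ (2 * K + 1) * ((K + cc * (K * K ^ 2) + ((K : ℝ) + 1) ^ 4) * lam) := by ring
    _ ≤ Λ ^ (2 * K + 1) * (((K + 1) ^ 4 + cc * (K + 1) ^ 4 + ((K : ℝ) + 1) ^ 4) * lam) := by
        gcongr
    _ = _ := by ring

end Final
end Perceptron

theorem lemma2p7 (κ : ℝ) (hκ : 0 < κ) :
    ∃ η₀ : ℝ, 0 < η₀ ∧ ∀ η : ℝ, 0 < η → η ≤ η₀ →
      ∃ N : ℕ, ∀ n : ℕ, N ≤ n →
        ∀ g : EuclideanSpace ℝ (Fin (Perceptron.maxLen η n)) → ℝ, ContDiff ℝ 3 g →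
        ∀ (Ω : Type*) [MeasurableSpace Ω] (P : Measure Ω) [IsProbabilityMeasure P]
          (M : ℕ → Ω → Fin n → ℝ),
          (Perceptron.IsSample P (Perceptron.delta0 n) M →
            Perceptron.CloseToGaussian P
              (fun ω => Perceptron.cycleVec κ η n (fun j => M j ω))
              g ((n : ℝ) ^ (-(1 / 5 : ℝ)))) ∧
          (Perceptron.IsSample P (Perceptron.delta1 κ n) M →
            Perceptron.CloseToGaussian P
              (fun ω => Perceptron.cycleVec κ η n (fun j => M j ω) - Perceptron.shiftVec κ η n)
              g ((n : ℝ) ^ (-(1 / 5 : ℝ)))) ∧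
          (∀ t : ℤ, t ≡ n [ZMOD 2] → |(t : ℝ)| ≤ Real.sqrt n * Real.log n →
            Perceptron.IsSample P (Perceptron.delta2 κ n t) M →
            Perceptron.CloseToGaussian P
              (fun ω => Perceptron.cycleVec κ η n (fun j => M j ω)
                - (2 : ℝ) • Perceptron.shiftVec κ η n)
              g ((n : ℝ) ^ (-(1 / 5 : ℝ)))) := by
  obtain ⟨C, hC1, hC⟩ := Perceptron.exists_countVec_close
  have hα := Perceptron.alphaC_pos hκ
  have hp := Perceptron.gaussProb_pos hκ
  set α := Perceptron.alphaC κ with hαd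
  set p := Perceptron.gaussProb κ with hpd
  have hsα : 0 < √α := Real.sqrt_pos.mpr hα
  -- `B` bounds the coefficients of a conditioned row in the basis of the plane of the slabs.
  set B := 3 * κ + 2 with hBd
  have hB : 0 ≤ B := by positivity
  have hcc1 := Perceptron.one_le_couplingConst 1 B hB
  have hcc2 := Perceptron.one_le_couplingConst 2 B hB
  set a := Perceptron.couplingConst 1 B + Perceptron.couplingConst 2 B + 2 * (1 + κ ^ 2) with had
  have hκ2 : 0 ≤ κ ^ 2 := sq_nonneg κ
  have ha1 : 1 ≤ a := by linarith
  set A := 1 + α + 2 / α with hA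
  have h2α : 0 < 2 / α := by positivity
  have hA1 : 1 ≤ A := by linarith
  set Q := 1 + α with hQ
  have hQ1 : 1 ≤ Q := by linarith
  have hsαQ : √α ≤ Q := by
    rw [Real.sqrt_le_iff]
    exact ⟨by linarith, by rw [hQ, add_sq]; linarith [sq_nonneg α]⟩
  set c₂ := 16 * (288 * κ ^ 3 / p ^ 2) + 4 * (1 + κ ^ 2) with hc₂
  have hc₂0 : 0 ≤ c₂ := by positivity
  -- `Λ` exceeds the bases of all the exponential errors, `c₃` the sum of the polynomial ones.
  set c₃ := 2 / α + 1 + c₂ + 2 + 2 / √α with hc₃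
  have hc₃0 : 0 ≤ c₃ := by positivity
  set Λ := 45 * a ^ 2 * Q + 2 * Q * a + C * A with hΛ
  have hL1 : 1 ≤ 45 * a ^ 2 * Q :=
    one_le_mul_of_one_le_of_one_le (by linarith [one_le_pow₀ ha1 (n := 2)]) hQ1
  have hL2 : 1 ≤ 2 * Q * a := one_le_mul_of_one_le_of_one_le (by linarith) ha1
  have hL3 : 1 ≤ C * A := one_le_mul_of_one_le_of_one_le hC1 hA1
  have hΛ1 : 1 ≤ Λ := by linarith
  obtain ⟨η₀, hη₀, hη₀1, N₁, hN₁⟩ := Perceptron.exists_error_le hΛ1 (c := 2 + c₃) (by positivity)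
  -- For `log n ≤ ξ √n`, the correlation `t / n` is small enough that both slabs have a joint
  -- probability of order `p ^ 2`, and `tauPre` is at least `α n / 2`.
  set ξ := min (min (α / 4) (1 / 2)) (p ^ 2 / (32 * κ)) with hξ
  have hξ0 : 0 < ξ := lt_min (lt_min (by positivity) (by norm_num)) (by positivity)
  obtain ⟨N₂, hN₂⟩ := Perceptron.exists_log_le ξ hξ0
  refine ⟨η₀, hη₀, fun η hη hηη => ⟨max (max N₁ N₂) (max 1 ⌈4 / α⌉₊),
    fun n hn g hg Ω _ P _ M => ?_⟩⟩
  have hnN₁ : N₁ ≤ n := (le_max_left _ _).trans ((le_max_left _ _).trans hn)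
  have hnN₂ : N₂ ≤ n := (le_max_right _ _).trans ((le_max_left _ _).trans hn)
  have hn1 : 1 ≤ n := (le_max_left _ _).trans ((le_max_right _ _).trans hn)
  have hnα : 4 / α ≤ n := (Nat.le_ceil _).trans (by
    exact_mod_cast (le_max_right _ _).trans ((le_max_right _ _).trans hn))
  have hn0 : 0 < n := hn1
  have hn1' : (1 : ℝ) ≤ n := by exact_mod_cast hn1
  have hn0' : (0 : ℝ) < n := by linarith
  have hsn : 0 < √(n : ℝ) := Real.sqrt_pos.mpr hn0'
  have hsnn : √(n : ℝ) ≤ n := by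
    rw [Real.sqrt_le_iff]
    exact ⟨hn0'.le, le_self_pow₀ hn1' two_ne_zero⟩
  have hl : 0 ≤ Real.log n := Real.log_nonneg hn1'
  have hlξ := hN₂ n hnN₂
  have hη1 : η ≤ 1 := hηη.trans hη₀1
  have hlogα : Real.log n + 1 ≤ α / 2 * n := by
    have h1 : ξ * √n ≤ α / 4 * n := mul_le_mul ((min_le_left _ _).trans (min_le_left _ _)) hsnn
      hsn.le (by positivity)
    have h2 : 1 ≤ α / 4 * n := by
      rw [div_le_iff₀ hα] at hnα
      linarith
    linarith
  obtain ⟨hm1, hm2, hm3⟩ := Perceptron.tauPre_bounds hκ hη hη1 hn1 hlogα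
  rw [← hαd] at hm1 hm2 hm3
  have hE := hN₁ η hη hηη n hnN₁
  have hKle := Perceptron.maxLen_le hη hn1
  have hm0' : (0 : ℝ) < (Perceptron.tauPre κ η n) := lt_of_lt_of_le (by positivity) hm1
  have hm0 : 0 < (Perceptron.tauPre κ η n) := by exact_mod_cast hm0'
  have hKn : (Perceptron.maxLen η n) ≤ n := by
    have h1 : η * Real.log n ≤ Real.log n := mul_le_of_le_one_left hl hη1
    have h2 := Real.log_le_sub_one_of_pos hn0'
    have : (Perceptron.maxLen η n : ℝ) ≤ n := by linarith
    exact_mod_cast this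
  have hE0 : (0 : ℝ) < (n : ℝ) ^ (-(1 / 5 : ℝ)) := Real.rpow_pos_of_pos hn0' _
  set lam := (1 + Real.log n) / √n with hlam
  have hlam1 : 1 / √n ≤ lam := div_le_div_of_nonneg_right (by linarith) hsn.le
  have hlam0 : 0 ≤ lam := by positivity
  have hgauss : ∀ M₁ M₂ M₃ : ℝ, (∀ x, ‖iteratedFDeriv ℝ 1 g x‖ ≤ M₁) →
      (∀ x, ‖iteratedFDeriv ℝ 2 g x‖ ≤ M₂) → (∀ x, ‖iteratedFDeriv ℝ 3 g x‖ ≤ M₃) →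
      |∫ x, g (Perceptron.countVec (Perceptron.maxLen η n) x)
          ∂(Perceptron.gaussMatrix (Perceptron.tauPre κ η n) n)
        - ∫ z, g z ∂(stdGaussian (EuclideanSpace ℝ (Fin (Perceptron.maxLen η n))))|
        ≤ (M₁ + M₂ + M₃) * (Λ ^ (2 * Perceptron.maxLen η n + 1)
          * (((Perceptron.maxLen η n : ℝ) + 1) ^ 4 * lam)) :=
    fun M₁ M₂ M₃ h₁ h₂ h₃ => by
      refine (hC α hα (Perceptron.tauPre κ η n) n (Perceptron.maxLen η n) hn1 hm1 hm2 g hg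
        M₁ M₂ M₃ h₁ h₂ h₃).trans (mul_le_mul_of_nonneg_left ?_ (add_nonneg (add_nonneg
          ((norm_nonneg _).trans (h₁ 0))
          ((norm_nonneg _).trans (h₂ 0))) ((norm_nonneg _).trans (h₃ 0))))
      have h1 : (C * A) ^ (2 * Perceptron.maxLen η n + 1) ≤ Λ ^ (2 * Perceptron.maxLen η n + 1) :=
        pow_le_pow_left₀ (by linarith) (by linarith) _
      exact mul_le_mul h1 (mul_le_mul_of_nonneg_left hlam1 (by positivity)) (by positivity)
        (by positivity)
  have hθ : |Perceptron.mu2 κ - 1| ≤ 1 + κ ^ 2 := by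
    have h1 := Perceptron.mu2_nonneg κ
    have h2 := Perceptron.mu2_le hκ
    rw [abs_le]
    constructor <;> linarith
  -- the error of the coupling together with that of the Gaussian approximation
  have hcouple : ∀ (ε σ : ℝ), 0 ≤ ε → ε ≤ c₂ * lam → 0 ≤ σ → σ ≤ lam →
      (Perceptron.maxLen η n) * ((45 * a ^ 2 * Q) ^ (Perceptron.maxLen η n + 1) / √n
        + (Perceptron.maxLen η n) ^ 2 * (2 * Q * a) ^ (Perceptron.maxLen η n)
        * (1 / (Perceptron.tauPre κ η n) + 1 / n + ε + 2 * σ + 2 * (lam / √α)))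
      + Λ ^ (2 * Perceptron.maxLen η n + 1) * (((Perceptron.maxLen η n : ℝ) + 1) ^ 4 * lam)
        ≤ (n : ℝ) ^ (-(1 / 5 : ℝ)) :=
    fun ε σ hε0 hε hσ0 hσ => (Perceptron.coupling_error_le hΛ1 hL1 (by linarith) hL2 (by linarith)
      hn1' hα hm1 hlam1 hsα hc₂0 hε0 hε hσ0 hσ).trans hE
  have hmQ : √(Perceptron.tauPre κ η n : ℝ) / √n ≤ Q := by
    rw [div_le_iff₀ hsn]
    calc √(Perceptron.tauPre κ η n : ℝ) ≤ √(α * n) := Real.sqrt_le_sqrt hm2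
      _ = √α * √n := Real.sqrt_mul hα.le _
      _ ≤ Q * √n := by gcongr
  have hmQn : (Perceptron.tauPre κ η n : ℝ) ≤ Q * n := hm2.trans (by gcongr; linarith)
  have hwQ : |√α| ≤ Q := by rwa [abs_of_pos hsα]
  refine ⟨fun hS => ?_, fun hS => ?_, fun t ht htl hS => ?_⟩
  · refine Perceptron.closeToGaussian_cycleVec hS hg hE0 fun M₁ M₂ M₃ h₁ h₂ h₃ =>
      (hgauss M₁ M₂ M₃ h₁ h₂ h₃).trans (mul_le_mul_of_nonneg_left (le_trans ?_ hE) ?_)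
    · refine mul_le_mul_of_nonneg_left ?_ (by positivity)
      rw [mul_assoc]
      exact le_mul_of_one_le_left (by positivity) (by linarith)
    · exact add_nonneg (add_nonneg ((norm_nonneg _).trans (h₁ 0))
        ((norm_nonneg _).trans (h₂ 0))) ((norm_nonneg _).trans (h₃ 0))
  · have hcond := Perceptron.isConditioned_delta1 hκ hn0
    have hΔ := hcond.isProbabilityMeasure
    have hcoup := hcond.exists_coupling hB hn0 hm0 hQ1 hmQn hKn (a := a) (Q := Q) (w := √α) (T := 1)
      (σ := 0) (e := lam / √α) (by linarith) le_rfl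
      (fun _ _ => by rw [mul_one]; linarith) (by linarith) hQ1 hwQ hm3 hmQ (by norm_num) le_rfl
      (fun L => by
        have : (n : ℝ) ^ (L + 1) ≠ 0 := by positivity
        simp [this])
    rw [← Perceptron.shiftVec_eq_powVec κ η n] at hcoup
    have := Perceptron.closeToGaussian_cycleVec_sub (hcond.hasAllMoments) hS hg hE0 hcoup hgauss
      (hcouple 0 0 le_rfl (by positivity) le_rfl hlam0)
    simpa only [one_smul] using this
  · have hρeq : |(t : ℝ) / n| = |(t : ℝ)| / n := by rw [abs_div, abs_of_pos hn0']
    have hρ : |(t : ℝ) / n| ≤ Real.log n / √n := by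
      rw [hρeq, div_le_div_iff₀ hn0' hsn]
      calc |(t : ℝ)| * √n ≤ √n * Real.log n * √n := by gcongr
        _ = Real.log n * (√n * √n) := by ring
        _ = Real.log n * n := by rw [Real.mul_self_sqrt hn0'.le]
    have hρξ : |(t : ℝ) / n| ≤ ξ := hρ.trans (by rwa [div_le_iff₀ hsn])
    have hρlam : |(t : ℝ) / n| ≤ lam :=
      hρ.trans (div_le_div_of_nonneg_right (by linarith) hsn.le)
    have hρ2 : |(t : ℝ) / n| ≤ 1 / 2 := hρξ.trans ((min_le_left _ _).trans (min_le_right _ _))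
    have hρκ : 16 * κ * |(t : ℝ) / n| < p ^ 2 := by
      have h1 : |(t : ℝ) / n| ≤ p ^ 2 / (32 * κ) := hρξ.trans (min_le_right _ _)
      rw [le_div_iff₀ (by positivity)] at h1
      have : 0 < p ^ 2 := by positivity
      linarith
    have hcond := Perceptron.isConditioned_delta2 hκ hn0 ht hρ2 hρκ
    have hΔ := hcond.isProbabilityMeasure
    have hcoup := hcond.exists_coupling hB hn0 hm0 hQ1 hmQn hKn (a := a) (Q := Q) (w := √α) (T := 2)
      (σ := |(t : ℝ) / n|) (e := lam / √α) (by linarith) (by positivity)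
      (fun c d => by
        rw [abs_mul]
        have h1 : |1 + Perceptron.signVec n t c * Perceptron.signVec n t d| ≤ 2 := by
          refine (abs_add_le _ _).trans ?_
          rw [abs_mul, Perceptron.abs_signVec, Perceptron.abs_signVec]
          norm_num
        have := mul_le_mul hθ h1 (abs_nonneg _) (by positivity)
        linarith) (by linarith) hQ1 hwQ hm3 hmQ (by norm_num) (abs_nonneg _)
      (fun L => Perceptron.abs_sum_prod_signVec_sub_le hn0 ht (by linarith) L)
    rw [← Perceptron.shiftVec_eq_powVec κ η n] at hcoup
    exact Perceptron.closeToGaussian_cycleVec_sub (hcond.hasAllMoments) hS hg hE0 hcoup hgauss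
      (hcouple _ _ (by positivity) (mul_le_mul_of_nonneg_left hρlam hc₂0) (abs_nonneg _) hρlam)
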